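/- Let $d\ge 1$, $\mathfrak n\ge 0$ be integers, $\mathbb T=\mathbb R/2\pi\mathbb Z$, $\mathfrak e>0$, $\gamma\in(0,1)$, $\tau>\mathfrak n+d$, $\varepsilon_0>0$, and $\Omega=[1,2]^{\mathfrak n+d}\ni\tilde\omega=(\omega,\nu)$; put $\langle\xi\rangle=(1+|\xi|^2)^{1/2}$. **Classes of operators.** $S^m$ is the set of $C^\infty$ functions $a:\mathbb T^d\times\mathbb R^d\to\mathbb C$ with $|\partial_x^\alpha\partial_\xi^\beta a(x,\xi)|\le C_{\alpha,\beta}\langle\xi\rangle^{m-|\beta|}$ for all $\alpha,\beta$, and $OPS^m$ is the set of the operators $\mathrm{Op}(a)u(x)=\sum_{\xi\in\mathbb Z^d}a(x,\xi)\,\hat u(\xi)\,e^{\mathrm i x\cdot\xi}$, $u\in C^\infty(\mathbb T^d)$, with $a\in S^m$. For $\Omega_0\subseteq\Omega$, $\mathcal Lip(\Omega_0;C^\infty(\mathbb T^{\mathfrak n};OPS^m))$ consists of the families $A(\varphi,\tilde\omega)=\mathrm{Op}(a(\varphi,\cdot,\cdot,\tilde\omega))$ with $a$ smooth in $(\varphi,x,\xi)\in\mathbb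 T^{\mathfrak n}\times\mathbb T^d\times\mathbb R^d$, such that for all multi-indices $\delta,\alpha,\beta$ the function $\langle\xi\rangle^{|\beta|-m}\,\partial_\varphi^\delta\partial_x^\alpha\partial_\xi^\beta a$ is bounded, and Lipschitz in $\tilde\omega\in\Omega_0$ uniformly in $(\varphi,x,\xi)$; $\mathcal Lip(\Omega_0;OPS^m)$ is its subset of families independent of $\varphi$. A family $A\in\mathcal Lip(\Omega_0;C^\infty(\mathbb T^{\mathfrak n};OPS^1))$ is *symmetric hyperbolic* if $A+A^*\in\mathcal Lip(\Omega_0;C^\infty(\mathbb T^{\mathfrak n};OPS^0))$, where $A^*$ is the $L^2(\mathbb T^d)$-adjoint. An operator is *real* if it maps real valued functions to real valued functions; a family of real operators $R(\varphi)$ is *reversible* if $R(\varphi)\circ S=-S\circ R(-\varphi)$, where $(Su)(x)=u(-x)$. **Data.** For each $\varepsilon\in(0,\varepsilon_0]$ let $\nu^{(0)}=\nu^{(0)}_\varepsilon:\Omega\to\mathbb R^d$ be Lipschitz, with a Lipschitz constant independent of $\varepsilon$, and set $$\Omega_{0,\gamma}=\Big\{\tilde\omega\in\Omega:\ |\omega\cdot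 l+\nu^{(0)}(\tilde\omega)\cdot j|>\frac{\gamma}{\langle (l,j)\rangle^{\tau}}\ \ \forall (l,j)\in\mathbb Z^{\mathfrak n+d}\setminus\{0\}\Big\}.$$ Let $\mathcal W^{(0)}=\mathcal W^{(0)}_\varepsilon\in\mathcal Lip(\Omega_{0,\gamma};C^\infty(\mathbb T^{\mathfrak n};OPS^{1-\mathfrak e}))$ be symmetric hyperbolic. Here and below, all bounds and Lipschitz constants in memberships of these classes are understood to be uniform in $\varepsilon\in(0,\varepsilon_0]$. **Theorem.** For every integer $M\ge1$ there are symmetric hyperbolic families $$G_j\in\mathcal Lip(\Omega_{0,\gamma};C^\infty(\mathbb T^{\mathfrak n};OPS^{1-j\mathfrak e})),\qquad j=1,\dots,M,$$ and families $$Z^{(M)}\in\mathcal Lip(\Omega_{0,\gamma};OPS^{1-\mathfrak e}),\qquad \mathcal W^{(M)}\in\mathcal Lip(\Omega_{0,\gamma};C^\infty(\mathbb T^{\mathfrak n};OPS^{1-M\mathfrak e}))$$ (all depending also on $\varepsilon$) such that, for all $\varepsilon\in(0,\varepsilon_0]$ and $\tilde\omega\in\Omega_{0,\gamma}$: 1.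 each equation $\partial_t u=G_j(\varphi,\tilde\omega)u$ has a flow $e^{tG_j(\varphi,\tilde\omega)}$ on $C^\infty(\mathbb T^d)$: for each $u$, $e^{tG_j(\varphi,\tilde\omega)}u(x)$ is smooth in $(t,\varphi,x)$, and for every $s\ge0$ the flow is bounded in the norm of the Sobolev space $H^s(\mathbb T^d)$, uniformly in $\varphi$ and locally uniformly in $t$; 2. $U(\varphi)=e^{-\varepsilon G_1(\varphi,\tilde\omega)}\cdots e^{-\varepsilon G_M(\varphi,\tilde\omega)}$ is invertible on $C^\infty(\mathbb T^d)$, and the change of variables $\psi=U(\omega t)\phi$ transforms $H(\varphi)=\nu^{(0)}\cdot\nabla+\varepsilon\mathcal W^{(0)}(\varphi)$ into $$H^{(M)}(\varphi)=\nu^{(0)}\cdot\nabla+\varepsilon Z^{(M)}(\tilde\omega)+\varepsilon\mathcal W^{(M)}(\varphi,\tilde\omega),$$ that is, $H^{(M)}(\varphi)=U(\varphi)^{-1}\big[H(\varphi)U(\varphi)-\omega\cdot\partial_\varphi U(\varphi)\big]$ for all $\varphi\in\mathbb T^{\mathfrak n}$; 3. $Z^{(M)}=\mathrm{Op}(z)$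 is a Fourier multiplier independent of time, with a symbol $z(\xi,\tilde\omega)$ that does not depend on $x$ and realizes the membership of $Z^{(M)}$ above; in particular $[Z^{(M)},K_m]=0$ for $K_m=\mathrm i\,\partial_{x_m}$, $m=1,\dots,d$; 4. if $\mathcal W^{(0)}(\cdot,\tilde\omega)$ is real and reversible, then $Z^{(M)}(\tilde\omega)$ and $\mathcal W^{(M)}(\cdot,\tilde\omega)$ are real and reversible. -/

import Mathlib

open scoped ContDiff NNReal

noncomputable section

namespace TorusPDO

/-- Column vectors; as a space of points it serves as the universal cover of the torus
`(ℝ / 2πℤ)^k`, so that functions on the torus are `2π`-periodic functions on `Vec k`. -/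
abbrev Vec (k : ℕ) := Fin k → ℝ

/-- The frequencies `(ω, ν)`. -/
abbrev Param (n d : ℕ) := Vec n × Vec d

/-- The variables `(φ, x, ξ)` of a symbol depending on the angles `φ`. -/
abbrev Phase (n d : ℕ) := Vec n × Vec d × Vec d

/-- An integer vector as a real vector. -/
def intVec {k : ℕ} (l : Fin k → ℤ) : Vec k := fun i => (l i : ℝ)

/-- The Euclidean scalar product. -/
def dot {k : ℕ} (a b : Vec k) : ℝ := ∑ i, a i * b i

/-- The Japanese bracket `⟨ξ⟩ = (1 + |ξ|²)^{1/2}`, with the Euclidean norm. -/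
def bracket {k : ℕ} (ξ : Vec k) : ℝ := Real.sqrt (1 + dot ξ ξ)

/-- `u` is `2π`-periodic in each variable. -/
def IsPeriodic {k : ℕ} (u : Vec k → ℂ) : Prop :=
  ∀ (x : Vec k) (l : Fin k → ℤ), u (x + (2 * Real.pi) • intVec l) = u x

/-- The space `C^∞(𝕋^d)` of smooth complex functions on the torus. -/
def Smooth (d : ℕ) : Submodule ℂ (Vec d → ℂ) where
  carrier := {u | ContDiff ℝ ∞ u ∧ IsPeriodic u}
  add_mem' := fun {a b} ha hb =>
    ⟨ha.1.add hb.1, fun x l => by simp only [Pi.add_apply, ha.2 x l, hb.2 x l]⟩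
  zero_mem' := ⟨contDiff_const, fun _ _ => rfl⟩
  smul_mem' := fun c a ha =>
    ⟨contDiff_const.smul ha.1, fun x l => by simp only [Pi.smul_apply, ha.2 x l]⟩

/-- Linear operators on `C^∞(𝕋^d)`; the product is the composition. -/
abbrev Oper (d : ℕ) := Module.End ℂ (Smooth d)

/-- The exponential `e^{i x·ξ}`. -/
def character {d : ℕ} (ξ : Fin d → ℤ) (x : Vec d) : ℂ :=
  Complex.exp (Complex.I * (dot x (intVec ξ) : ℂ))

/-- A fundamental domain of the torus. -/
def cell (d : ℕ) : Set (Vec d) := Set.Icc 0 (fun _ => 2 * Real.pi)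

/-- The Fourier coefficient `û(ξ)`, normalised so that `u = ∑ û(ξ) e^{i x·ξ}`. -/
def fourierCoeff {d : ℕ} (u : Smooth d) (ξ : Fin d → ℤ) : ℂ :=
  (((2 * Real.pi) ^ d)⁻¹ : ℝ) * ∫ x in cell d, u.1 x * (starRingEnd ℂ) (character ξ x)

/-- The Sobolev norm of `H^s(𝕋^d)`. -/
def sobolevNorm {d : ℕ} (s : ℝ) (u : Smooth d) : ℝ :=
  Real.sqrt (∑' ξ : Fin d → ℤ, bracket (intVec ξ) ^ (2 * s) * ‖fourierCoeff u ξ‖ ^ 2)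

/-- The scalar product of `L²(𝕋^d)`. -/
def l2inner {d : ℕ} (u v : Smooth d) : ℂ :=
  ∫ x in cell d, u.1 x * (starRingEnd ℂ) (v.1 x)

theorem partial_mem {d : ℕ} (i : Fin d) (u : Smooth d) :
    (fun x => fderiv ℝ u.1 x (Pi.single i 1)) ∈ Smooth d := by
  refine ⟨(u.2.1.fderiv_right (m := ∞) (by simp)).clm_apply contDiff_const, fun x l => ?_⟩
  have h : (fun y => u.1 (y + (2 * Real.pi) • intVec l)) = u.1 := funext fun y => u.2.2 y l
  have h2 := fderiv_comp_add_right (𝕜 := ℝ) (f := u.1) (x := x) ((2 * Real.pi) • intVec l)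
  rw [h] at h2
  simp only [h2]

/-- The partial derivative `∂_i` on `C^∞(𝕋^d)`. -/
def partialD {d : ℕ} (i : Fin d) : Oper d where
  toFun u := ⟨fun x => fderiv ℝ u.1 x (Pi.single i 1), partial_mem i u⟩
  map_add' u v := by
    ext x
    have hu : DifferentiableAt ℝ u.1 x := (u.2.1.differentiable (by simp)) x
    have hv : DifferentiableAt ℝ v.1 x := (v.2.1.differentiable (by simp)) x
    change fderiv ℝ (u.1 + v.1) x _ = fderiv ℝ u.1 x _ + fderiv ℝ v.1 x _
    rw [fderiv_add hu hv]
    rfl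
  map_smul' c u := by
    ext x
    have hu : DifferentiableAt ℝ u.1 x := (u.2.1.differentiable (by simp)) x
    change fderiv ℝ (c • u.1) x _ = c • fderiv ℝ u.1 x _
    rw [fderiv_const_smul hu]
    rfl

/-- The operators `K_m = i ∂_m`. -/
def opK {d : ℕ} (m : Fin d) : Oper d := Complex.I • partialD m

/-- The constant coefficient transport operator `v · ∇`. -/
def transport {d : ℕ} (v : Vec d) : Oper d := ∑ i, (v i : ℂ) • partialD i

/-- The involution `(S u)(x) = u(-x)`. -/
def reflect (d : ℕ) : Oper d where
  toFun u := ⟨fun x => u.1 (-x), u.2.1.comp contDiff_neg, fun x l => by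
    have h := u.2.2 (-(x + (2 * Real.pi) • intVec l)) l
    have e : -(x + (2 * Real.pi) • intVec l) + (2 * Real.pi) • intVec l = -x := by abel
    rw [e] at h
    exact h.symm⟩
  map_add' u v := rfl
  map_smul' c u := rfl

/-- `A` maps real valued functions into real valued functions. -/
def IsRealOp {d : ℕ} (A : Oper d) : Prop :=
  ∀ u : Smooth d, (∀ x, (u.1 x).im = 0) → ∀ x, ((A u).1 x).im = 0

/-- Reversibility of a `φ`-dependent family: `R(φ) ∘ S = - S ∘ R(-φ)`. -/
def IsReversible {n d : ℕ} (R : Vec n → Oper d) : Prop :=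
  ∀ φ, R φ * reflect d = -(reflect d * R (-φ))

/-- `A = Op(a)`, that is `A u (x) = ∑_ξ a(x, ξ) û(ξ) e^{i x·ξ}` for all smooth `u`. -/
def IsOp {d : ℕ} (a : Vec d → Vec d → ℂ) (A : Oper d) : Prop :=
  ∀ (u : Smooth d) (x : Vec d),
    HasSum (fun ξ : Fin d → ℤ => a x (intVec ξ) * fourierCoeff u ξ * character ξ x) ((A u).1 x)

/-- The coordinate directions of the variables `φ`, `x` and `ξ`, in this order. -/
def coordDir {n d : ℕ} : Fin n ⊕ Fin d ⊕ Fin d → Phase n d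
  | .inl i => (Pi.single i 1, 0, 0)
  | .inr (.inl i) => (0, Pi.single i 1, 0)
  | .inr (.inr i) => (0, 0, Pi.single i 1)

/-- The mixed partial derivative of `a` along the listed coordinate directions. Every
`∂_φ^δ ∂_x^α ∂_ξ^β` arises from a list `v`. -/
def mixedDeriv {n d N : ℕ} (v : Fin N → Fin n ⊕ Fin d ⊕ Fin d) (a : Phase n d → ℂ)
    (p : Phase n d) : ℂ :=
  iteratedFDeriv ℝ N a p (fun i => coordDir (v i))

/-- The number `|β|` of derivatives with respect to `ξ` in the list `v`. -/
def xiOrder {n d N : ℕ} (v : Fin N → Fin n ⊕ Fin d ⊕ Fin d) : ℕ :=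
  (Finset.univ.filter fun i => ∃ k, v i = Sum.inr (Sum.inr k)).card

/-- Symbols in `Lip(Ω₀; C^∞(𝕋^n; S^m))`, for a family of symbols that depends also on a small
parameter `ε ∈ I` (on which the set `Ω₀` of frequencies may depend): `a ε (ω, ν)` is smooth in
`(φ, x, ξ)`, periodic in `φ` and `x`, and for each seminorm of `C^∞(𝕋^n; S^m)` the family is
bounded and Lipschitz with respect to `(ω, ν)`, with constants that do not depend on `ε`.
(The distance on the parameters is the sup distance, equivalent to the Euclidean one.) -/
structure IsLipSymbol {n d : ℕ} (I : Set ℝ) (Ω₀ : ℝ → Set (Param n d)) (m : ℝ)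
    (a : ℝ → Param n d → Phase n d → ℂ) : Prop where
  smooth : ∀ ε ∈ I, ∀ w ∈ Ω₀ ε, ContDiff ℝ ∞ (a ε w)
  periodic_angle : ∀ ε ∈ I, ∀ w ∈ Ω₀ ε, ∀ x ξ, IsPeriodic fun φ => a ε w (φ, x, ξ)
  periodic_space : ∀ ε ∈ I, ∀ w ∈ Ω₀ ε, ∀ φ ξ, IsPeriodic fun x => a ε w (φ, x, ξ)
  bound : ∀ (N : ℕ) (v : Fin N → Fin n ⊕ Fin d ⊕ Fin d), ∃ C : ℝ,
    ∀ ε ∈ I, ∀ w ∈ Ω₀ ε, ∀ p : Phase n d,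
      ‖mixedDeriv v (a ε w) p‖ ≤ C * bracket p.2.2 ^ (m - xiOrder v)
  lipschitz : ∀ (N : ℕ) (v : Fin N → Fin n ⊕ Fin d ⊕ Fin d), ∃ C : ℝ,
    ∀ ε ∈ I, ∀ w₁ ∈ Ω₀ ε, ∀ w₂ ∈ Ω₀ ε, ∀ p : Phase n d,
      ‖mixedDeriv v (a ε w₁) p - mixedDeriv v (a ε w₂) p‖
        ≤ C * dist w₁ w₂ * bracket p.2.2 ^ (m - xiOrder v)

/-- Families of operators in `Lip(Ω₀; C^∞(𝕋^n; OPS^m))`, uniformly in `ε ∈ I`. -/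
def InLipOPS {n d : ℕ} (I : Set ℝ) (Ω₀ : ℝ → Set (Param n d)) (m : ℝ)
    (A : ℝ → Param n d → Vec n → Oper d) : Prop :=
  ∃ a : ℝ → Param n d → Phase n d → ℂ, IsLipSymbol I Ω₀ m a ∧
    ∀ ε ∈ I, ∀ w ∈ Ω₀ ε, ∀ φ, IsOp (fun x ξ => a ε w (φ, x, ξ)) (A ε w φ)

/-- Symmetric hyperbolicity of a family: `A` is of order `1`, and `A + A^*` is of order `0`
(within the same class of families), `A^*` being the adjoint in `L²(𝕋^d)`. -/
def IsSymmHyperbolic {n d : ℕ} (I : Set ℝ) (Ω₀ : ℝ → Set (Param n d))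
    (A : ℝ → Param n d → Vec n → Oper d) : Prop :=
  InLipOPS I Ω₀ 1 A ∧ ∃ B : ℝ → Param n d → Vec n → Oper d, InLipOPS I Ω₀ 0 B ∧
    ∀ ε ∈ I, ∀ w ∈ Ω₀ ε, ∀ φ, ∀ u v : Smooth d,
      l2inner (A ε w φ u) v + l2inner u (A ε w φ v) = l2inner (B ε w φ u) v

/-- `Φ τ φ = e^{τ G(φ)}` is the flow of `∂_τ u = G(φ) u`: `Φ τ φ u` is the smooth solution with
initial datum `u`, depends smoothly on `(τ, φ, x)`, and is bounded on every Sobolev space,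
uniformly in `φ` and locally uniformly in `τ` (hence extends to all of `H^s`). For symmetric
hyperbolic `G` the energy estimate shows that a flow is unique. -/
structure IsFlow {n d : ℕ} (G : Vec n → Oper d) (Φ : ℝ → Vec n → Oper d) : Prop where
  initial : ∀ φ, Φ 0 φ = 1
  smooth : ∀ u : Smooth d,
    ContDiff ℝ ∞ fun p : ℝ × Vec n × Vec d => (Φ p.1 p.2.1 u).1 p.2.2
  equation : ∀ (τ : ℝ) (φ : Vec n) (u : Smooth d) (x : Vec d),
    HasDerivAt (fun t => (Φ t φ u).1 x) ((G φ (Φ τ φ u)).1 x) τ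
  bounded : ∀ s : ℝ, 0 ≤ s → ∀ T : ℝ, ∃ C : ℝ, ∀ τ : ℝ, |τ| ≤ T →
    ∀ (φ : Vec n) (u : Smooth d), sobolevNorm s (Φ τ φ u) ≤ C * sobolevNorm s u

/-- The change of variables `ψ = U(ω t) ψ'`, with frequency vector
`ω = freq`, transforms `H` into `H'`, that is
`H'(φ) = U(φ)⁻¹ [H(φ) U(φ) - ω·∂_φ U(φ)]`, with `U(φ)` invertible. -/
def Transforms {n d : ℕ} (freq : Vec n) (U H H' : Vec n → Oper d) : Prop :=
  ∀ φ, IsUnit (U φ) ∧ ∀ (u : Smooth d) (x : Vec d),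
    HasDerivAt (fun t : ℝ => (U (φ + t • freq) u).1 x)
      ((H φ (U φ u)).1 x - (U φ (H' φ u)).1 x) 0

/-- The set `Ω = [1, 2]^{n + d}` of frequencies. -/
def Omega (n d : ℕ) : Set (Param n d) :=
  {w | (∀ i, w.1 i ∈ Set.Icc (1 : ℝ) 2) ∧ ∀ i, w.2 i ∈ Set.Icc (1 : ℝ) 2}

/-- The set `Ω_{0,γ}` of the `(ω, ν) ∈ Ω` such that
`|ω·l + ν⁽⁰⁾(ω, ν)·j| > γ / ⟨l, j⟩^τ` for all `(l, j) ≠ 0`. -/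
def Omega0 {n d : ℕ} (γ τ : ℝ) (ν₀ : Param n d → Vec d) : Set (Param n d) :=
  {w | w ∈ Omega n d ∧ ∀ (l : Fin n → ℤ) (j : Fin d → ℤ), (l, j) ≠ (0, 0) →
    γ / Real.sqrt (1 + dot (intVec l) (intVec l) + dot (intVec j) (intVec j)) ^ τ
      < |dot w.1 (intVec l) + dot (ν₀ w) (intVec j)|}

end TorusPDO

end

/-!
Operators on `C^∞(𝕋^d)` depending on `φ ∈ 𝕋^n` are encoded by lattice symbols `a κ q` (`Hat`):
`κ ∈ ℤ^n × ℤ^d` is the frequency of the symbol in `(φ, x)`, and `q ∈ ℤ^d` is the lattice point at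
which the symbol is taken. A lattice symbol has order `m` (`Bd`) if it decreases rapidly in `κ` and
its differences of order `k` in `q` are of order `m - k`. Lipschitz families (`LipBd`) are bounded on
the vertices of a graph of parameters (`ParamGraph`) with differences along the edges bounded by
their length. Composition becomes an explicit series, adjoints preserve the order, and commutators
lower the total order by one (`LipBd.comm`), because all terms of the series beyond the pointwise
product contain a difference.

A generator (`IsGen`) has order at most one and a Hermitian part of order zero. Conjugating it with
a power of the frequency preserves this structure, so that finite truncations obey energy
estimates with constants independent of the truncation (`energy_finite`); this gives existence of the
flow (`exists_flow`) and, by `energy_estimate`, uniqueness and weighted bounds. These bounds and the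
Lipschitz bounds for the flow lose a fixed number of powers of the weight. Egorov's theorem
(`IsGen.egorov`), that conjugation by the flow of a generator of order less than one preserves the
class of a symbol, is a consequence: the derivative of a conjugated symbol is the conjugated
commutator with the generator, whose order is lower by a fixed positive amount, and after sufficiently
many commutators the bound `IsGen.cj_base`, crude but with a loss independent of the order, suffices.

In the variables `(φ, x)` the equation is governed by `λ + ε (z + w)`, where the diagonal operator `λ`
has the entries `i (ν · j - ω · l)`. One step of the reduction (`exists_step`) conjugates with the flow
at time `ε` of the generator with symbol `(w - ⟨w⟩) / λ`, where `⟨w⟩` is the average in `(φ, x)`. By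
the nonresonance condition (`inv_dirFreq_le`) the division costs powers of `κ` only, hence no order.
The commutator with `λ` cancels `w - ⟨w⟩`, the average joins the normal form `z`, and what is left,
the commutator with `ε (z + w)` and the Taylor remainder of second order in `ε`, gains `𝔢` orders.
Iteration gives `exists_normal_form`. Generators inherit a Hermitian part of order zero from `w`,
since `λ` is purely imaginary. Reality and reversibility are symmetries of the lattice symbols; they
pass to the flows by uniqueness, and hence to the conjugated operators.

It remains to translate. On the side of operators, a tame operator in `(φ, x)` that commutes with
functions of `φ` acts fibrewise (`opAt`); this turns flows into flows (`IsGen.isFlow`), conjugations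
into time dependent changes of variables (`transforms_of_conj`), and formal adjoints, reality and
reversibility into conditions on lattice symbols (`l2inner_sum_iff`, `isRealOp_iff_hatSym`,
`isReversible_iff_hatSym`). On the side of symbols, the restriction to integer frequencies turns
derivatives into differences (`SymBd.hat`). Conversely a lattice symbol is interpolated with the
Fourier transform of a bump function whose integer translates add up to one (`interp_partBump`); the
derivative of such a kernel is a difference of kernels of the same kind, so that by summation by
parts derivatives of the interpolation are interpolations of differences (`Bd.ext`).
-/

noncomputable section

namespace TorusPDO

/-! ### Weights on lattices -/

/-- The weight `1 + ‖x‖`; on a lattice it is a submultiplicative substitute for `⟨x⟩`. -/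
def jb {V : Type*} [SeminormedAddCommGroup V] (x : V) : ℝ := 1 + ‖x‖

section jb
variable {V W : Type*} [SeminormedAddCommGroup V] [SeminormedAddCommGroup W]

theorem one_le_jb (x : V) : 1 ≤ jb x := by unfold jb; linarith [norm_nonneg x]
theorem jb_pos (x : V) : 0 < jb x := lt_of_lt_of_le one_pos (one_le_jb x)
@[simp] theorem jb_zero : jb (0 : V) = 1 := by simp [jb]
@[simp] theorem jb_neg (x : V) : jb (-x) = jb x := by simp [jb]
theorem jb_sub_comm (x y : V) : jb (x - y) = jb (y - x) := by simp [jb, norm_sub_rev]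

theorem jb_add_le (x y : V) : jb (x + y) ≤ jb x * jb y := by
  unfold jb
  nlinarith [norm_add_le x y, norm_nonneg x, norm_nonneg y,
    mul_nonneg (norm_nonneg x) (norm_nonneg y)]

theorem jb_le_sub_mul (x y : V) : jb x ≤ jb (x - y) * jb y := by
  simpa using jb_add_le (x - y) y

theorem one_le_jb_pow (x : V) (L : ℕ) : 1 ≤ jb x ^ L := one_le_pow₀ (one_le_jb x)
theorem jb_pow_pos (x : V) (L : ℕ) : 0 < jb x ^ L := pow_pos (jb_pos x) L
theorem jb_rpow_pos (x : V) (m : ℝ) : 0 < jb x ^ m := Real.rpow_pos_of_pos (jb_pos x) m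

theorem jb_pow_mono (x : V) {L L' : ℕ} (h : L ≤ L') : jb x ^ L ≤ jb x ^ L' :=
  pow_le_pow_right₀ (one_le_jb x) h

theorem jb_rpow_mono (x : V) {m m' : ℝ} (h : m ≤ m') : jb x ^ m ≤ jb x ^ m' :=
  Real.rpow_le_rpow_of_exponent_le (one_le_jb x) h

theorem jb_snd_le (x : V × W) : jb x.2 ≤ jb x := by
  unfold jb; linarith [norm_snd_le x]

theorem jb_fst_le (x : V × W) : jb x.1 ≤ jb x := by
  unfold jb; linarith [norm_fst_le x]

/-- Peetre's inequality for the weight `jb`. -/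
theorem jb_add_rpow_le (x y : V) (m : ℝ) : jb (x + y) ^ m ≤ jb x ^ m * jb y ^ ⌈|m|⌉₊ := by
  have hx := jb_pos x
  have hy := jb_pos y
  have hxy := jb_pos (x + y)
  have key : jb (x + y) ^ m ≤ jb x ^ m * jb y ^ |m| := by
    rcases le_or_gt 0 m with h | h
    · rw [abs_of_nonneg h, ← Real.mul_rpow hx.le hy.le]
      exact Real.rpow_le_rpow hxy.le (jb_add_le x y) h
    · rw [abs_of_neg h]
      have h1 : jb x ≤ jb (x + y) * jb y := by
        have := jb_add_le (x + y) (-y)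
        simpa using this
      have h2 : jb (x + y) = jb (x + y) * jb y / jb y := by field_simp
      rw [h2, Real.div_rpow (by positivity) hy.le, Real.rpow_neg hy.le, div_eq_mul_inv]
      exact mul_le_mul_of_nonneg_right (Real.rpow_le_rpow_of_nonpos hx h1 h.le)
        (inv_nonneg.2 (Real.rpow_nonneg hy.le _))
  refine key.trans ?_
  gcongr
  rw [← Real.rpow_natCast]
  exact jb_rpow_mono y (Nat.le_ceil _)

end jb

/-- Polynomial weights of large degree are summable. -/
class PolySummable (X : Type*) [NormedAddCommGroup X] : Prop where
  exists_summable : ∃ r : ℕ, Summable fun x : X => (jb x ^ r)⁻¹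

instance : PolySummable ℤ := by
  refine ⟨2, ?_⟩
  have h := (Real.summable_one_div_int_pow (p := 2)).2 (by norm_num)
  refine Summable.of_norm_bounded_eventually (g := fun n : ℤ => 1 / (n : ℝ) ^ 2) h ?_
  have : ({0} : Set ℤ)ᶜ ∈ Filter.cofinite := (Set.finite_singleton 0).compl_mem_cofinite
  filter_upwards [this] with n hn
  have hn : n ≠ 0 := hn
  have hpos : (0 : ℝ) < |(n : ℝ)| := by positivity
  rw [Real.norm_of_nonneg (by have := jb_pos n; positivity), ← sq_abs (n : ℝ), one_div]
  gcongr
  simp [jb, Int.norm_eq_abs]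

instance {X Y : Type*} [NormedAddCommGroup X] [NormedAddCommGroup Y] [PolySummable X]
    [PolySummable Y] : PolySummable (X × Y) := by
  obtain ⟨r, hr⟩ := PolySummable.exists_summable (X := X)
  obtain ⟨s, hs⟩ := PolySummable.exists_summable (X := Y)
  refine ⟨r + s, ?_⟩
  refine Summable.of_nonneg_of_le (fun x => by have := jb_pos x; positivity) (fun x => ?_)
    (hr.mul_of_nonneg hs (fun x => by have := jb_pos x; positivity)
      (fun x => by have := jb_pos x; positivity))
  have h1 := jb_pos x.1
  have h2 := jb_pos x.2
  have h3 := jb_pos x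
  rw [← mul_inv, pow_add]
  have e1 := pow_le_pow_left₀ h1.le (jb_fst_le x) r
  have e2 := pow_le_pow_left₀ h2.le (jb_snd_le x) s
  exact inv_anti₀ (by positivity) (mul_le_mul e1 e2 (by positivity) (by positivity))

theorem PolySummable.of_equiv {X Y : Type*} [NormedAddCommGroup X] [NormedAddCommGroup Y]
    [PolySummable X] (e : Y ≃ X) (h : ∀ y, ‖e y‖ ≤ ‖y‖) : PolySummable Y := by
  obtain ⟨r, hr⟩ := PolySummable.exists_summable (X := X)
  refine ⟨r, Summable.of_nonneg_of_le (fun x => by have := jb_pos x; positivity) (fun x => ?_)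
    (e.summable_iff.2 hr)⟩
  have := jb_pos (e x)
  simp only [Function.comp]
  gcongr
  unfold jb; linarith [h x]

instance polySummable_fin (k : ℕ) : PolySummable (Fin k → ℤ) := by
  induction k with
  | zero => exact ⟨0, Summable.of_finite⟩
  | succ k ih =>
    refine PolySummable.of_equiv (X := ℤ × (Fin k → ℤ)) (Fin.consEquiv fun _ => ℤ).symm
      (fun y => ?_)
    refine max_le (norm_le_pi_norm y 0) ?_
    exact (pi_norm_le_iff_of_nonneg (norm_nonneg y)).2 fun i => norm_le_pi_norm y _

section decay
variable {X : Type*} [NormedAddCommGroup X] [PolySummable X]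

/-- An exponent for which the polynomial weights on `X` are summable. -/
def decayExp (X : Type*) [NormedAddCommGroup X] [PolySummable X] : ℕ :=
  (PolySummable.exists_summable (X := X)).choose

/-- The sum of the weights with exponent `decayExp`. -/
def decaySum (X : Type*) [NormedAddCommGroup X] [PolySummable X] : ℝ :=
  ∑' x : X, (jb x ^ decayExp X)⁻¹

theorem summable_decay : Summable fun x : X => (jb x ^ decayExp X)⁻¹ :=
  (PolySummable.exists_summable (X := X)).choose_spec

theorem decaySum_nonneg : 0 ≤ decaySum X :=
  tsum_nonneg fun x => by have := jb_pos x; positivity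

theorem le_decay {E : Type*} [SeminormedAddCommGroup E] {f : X → E} {C : ℝ}
    (h : ∀ x, jb x ^ decayExp X * ‖f x‖ ≤ C) (x : X) : ‖f x‖ ≤ C * (jb x ^ decayExp X)⁻¹ := by
  have := jb_pow_pos x (decayExp X)
  rw [← div_eq_mul_inv, le_div_iff₀ this, mul_comm]
  exact h x

theorem summable_norm_of_decay {E : Type*} [SeminormedAddCommGroup E] {f : X → E} {C : ℝ}
    (h : ∀ x, jb x ^ decayExp X * ‖f x‖ ≤ C) : Summable fun x => ‖f x‖ :=
  Summable.of_nonneg_of_le (fun _ => norm_nonneg _) (le_decay h) (summable_decay.mul_left C)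

theorem summable_of_decay {f : X → ℂ} {C : ℝ}
    (h : ∀ x, jb x ^ decayExp X * ‖f x‖ ≤ C) : Summable f :=
  (summable_norm_of_decay h).of_norm

theorem tsum_norm_le_of_decay {E : Type*} [SeminormedAddCommGroup E] {f : X → E} {C : ℝ}
    (h : ∀ x, jb x ^ decayExp X * ‖f x‖ ≤ C) : ∑' x, ‖f x‖ ≤ C * decaySum X := by
  rw [decaySum, ← tsum_mul_left]
  exact (summable_norm_of_decay h).tsum_le_tsum (le_decay h) (summable_decay.mul_left C)

theorem norm_tsum_le_of_decay {f : X → ℂ} {C : ℝ}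
    (h : ∀ x, jb x ^ decayExp X * ‖f x‖ ≤ C) : ‖∑' x, f x‖ ≤ C * decaySum X :=
  (norm_tsum_le_tsum_norm (summable_norm_of_decay h)).trans (tsum_norm_le_of_decay h)

theorem summable_norm_of_decay_sub {f : X → ℂ} {C : ℝ} (y : X)
    (h : ∀ x, jb (y - x) ^ decayExp X * ‖f x‖ ≤ C) : Summable fun x => ‖f x‖ := by
  have := summable_norm_of_decay (f := fun x => f (y - x)) (C := C) (fun x => by
    simpa using h (y - x))
  exact (Equiv.subLeft y).summable_iff.1 this

theorem summable_of_decay_sub {f : X → ℂ} {C : ℝ} (y : X)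
    (h : ∀ x, jb (y - x) ^ decayExp X * ‖f x‖ ≤ C) : Summable f :=
  (summable_norm_of_decay_sub y h).of_norm

theorem norm_tsum_le_of_decay_sub {f : X → ℂ} {C : ℝ} (y : X)
    (h : ∀ x, jb (y - x) ^ decayExp X * ‖f x‖ ≤ C) : ‖∑' x, f x‖ ≤ C * decaySum X := by
  rw [← (Equiv.subLeft y).tsum_eq f]
  exact norm_tsum_le_of_decay fun x => by simpa using h (y - x)

theorem sum_le_of_decay_sub {f : X → ℝ} {C : ℝ} (y : X) (h0 : ∀ x, 0 ≤ f x)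
    (h : ∀ x, jb (y - x) ^ decayExp X * f x ≤ C) (F : Finset X) :
    ∑ x ∈ F, f x ≤ C * decaySum X := by
  have h' : ∀ x, jb x ^ decayExp X * ‖f (y - x)‖ ≤ C := fun x => by
    rw [Real.norm_of_nonneg (h0 _)]; simpa using h (y - x)
  have hs : Summable f := by
    have := summable_norm_of_decay h'
    refine (Equiv.subLeft y).summable_iff.1 (this.congr fun x => ?_)
    rw [Real.norm_of_nonneg (h0 _)]; rfl
  refine (hs.sum_le_tsum F fun x _ => h0 x).trans ?_
  rw [← (Equiv.subLeft y).tsum_eq f]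
  refine le_trans (le_of_eq (tsum_congr fun x => ?_)) (tsum_norm_le_of_decay h')
  rw [Real.norm_of_nonneg (h0 _)]; rfl

end decay

/-! ### Lattice symbols -/

/-- The lattice dual to `𝕋^n × 𝕋^d`. -/
abbrev Freq (n d : ℕ) := (Fin n → ℤ) × (Fin d → ℤ)

/-- The Fourier transform in `(φ, x)` of a symbol `a(φ, x, ξ)` with `ξ` restricted to the lattice:
`a κ q` is the coefficient of `e^{i κ·(φ, x)}` in `a(·, ·, q)`. -/
abbrev Hat (n d : ℕ) := Freq n d → (Fin d → ℤ) → ℂ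

/-- Iterated forward differences along the listed coordinate directions. -/
def diffList {d : ℕ} : List (Fin d) → ((Fin d → ℤ) → ℂ) → (Fin d → ℤ) → ℂ
  | [], f => f
  | j :: v, f => diffList v fun q => f (q + Pi.single j 1) - f q

section diffList
variable {d : ℕ}

theorem diffList_add (v : List (Fin d)) (f g : (Fin d → ℤ) → ℂ) :
    diffList v (fun q => f q + g q) = fun q => diffList v f q + diffList v g q := by
  induction v generalizing f g with
  | nil => rfl
  | cons j v ih =>
    simp only [diffList]
    rw [← ih]
    congr 1; funext q; ring

theorem diffList_const_mul (v : List (Fin d)) (c : ℂ) (f : (Fin d → ℤ) → ℂ) :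
    diffList v (fun q => c * f q) = fun q => c * diffList v f q := by
  induction v generalizing f with
  | nil => rfl
  | cons j v ih =>
    simp only [diffList]
    rw [← ih]
    congr 1; funext q; ring

theorem diffList_sub (v : List (Fin d)) (f g : (Fin d → ℤ) → ℂ) :
    diffList v (fun q => f q - g q) = fun q => diffList v f q - diffList v g q := by
  induction v generalizing f g with
  | nil => rfl
  | cons j v ih =>
    simp only [diffList]
    rw [← ih]
    congr 1; funext q; ring

theorem diffList_comp_add (v : List (Fin d)) (k : Fin d → ℤ) (f : (Fin d → ℤ) → ℂ) :
    diffList v (fun q => f (q + k)) = fun q => diffList v f (q + k) := by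
  induction v generalizing f with
  | nil => rfl
  | cons j v ih =>
    simp only [diffList]
    rw [← ih]
    simp only [add_right_comm]

theorem diffList_conj (v : List (Fin d)) (f : (Fin d → ℤ) → ℂ) :
    diffList v (fun q => (starRingEnd ℂ) (f q)) = fun q => (starRingEnd ℂ) (diffList v f q) := by
  induction v generalizing f with
  | nil => rfl
  | cons j v ih =>
    simp only [diffList]
    rw [← ih]
    simp only [map_sub]

/-- Differences of order `N` are controlled by `2^N` values, up to Peetre's inequality. -/
theorem norm_diffList_le (v : List (Fin d)) (m : ℝ) : ∃ A : ℝ, 0 ≤ A ∧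
    ∀ (f : (Fin d → ℤ) → ℂ) (B : ℝ), (∀ q, ‖f q‖ ≤ B * jb q ^ m) →
      ∀ q, ‖diffList v f q‖ ≤ A * B * jb q ^ m := by
  induction v with
  | nil => exact ⟨1, zero_le_one, fun f B h q => by simpa [diffList] using h q⟩
  | cons j v ih =>
    obtain ⟨A, hA, h⟩ := ih
    refine ⟨A * (jb (Pi.single j 1 : Fin d → ℤ) ^ ⌈|m|⌉₊ + 1), by
      have := jb_pow_pos (Pi.single j 1 : Fin d → ℤ) ⌈|m|⌉₊; positivity, fun f B hf q => ?_⟩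
    have hB : 0 ≤ B := by
      have h0 := (norm_nonneg _).trans (hf 0)
      simpa using h0
    have := h (fun q => f (q + Pi.single j 1) - f q)
      (B * (jb (Pi.single j 1 : Fin d → ℤ) ^ ⌈|m|⌉₊ + 1)) (fun q => ?_) q
    · refine this.trans (le_of_eq ?_); ring
    · refine (norm_sub_le _ _).trans ?_
      have h1 := hf (q + Pi.single j 1)
      have h2 := hf q
      have h3 := jb_add_rpow_le q (Pi.single j 1 : Fin d → ℤ) m
      have h4 := mul_le_mul_of_nonneg_left h3 hB
      nlinarith

end diffList

section Bd
variable {n d : ℕ} {P : Type}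

/-- One seminorm of the class `Bd`. -/
def BdAt (v : List (Fin d)) (L : ℕ) (m : ℝ) (wt : P → ℝ) (a : P → Hat n d) : Prop :=
  ∃ C : ℝ, ∀ p κ q, jb κ ^ L * ‖diffList v (a p κ) q‖ ≤ C * wt p * jb q ^ (m - v.length)

/-- Families of lattice symbols of order `m`: each difference in `q` gains one order, and there
is rapid decrease in the frequency `κ`. The constants are uniform in the parameter `p`, up to
the factor `wt p`. -/
def Bd (m : ℝ) (wt : P → ℝ) (a : P → Hat n d) : Prop :=
  ∀ (v : List (Fin d)) (L : ℕ), BdAt v L m wt a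

variable {m m' : ℝ} {wt wt' : P → ℝ} {a b : P → Hat n d}

theorem BdAt.mono {v : List (Fin d)} {L : ℕ} (h : BdAt v L m wt a) (hm : m ≤ m') :
    BdAt v L m' wt a := by
  obtain ⟨C, hC⟩ := h
  refine ⟨C, fun p κ q => (hC p κ q).trans ?_⟩
  have h0 : 0 ≤ C * wt p := by
    have h1 := (mul_nonneg (jb_pow_pos κ L).le (norm_nonneg _)).trans (hC p κ q)
    exact nonneg_of_mul_nonneg_left h1 (jb_rpow_pos q _)
  exact mul_le_mul_of_nonneg_left (jb_rpow_mono q (by linarith)) h0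

theorem Bd.mono (h : Bd m wt a) (hm : m ≤ m') : Bd m' wt a := fun v L => (h v L).mono hm

theorem BdAt.add {v : List (Fin d)} {L : ℕ} (ha : BdAt v L m wt a) (hb : BdAt v L m wt b) :
    BdAt v L m wt fun p κ q => a p κ q + b p κ q := by
  obtain ⟨C, hC⟩ := ha
  obtain ⟨C', hC'⟩ := hb
  refine ⟨C + C', fun p κ q => ?_⟩
  rw [diffList_add]
  have h := norm_add_le (diffList v (a p κ) q) (diffList v (b p κ) q)
  nlinarith [hC p κ q, hC' p κ q, mul_le_mul_of_nonneg_left h (jb_pow_pos κ L).le]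

theorem Bd.add (ha : Bd m wt a) (hb : Bd m wt b) : Bd m wt fun p κ q => a p κ q + b p κ q :=
  fun v L => (ha v L).add (hb v L)

/-- Multiplication by functions of the parameter and of `κ`, of polynomial growth in `κ`. -/
theorem Bd.mul_freq (ha : Bd m wt a) (f : P → Freq n d → ℂ) {C : ℝ} {N : ℕ}
    (hf : ∀ p κ, ‖f p κ‖ ≤ C * wt' p * jb κ ^ N) :
    Bd m (fun p => wt' p * wt p) fun p κ q => f p κ * a p κ q := by
  intro v L
  obtain ⟨C', hC'⟩ := ha v (L + N)
  refine ⟨C * C', fun p κ q => ?_⟩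
  rw [diffList_const_mul, norm_mul]
  have hk := jb_pow_pos κ N
  have hL := jb_pow_pos κ L
  have h1 := hC' p κ q
  have h0 := (norm_nonneg _).trans (hf p κ)
  have h0' : 0 ≤ C * wt' p := nonneg_of_mul_nonneg_left h0 hk
  calc jb κ ^ L * (‖f p κ‖ * ‖diffList v (a p κ) q‖)
      ≤ jb κ ^ L * ((C * wt' p * jb κ ^ N) * ‖diffList v (a p κ) q‖) := by
        gcongr; exact hf p κ
    _ = C * wt' p * (jb κ ^ (L + N) * ‖diffList v (a p κ) q‖) := by rw [pow_add]; ring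
    _ ≤ C * wt' p * (C' * wt p * jb q ^ (m - v.length)) := by gcongr
    _ = _ := by ring

theorem Bd.congr_wt (ha : Bd m wt a) (h : ∀ p, wt p = wt' p) : Bd m wt' a := by
  rwa [show wt' = wt from funext fun p => (h p).symm]

theorem Bd.const_mul (ha : Bd m wt a) (c : ℂ) : Bd m wt fun p κ q => c * a p κ q := by
  have := ha.mul_freq (wt' := fun _ => 1) (fun _ _ => c) (C := ‖c‖) (N := 0) (by simp)
  exact this.congr_wt (by simp)

theorem Bd.neg (ha : Bd m wt a) : Bd m wt fun p κ q => -a p κ q := by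
  simpa using ha.const_mul (-1)

theorem Bd.sub (ha : Bd m wt a) (hb : Bd m wt b) : Bd m wt fun p κ q => a p κ q - b p κ q := by
  simpa [sub_eq_add_neg] using ha.add hb.neg

theorem Bd.comp {Q : Type} (ha : Bd m wt a) (g : Q → P) :
    Bd m (fun x => wt (g x)) fun x => a (g x) := fun v L => by
  obtain ⟨C, hC⟩ := ha v L
  exact ⟨C, fun p => hC (g p)⟩

theorem Bd.diff (ha : Bd m wt a) (j : Fin d) :
    Bd (m - 1) wt fun p κ q => a p κ (q + Pi.single j 1) - a p κ q := by
  intro v L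
  obtain ⟨C, hC⟩ := ha (j :: v) L
  refine ⟨C, fun p κ q => ?_⟩
  have := hC p κ q
  simp only [List.length_cons, Nat.cast_add, Nat.cast_one] at this
  rw [show m - 1 - (v.length : ℝ) = m - (v.length + 1) by ring]
  exact this

theorem Bd.shift (ha : Bd m wt a) (k : Fin d → ℤ) : Bd m wt fun p κ q => a p κ (q + k) := by
  intro v L
  obtain ⟨C, hC⟩ := ha v L
  refine ⟨C * jb k ^ ⌈|m - v.length|⌉₊, fun p κ q => ?_⟩
  rw [diffList_comp_add]
  have h0 := (mul_nonneg (jb_pow_pos κ L).le (norm_nonneg _)).trans (hC p κ (q + k))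
  have h1 : 0 ≤ C * wt p := nonneg_of_mul_nonneg_left h0 (jb_rpow_pos _ _)
  refine (hC p κ (q + k)).trans ?_
  refine (mul_le_mul_of_nonneg_left (jb_add_rpow_le q k _) h1).trans (le_of_eq (by ring))

/-- Restriction to the zero frequency, i.e. the average over the torus. -/
def avg (a : Hat n d) : Hat n d := fun κ q => if κ = 0 then a κ q else 0

/-- Polynomially bounded lattice symbols. -/
def Temp (a : Hat n d) : Prop :=
  ∀ L : ℕ, ∃ (C : ℝ) (N : ℕ), 0 ≤ C ∧ ∀ κ q, jb κ ^ L * ‖a κ q‖ ≤ C * jb q ^ N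

theorem BdAt.temp_bound {L : ℕ} (h : BdAt [] L m wt a) (p : P) :
    ∃ (C : ℝ) (N : ℕ), 0 ≤ C ∧ ∀ κ q, jb κ ^ L * ‖a p κ q‖ ≤ C * jb q ^ N := by
  obtain ⟨C, hC⟩ := h
  refine ⟨|C * wt p|, ⌈|m|⌉₊, abs_nonneg _, fun κ q => (hC p κ q).trans ?_⟩
  refine (mul_le_mul_of_nonneg_right (le_abs_self _) (jb_rpow_pos q _).le).trans ?_
  refine mul_le_mul_of_nonneg_left ?_ (abs_nonneg _)
  rw [← Real.rpow_natCast]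
  refine jb_rpow_mono q ?_
  simp only [List.length_nil, Nat.cast_zero, sub_zero]
  exact (le_abs_self m).trans (Nat.le_ceil _)

theorem Bd.temp (h : Bd m wt a) (p : P) : Temp (a p) := fun L => (h [] L).temp_bound p

theorem Temp.shift {a : Hat n d} (ha : Temp a) (k : Fin d → ℤ) : Temp fun κ q => a κ (q + k) := by
  intro L
  obtain ⟨C, N, hC0, hC⟩ := ha L
  refine ⟨C * jb k ^ N, N, by have := jb_pos k; positivity, fun κ q => (hC κ (q + k)).trans ?_⟩
  have := jb_pos (q + k)
  have h : jb (q + k) ^ N ≤ (jb q * jb k) ^ N := by gcongr; exact jb_add_le q k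
  rw [mul_pow] at h
  nlinarith [mul_le_mul_of_nonneg_left h hC0]

theorem Temp.add {a b : Hat n d} (ha : Temp a) (hb : Temp b) : Temp fun κ q => a κ q + b κ q := by
  intro L
  obtain ⟨C, N, hC0, hC⟩ := ha L
  obtain ⟨C', N', hC0', hC'⟩ := hb L
  refine ⟨C + C', N + N', by positivity, fun κ q => ?_⟩
  have h1 := mul_le_mul_of_nonneg_left (jb_pow_mono q (Nat.le_add_right N N')) hC0
  have h2 := mul_le_mul_of_nonneg_left (jb_pow_mono q (Nat.le_add_left N' N)) hC0'
  have h3 := mul_le_mul_of_nonneg_left (norm_add_le (a κ q) (b κ q)) (jb_pow_pos κ L).le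
  nlinarith [hC κ q, hC' κ q]

theorem Temp.mul_freq {a : Hat n d} (ha : Temp a) (f : Freq n d → ℂ) {C : ℝ} {N : ℕ}
    (hf : ∀ κ, ‖f κ‖ ≤ C * jb κ ^ N) : Temp fun κ q => f κ * a κ q := by
  intro L
  obtain ⟨C', N', hC0', hC'⟩ := ha (L + N)
  have hC0 : 0 ≤ C := by have := (norm_nonneg _).trans (hf 0); simpa using this
  refine ⟨C * C', N', by positivity, fun κ q => ?_⟩
  rw [norm_mul]
  have hL := jb_pow_pos κ L
  calc jb κ ^ L * (‖f κ‖ * ‖a κ q‖)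
      ≤ jb κ ^ L * ((C * jb κ ^ N) * ‖a κ q‖) := by
        gcongr; exact hf κ
    _ = C * (jb κ ^ (L + N) * ‖a κ q‖) := by rw [pow_add]; ring
    _ ≤ C * (C' * jb q ^ N') := mul_le_mul_of_nonneg_left (hC' κ q) hC0
    _ = _ := by ring

theorem Temp.const_mul {a : Hat n d} (ha : Temp a) (c : ℂ) : Temp fun κ q => c * a κ q :=
  ha.mul_freq (fun _ => c) (C := ‖c‖) (N := 0) (by simp)

theorem Temp.neg {a : Hat n d} (ha : Temp a) : Temp fun κ q => -a κ q := by
  simpa using ha.const_mul (-1)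

theorem Temp.sub {a b : Hat n d} (ha : Temp a) (hb : Temp b) : Temp fun κ q => a κ q - b κ q := by
  simpa [sub_eq_add_neg] using ha.add hb.neg

/-! ### Composition of lattice symbols -/

/-- A common form of the composition (`c = 0`) and of its part beyond the pointwise
product of symbols (`c = 1`). -/
def gsharp (c : ℂ) (a b : Hat n d) : Hat n d := fun κ q =>
  ∑' κ' : Freq n d, (a (κ - κ') (q + κ'.2) - c * a (κ - κ') q) * b κ' q

/-- Composition of symbols: `Op(a # b) = Op(a) Op(b)`. -/
def sharp (a b : Hat n d) : Hat n d := gsharp 0 a b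

theorem sharp_apply (a b : Hat n d) (κ : Freq n d) (q : Fin d → ℤ) :
    sharp a b κ q = ∑' κ' : Freq n d, a (κ - κ') (q + κ'.2) * b κ' q := by
  simp [sharp, gsharp]

theorem gsharp_summable_norm (c : ℂ) {a b : Hat n d} (ha : Temp a) (hb : Temp b) (κ : Freq n d)
    (q : Fin d → ℤ) :
    Summable fun κ' : Freq n d => ‖(a (κ - κ') (q + κ'.2) - c * a (κ - κ') q) * b κ' q‖ := by
  obtain ⟨C, N, hC0, hC⟩ := ha 0
  obtain ⟨C', N', hC0', hC'⟩ := hb (N + decayExp (Freq n d))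
  refine summable_norm_of_decay (C := C * jb q ^ N * (1 + ‖c‖) * (C' * jb q ^ N')) fun κ' => ?_
  rw [norm_mul]
  have hq := jb_pos q
  have hk := one_le_jb κ'
  have hk0 := jb_pos κ'
  have h1 : ‖a (κ - κ') (q + κ'.2) - c * a (κ - κ') q‖ ≤ C * jb q ^ N * (1 + ‖c‖) * jb κ' ^ N := by
    have e1 := hC (κ - κ') (q + κ'.2)
    have e2 := hC (κ - κ') q
    rw [pow_zero, one_mul] at e1 e2
    have e3 : jb (q + κ'.2) ^ N ≤ (jb q * jb κ') ^ N := by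
      have := jb_pos (q + κ'.2)
      gcongr
      refine (jb_add_le _ _).trans ?_
      gcongr
      exact jb_snd_le κ'
    rw [mul_pow] at e3
    refine (norm_sub_le _ _).trans ?_
    rw [norm_mul]
    have e4 : C * jb q ^ N ≤ C * jb q ^ N * jb κ' ^ N :=
      le_mul_of_one_le_right (by positivity) (one_le_jb_pow κ' N)
    have e5 := mul_le_mul_of_nonneg_left e3 hC0
    have e6 := mul_le_mul_of_nonneg_left (e2.trans e4) (norm_nonneg c)
    nlinarith
  calc jb κ' ^ decayExp (Freq n d) * (‖a (κ - κ') (q + κ'.2) - c * a (κ - κ') q‖ * ‖b κ' q‖)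
      ≤ jb κ' ^ decayExp (Freq n d) * ((C * jb q ^ N * (1 + ‖c‖) * jb κ' ^ N) * ‖b κ' q‖) := by
        gcongr
    _ = C * jb q ^ N * (1 + ‖c‖) * (jb κ' ^ (N + decayExp (Freq n d)) * ‖b κ' q‖) := by
        rw [pow_add]; ring
    _ ≤ _ := by
        refine mul_le_mul_of_nonneg_left (hC' κ' q) (by positivity)

theorem gsharp_summable (c : ℂ) {a b : Hat n d} (ha : Temp a) (hb : Temp b) (κ : Freq n d)
    (q : Fin d → ℤ) :
    Summable fun κ' : Freq n d => (a (κ - κ') (q + κ'.2) - c * a (κ - κ') q) * b κ' q :=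
  (gsharp_summable_norm c ha hb κ q).of_norm

theorem gsharp_sub_left (c : ℂ) {a a' b : Hat n d} (ha : Temp a) (ha' : Temp a') (hb : Temp b) :
    gsharp c (fun κ q => a κ q - a' κ q) b = fun κ q => gsharp c a b κ q - gsharp c a' b κ q := by
  funext κ q
  simp only [gsharp]
  rw [← (gsharp_summable c ha hb κ q).tsum_sub (gsharp_summable c ha' hb κ q)]
  exact tsum_congr fun κ' => by ring

theorem gsharp_sub_right (c : ℂ) {a b b' : Hat n d} (ha : Temp a) (hb : Temp b) (hb' : Temp b') :
    gsharp c a (fun κ q => b κ q - b' κ q) = fun κ q => gsharp c a b κ q - gsharp c a b' κ q := by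
  funext κ q
  simp only [gsharp]
  rw [← (gsharp_summable c ha hb κ q).tsum_sub (gsharp_summable c ha hb' κ q)]
  exact tsum_congr fun κ' => by ring

/-- Leibniz rule for first differences of a composition. -/
theorem gsharp_diff (c : ℂ) {a b : Hat n d} (ha : Temp a) (hb : Temp b) (j : Fin d) (κ : Freq n d)
    (q : Fin d → ℤ) :
    gsharp c a b κ (q + Pi.single j 1) - gsharp c a b κ q =
      gsharp c (fun κ q => a κ (q + Pi.single j 1) - a κ q) (fun κ q => b κ (q + Pi.single j 1)) κ q
      + gsharp c a (fun κ q => b κ (q + Pi.single j 1) - b κ q) κ q := by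
  have hb1 := hb.shift (Pi.single j 1)
  rw [gsharp_sub_left c (ha.shift _) ha hb1, gsharp_sub_right c ha hb1 hb]
  have : gsharp c a b κ (q + Pi.single j 1) = gsharp c (fun κ q => a κ (q + Pi.single j 1))
      (fun κ q => b κ (q + Pi.single j 1)) κ q := by
    simp only [gsharp]
    exact tsum_congr fun κ' => by simp only [add_right_comm]
  rw [this]; ring

/-- A base estimate propagates to all differences by the Leibniz rule. -/
theorem Bd.gsharp_of_base (c : ℂ) (g : ℝ)
    (base : ∀ (m m' : ℝ) (a b : P → Hat n d), Bd m wt a → Bd m' wt' b →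
      ∀ L, BdAt [] L (m + m' - g) (fun p => wt p * wt' p) fun p => gsharp c (a p) (b p))
    (ha : Bd m wt a) (hb : Bd m' wt' b) :
    Bd (m + m' - g) (fun p => wt p * wt' p) fun p => gsharp c (a p) (b p) := by
  intro v
  induction v generalizing m m' a b with
  | nil => exact base m m' a b ha hb
  | cons j v ih =>
    intro L
    obtain ⟨C, hC⟩ := (show BdAt v L (m + m' - g - 1) _ _ from by
      have := ih (ha.diff j) (hb.shift (Pi.single j 1)) L
      rwa [show m - 1 + m' - g = m + m' - g - 1 by ring] at this).add
      (show BdAt v L (m + m' - g - 1) (fun p => wt p * wt' p) _ from by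
      have := ih ha (hb.diff j) L
      rwa [show m + (m' - 1) - g = m + m' - g - 1 by ring] at this)
    refine ⟨C, fun p κ q => ?_⟩
    have h := hC p κ q
    simp only [diffList, List.length_cons, Nat.cast_add, Nat.cast_one]
    rw [show m + m' - g - ((v.length : ℝ) + 1) = m + m' - g - 1 - v.length by ring]
    have e : (fun q => gsharp c (a p) (b p) κ (q + Pi.single j 1) - gsharp c (a p) (b p) κ q) =
      fun q => gsharp c (fun κ q => a p κ (q + Pi.single j 1) - a p κ q)
        (fun κ q => b p κ (q + Pi.single j 1)) κ q
        + gsharp c (a p) (fun κ q => b p κ (q + Pi.single j 1) - b p κ q) κ q :=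
      funext fun q => gsharp_diff c (ha.temp p) (hb.temp p) j κ q
    rw [e]
    exact h

/-- The base estimate, given an estimate for the translated factor. -/
theorem gsharp_base (c : ℂ) {g : ℝ} (hb : Bd m' wt' b) (L N : ℕ) {C : ℝ}
    (h : ∀ p κ q (k : Fin d → ℤ), jb κ ^ L * ‖a p κ (q + k) - c * a p κ q‖
      ≤ C * wt p * jb q ^ (m - g) * jb k ^ N) :
    BdAt [] L (m + m' - g) (fun p => wt p * wt' p) fun p => gsharp c (a p) (b p) := by
  obtain ⟨C', hC'⟩ := hb [] (L + N + decayExp (Freq n d))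
  refine ⟨C * C' * decaySum (Freq n d), fun p κ q => ?_⟩
  have hL := jb_pow_pos κ L
  have hq := jb_rpow_pos q
  have hCw : 0 ≤ C * wt p * jb q ^ (m - g) := by
    have := h p 0 q 0
    have h1 := (mul_nonneg (jb_pow_pos (0 : Freq n d) L).le (norm_nonneg _)).trans this
    simpa using h1
  have key : ∀ κ', jb κ' ^ decayExp (Freq n d) *
      ‖(jb κ ^ L : ℝ) * ((a p (κ - κ') (q + κ'.2) - c * a p (κ - κ') q) * b p κ' q)‖
      ≤ C * wt p * jb q ^ (m - g) * (C' * wt' p * jb q ^ m') := fun κ' => by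
    have hb' := hC' p κ' q
    simp only [List.length_nil, Nat.cast_zero, sub_zero, diffList] at hb'
    have hk := jb_pos κ'
    have hk2 := jb_pos κ'.2
    have hkk := jb_pos (κ - κ')
    have hkL : jb κ ^ L ≤ jb (κ - κ') ^ L * jb κ' ^ L := by
      rw [← mul_pow]
      have := jb_pos κ
      gcongr
      exact jb_le_sub_mul κ κ'
    have ha' := h p (κ - κ') q κ'.2
    rw [norm_mul, norm_mul]
    norm_cast
    rw [Real.norm_of_nonneg hL.le]
    set A := ‖a p (κ - κ') (q + κ'.2) - c * a p (κ - κ') q‖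
    set B := ‖b p κ' q‖
    have hA : 0 ≤ A := norm_nonneg _
    have hB : 0 ≤ B := norm_nonneg _
    calc jb κ' ^ decayExp (Freq n d) * (jb κ ^ L * (A * B))
        ≤ jb κ' ^ decayExp (Freq n d) * ((jb (κ - κ') ^ L * jb κ' ^ L) * (A * B)) := by gcongr
      _ = (jb (κ - κ') ^ L * A) * (jb κ' ^ L * jb κ' ^ decayExp (Freq n d) * B) := by ring
      _ ≤ (C * wt p * jb q ^ (m - g) * jb κ' ^ N) *
            (jb κ' ^ L * jb κ' ^ decayExp (Freq n d) * B) := by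
          refine mul_le_mul_of_nonneg_right (ha'.trans ?_) (by positivity)
          gcongr
          exact jb_snd_le κ'
      _ = C * wt p * jb q ^ (m - g) * (jb κ' ^ (L + N + decayExp (Freq n d)) * B) := by
          rw [pow_add, pow_add]; ring
      _ ≤ _ := mul_le_mul_of_nonneg_left hb' hCw
  have h2 := norm_tsum_le_of_decay key
  rw [tsum_mul_left, norm_mul] at h2
  norm_cast at h2
  rw [Real.norm_of_nonneg hL.le] at h2
  simp only [diffList, List.length_nil, Nat.cast_zero, sub_zero]
  refine h2.trans (le_of_eq ?_)
  rw [show m + m' - g = (m - g) + m' by ring, Real.rpow_add (jb_pos q)]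
  ring

/-- If all first differences of `f` are of order `m`, then `f (q + k) - f q` is of order `m`,
with polynomial growth in `k`. -/
theorem norm_add_sub_le (m : ℝ) : ∃ (A : ℝ) (N : ℕ), 0 ≤ A ∧
    ∀ (f : (Fin d → ℤ) → ℂ) (B : ℝ),
      (∀ j q, ‖f (q + Pi.single j 1) - f q‖ ≤ B * jb q ^ m) →
      0 ≤ B → ∀ q k, ‖f (q + k) - f q‖ ≤ A * B * jb q ^ m * jb k ^ N := by
  set c := ⌈|m|⌉₊
  -- moving along one coordinate
  have one : ∀ (f : (Fin d → ℤ) → ℂ) (B : ℝ),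
      (∀ j q, ‖f (q + Pi.single j 1) - f q‖ ≤ B * jb q ^ m) → 0 ≤ B →
      ∀ (N : ℕ) j q (z : ℤ), 0 ≤ z → z ≤ N →
        ‖f (q + Pi.single j z) - f q‖ ≤ z * (B * jb q ^ m * (jb (N : ℤ)) ^ c) := by
    intro f B hf hB N j q z hz hzN
    induction z, hz using Int.leInduction with
    | base => simp
    | succ z hz ih =>
      have ih := ih (by omega)
      have e : q + Pi.single j (z + 1) = q + Pi.single j z + Pi.single j 1 := by
        rw [Pi.single_add, add_assoc]
      have h1 := hf j (q + Pi.single j z)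
      have h2 := jb_add_rpow_le q (Pi.single j z : Fin d → ℤ) m
      have h3 : jb (Pi.single j z : Fin d → ℤ) ≤ jb (N : ℤ) := by
        unfold jb
        rw [Pi.norm_single]
        have : ‖z‖ ≤ ‖(N : ℤ)‖ := by
          rw [Int.norm_eq_abs, Int.norm_eq_abs]
          rw [abs_of_nonneg (by exact_mod_cast hz), abs_of_nonneg (by positivity)]
          exact_mod_cast (by omega : z ≤ N)
        linarith
      have h4 : jb (Pi.single j z : Fin d → ℤ) ^ c ≤ jb (N : ℤ) ^ c :=
        pow_le_pow_left₀ (jb_pos _).le h3 c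
      have hq := jb_rpow_pos q m
      have h5 : B * jb (q + Pi.single j z) ^ m ≤ B * (jb q ^ m * jb (N : ℤ) ^ c) :=
        mul_le_mul_of_nonneg_left (h2.trans (mul_le_mul_of_nonneg_left h4 hq.le)) hB
      rw [e]
      calc ‖f (q + Pi.single j z + Pi.single j 1) - f q‖
          ≤ ‖f (q + Pi.single j z + Pi.single j 1) - f (q + Pi.single j z)‖
            + ‖f (q + Pi.single j z) - f q‖ := by
            refine le_trans (le_of_eq ?_) (norm_add_le _ _)
            congr 1; ring
        _ ≤ _ := by push_cast; linarith
  have two : ∀ (f : (Fin d → ℤ) → ℂ) (B : ℝ),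
      (∀ j q, ‖f (q + Pi.single j 1) - f q‖ ≤ B * jb q ^ m) → 0 ≤ B →
      ∀ j q (z : ℤ), ‖f (q + Pi.single j z) - f q‖ ≤ B * jb q ^ m * jb z ^ (2 * c + 1) := by
    intro f B hf hB j q z
    have hz1 := one_le_jb z
    have hz0 := jb_pos z
    have hq := jb_rpow_pos q m
    have hzN : jb ((z.natAbs : ℕ) : ℤ) = jb z := by
      simp [jb, Int.norm_eq_abs]
    have hzz : |(z : ℝ)| ≤ jb z := by simp [jb, Int.norm_eq_abs]
    rcases le_or_gt 0 z with h | h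
    · have h1 := one f B hf hB z.natAbs j q z h (by omega)
      rw [hzN] at h1
      refine h1.trans ?_
      have : (z : ℝ) ≤ jb z := (le_abs_self _).trans hzz
      calc (z : ℝ) * (B * jb q ^ m * jb z ^ c) ≤ jb z * (B * jb q ^ m * jb z ^ c) := by gcongr
        _ = B * jb q ^ m * jb z ^ (c + 1) := by ring
        _ ≤ _ := by gcongr; omega
    · have h1 := one f B hf hB z.natAbs j (q + Pi.single j z) (-z) (by omega) (by omega)
      rw [hzN, add_assoc, ← Pi.single_add, add_neg_cancel, Pi.single_zero, add_zero,
        norm_sub_rev] at h1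
      refine h1.trans ?_
      have h2 : ((-z : ℤ) : ℝ) ≤ jb z := by push_cast; exact (neg_le_abs _).trans hzz
      have h3 := jb_add_rpow_le q (Pi.single j z : Fin d → ℤ) m
      have h4 : jb (Pi.single j z : Fin d → ℤ) = jb z := by unfold jb; rw [Pi.norm_single]
      rw [h4] at h3
      have h5 := jb_rpow_pos (q + Pi.single j z) m
      calc ((-z : ℤ) : ℝ) * (B * jb (q + Pi.single j z) ^ m * jb z ^ c)
          ≤ jb z * (B * (jb q ^ m * jb z ^ c) * jb z ^ c) := by gcongr
        _ = _ := by rw [pow_add, two_mul, pow_add]; ring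
  -- moving along several coordinates
  have many : ∀ s : Finset (Fin d), ∃ A : ℝ, 0 ≤ A ∧ ∀ (f : (Fin d → ℤ) → ℂ) (B : ℝ),
      (∀ j q, ‖f (q + Pi.single j 1) - f q‖ ≤ B * jb q ^ m) → 0 ≤ B →
      ∀ q (k : Fin d → ℤ), ‖f (q + ∑ i ∈ s, Pi.single i (k i)) - f q‖ ≤ A * B * jb q ^ m * jb k ^ (3 * c + 1) := by
    intro s
    induction s using Finset.induction_on with
    | empty => exact ⟨0, le_rfl, fun f B hf hB q k => by simp⟩
    | insert i s hi ih =>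
      obtain ⟨A, hA, h⟩ := ih
      refine ⟨A + 1, by positivity, fun f B hf hB q k => ?_⟩
      have h1 := h f B hf hB q k
      have h2 := two f B hf hB i (q + ∑ j ∈ s, Pi.single j (k j)) (k i)
      have h3 := jb_add_rpow_le q (∑ j ∈ s, Pi.single j (k j) : Fin d → ℤ) m
      have hk0 := jb_pos k
      have hq := jb_rpow_pos q m
      have h4 : jb (∑ j ∈ s, Pi.single j (k j) : Fin d → ℤ) ≤ jb k := by
        unfold jb
        gcongr
        refine (pi_norm_le_iff_of_nonneg (norm_nonneg k)).2 fun t => ?_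
        rw [Finset.sum_apply]
        simp only [Pi.single_apply]
        rw [Finset.sum_ite_eq]
        split_ifs
        · exact norm_le_pi_norm k t
        · simp
      have h5 : jb (k i) ≤ jb k := by unfold jb; gcongr; exact norm_le_pi_norm k i
      have hki := jb_pos (k i)
      have hss := jb_pos (∑ j ∈ s, Pi.single j (k j) : Fin d → ℤ)
      rw [Finset.sum_insert hi, add_comm _ (∑ j ∈ s, Pi.single j (k j)), ← add_assoc]
      calc ‖f (q + ∑ j ∈ s, Pi.single j (k j) + Pi.single i (k i)) - f q‖
          ≤ ‖f (q + ∑ j ∈ s, Pi.single j (k j) + Pi.single i (k i))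
              - f (q + ∑ j ∈ s, Pi.single j (k j))‖
            + ‖f (q + ∑ j ∈ s, Pi.single j (k j)) - f q‖ := by
            refine le_trans (le_of_eq ?_) (norm_add_le _ _)
            congr 1; ring
        _ ≤ B * (jb q ^ m * jb k ^ c) * jb k ^ (2 * c + 1)
              + A * B * jb q ^ m * jb k ^ (3 * c + 1) := by
            refine add_le_add (h2.trans ?_) h1
            gcongr
            refine h3.trans ?_
            gcongr
        _ = _ := by rw [show 3 * c + 1 = c + (2 * c + 1) by ring, pow_add]; ring
  obtain ⟨A, hA, h⟩ := many Finset.univ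
  refine ⟨A, 3 * c + 1, hA, fun f B hf hB q k => ?_⟩
  have := h f B hf hB q k
  rwa [Finset.univ_sum_single] at this

/-- The part of the composition beyond the pointwise product gains one order, since it contains a
difference of the first factor. -/
theorem Bd.gsharp_one (hwt : ∀ p, 0 ≤ wt p) (ha : Bd m wt a) (hb : Bd m' wt' b) :
    Bd (m + m' - 1) (fun p => wt p * wt' p) fun p => gsharp 1 (a p) (b p) := by
  refine Bd.gsharp_of_base 1 1 (fun m m' a b ha hb L => ?_) ha hb
  obtain ⟨A, N, hA, hAN⟩ := norm_add_sub_le (d := d) (m - 1)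
  have hex : ∃ C : ℝ, 0 ≤ C ∧ ∀ j p κ q, jb κ ^ L * ‖a p κ (q + Pi.single j 1) - a p κ q‖
      ≤ C * wt p * jb q ^ (m - 1) := by
    choose C hC using fun j : Fin d => ha [j] L
    refine ⟨∑ j, |C j|, Finset.sum_nonneg fun i _ => abs_nonneg _, fun j p κ q => ?_⟩
    have h := hC j p κ q
    simp only [diffList, List.length_singleton, Nat.cast_one] at h
    refine h.trans ?_
    have hq := jb_rpow_pos q (m - 1)
    have hw := hwt p
    gcongr
    refine (le_abs_self _).trans ?_
    exact Finset.single_le_sum (f := fun j => |C j|) (fun i _ => abs_nonneg _) (Finset.mem_univ j)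
  obtain ⟨C, hC0, hC⟩ := hex
  refine gsharp_base (g := 1) 1 hb L N (C := A * C) (fun p κ q k => ?_)
  have hL := jb_pow_pos κ L
  have hw := hwt p
  have h := hAN (fun q => (jb κ ^ L : ℝ) * a p κ q) (C * wt p) (fun j q => by
    rw [← mul_sub, norm_mul]
    norm_cast
    rw [Real.norm_of_nonneg hL.le]
    exact hC j p κ q) (by positivity) q k
  rw [← mul_sub, norm_mul] at h
  norm_cast at h
  rw [Real.norm_of_nonneg hL.le] at h
  rw [one_mul]
  refine h.trans (le_of_eq ?_)
  ring

/-- The commutator of symbols. -/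
def comm (a b : Hat n d) : Hat n d := fun κ q => sharp a b κ q - sharp b a κ q

theorem sharp_eq_conv_add {a b : Hat n d} (ha : Temp a) (hb : Temp b) (κ : Freq n d)
    (q : Fin d → ℤ) :
    sharp a b κ q = (∑' κ' : Freq n d, a (κ - κ') q * b κ' q) + gsharp 1 a b κ q := by
  have h0 := gsharp_summable 0 ha hb κ q
  have h1 := gsharp_summable 1 ha hb κ q
  have h2 : Summable fun κ' : Freq n d => a (κ - κ') q * b κ' q :=
    (h0.sub h1).congr fun κ' => by ring
  rw [sharp, gsharp, gsharp, ← h2.tsum_add h1]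
  exact tsum_congr fun κ' => by ring

/-- The pointwise products of symbols cancel in a commutator. -/
theorem comm_eq {a b : Hat n d} (ha : Temp a) (hb : Temp b) :
    comm a b = fun κ q => gsharp 1 a b κ q - gsharp 1 b a κ q := by
  funext κ q
  have : (∑' κ' : Freq n d, a (κ - κ') q * b κ' q) = ∑' κ' : Freq n d, b (κ - κ') q * a κ' q := by
    rw [← (Equiv.subLeft κ).tsum_eq]
    exact tsum_congr fun κ' => by simp [mul_comm]
  rw [comm, sharp_eq_conv_add ha hb, sharp_eq_conv_add hb ha, this]
  ring

/-- The commutator gains one order. -/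
theorem Bd.comm (hwt : ∀ p, 0 ≤ wt p) (hwt' : ∀ p, 0 ≤ wt' p) (ha : Bd m wt a) (hb : Bd m' wt' b) :
    Bd (m + m' - 1) (fun p => wt p * wt' p) fun p => comm (a p) (b p) := by
  have h1 := ha.gsharp_one hwt hb
  have h2 := hb.gsharp_one hwt' ha
  rw [add_comm m' m] at h2
  have h3 := h1.sub (h2.congr_wt fun p => mul_comm _ _)
  refine cast (congrArg _ ?_) h3
  funext p
  exact (comm_eq (ha.temp p) (hb.temp p)).symm

/-- The symbol of the adjoint operator. -/
def adj (a : Hat n d) : Hat n d := fun κ q => (starRingEnd ℂ) (a (-κ) (q + κ.2))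

theorem adj_adj (a : Hat n d) : adj (adj a) = a := by
  funext κ q; simp [adj]

theorem Bd.adj (ha : Bd m wt a) : Bd m wt fun p => adj (a p) := by
  intro v L
  obtain ⟨C, hC⟩ := ha v (L + ⌈|m - v.length|⌉₊)
  refine ⟨C, fun p κ q => ?_⟩
  have e : TorusPDO.adj (a p) κ = fun q => (starRingEnd ℂ) (a p (-κ) (q + κ.2)) := rfl
  have h := hC p (-κ) (q + κ.2)
  have h0 := (mul_nonneg (jb_pow_pos _ _).le (norm_nonneg _)).trans h
  have h1 : 0 ≤ C * wt p := nonneg_of_mul_nonneg_left h0 (jb_rpow_pos _ _)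
  change jb κ ^ L * ‖diffList v (TorusPDO.adj (a p) κ) q‖ ≤ _
  rw [e, diffList_conj, diffList_comp_add v κ.2 (a p (-κ)), RCLike.norm_conj]
  have hk := jb_pow_pos κ ⌈|m - v.length|⌉₊
  refine le_of_mul_le_mul_right ?_ hk
  calc _ = jb (-κ) ^ (L + ⌈|m - v.length|⌉₊) * ‖diffList v (a p (-κ)) (q + κ.2)‖ := by
        rw [jb_neg, pow_add]; ring
    _ ≤ C * wt p * jb (q + κ.2) ^ (m - v.length) := h
    _ ≤ C * wt p * (jb q ^ (m - v.length) * jb κ ^ ⌈|m - v.length|⌉₊) := by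
        gcongr
        refine (jb_add_rpow_le _ _ _).trans ?_
        have := jb_pos κ.2
        have := jb_rpow_pos q (m - v.length)
        gcongr
        exact jb_snd_le κ
    _ = _ := by ring

theorem adj_sharp (a b : Hat n d) : adj (sharp a b) = sharp (adj b) (adj a) := by
  funext κ q
  rw [adj, sharp_apply, sharp_apply, Complex.conj_tsum, ← (Equiv.addRight κ).symm.tsum_eq]
  refine tsum_congr fun κ' => ?_
  have e1 : -κ - (κ' + -κ) = -κ' := by abel
  have e2 : q + κ.2 + (κ' + -κ).2 = q + κ'.2 := by
    simp only [Prod.snd_add, Prod.snd_neg]; abel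
  have e3 : -(κ - κ') = κ' + -κ := by abel
  have e4 : q + κ'.2 + (κ - κ').2 = q + κ.2 := by simp
  simp only [adj, Equiv.addRight_symm, Equiv.coe_addRight, map_mul, e1, e2, e3, e4]
  rw [mul_comm]

end Bd

/-! ### Rapidly decreasing sequences and tame maps -/

section RS
variable {X Y Z : Type*} [NormedAddCommGroup X] [NormedAddCommGroup Y] [NormedAddCommGroup Z]

/-- Rapidly decreasing functions on a lattice. -/
def RS (X : Type*) [NormedAddCommGroup X] : Submodule ℂ (X → ℂ) where
  carrier := {v | ∀ L : ℕ, ∃ C : ℝ, ∀ x, jb x ^ L * ‖v x‖ ≤ C}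
  add_mem' := fun {a b} ha hb L => by
    obtain ⟨C, hC⟩ := ha L
    obtain ⟨C', hC'⟩ := hb L
    refine ⟨C + C', fun x => ?_⟩
    have := mul_le_mul_of_nonneg_left (norm_add_le (a x) (b x)) (jb_pow_pos x L).le
    have h1 := hC x
    have h2 := hC' x
    simp only [Pi.add_apply]
    nlinarith
  zero_mem' := fun L => ⟨0, fun x => by simp⟩
  smul_mem' := fun c a ha L => by
    obtain ⟨C, hC⟩ := ha L
    refine ⟨‖c‖ * C, fun x => ?_⟩
    have := mul_le_mul_of_nonneg_left (hC x) (norm_nonneg c)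
    simp only [Pi.smul_apply, smul_eq_mul, norm_mul]
    linarith

theorem RS.ext {u v : RS X} (h : ∀ x, u.1 x = v.1 x) : u = v := Subtype.ext (funext h)

@[simp] theorem RS.add_apply (u v : RS X) (x : X) : (u + v).1 x = u.1 x + v.1 x := rfl
@[simp] theorem RS.sub_apply (u v : RS X) (x : X) : (u - v).1 x = u.1 x - v.1 x := rfl
@[simp] theorem RS.smul_apply (c : ℂ) (v : RS X) (x : X) : (c • v).1 x = c * v.1 x := rfl
@[simp] theorem RS.neg_apply (v : RS X) (x : X) : (-v).1 x = -v.1 x := rfl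

theorem RS.sum_apply {ι : Type*} (s : Finset ι) (f : ι → RS X) (x : X) :
    (∑ i ∈ s, f i).1 x = ∑ i ∈ s, (f i).1 x := by
  simp

/-- Continuous linear maps between spaces of rapidly decreasing sequences. -/
def Tame (T : RS X →ₗ[ℂ] RS Y) : Prop :=
  ∀ L : ℕ, ∃ (L' : ℕ) (C : ℝ), 0 ≤ C ∧ ∀ (v : RS X) (B : ℝ), (∀ x, jb x ^ L' * ‖v.1 x‖ ≤ B) →
    ∀ y, jb y ^ L * ‖(T v).1 y‖ ≤ C * B

theorem Tame.comp {T : RS Y →ₗ[ℂ] RS Z} {S : RS X →ₗ[ℂ] RS Y} (hT : Tame T) (hS : Tame S) :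
    Tame (T ∘ₗ S) := by
  intro L
  obtain ⟨L₁, C₁, h₁, hT⟩ := hT L
  obtain ⟨L₂, C₂, h₂, hS⟩ := hS L₁
  refine ⟨L₂, C₁ * C₂, by positivity, fun v B hv y => ?_⟩
  rw [mul_assoc]
  exact hT _ _ (hS v B hv) y

theorem Tame.mul {T S : Module.End ℂ (RS X)} (hT : Tame T) (hS : Tame S) : Tame (T * S) :=
  Tame.comp hT hS

theorem Tame.one : Tame (1 : Module.End ℂ (RS X)) := fun L =>
  ⟨L, 1, zero_le_one, fun v B hv y => by simpa using hv y⟩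

theorem Tame.add {T S : RS X →ₗ[ℂ] RS Y} (hT : Tame T) (hS : Tame S) : Tame (T + S) := by
  intro L
  obtain ⟨L₁, C₁, h₁, hT⟩ := hT L
  obtain ⟨L₂, C₂, h₂, hS⟩ := hS L
  refine ⟨L₁ + L₂, C₁ + C₂, by positivity, fun v B hv y => ?_⟩
  have e1 := hT v B (fun x => le_trans (mul_le_mul_of_nonneg_right
    (jb_pow_mono x (by omega)) (norm_nonneg _)) (hv x)) y
  have e2 := hS v B (fun x => le_trans (mul_le_mul_of_nonneg_right
    (jb_pow_mono x (by omega)) (norm_nonneg _)) (hv x)) y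
  have e3 := mul_le_mul_of_nonneg_left (norm_add_le ((T v).1 y) ((S v).1 y)) (jb_pow_pos y L).le
  simp only [LinearMap.add_apply, RS.add_apply]
  nlinarith

theorem Tame.smul {T : RS X →ₗ[ℂ] RS Y} (hT : Tame T) (c : ℂ) : Tame (c • T) := by
  intro L
  obtain ⟨L₁, C₁, h₁, hT⟩ := hT L
  refine ⟨L₁, ‖c‖ * C₁, by positivity, fun v B hv y => ?_⟩
  have e1 := mul_le_mul_of_nonneg_left (hT v B hv y) (norm_nonneg c)
  simp only [LinearMap.smul_apply, RS.smul_apply, norm_mul]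
  linarith

theorem Tame.neg {T : RS X →ₗ[ℂ] RS Y} (hT : Tame T) : Tame (-T) := by
  rw [← neg_one_smul ℂ T]
  exact hT.smul (-1)

theorem Tame.sub {T S : RS X →ₗ[ℂ] RS Y} (hT : Tame T) (hS : Tame S) : Tame (T - S) := by
  have e : T - S = T + -S := sub_eq_add_neg T S
  rw [e]
  exact hT.add hS.neg

open Classical in
/-- The unit vectors. -/
def delta (x : X) : RS X := ⟨fun y => if y = x then 1 else 0, fun L => ⟨jb x ^ L, fun y => by
  dsimp only
  split_ifs with h
  · simp [h]
  · simpa using (jb_pow_pos x L).le⟩⟩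

open Classical in
theorem delta_apply (x y : X) : (delta x).1 y = if y = x then 1 else 0 := rfl

@[simp] theorem delta_self (x : X) : (delta x).1 x = 1 := by simp [delta_apply]
theorem delta_ne {x y : X} (h : y ≠ x) : (delta x).1 y = 0 := by simp [delta_apply, h]

theorem RS.decay (v : RS X) (L : ℕ) : ∃ C : ℝ, 0 ≤ C ∧ ∀ x, jb x ^ L * ‖v.1 x‖ ≤ C := by
  obtain ⟨C, hC⟩ := v.2 L
  exact ⟨C, (mul_nonneg (jb_pow_pos 0 L).le (norm_nonneg _)).trans (hC 0), hC⟩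

/-- Matrices with rapid off-diagonal decrease and polynomial growth. -/
def MatTemp (G : X → X → ℂ) : Prop :=
  ∀ L : ℕ, ∃ (C : ℝ) (N : ℕ), 0 ≤ C ∧ ∀ x y, jb (x - y) ^ L * ‖G x y‖ ≤ C * jb y ^ N

variable [PolySummable X]

theorem RS.summable_weighted (v : RS X) (L : ℕ) : Summable fun x => jb x ^ L * ‖v.1 x‖ := by
  obtain ⟨C, -, hC⟩ := RS.decay v (L + decayExp X)
  have := summable_norm_of_decay (f := fun x => ((jb x ^ L * ‖v.1 x‖ : ℝ) : ℝ)) (C := C)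
    (fun x => by
      have := jb_pow_pos x L
      rw [Real.norm_of_nonneg (by positivity), ← mul_assoc, ← pow_add, add_comm]
      exact hC x)
  refine this.congr fun x => ?_
  have := jb_pow_pos x L
  rw [Real.norm_of_nonneg (by positivity)]

/-- A tame map is determined by its matrix. -/
theorem Tame.hasSum {T : RS X →ₗ[ℂ] RS Y} (hT : Tame T) (v : RS X) (y : Y) :
    HasSum (fun x => v.1 x * (T (delta x)).1 y) ((T v).1 y) := by
  classical
  obtain ⟨L', C, hC0, hC⟩ := hT 0
  have hs := RS.summable_weighted v L'
  rw [HasSum, SummationFilter.unconditional_filter]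
  have h0 := tendsto_tsum_compl_atTop_zero fun x => jb x ^ L' * ‖v.1 x‖
  refine tendsto_iff_norm_sub_tendsto_zero.2 (squeeze_zero (fun _ => norm_nonneg _) (fun F => ?_)
    (by simpa using h0.const_mul C))
  have e : ∑ x ∈ F, v.1 x * (T (delta x)).1 y - (T v).1 y
      = (T (∑ x ∈ F, v.1 x • delta x - v)).1 y := by
    rw [map_sub, map_sum, RS.sub_apply, RS.sum_apply]
    simp
  rw [e]
  have := hC (∑ x ∈ F, v.1 x • delta x - v) (∑' x : { x // x ∉ F }, jb x.1 ^ L' * ‖v.1 x.1‖)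
    (fun x => ?_) y
  · simpa using this
  · rw [RS.sub_apply, RS.sum_apply]
    have hsF : Summable fun x : { x // x ∉ F } => jb x.1 ^ L' * ‖v.1 x.1‖ :=
      hs.comp_injective Subtype.val_injective
    by_cases hx : x ∈ F
    · have : ∑ z ∈ F, (v.1 z • delta z).1 x = v.1 x := by
        rw [Finset.sum_eq_single_of_mem x hx fun z _ hz => by
          simp [delta_ne hz.symm]]
        simp
      rw [this, sub_self, norm_zero, mul_zero]
      exact tsum_nonneg fun x => mul_nonneg (jb_pow_pos _ _).le (norm_nonneg _)
    · have : ∑ z ∈ F, (v.1 z • delta z).1 x = 0 :=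
        Finset.sum_eq_zero fun z hz => by
          have : x ≠ z := fun h => hx (h ▸ hz)
          simp [delta_ne this]
      rw [this, zero_sub, norm_neg]
      exact hsF.le_tsum ⟨x, hx⟩ fun z _ => mul_nonneg (jb_pow_pos _ _).le (norm_nonneg _)

theorem Tame.ext {T S : RS X →ₗ[ℂ] RS Y} (hT : Tame T) (hS : Tame S)
    (h : ∀ x y, (T (delta x)).1 y = (S (delta x)).1 y) : T = S := by
  refine LinearMap.ext fun v => RS.ext fun y => ?_
  have h1 := hT.hasSum v y
  simp only [h] at h1
  exact h1.unique (hS.hasSum v y)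

/-! ### Matrices -/

theorem MatTemp.row_bound {G : X → X → ℂ} (hG : MatTemp G) (L : ℕ) : ∃ (L' : ℕ) (C : ℝ), 0 ≤ C ∧
    ∀ (v : X → ℂ) (B : ℝ), (∀ x, jb x ^ L' * ‖v x‖ ≤ B) →
      ∀ x, (∀ y, jb y ^ decayExp X * ‖(jb x ^ L : ℝ) * (G x y * v y)‖ ≤ C * B) := by
  obtain ⟨C, N, hC0, hC⟩ := hG L
  refine ⟨decayExp X + (L + N), C, by positivity, fun v B hv x y => ?_⟩
  have hx := jb_pow_pos x L
  have hy := jb_pos y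
  have hxy := jb_pos (x - y)
  have h1 : jb x ^ L ≤ jb (x - y) ^ L * jb y ^ L := by
    rw [← mul_pow]
    exact pow_le_pow_left₀ (jb_pos x).le (jb_le_sub_mul x y) L
  rw [norm_mul, norm_mul]
  norm_cast
  rw [Real.norm_of_nonneg hx.le]
  calc jb y ^ decayExp X * (jb x ^ L * (‖G x y‖ * ‖v y‖))
      ≤ jb y ^ decayExp X * ((jb (x - y) ^ L * jb y ^ L) * (‖G x y‖ * ‖v y‖)) := by gcongr
    _ = (jb (x - y) ^ L * ‖G x y‖) * (jb y ^ decayExp X * jb y ^ L * ‖v y‖) := by ring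
    _ ≤ (C * jb y ^ N) * (jb y ^ decayExp X * jb y ^ L * ‖v y‖) := by
        refine mul_le_mul_of_nonneg_right (hC x y) (by positivity)
    _ = C * (jb y ^ (decayExp X + (L + N)) * ‖v y‖) := by rw [pow_add, pow_add]; ring
    _ ≤ C * B := by gcongr; exact hv y

theorem MatTemp.summable {G : X → X → ℂ} (hG : MatTemp G) (v : RS X) (x : X) :
    Summable fun y => G x y * v.1 y := by
  obtain ⟨L', C, hC0, hC⟩ := hG.row_bound 0
  obtain ⟨B, -, hB⟩ := RS.decay v L'
  refine summable_of_decay (C := C * B) fun y => ?_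
  simpa using hC v.1 B hB x y

theorem MatTemp.bound {G : X → X → ℂ} (hG : MatTemp G) (L : ℕ) : ∃ (L' : ℕ) (C : ℝ), 0 ≤ C ∧
    ∀ (v : X → ℂ) (B : ℝ), (∀ x, jb x ^ L' * ‖v x‖ ≤ B) →
      ∀ x, jb x ^ L * ‖∑' y, G x y * v y‖ ≤ C * B := by
  obtain ⟨L', C, hC0, hC⟩ := hG.row_bound L
  refine ⟨L', C * decaySum X, mul_nonneg hC0 decaySum_nonneg, fun v B hv x => ?_⟩
  have := norm_tsum_le_of_decay (hC v B hv x)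
  rw [tsum_mul_left, norm_mul] at this
  norm_cast at this
  rw [Real.norm_of_nonneg (jb_pow_pos x L).le] at this
  linarith

open Classical in
/-- The operator with the given matrix, and zero if the matrix is not of tempered type. -/
def matOp (G : X → X → ℂ) : Module.End ℂ (RS X) :=
  if hG : MatTemp G then
    { toFun := fun v => ⟨fun x => ∑' y, G x y * v.1 y, fun L => by
        obtain ⟨L', C, hC0, hC⟩ := hG.bound L
        obtain ⟨B, -, hB⟩ := RS.decay v L'
        exact ⟨C * B, hC v.1 B hB⟩⟩
      map_add' := fun u v => RS.ext fun x => by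
        simp only [RS.add_apply]
        rw [← (hG.summable u x).tsum_add (hG.summable v x)]
        exact tsum_congr fun y => by ring
      map_smul' := fun c v => RS.ext fun x => by
        simp only [RS.smul_apply, RingHom.id_apply]
        rw [← tsum_mul_left]
        exact tsum_congr fun y => by ring }
  else 0

theorem matOp_apply {G : X → X → ℂ} (hG : MatTemp G) (v : RS X) (x : X) :
    (matOp G v).1 x = ∑' y, G x y * v.1 y := by
  simp [matOp, hG]

theorem matOp_delta {G : X → X → ℂ} (hG : MatTemp G) (x y : X) :
    (matOp G (delta y)).1 x = G x y := by
  rw [matOp_apply hG, tsum_eq_single y fun z hz => by simp [delta_ne hz]]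
  simp

theorem matOp_tame (G : X → X → ℂ) : Tame (matOp G) := by
  by_cases hG : MatTemp G
  · intro L
    obtain ⟨L', C, hC0, hC⟩ := hG.bound L
    refine ⟨L', C, hC0, fun v B hv y => ?_⟩
    rw [matOp_apply hG]
    exact hC v.1 B hv y
  · intro L
    refine ⟨0, 1, zero_le_one, fun v B hv y => ?_⟩
    have h0 := (mul_nonneg (jb_pow_pos 0 0).le (norm_nonneg _)).trans (hv 0)
    simpa [matOp, hG] using h0

/-! ### Operators with lattice symbols -/

variable {n d : ℕ}

/-- The matrix of the operator with symbol `a`. -/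
def hatMat (a : Hat n d) (κ κ' : Freq n d) : ℂ := a (κ - κ') κ'.2

theorem Temp.mat {a : Hat n d} (ha : Temp a) : MatTemp (hatMat a) := by
  intro L
  obtain ⟨C, N, hC0, hC⟩ := ha L
  refine ⟨C, N, hC0, fun x y => (hC (x - y) y.2).trans ?_⟩
  have := jb_pos y.2
  gcongr
  exact jb_snd_le y

/-- The operator with lattice symbol `a`, acting on functions of `(φ, x)`. -/
def hatOp (a : Hat n d) : Module.End ℂ (RS (Freq n d)) := matOp (hatMat a)

theorem hatOp_tame (a : Hat n d) : Tame (hatOp a) := matOp_tame _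

theorem hatOp_apply {a : Hat n d} (ha : Temp a) (v : RS (Freq n d)) (κ : Freq n d) :
    (hatOp a v).1 κ = ∑' κ' : Freq n d, a (κ - κ') κ'.2 * v.1 κ' := matOp_apply ha.mat v κ

theorem hatOp_delta {a : Hat n d} (ha : Temp a) (κ κ' : Freq n d) :
    (hatOp a (delta κ')).1 κ = a (κ - κ') κ'.2 := matOp_delta ha.mat κ κ'

theorem hatOp_add {a b : Hat n d} (ha : Temp a) (hb : Temp b) :
    hatOp (fun κ q => a κ q + b κ q) = hatOp a + hatOp b :=
  (hatOp_tame _).ext ((hatOp_tame _).add (hatOp_tame _)) fun x y => by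
    simp [hatOp_delta ha, hatOp_delta hb, hatOp_delta (ha.add hb)]

theorem hatOp_sub {a b : Hat n d} (ha : Temp a) (hb : Temp b) :
    hatOp (fun κ q => a κ q - b κ q) = hatOp a - hatOp b :=
  (hatOp_tame _).ext ((hatOp_tame _).sub (hatOp_tame _)) fun x y => by
    simp [hatOp_delta ha, hatOp_delta hb, hatOp_delta (ha.sub hb)]

theorem hatOp_smul {a : Hat n d} (ha : Temp a) (c : ℂ) :
    hatOp (fun κ q => c * a κ q) = c • hatOp a :=
  (hatOp_tame _).ext ((hatOp_tame _).smul c) fun x y => by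
    simp [hatOp_delta ha, hatOp_delta (ha.const_mul c)]

/-- Translation in the frequencies of `φ`, i.e. multiplication by `e^{i l·φ}`. -/
def shiftOp (l : Fin n → ℤ) : Module.End ℂ (RS (Freq n d)) where
  toFun v := ⟨fun κ => v.1 (κ - (l, 0)), fun L => by
    obtain ⟨C, hC0, hC⟩ := RS.decay v L
    refine ⟨C * jb ((l, 0) : Freq n d) ^ L, fun κ => ?_⟩
    have h1 := hC (κ - (l, 0))
    have h2 : jb κ ^ L ≤ jb (κ - (l, 0)) ^ L * jb ((l, 0) : Freq n d) ^ L := by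
      rw [← mul_pow]
      exact pow_le_pow_left₀ (jb_pos κ).le (jb_le_sub_mul κ (l, 0)) L
    have h3 := jb_pow_pos ((l, 0) : Freq n d) L
    calc jb κ ^ L * ‖v.1 (κ - (l, 0))‖
        ≤ (jb (κ - (l, 0)) ^ L * jb ((l, 0) : Freq n d) ^ L) * ‖v.1 (κ - (l, 0))‖ := by gcongr
      _ = (jb (κ - (l, 0)) ^ L * ‖v.1 (κ - (l, 0))‖) * jb ((l, 0) : Freq n d) ^ L := by ring
      _ ≤ _ := by gcongr⟩
  map_add' u v := rfl
  map_smul' c u := rfl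

theorem shiftOp_apply (l : Fin n → ℤ) (v : RS (Freq n d)) (κ : Freq n d) :
    (shiftOp l v).1 κ = v.1 (κ - (l, 0)) := rfl

theorem shiftOp_delta (l : Fin n → ℤ) (κ : Freq n d) :
    shiftOp l (delta κ) = delta (κ + (l, 0)) := by
  refine RS.ext fun κ' => ?_
  rw [shiftOp_apply, delta_apply, delta_apply]
  simp only [sub_eq_iff_eq_add]
  congr

theorem shiftOp_tame (l : Fin n → ℤ) : Tame (shiftOp l : Module.End ℂ (RS (Freq n d))) := by
  intro L
  refine ⟨L, jb ((l, 0) : Freq n d) ^ L, (jb_pow_pos _ _).le, fun v B hC κ => ?_⟩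
  have h1 := hC (κ - (l, 0))
  have h2 : jb κ ^ L ≤ jb (κ - (l, 0)) ^ L * jb ((l, 0) : Freq n d) ^ L := by
    rw [← mul_pow]
    exact pow_le_pow_left₀ (jb_pos κ).le (jb_le_sub_mul κ (l, 0)) L
  have h3 := jb_pow_pos ((l, 0) : Freq n d) L
  rw [shiftOp_apply]
  calc jb κ ^ L * ‖v.1 (κ - (l, 0))‖
      ≤ (jb (κ - (l, 0)) ^ L * jb ((l, 0) : Freq n d) ^ L) * ‖v.1 (κ - (l, 0))‖ := by gcongr
    _ = jb ((l, 0) : Freq n d) ^ L * (jb (κ - (l, 0)) ^ L * ‖v.1 (κ - (l, 0))‖) := by ring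
    _ ≤ _ := by gcongr

/-- Operators commuting with multiplication by functions of `φ`, i.e. families `T(φ)`. -/
def ShiftInv (T : Module.End ℂ (RS (Freq n d))) : Prop := ∀ l, T * shiftOp l = shiftOp l * T

theorem ShiftInv.mul {T S : Module.End ℂ (RS (Freq n d))} (hT : ShiftInv T) (hS : ShiftInv S) :
    ShiftInv (T * S) := fun l => by
  rw [mul_assoc, hS l, ← mul_assoc, hT l, mul_assoc]

theorem ShiftInv.one : ShiftInv (1 : Module.End ℂ (RS (Freq n d))) := fun l => by simp

theorem hatOp_shiftInv {a : Hat n d} (ha : Temp a) : ShiftInv (hatOp a) := fun l =>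
  ((hatOp_tame a).mul (shiftOp_tame l)).ext ((shiftOp_tame l).mul (hatOp_tame a)) fun x y => by
    simp only [Module.End.mul_apply, shiftOp_delta, shiftOp_apply, hatOp_delta ha]
    congr 1
    · abel
    · simp

/-- The lattice symbol of an operator. -/
def symb (T : Module.End ℂ (RS (Freq n d))) : Hat n d := fun κ q =>
  (T (delta (0, q))).1 (κ + (0, q))

@[simp] theorem symb_hatOp {a : Hat n d} (ha : Temp a) : symb (hatOp a) = a := by
  funext κ q; simp [symb, hatOp_delta ha]

theorem jb_delta_le {L : ℕ} (q : Fin d → ℤ) (x : Freq n d) :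
    jb x ^ L * ‖(delta ((0, q) : Freq n d)).1 x‖ ≤ jb q ^ L := by
  rw [delta_apply]
  split_ifs with h
  · subst h; simp [jb, Prod.norm_def]
  · simpa using (jb_pow_pos q L).le

theorem jb_zero_prod (q : Fin d → ℤ) : jb ((0, q) : Freq n d) = jb q := by
  simp [jb, Prod.norm_def]

theorem Tame.temp_symb {T : Module.End ℂ (RS (Freq n d))} (hT : Tame T) : Temp (symb T) := by
  intro L
  obtain ⟨L', C, hC0, hC⟩ := hT L
  refine ⟨C, L' + L, hC0, fun κ q => ?_⟩
  have h := hC (delta (0, q)) (jb q ^ L') (jb_delta_le q) (κ + (0, q))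
  have h1 : jb κ ≤ jb (κ + (0, q)) * jb q := by
    have := jb_add_le (κ + (0, q)) (-(0, q) : Freq n d)
    rwa [jb_neg, jb_zero_prod, add_neg_cancel_right] at this
  have hq := jb_pow_pos q L
  have h2 : jb κ ^ L ≤ jb (κ + (0, q)) ^ L * jb q ^ L := by
    rw [← mul_pow]
    exact pow_le_pow_left₀ (jb_pos κ).le h1 L
  unfold symb
  calc _ ≤ (jb (κ + (0, q)) ^ L * jb q ^ L) * ‖(T (delta (0, q))).1 (κ + (0, q))‖ := by gcongr
    _ = (jb (κ + (0, q)) ^ L * ‖(T (delta (0, q))).1 (κ + (0, q))‖) * jb q ^ L := by ring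
    _ ≤ (C * jb q ^ L') * jb q ^ L := by gcongr
    _ = _ := by rw [pow_add]; ring

/-- A tame operator that commutes with multiplication by functions of `φ` is the operator of its
lattice symbol. -/
theorem Tame.eq_hatOp_symb {T : Module.End ℂ (RS (Freq n d))} (hT : Tame T) (hs : ShiftInv T) :
    T = hatOp (symb T) :=
  hT.ext (hatOp_tame _) fun x y => by
    rw [hatOp_delta hT.temp_symb, symb]
    have e : delta x = shiftOp x.1 (delta ((0, x.2) : Freq n d)) := by
      rw [shiftOp_delta]; congr 1; ext <;> simp
    have := LinearMap.congr_fun (hs x.1) (delta (0, x.2))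
    simp only [Module.End.mul_apply] at this
    rw [e, this, shiftOp_apply]
    have e3 : y - (x.1, 0) = y - x + (0, x.2) := Prod.ext (by simp) (by simp)
    rw [e3]

theorem hatOp_sharp {a b : Hat n d} (ha : Temp a) (hb : Temp b) :
    hatOp a * hatOp b = hatOp (sharp a b) ∧ Temp (sharp a b) := by
  have ht : Tame (hatOp a * hatOp b) := (hatOp_tame a).mul (hatOp_tame b)
  have e : symb (hatOp a * hatOp b) = sharp a b := by
    funext κ q
    rw [sharp_apply, symb, Module.End.mul_apply, hatOp_apply ha,
      ← (Equiv.addRight ((0, q) : Freq n d)).tsum_eq]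
    refine tsum_congr fun κ' => ?_
    rw [hatOp_delta hb]
    simp [add_comm]
  have h := ht.eq_hatOp_symb ((hatOp_shiftInv ha).mul (hatOp_shiftInv hb))
  rw [e] at h
  exact ⟨h, e ▸ ht.temp_symb⟩

theorem hatOp_comm {a b : Hat n d} (ha : Temp a) (hb : Temp b) :
    hatOp a * hatOp b - hatOp b * hatOp a = hatOp (comm a b) := by
  rw [(hatOp_sharp ha hb).1, (hatOp_sharp hb ha).1,
    ← hatOp_sub (hatOp_sharp ha hb).2 (hatOp_sharp hb ha).2]
  rfl

theorem Temp.comm {a b : Hat n d} (ha : Temp a) (hb : Temp b) : Temp (comm a b) :=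
  (hatOp_sharp ha hb).2.sub (hatOp_sharp hb ha).2

end RS

/-! ### Energy estimates -/

section energy
variable {X : Type*} [NormedAddCommGroup X] {P : Type}

/-- Families of matrices with rapid off-diagonal decrease whose entries have size `ρ`. -/
def MatBd (ρ : X → ℝ) (wt : P → ℝ) (G : P → X → X → ℂ) : Prop :=
  ∀ L : ℕ, ∃ C : ℝ, 0 ≤ C ∧ ∀ p x y, jb (x - y) ^ L * ‖G p x y‖ ≤ C * wt p * ρ y

/-- The Hermitian part of `G` is bounded. -/
def HermBd (G : P → X → X → ℂ) : Prop :=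
  MatBd (fun _ => 1) (fun _ => 1) fun p x y => G p x y + (starRingEnd ℂ) (G p y x)

/-- Weights whose commutators with matrices of size `ρ` are bounded. -/
structure Weight (ρ Λ : X → ℝ) : Prop where
  pos : ∀ x, 0 < Λ x
  comm : ∃ (C : ℝ) (c : ℕ), 0 ≤ C ∧ ∀ x y, |Λ x / Λ y - 1| ≤ C * jb (x - y) ^ c / ρ y

theorem Weight.ratio {ρ Λ : X → ℝ} (h : Weight ρ Λ) (hρ : ∀ x, 1 ≤ ρ x) :
    ∃ (C : ℝ) (c : ℕ), 0 ≤ C ∧ ∀ x y, Λ x / Λ y ≤ C * jb (x - y) ^ c := by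
  obtain ⟨C, c, hC, h⟩ := h.comm
  refine ⟨C + 1, c, by positivity, fun x y => ?_⟩
  have h1 := (le_abs_self _).trans (h x y)
  have h2 : C * jb (x - y) ^ c / ρ y ≤ C * jb (x - y) ^ c :=
    div_le_self (by have := jb_pos (x - y); positivity) (hρ y)
  have h3 := one_le_jb_pow (x - y) c
  linarith

theorem Weight.mono {ρ ρ' Λ : X → ℝ} (h : Weight ρ' Λ) (hρ : ∀ x, 1 ≤ ρ x)
    (hρ' : ∀ x, ρ x ≤ ρ' x) : Weight ρ Λ := by
  refine ⟨h.pos, ?_⟩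
  obtain ⟨C, c, hC, h⟩ := h.comm
  refine ⟨C, c, hC, fun x y => (h x y).trans ?_⟩
  have := jb_pos (x - y)
  have := hρ y
  have := hρ' y
  gcongr

theorem Weight.mul {ρ Λ Λ' : X → ℝ} (hρ : ∀ x, 1 ≤ ρ x) (h : Weight ρ Λ) (h' : Weight ρ Λ') :
    Weight ρ fun x => Λ x * Λ' x := by
  refine ⟨fun x => mul_pos (h.pos x) (h'.pos x), ?_⟩
  obtain ⟨A, a, hA, hr⟩ := h.ratio hρ
  obtain ⟨C, c, hC, h1⟩ := h.comm
  obtain ⟨C', c', hC', h2⟩ := h'.comm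
  refine ⟨A * C' + C, a + c' + c, by positivity, fun x y => ?_⟩
  have p1 := h.pos y
  have p2 := h'.pos y
  have p3 := h.pos x
  have hj := one_le_jb (x - y)
  have hj0 := jb_pos (x - y)
  have hρ0 : 0 < ρ y := lt_of_lt_of_le one_pos (hρ y)
  have e : Λ x * Λ' x / (Λ y * Λ' y) - 1 = Λ x / Λ y * (Λ' x / Λ' y - 1) + (Λ x / Λ y - 1) := by
    field_simp; ring
  rw [e]
  calc |Λ x / Λ y * (Λ' x / Λ' y - 1) + (Λ x / Λ y - 1)|
      ≤ |Λ x / Λ y| * |Λ' x / Λ' y - 1| + |Λ x / Λ y - 1| := by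
        rw [← abs_mul]; exact abs_add_le _ _
    _ ≤ (A * jb (x - y) ^ a) * (C' * jb (x - y) ^ c' / ρ y) + C * jb (x - y) ^ c / ρ y := by
        rw [abs_of_pos (div_pos p3 p1)]
        gcongr
        exacts [hr x y, h2 x y, h1 x y]
    _ = (A * C' * jb (x - y) ^ (a + c') + C * jb (x - y) ^ c) / ρ y := by rw [pow_add]; ring
    _ ≤ (A * C' * jb (x - y) ^ (a + c' + c) + C * jb (x - y) ^ (a + c' + c)) / ρ y := by
        have q1 := pow_le_pow_right₀ hj (show a + c' ≤ a + c' + c by omega)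
        have q2 := pow_le_pow_right₀ hj (show c ≤ a + c' + c by omega)
        exact div_le_div_of_nonneg_right (add_le_add
          (mul_le_mul_of_nonneg_left q1 (by positivity))
          (mul_le_mul_of_nonneg_left q2 hC)) hρ0.le
    _ = _ := by ring

theorem weight_one {ρ : X → ℝ} : Weight ρ fun _ => 1 :=
  ⟨fun _ => one_pos, 0, 0, le_rfl, fun x y => by simp⟩

/-- Powers of a weight comparable with a norm. -/
theorem weight_rpow {Y : Type*} [NormedAddCommGroup Y] (g : X → Y) (a : ℝ)
    (hg : ∀ x y, ‖g x - g y‖ ≤ ‖x - y‖) :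
    Weight (fun x => jb (g x)) fun x => jb (g x) ^ a := by
  refine ⟨fun x => jb_rpow_pos _ _, |a|, ⌈|a|⌉₊ + 2, abs_nonneg _, fun x y => ?_⟩
  have hx := jb_pos (g x)
  have hy := jb_pos (g y)
  have hj := one_le_jb (x - y)
  have hj0 := jb_pos (x - y)
  have h1 : jb (g x) ≤ jb (x - y) * jb (g y) :=
    (jb_le_sub_mul (g x) (g y)).trans (by gcongr; unfold jb; linarith [hg x y])
  have h2 : jb (g y) ≤ jb (x - y) * jb (g x) :=
    (jb_le_sub_mul (g y) (g x)).trans (by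
      gcongr; rw [jb_sub_comm]; unfold jb; linarith [hg x y])
  have hd : |jb (g x) - jb (g y)| ≤ jb (x - y) := by
    have e : jb (g x) - jb (g y) = ‖g x‖ - ‖g y‖ := by unfold jb; ring
    rw [e]
    refine (abs_norm_sub_norm_le _ _).trans ((hg x y).trans ?_)
    unfold jb; linarith
  set r := jb (g x) / jb (g y) with hr
  have hr0 : 0 < r := div_pos hx hy
  have hlog : |Real.log r| ≤ jb (x - y) ^ 2 / jb (g y) := by
    rw [abs_le]
    constructor
    · have := Real.one_sub_inv_le_log_of_pos hr0
      have e : 1 - r⁻¹ = (jb (g x) - jb (g y)) / jb (g x) := by rw [hr]; field_simp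
      rw [e] at this
      refine le_trans ?_ this
      rw [neg_le, ← neg_div, div_le_div_iff₀ hx hy]
      have := (neg_le_abs _).trans hd
      nlinarith
    · have := Real.log_le_sub_one_of_pos hr0
      have e : r - 1 = (jb (g x) - jb (g y)) / jb (g y) := by rw [hr]; field_simp
      rw [e] at this
      refine this.trans ?_
      gcongr
      have := (le_abs_self _).trans hd
      nlinarith
  have hlog2 : |Real.log r| ≤ Real.log (jb (x - y)) := by
    rw [abs_le']
    constructor
    · exact Real.log_le_log hr0 ((div_le_iff₀ hy).2 h1)
    · rw [← Real.log_inv]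
      refine Real.log_le_log (inv_pos.2 hr0) ?_
      rw [hr, inv_div]
      exact (div_le_iff₀ hx).2 h2
  rw [← Real.div_rpow hx.le hy.le, ← hr, Real.rpow_def_of_pos hr0]
  have key : ∀ z : ℝ, |Real.exp z - 1| ≤ |z| * Real.exp |z| := by
    intro z
    rcases le_or_gt 0 z with h | h
    · rw [abs_of_nonneg h, abs_of_nonneg (by linarith [Real.add_one_le_exp z])]
      have := Real.add_one_le_exp (-z)
      have h3 : Real.exp z * Real.exp (-z) = 1 := by rw [← Real.exp_add]; simp
      nlinarith [Real.exp_pos z]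
    · rw [abs_of_neg h, abs_of_nonpos (by linarith [Real.exp_le_one_iff.2 h.le])]
      have := Real.add_one_le_exp z
      have h3 : 1 ≤ Real.exp (-z) := Real.one_le_exp (by linarith)
      nlinarith
  refine (key _).trans ?_
  rw [abs_mul]
  have h4 : Real.exp (|Real.log r| * |a|) ≤ jb (x - y) ^ ⌈|a|⌉₊ := by
    calc Real.exp (|Real.log r| * |a|) ≤ Real.exp (Real.log (jb (x - y)) * (⌈|a|⌉₊ : ℕ)) :=
          Real.exp_le_exp.2 (mul_le_mul hlog2 (Nat.le_ceil |a|) (abs_nonneg a)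
            ((abs_nonneg _).trans hlog2))
      _ = _ := by rw [mul_comm, Real.exp_nat_mul, Real.exp_log hj0]
  calc |Real.log r| * |a| * Real.exp (|Real.log r| * |a|)
      ≤ (jb (x - y) ^ 2 / jb (g y)) * |a| * jb (x - y) ^ ⌈|a|⌉₊ := by gcongr
    _ = _ := by rw [pow_add]; ring

/-- The rows of the Hermitian part of `Λ G Λ⁻¹` are absolutely summable, uniformly: the Hermitian
part of `G` is bounded and the commutator of `G` with the weight has order zero. -/
theorem schur_bound [PolySummable X] {ρ Λ : X → ℝ} (hρ : ∀ x, 1 ≤ ρ x) {G : P → X → X → ℂ}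
    (hG : MatBd ρ (fun _ => 1) G) (hH : HermBd G) (hΛ : Weight ρ Λ) :
    ∃ c : ℝ, 0 ≤ c ∧ ∀ p x (F : Finset X),
      ∑ y ∈ F, ‖(Λ x / Λ y : ℝ) * G p x y + (Λ y / Λ x : ℝ) * (starRingEnd ℂ) (G p y x)‖ ≤ c := by
  obtain ⟨C, c, hC, h⟩ := hΛ.comm
  obtain ⟨A, hA, hG⟩ := hG (decayExp X + c)
  obtain ⟨B, hB, hH⟩ := hH (decayExp X)
  refine ⟨(B + C * A + C * A) * decaySum X, mul_nonneg (by positivity) decaySum_nonneg,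
    fun p x F => sum_le_of_decay_sub x (fun _ => norm_nonneg _) (fun y => ?_) F⟩
  have hρy : 0 < ρ y := lt_of_lt_of_le one_pos (hρ y)
  have hρx : 0 < ρ x := lt_of_lt_of_le one_pos (hρ x)
  have hj := jb_pos (x - y)
  have e : (Λ x / Λ y : ℝ) * G p x y + (Λ y / Λ x : ℝ) * (starRingEnd ℂ) (G p y x)
      = (G p x y + (starRingEnd ℂ) (G p y x)) + ((Λ x / Λ y - 1 : ℝ) * G p x y
        + (Λ y / Λ x - 1 : ℝ) * (starRingEnd ℂ) (G p y x)) := by push_cast; ring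
  have h1 := hH p x y
  have h2 := hG p x y
  have h3 := hG p y x
  rw [jb_sub_comm y x] at h3
  have h4 := h x y
  have h5 := h y x
  rw [jb_sub_comm y x] at h5
  have k1 : jb (x - y) ^ decayExp X * (|Λ x / Λ y - 1| * ‖G p x y‖) ≤ C * A := by
    calc _ ≤ jb (x - y) ^ decayExp X * ((C * jb (x - y) ^ c / ρ y) * ‖G p x y‖) := by gcongr
      _ = C * (jb (x - y) ^ (decayExp X + c) * ‖G p x y‖) / ρ y := by rw [pow_add]; ring
      _ ≤ C * (A * 1 * ρ y) / ρ y := by gcongr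
      _ = C * A := by field_simp
  have k2 : jb (x - y) ^ decayExp X * (|Λ y / Λ x - 1| * ‖G p y x‖) ≤ C * A := by
    calc _ ≤ jb (x - y) ^ decayExp X * ((C * jb (x - y) ^ c / ρ x) * ‖G p y x‖) := by gcongr
      _ = C * (jb (x - y) ^ (decayExp X + c) * ‖G p y x‖) / ρ x := by rw [pow_add]; ring
      _ ≤ C * (A * 1 * ρ x) / ρ x := by gcongr
      _ = C * A := by field_simp
  rw [e]
  have n1 : ‖((Λ x / Λ y - 1 : ℝ) : ℂ) * G p x y‖ = |Λ x / Λ y - 1| * ‖G p x y‖ := by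
    rw [norm_mul, Complex.norm_real, Real.norm_eq_abs]
  have n2 : ‖((Λ y / Λ x - 1 : ℝ) : ℂ) * (starRingEnd ℂ) (G p y x)‖
      = |Λ y / Λ x - 1| * ‖G p y x‖ := by
    rw [norm_mul, Complex.norm_real, Real.norm_eq_abs, RCLike.norm_conj]
  have n3 := (norm_add_le (G p x y + (starRingEnd ℂ) (G p y x)) (((Λ x / Λ y - 1 : ℝ) : ℂ) * G p x y
        + ((Λ y / Λ x - 1 : ℝ) : ℂ) * (starRingEnd ℂ) (G p y x))).trans
    (add_le_add le_rfl (norm_add_le _ _))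
  rw [n1, n2] at n3
  have := mul_le_mul_of_nonneg_left n3 (jb_pow_pos (x - y) (decayExp X)).le
  nlinarith

theorem gronwall_nonneg {E E' : ℝ → ℝ} {k B T : ℝ} (hk : 1 ≤ k) (hB : 0 ≤ B) (hE : ∀ t, 0 ≤ E t)
    (hd : ∀ t ∈ Set.Icc 0 T, HasDerivAt E (E' t) t)
    (hb : ∀ t ∈ Set.Icc 0 T, |E' t| ≤ k * E t + B) :
    ∀ t ∈ Set.Icc 0 T, E t ≤ Real.exp (k * T) * (E 0 + B) := by
  intro t ht
  have h := norm_le_gronwallBound_of_norm_deriv_right_le (f := E) (f' := E') (δ := E 0) (K := k)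
    (ε := B) (a := 0) (b := T) (fun t ht => (hd t ht).continuousAt.continuousWithinAt)
    (fun t ht => (hd t ⟨ht.1, ht.2.le⟩).hasDerivWithinAt) (by rw [Real.norm_of_nonneg (hE 0)])
    (fun t ht => by
      rw [Real.norm_of_nonneg (hE t)]
      exact hb t ⟨ht.1, ht.2.le⟩) t ht
  rw [Real.norm_of_nonneg (hE t), gronwallBound_of_K_ne_0 (by positivity), sub_zero] at h
  have hexp : Real.exp (k * t) ≤ Real.exp (k * T) := by
    have := ht.2
    gcongr
  have h1 : B / k ≤ B := div_le_self hB hk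
  have h1' : 0 ≤ B / k := by positivity
  have h2 := Real.exp_pos (k * t)
  have h3 := hE 0
  have h4 : B / k * (Real.exp (k * t) - 1) ≤ B * Real.exp (k * t) := by nlinarith
  nlinarith

theorem gronwall_abs {E E' : ℝ → ℝ} {k B T : ℝ} (hk : 1 ≤ k) (hB : 0 ≤ B) (hE : ∀ t, 0 ≤ E t)
    (hd : ∀ t, |t| ≤ T → HasDerivAt E (E' t) t)
    (hb : ∀ t, |t| ≤ T → |E' t| ≤ k * E t + B) :
    ∀ t, |t| ≤ T → E t ≤ Real.exp (k * T) * (E 0 + B) := by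
  intro t ht
  rcases le_or_gt 0 t with h | h
  · exact gronwall_nonneg hk hB hE
      (fun s hs => hd s (abs_le.2 ⟨by linarith [hs.1, hs.2], hs.2⟩))
      (fun s hs => hb s (abs_le.2 ⟨by linarith [hs.1, hs.2], hs.2⟩)) t ⟨h, (le_abs_self t).trans ht⟩
  · have := gronwall_nonneg (E := fun s => E (-s)) (E' := fun s => -E' (-s)) (k := k) (B := B)
      (T := T) hk hB (fun s => hE _)
      (fun s hs => by
        have h1 := hd (-s) (by rw [abs_neg]; exact abs_le.2 ⟨by linarith [hs.1, hs.2], hs.2⟩)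
        have := HasDerivAt.comp s h1 (hasDerivAt_neg s)
        rw [mul_neg_one] at this
        exact this)
      (fun s hs => by
        rw [abs_neg]
        exact hb (-s) (by rw [abs_neg]; exact abs_le.2 ⟨by linarith [hs.1, hs.2], hs.2⟩))
      (-t) ⟨by linarith, (neg_le_abs t).trans ht⟩
    simpa using this

/-- The energy estimate for a finite system with Hermitian part bounded by `c` in the
weighted norm. -/
theorem energy_finite {X : Type*} (F : Finset X) (G : X → X → ℂ) (Λ : X → ℝ) (hΛ : ∀ x, 0 < Λ x) {c : ℝ}
    (hc : 0 ≤ c)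
    (hS : ∀ x, ∑ y ∈ F, ‖(Λ x / Λ y : ℝ) * G x y + (Λ y / Λ x : ℝ) * (starRingEnd ℂ) (G y x)‖ ≤ c)
    (y f : ℝ → X → ℂ) {T B : ℝ} (hT : 0 ≤ T)
    (hd : ∀ t, |t| ≤ T → ∀ x ∈ F,
      HasDerivAt (fun s => y s x) (∑ z ∈ F, G x z * y t z + f t x) t)
    (hf : ∀ t, |t| ≤ T → ∑ x ∈ F, Λ x ^ 2 * ‖f t x‖ ^ 2 ≤ B) :
    ∀ t, |t| ≤ T → ∑ x ∈ F, Λ x ^ 2 * ‖y t x‖ ^ 2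
      ≤ Real.exp ((c + 1) * T) * (∑ x ∈ F, Λ x ^ 2 * ‖y 0 x‖ ^ 2 + B) := by
  have hB : 0 ≤ B :=
    (Finset.sum_nonneg fun x _ => by positivity).trans (hf 0 (by simpa using hT))
  refine gronwall_abs (E := fun t => ∑ x ∈ F, Λ x ^ 2 * ‖y t x‖ ^ 2)
    (E' := fun t => ∑ x ∈ F, Λ x ^ 2 * (2 * inner ℝ (y t x) (∑ z ∈ F, G x z * y t z + f t x)))
    (by linarith) hB (fun t => Finset.sum_nonneg fun x _ => by positivity)
    (fun t ht => HasDerivAt.fun_sum fun x hx => ((hd t ht x hx).norm_sq).const_mul _) ?_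
  intro t ht
  set u : X → ℂ := fun x => (Λ x : ℂ) * y t x with hu
  set M : X → X → ℂ := fun x z => (Λ x / Λ z : ℝ) * G x z with hM
  have hun : ∀ x, ‖u x‖ ^ 2 = Λ x ^ 2 * ‖y t x‖ ^ 2 := fun x => by
    rw [hu]; simp only [norm_mul, Complex.norm_real, Real.norm_eq_abs, mul_pow, sq_abs]
  -- the Hermitian part
  have e1 : ∑ x ∈ F, Λ x ^ 2 * (2 * inner ℝ (y t x) (∑ z ∈ F, G x z * y t z + f t x))
      = (∑ x ∈ F, ∑ z ∈ F, ((starRingEnd ℂ) (u x) * (M x z + (starRingEnd ℂ) (M z x)) * u z).re)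
        + ∑ x ∈ F, 2 * Λ x ^ 2 * inner ℝ (y t x) (f t x) := by
    have a1 : ∀ x ∈ F, Λ x ^ 2 * (2 * inner ℝ (y t x) (∑ z ∈ F, G x z * y t z + f t x))
        = 2 * (∑ z ∈ F, ((starRingEnd ℂ) (u x) * M x z * u z).re)
          + 2 * Λ x ^ 2 * inner ℝ (y t x) (f t x) := by
      intro x hx
      rw [inner_add_right, inner_sum, mul_add, mul_add]
      congr 1
      · rw [Finset.mul_sum, Finset.mul_sum, Finset.mul_sum]
        refine Finset.sum_congr rfl fun z hz => ?_
        have hz0 := (hΛ z).ne'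
        have : (starRingEnd ℂ) (u x) * M x z * u z
            = ((Λ x ^ 2 : ℝ) : ℂ) * ((starRingEnd ℂ) (y t x) * (G x z * y t z)) := by
          have hz1 : (Λ z : ℂ) ≠ 0 := by exact_mod_cast hz0
          simp only [hu, hM, map_mul, Complex.conj_ofReal]
          push_cast
          field_simp
        rw [this, Complex.re_ofReal_mul, Complex.inner, mul_comm ((starRingEnd ℂ) (y t x))]
        ring_nf
      · ring
    rw [Finset.sum_congr rfl a1, Finset.sum_add_distrib]
    congr 1
    rw [← Finset.mul_sum, two_mul]
    have a2 : ∑ x ∈ F, ∑ z ∈ F, ((starRingEnd ℂ) (u x) * M x z * u z).re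
        = ∑ x ∈ F, ∑ z ∈ F, ((starRingEnd ℂ) (u x) * (starRingEnd ℂ) (M z x) * u z).re := by
      rw [Finset.sum_comm]
      refine Finset.sum_congr rfl fun x _ => Finset.sum_congr rfl fun z _ => ?_
      rw [← Complex.conj_re]
      simp only [map_mul, Complex.conj_conj]
      ring_nf
    nth_rewrite 2 [a2]
    rw [← Finset.sum_add_distrib]
    refine Finset.sum_congr rfl fun x _ => ?_
    rw [← Finset.sum_add_distrib]
    refine Finset.sum_congr rfl fun z _ => ?_
    rw [← Complex.add_re]
    ring_nf
  set H : X → X → ℝ := fun x z => ‖M x z + (starRingEnd ℂ) (M z x)‖ with hH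
  have hsymm : ∀ x z, H x z = H z x := fun x z => by
    simp only [hH]
    rw [← RCLike.norm_conj, map_add, Complex.conj_conj, add_comm]
  have hrow : ∀ x, ∑ z ∈ F, H x z ≤ c := fun x => by
    refine le_trans (le_of_eq (Finset.sum_congr rfl fun z _ => ?_)) (hS x)
    simp only [hH, hM, map_mul, Complex.conj_ofReal]
  have e2 : |∑ x ∈ F, ∑ z ∈ F, ((starRingEnd ℂ) (u x) * (M x z + (starRingEnd ℂ) (M z x)) * u z).re|
      ≤ c * ∑ x ∈ F, ‖u x‖ ^ 2 := by
    calc _ ≤ ∑ x ∈ F, ∑ z ∈ F, (H x z * ‖u x‖ ^ 2 / 2 + H z x * ‖u z‖ ^ 2 / 2) := by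
          refine (Finset.abs_sum_le_sum_abs _ _).trans (Finset.sum_le_sum fun x _ => ?_)
          refine (Finset.abs_sum_le_sum_abs _ _).trans (Finset.sum_le_sum fun z _ => ?_)
          refine (Complex.abs_re_le_norm _).trans ?_
          rw [norm_mul, norm_mul, RCLike.norm_conj, ← hsymm x z]
          have : 0 ≤ H x z := norm_nonneg _
          change ‖u x‖ * H x z * ‖u z‖ ≤ _
          nlinarith [mul_nonneg this (sq_nonneg (‖u x‖ - ‖u z‖))]
      _ = ∑ x ∈ F, (∑ z ∈ F, H x z) * ‖u x‖ ^ 2 := by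
          simp only [Finset.sum_add_distrib]
          rw [Finset.sum_comm (f := fun x z => H z x * ‖u z‖ ^ 2 / 2), ← Finset.sum_add_distrib]
          refine Finset.sum_congr rfl fun x _ => ?_
          rw [Finset.sum_mul, ← Finset.sum_add_distrib]
          exact Finset.sum_congr rfl fun z _ => by ring
      _ ≤ ∑ x ∈ F, c * ‖u x‖ ^ 2 := by gcongr with x _; exact hrow x
      _ = _ := by rw [Finset.mul_sum]
  have e3 : |∑ x ∈ F, 2 * Λ x ^ 2 * inner ℝ (y t x) (f t x)|
      ≤ ∑ x ∈ F, ‖u x‖ ^ 2 + B := by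
    calc _ ≤ ∑ x ∈ F, (‖u x‖ ^ 2 + Λ x ^ 2 * ‖f t x‖ ^ 2) := by
          refine (Finset.abs_sum_le_sum_abs _ _).trans (Finset.sum_le_sum fun x _ => ?_)
          rw [abs_mul, abs_of_nonneg (by positivity : 0 ≤ 2 * Λ x ^ 2), hun]
          have := abs_real_inner_le_norm (y t x) (f t x)
          have hL : 0 ≤ Λ x ^ 2 := by positivity
          nlinarith [mul_le_mul_of_nonneg_left this hL,
            mul_nonneg hL (sq_nonneg (‖y t x‖ - ‖f t x‖))]
      _ ≤ _ := by rw [Finset.sum_add_distrib]; linarith [hf t ht]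
  rw [e1]
  have : ∑ x ∈ F, Λ x ^ 2 * ‖y t x‖ ^ 2 = ∑ x ∈ F, ‖u x‖ ^ 2 :=
    Finset.sum_congr rfl fun x _ => (hun x).symm
  simp only [this]
  calc _ ≤ _ := abs_add_le _ _
    _ ≤ c * ∑ x ∈ F, ‖u x‖ ^ 2 + (∑ x ∈ F, ‖u x‖ ^ 2 + B) := add_le_add e2 e3
    _ = _ := by ring

end energy

/-! ### Existence and uniqueness of flows -/

section flow
variable {X : Type*} [NormedAddCommGroup X] [PolySummable X] {P : Type} {ρ : X → ℝ}
  {wt : P → ℝ} {G : P → X → X → ℂ}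

theorem MatBd.temp {X : Type*} [NormedAddCommGroup X] {P : Type} {ρ : X → ℝ}
    {wt : P → ℝ} {G : P → X → X → ℂ} (hG : MatBd ρ wt G) (hρ2 : ∀ x, ρ x ≤ jb x)
    (hρ1 : ∀ x, 1 ≤ ρ x) (p : P) : MatTemp (G p) := by
  intro L
  obtain ⟨C, hC0, hC⟩ := hG L
  refine ⟨|C * wt p|, 1, abs_nonneg _, fun x y => (hC p x y).trans ?_⟩
  have h1 := hρ1 y
  calc C * wt p * ρ y ≤ |C * wt p| * ρ y := by gcongr; exact le_abs_self _
    _ ≤ |C * wt p| * jb y ^ 1 := by rw [pow_one]; gcongr; exact hρ2 y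

/-- Rapid decrease, locally uniformly in time. -/
def LocRapid (y : ℝ → X → ℂ) : Prop :=
  ∀ (T : ℝ) (L : ℕ), ∃ C : ℝ, ∀ t, |t| ≤ T → ∀ x, jb x ^ L * ‖y t x‖ ≤ C

/-- The terms of `G v` decay for rapidly decreasing `v`, so that truncation errors are tails of a
convergent sum. -/
theorem weighted_row (hρ1 : ∀ x, 1 ≤ ρ x) (hρ2 : ∀ x, ρ x ≤ jb x)
    (hG : MatBd ρ wt G) {Λ : X → ℝ} (hΛ : Weight ρ Λ) (s : ℕ) :
    ∃ (L' : ℕ) (C : ℝ), 0 ≤ C ∧ ∀ p (v : X → ℂ) (B : ℝ), 0 ≤ wt p →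
      (∀ x, jb x ^ L' * ‖v x‖ ≤ B) →
      ∀ x z, Λ x * jb x ^ s * ‖G p x z * v z‖ ≤ C * wt p * B * (jb z ^ decayExp X)⁻¹ := by
  obtain ⟨A, a, hA, hr⟩ := hΛ.ratio hρ1
  obtain ⟨C, hC, hG⟩ := hG (a + s)
  have hΛ0 := hΛ.pos 0
  refine ⟨a + s + 1 + decayExp X, A * A * Λ 0 * C, by positivity, fun p v B hw hv x z => ?_⟩
  have hx := jb_pos x
  have hz := jb_pos z
  have hxz := jb_pos (x - z)
  have hΛx := hΛ.pos x
  have hΛz := hΛ.pos z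
  have hB : 0 ≤ B := (mul_nonneg (jb_pow_pos x _).le (norm_nonneg _)).trans (hv x)
  have h1 : Λ x ≤ A * jb (x - z) ^ a * (A * jb z ^ a * Λ 0) := by
    have e1 := (div_le_iff₀ hΛz).1 (hr x z)
    have e2 := (div_le_iff₀ hΛ0).1 (hr z 0)
    rw [sub_zero] at e2
    exact e1.trans (by gcongr)
  have h2 : jb x ^ s ≤ jb (x - z) ^ s * jb z ^ s := by
    rw [← mul_pow]; exact pow_le_pow_left₀ hx.le (jb_le_sub_mul x z) s
  rw [← div_eq_mul_inv, le_div_iff₀ (by positivity), norm_mul]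
  calc Λ x * jb x ^ s * (‖G p x z‖ * ‖v z‖) * jb z ^ decayExp X
      ≤ (A * jb (x - z) ^ a * (A * jb z ^ a * Λ 0)) * (jb (x - z) ^ s * jb z ^ s)
          * (‖G p x z‖ * ‖v z‖) * jb z ^ decayExp X := by gcongr
    _ = A * A * Λ 0 * (jb (x - z) ^ (a + s) * ‖G p x z‖)
          * (jb z ^ (a + s) * jb z ^ decayExp X * ‖v z‖) := by rw [pow_add, pow_add]; ring
    _ ≤ A * A * Λ 0 * (C * wt p * jb z) * (jb z ^ (a + s) * jb z ^ decayExp X * ‖v z‖) := by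
        have := (hG p x z).trans (mul_le_mul_of_nonneg_left (hρ2 z) (by positivity))
        exact mul_le_mul_of_nonneg_right (mul_le_mul_of_nonneg_left this (by positivity))
          (by positivity)
    _ = A * A * Λ 0 * C * wt p * (jb z ^ (a + s + 1 + decayExp X) * ‖v z‖) := by
        rw [pow_add _ (a + s + 1), pow_succ]; ring
    _ ≤ A * A * Λ 0 * C * wt p * B := by gcongr; exact hv z

/-- The tail of the weights. -/
def tail (F : Finset X) : ℝ := ∑' z : { z // z ∉ F }, (jb z.1 ^ decayExp X)⁻¹

theorem tail_nonneg (F : Finset X) : 0 ≤ tail F :=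
  tsum_nonneg fun z => by have := jb_pos z.1; positivity

theorem tail_tendsto : Filter.Tendsto (tail (X := X)) Filter.atTop (nhds 0) :=
  tendsto_tsum_compl_atTop_zero fun z : X => (jb z ^ decayExp X)⁻¹

theorem norm_sub_sum_le_tail {f : X → ℂ} {C : ℝ}
    (h : ∀ z, ‖f z‖ ≤ C * (jb z ^ decayExp X)⁻¹) (F : Finset X) :
    ‖∑' z, f z - ∑ z ∈ F, f z‖ ≤ C * tail F := by
  have hs : Summable f := (Summable.of_nonneg_of_le (fun _ => norm_nonneg _) h
    (summable_decay.mul_left C)).of_norm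
  have e : ∑' z, f z - ∑ z ∈ F, f z = ∑' z : { z // z ∉ F }, f z := by
    rw [← hs.sum_add_tsum_subtype_compl F]; ring
  rw [e, tail, ← tsum_mul_left]
  exact tsum_of_norm_bounded
    ((summable_decay.comp_injective Subtype.val_injective).mul_left C).hasSum fun z => h z.1

theorem sum_compl_le_tail {f : X → ℝ} {C : ℝ} (hC : 0 ≤ C)
    (h : ∀ z, f z ≤ C * (jb z ^ decayExp X)⁻¹) (F F' : Finset X) (hF : Disjoint F F') :
    ∑ z ∈ F', f z ≤ C * tail F := by
  classical
  refine (Finset.sum_le_sum fun z _ => h z).trans ?_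
  rw [← Finset.mul_sum, tail]
  gcongr
  rw [← Finset.sum_subtype_of_mem (p := fun z => z ∉ F) (fun z => (jb z ^ decayExp X)⁻¹)
    fun z hz => Finset.disjoint_right.1 hF hz]
  exact (summable_decay.comp_injective Subtype.val_injective).sum_le_tsum _
    fun z _ => by have := jb_pos z.1; exact inv_nonneg.2 (by positivity)

theorem sq_add_le (a b : ℂ) : ‖a + b‖ ^ 2 ≤ 2 * ‖a‖ ^ 2 + 2 * ‖b‖ ^ 2 := by
  have h := norm_add_le a b
  nlinarith [sq_nonneg (‖a‖ - ‖b‖), norm_nonneg (a + b), norm_nonneg a, norm_nonneg b]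

/-- The energy estimate for infinite systems. -/
theorem energy_estimate (hρ1 : ∀ x, 1 ≤ ρ x) (hρ2 : ∀ x, ρ x ≤ jb x)
    (hG : MatBd ρ (fun _ => 1) G) (hH : HermBd G) {Λ : X → ℝ} (hΛ : Weight ρ Λ) :
    ∃ K : ℝ, 0 ≤ K ∧ ∀ p (y f : ℝ → X → ℂ) (T A B : ℝ), 0 ≤ T →
      (∀ L : ℕ, ∃ C : ℝ, ∀ t, |t| ≤ T → ∀ x, jb x ^ L * ‖y t x‖ ≤ C) →
      (∀ t, |t| ≤ T → ∀ x, HasDerivAt (fun s => y s x) (∑' z, G p x z * y t z + f t x) t) →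
      (∀ t, |t| ≤ T → ∀ F : Finset X, ∑ x ∈ F, Λ x ^ 2 * ‖f t x‖ ^ 2 ≤ B) →
      (∀ F : Finset X, ∑ x ∈ F, Λ x ^ 2 * ‖y 0 x‖ ^ 2 ≤ A) →
      ∀ t, |t| ≤ T → ∀ F : Finset X, ∑ x ∈ F, Λ x ^ 2 * ‖y t x‖ ^ 2
        ≤ Real.exp (K * T) * (A + 2 * B) := by
  classical
  obtain ⟨c, hc, hS⟩ := schur_bound hρ1 hG hH hΛ
  obtain ⟨L', C, hC, hrow⟩ := weighted_row hρ1 hρ2 hG hΛ (decayExp X)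
  refine ⟨c + 1, by positivity, fun p y f T A B hT hy hd hf h0 t ht F₀ => ?_⟩
  obtain ⟨D, hD⟩ := hy L'
  have hD0 : 0 ≤ D := (mul_nonneg (jb_pow_pos 0 _).le (norm_nonneg _)).trans
    (hD 0 (by simpa using hT) 0)
  -- the error of truncating the system to `F`; it enters the finite system as a source
  set R : Finset X → ℝ → X → ℂ := fun F t x => ∑' z, G p x z * y t z - ∑ z ∈ F, G p x z * y t z
  have hR : ∀ F t, |t| ≤ T → ∀ x, Λ x * jb x ^ decayExp X * ‖R F t x‖ ≤ C * D * tail F := by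
    intro F t ht x
    have hx := hΛ.pos x
    have hjx := jb_pos x
    have h := fun z => hrow p (y t) D zero_le_one (hD t ht) x z
    have h2 : ∀ z, ‖G p x z * y t z‖
        ≤ C * D / (Λ x * jb x ^ decayExp X) * (jb z ^ decayExp X)⁻¹ := fun z => by
      have := h z
      rw [div_mul_eq_mul_div, le_div_iff₀ (by positivity)]
      linarith
    have := norm_sub_sum_le_tail h2 F
    rw [div_mul_eq_mul_div, le_div_iff₀ (by positivity)] at this
    linarith
  have key : ∀ F, F₀ ⊆ F → ∑ x ∈ F₀, Λ x ^ 2 * ‖y t x‖ ^ 2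
      ≤ Real.exp ((c + 1) * T) * (A + (2 * B + 2 * ((C * D * tail F) ^ 2 * decaySum X))) := by
    intro F hF
    have h1 := energy_finite F (G p) Λ hΛ.pos hc (fun x => hS p x F) y
      (fun t x => f t x + R F t x) (T := T)
      (B := 2 * B + 2 * ((C * D * tail F) ^ 2 * decaySum X)) hT
      (fun t ht x hx => by
        have := hd t ht x
        refine this.congr_deriv ?_
        simp only [R]; ring)
      (fun t ht => by
        calc ∑ x ∈ F, Λ x ^ 2 * ‖f t x + R F t x‖ ^ 2
            ≤ ∑ x ∈ F, (2 * (Λ x ^ 2 * ‖f t x‖ ^ 2)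
                + 2 * ((C * D * tail F) ^ 2 * (jb x ^ decayExp X)⁻¹)) := by
              refine Finset.sum_le_sum fun x _ => ?_
              have h3 := hR F t ht x
              have hx := hΛ.pos x
              have hj := jb_pos x
              have hj1 := one_le_jb_pow x (decayExp X)
              have hj2 := jb_pow_pos x (decayExp X)
              have h4 : Λ x ^ 2 * ‖R F t x‖ ^ 2 ≤ (C * D * tail F) ^ 2 * (jb x ^ decayExp X)⁻¹ := by
                rw [← div_eq_mul_inv, le_div_iff₀ hj2]
                calc Λ x ^ 2 * ‖R F t x‖ ^ 2 * jb x ^ decayExp X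
                    ≤ Λ x ^ 2 * ‖R F t x‖ ^ 2 * jb x ^ decayExp X * jb x ^ decayExp X :=
                      le_mul_of_one_le_right (by positivity) hj1
                  _ = (Λ x * jb x ^ decayExp X * ‖R F t x‖) ^ 2 := by ring
                  _ ≤ _ := by gcongr
              have h5 := mul_le_mul_of_nonneg_left (sq_add_le (f t x) (R F t x))
                (by positivity : 0 ≤ Λ x ^ 2)
              linarith
          _ = 2 * ∑ x ∈ F, Λ x ^ 2 * ‖f t x‖ ^ 2
                + 2 * ((C * D * tail F) ^ 2 * ∑ x ∈ F, (jb x ^ decayExp X)⁻¹) := by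
              rw [Finset.sum_add_distrib, Finset.mul_sum, Finset.mul_sum, Finset.mul_sum]
          _ ≤ _ := by
              gcongr
              · exact hf t ht F
              · exact summable_decay.sum_le_tsum F fun x _ => by
                  have := jb_pos x; exact inv_nonneg.2 (by positivity)) t ht
    refine (Finset.sum_le_sum_of_subset_of_nonneg hF fun x _ _ => by positivity).trans
      (h1.trans ?_)
    gcongr
    exact h0 F
  have hlim : Filter.Tendsto (fun F : Finset X =>
      Real.exp ((c + 1) * T) * (A + (2 * B + 2 * ((C * D * tail F) ^ 2 * decaySum X))))
      Filter.atTop (nhds (Real.exp ((c + 1) * T)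
        * (A + (2 * B + 2 * ((C * D * 0) ^ 2 * decaySum X))))) :=
    ((((((tail_tendsto.const_mul (C * D)).pow 2).mul_const _).const_mul 2).const_add
      (2 * B)).const_add A).const_mul _
  have := ge_of_tendsto hlim (Filter.eventually_atTop.2 ⟨F₀, key⟩)
  simpa using this

/-- Rapid decrease in terms of weighted square sums. -/
theorem sq_sum_le {v : X → ℂ} {Λ : X → ℝ} (hΛ : ∀ x, 0 < Λ x) {B : ℝ}
    (h : ∀ x, jb x ^ decayExp X * (Λ x * ‖v x‖) ≤ B) (F : Finset X) :
    ∑ x ∈ F, Λ x ^ 2 * ‖v x‖ ^ 2 ≤ B ^ 2 * decaySum X := by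
  calc ∑ x ∈ F, Λ x ^ 2 * ‖v x‖ ^ 2 ≤ ∑ x ∈ F, B ^ 2 * (jb x ^ decayExp X)⁻¹ := by
        refine Finset.sum_le_sum fun x _ => ?_
        have hx := hΛ x
        have hj1 := one_le_jb_pow x (decayExp X)
        have hj2 := jb_pow_pos x (decayExp X)
        rw [← div_eq_mul_inv, le_div_iff₀ hj2]
        calc Λ x ^ 2 * ‖v x‖ ^ 2 * jb x ^ decayExp X
            ≤ Λ x ^ 2 * ‖v x‖ ^ 2 * jb x ^ decayExp X * jb x ^ decayExp X :=
              le_mul_of_one_le_right (by positivity) hj1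
          _ = (jb x ^ decayExp X * (Λ x * ‖v x‖)) ^ 2 := by ring
          _ ≤ _ := by gcongr; exact h x
    _ ≤ _ := by
        rw [← Finset.mul_sum]
        gcongr
        exact summable_decay.sum_le_tsum F fun x _ => by
          have := jb_pos x; exact inv_nonneg.2 (by positivity)

/-- The finite-dimensional truncation of the system `y' = G y`. -/
theorem exists_galerkin (G : X → X → ℂ) (v : X → ℂ) (F : Finset X) : ∃ y : ℝ → X → ℂ,
    (∀ t, ∀ x ∉ F, y t x = 0) ∧ (∀ x ∈ F, y 0 x = v x) ∧
    ∀ t, ∀ x ∈ F, HasDerivAt (fun s => y s x) (∑ z ∈ F, G x z * y t z) t := by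
  classical
  set A : (F → ℂ) →L[ℂ] (F → ℂ) :=
    LinearMap.toContinuousLinearMap (Matrix.toLin' fun x z : F => G x z) with hA
  set w : ℝ → F → ℂ := fun t => NormedSpace.exp (t • A) (fun x => v x) with hw
  have hd : ∀ t, HasDerivAt w (A (w t)) t := fun t => by
    exact ((ContinuousLinearMap.apply ℂ (F → ℂ) fun x : F => v x).restrictScalars
      ℝ).hasFDerivAt.comp_hasDerivAt t (hasDerivAt_exp_smul_const' (𝕂 := ℝ) A t)
  refine ⟨fun t x => if h : x ∈ F then w t ⟨x, h⟩ else 0, fun t x hx => by simp [hx],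
    fun x hx => ?_, fun t x hx => ?_⟩
  · have h0 : w 0 = fun x : F => v x := by
      simp only [hw]
      have hz : (0 : ℝ) • A = 0 := zero_smul ℝ A
      rw [hz, NormedSpace.exp_zero]
      rfl
    simp [hx, h0]
  simp only [hx, dif_pos]
  have h := (hasDerivAt_pi.1 (hd t)) ⟨x, hx⟩
  refine h.congr_deriv ?_
  rw [← Finset.sum_coe_sort F]
  simp only [Finset.coe_mem, dif_pos]
  rfl

/-- Solutions are limits of finite-dimensional truncations, whose energy bounds do not depend on
the truncation. -/
theorem exists_solution (hρ1 : ∀ x, 1 ≤ ρ x) (hρ2 : ∀ x, ρ x ≤ jb x)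
    (hG : MatBd ρ (fun _ => 1) G) (hH : HermBd G) (p : P) (v : RS X) :
    ∃ y : ℝ → X → ℂ, (∀ x, y 0 x = v.1 x) ∧ LocRapid y ∧
      ∀ t x, HasDerivAt (fun s => y s x) (∑' z, G p x z * y t z) t := by
  classical
  have hwt : ∀ L : ℕ, Weight ρ fun x : X => jb x ^ L := fun L => by
    have := (weight_rpow (fun x : X => x) (L : ℝ) fun x y => le_rfl).mono hρ1 hρ2
    simpa using this
  choose Y hY0 hYi hYd using exists_galerkin (G p) v.1
  -- bounds that are uniform in the truncation
  have hbd : ∀ (T : ℝ) (L : ℕ), ∃ C : ℝ, 0 ≤ C ∧ ∀ F t, |t| ≤ T → ∀ x, jb x ^ L * ‖Y F t x‖ ≤ C := by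
    intro T L
    rcases lt_or_ge T 0 with hT | hT
    · exact ⟨0, le_rfl, fun F t ht => by linarith [abs_nonneg t]⟩
    obtain ⟨c, hc, hS⟩ := schur_bound hρ1 hG hH (hwt L)
    obtain ⟨B, hB0, hB⟩ := RS.decay v (decayExp X + L)
    refine ⟨Real.sqrt (Real.exp ((c + 1) * T) * (B ^ 2 * decaySum X + 0)), Real.sqrt_nonneg _,
      fun F t ht x => ?_⟩
    by_cases hx : x ∈ F
    · have h := energy_finite F (G p) (fun x => jb x ^ L) (hwt L).pos hc (fun x => hS p x F) (Y F)
        (fun _ _ => 0) (T := T) (B := 0) hT (fun t _ x hx => by simpa using hYd F t x hx)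
        (fun t _ => by simp) t ht
      have h0 : ∑ x ∈ F, (jb x ^ L) ^ 2 * ‖Y F 0 x‖ ^ 2 ≤ B ^ 2 * decaySum X := by
        rw [Finset.sum_congr rfl fun x hx => by rw [hYi F x hx]]
        refine sq_sum_le (hwt L).pos (fun x => ?_) F
        rw [← mul_assoc, ← pow_add]
        exact hB x
      refine Real.le_sqrt_of_sq_le ?_
      rw [mul_pow]
      refine (Finset.single_le_sum (f := fun x => (jb x ^ L) ^ 2 * ‖Y F t x‖ ^ 2)
        (fun x _ => by positivity) hx).trans (h.trans ?_)
      gcongr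
    · rw [hY0 F t x hx]
      simp
  -- truncations form a Cauchy family
  have hcauchy : ∀ T : ℝ, 0 ≤ T → ∃ C : ℝ, 0 ≤ C ∧ ∀ F F', F ⊆ F' → ∀ t, |t| ≤ T → ∀ x,
      ‖Y F' t x - Y F t x‖ ^ 2 ≤ C * tail F := by
    intro T hT
    obtain ⟨c, hc, hS⟩ := schur_bound hρ1 hG hH (weight_one (ρ := ρ))
    obtain ⟨L', A, hA, hrow⟩ := weighted_row hρ1 hρ2 hG (weight_one (ρ := ρ)) (decayExp X)
    obtain ⟨D, hD0, hD⟩ := hbd T L'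
    obtain ⟨B, hB0, hB⟩ := RS.decay v (decayExp X)
    set E := (A * D * decaySum X) ^ 2 with hE
    refine ⟨Real.exp ((c + 1) * T) * (B ^ 2 + E), by positivity, fun F F' hF t ht x => ?_⟩
    have hsq : ∀ {a b : ℝ} (x : X), 0 ≤ a → jb x ^ decayExp X * a ≤ b →
        a ^ 2 ≤ b ^ 2 * (jb x ^ decayExp X)⁻¹ := fun {a b} x ha h => by
      have hj1 := one_le_jb_pow x (decayExp X)
      have hj2 := jb_pow_pos x (decayExp X)
      rw [← div_eq_mul_inv, le_div_iff₀ hj2]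
      calc a ^ 2 * jb x ^ decayExp X ≤ a ^ 2 * jb x ^ decayExp X * jb x ^ decayExp X :=
            le_mul_of_one_le_right (by positivity) hj1
        _ = (jb x ^ decayExp X * a) ^ 2 := by ring
        _ ≤ _ := by gcongr
    have h := energy_finite F' (G p) (fun _ => 1) (fun _ => one_pos) hc (fun x => hS p x F')
      (fun t x => Y F' t x - Y F t x)
      (fun t x => if x ∈ F then 0 else ∑ z ∈ F, G p x z * Y F t z) (T := T)
      (B := E * tail F) hT
      (fun t ht x hx => by
        have e : ∑ z ∈ F', G p x z * (Y F' t z - Y F t z)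
            = ∑ z ∈ F', G p x z * Y F' t z - ∑ z ∈ F, G p x z * Y F t z := by
          rw [Finset.sum_congr rfl fun z _ => mul_sub _ _ _, Finset.sum_sub_distrib]
          congr 1
          symm
          refine Finset.sum_subset hF fun z _ hz => ?_
          rw [hY0 F t z hz, mul_zero]
        by_cases hxF : x ∈ F
        · refine ((hYd F' t x hx).sub (hYd F t x hxF)).congr_deriv ?_
          rw [e, if_pos hxF, add_zero]
        · refine ((hYd F' t x hx).sub (hasDerivAt_const t 0)).congr_deriv ?_ |>.congr_of_eventuallyEq
            (Filter.Eventually.of_forall fun s => by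
              simp only [hY0 F s x hxF]; rfl)
          rw [e, if_neg hxF, sub_zero, sub_add_cancel])
      (fun t ht => by
        rw [← Finset.sum_sdiff hF]
        have z1 : ∑ x ∈ F, (1 : ℝ) ^ 2 * ‖if x ∈ F then 0 else ∑ z ∈ F, G p x z * Y F t z‖ ^ 2
            = 0 := Finset.sum_eq_zero fun x hx => by simp [hx]
        rw [z1, add_zero]
        refine sum_compl_le_tail (C := E) (by positivity) (fun x => ?_) F _ Finset.disjoint_sdiff
        rw [one_pow, one_mul]
        refine hsq x (norm_nonneg _) ?_
        split_ifs
        · rw [norm_zero, mul_zero]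
          exact mul_nonneg (by positivity) decaySum_nonneg
        · have hj2 := jb_pow_pos x (decayExp X)
          have := fun z => hrow p (Y F t) D zero_le_one (hD F t ht) x z
          calc jb x ^ decayExp X * ‖∑ z ∈ F, G p x z * Y F t z‖
              ≤ jb x ^ decayExp X * ∑ z ∈ F, ‖G p x z * Y F t z‖ := by
                gcongr; exact norm_sum_le _ _
            _ ≤ ∑ z ∈ F, A * D * (jb z ^ decayExp X)⁻¹ := by
                rw [Finset.mul_sum]
                exact Finset.sum_le_sum fun z _ => by simpa using this z
            _ ≤ _ := by
                rw [← Finset.mul_sum]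
                gcongr
                exact summable_decay.sum_le_tsum F fun x _ => by
                  have := jb_pos x; exact inv_nonneg.2 (by positivity))
      t ht
    have h0 : ∑ x ∈ F', (1 : ℝ) ^ 2 * ‖Y F' 0 x - Y F 0 x‖ ^ 2 ≤ B ^ 2 * tail F := by
      rw [← Finset.sum_sdiff hF]
      have z1 : ∑ x ∈ F, (1 : ℝ) ^ 2 * ‖Y F' 0 x - Y F 0 x‖ ^ 2 = 0 :=
        Finset.sum_eq_zero fun x hx => by rw [hYi F x hx, hYi F' x (hF hx)]; simp
      rw [z1, add_zero]
      rw [Finset.sum_congr rfl fun x hx => by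
        rw [hYi F' x (Finset.mem_sdiff.1 hx).1, hY0 F 0 x (Finset.mem_sdiff.1 hx).2, sub_zero,
          one_pow, one_mul]]
      exact sum_compl_le_tail (by positivity) (fun x => hsq x (norm_nonneg _) (hB x)) F _
        Finset.disjoint_sdiff
    by_cases hx : x ∈ F'
    · refine le_trans ?_ ((h.trans (mul_le_mul_of_nonneg_left (add_le_add h0 le_rfl)
        (Real.exp_pos _).le)).trans (le_of_eq (by ring)))
      refine le_trans ?_ (Finset.single_le_sum
        (f := fun x => (1 : ℝ) ^ 2 * ‖Y F' t x - Y F t x‖ ^ 2) (fun x _ => by positivity) hx)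
      simp
    · rw [hY0 F' t x hx, hY0 F t x fun h => hx (hF h)]
      have := tail_nonneg F
      simp only [sub_self, norm_zero]
      have hE0 : 0 ≤ E := by positivity
      have h1 := mul_nonneg (mul_nonneg (Real.exp_pos ((c + 1) * T)).le
        (add_nonneg (sq_nonneg B) hE0)) this
      simpa using h1
  -- the limit
  have hlim : ∀ t x, ∃ z, Filter.Tendsto (fun F => Y F t x) Filter.atTop (nhds z) := by
    intro t x
    obtain ⟨C, hC0, hC⟩ := hcauchy |t| (abs_nonneg t)
    refine cauchySeq_tendsto_of_complete (Metric.cauchySeq_iff'.2 fun ε hε => ?_)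
    have ht : Filter.Tendsto (fun F : Finset X => C * tail F) Filter.atTop (nhds 0) := by
      simpa using tail_tendsto.const_mul C
    obtain ⟨N, hN⟩ := Filter.eventually_atTop.1 (ht.eventually_lt_const (show 0 < ε ^ 2 by positivity))
    refine ⟨N, fun F hF => ?_⟩
    rw [dist_eq_norm]
    exact lt_of_pow_lt_pow_left₀ 2 hε.le ((hC N F hF t le_rfl x).trans_lt (hN N le_rfl))
  choose y hy using hlim
  have hconv : ∀ T : ℝ, 0 ≤ T → ∃ C : ℝ, 0 ≤ C ∧ ∀ F t, |t| ≤ T → ∀ x,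
      ‖y t x - Y F t x‖ ≤ Real.sqrt (C * tail F) := by
    intro T hT
    obtain ⟨C, hC0, hC⟩ := hcauchy T hT
    refine ⟨C, hC0, fun F t ht x => ?_⟩
    refine le_of_tendsto ((hy t x).sub_const (Y F t x)).norm
      (Filter.eventually_atTop.2 ⟨F, fun F' hF' => ?_⟩)
    exact Real.le_sqrt_of_sq_le (hC F F' hF' t ht x)
  refine ⟨y, fun x => ?_, fun T L => ?_, fun t x => ?_⟩
  · refine tendsto_nhds_unique (hy 0 x) (tendsto_const_nhds.congr' ?_)
    filter_upwards [Filter.eventually_ge_atTop {x}] with F hF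
    exact (hYi F x (hF (Finset.mem_singleton_self x))).symm
  · obtain ⟨C, -, hC⟩ := hbd T L
    exact ⟨C, fun t ht x => le_of_tendsto ((hy t x).norm.const_mul _)
      (Filter.Eventually.of_forall fun F => hC F t ht x)⟩
  · set T := |t| + 1
    obtain ⟨C, hC0, hC⟩ := hconv T (by positivity)
    obtain ⟨A, hA0, hA⟩ := hG (decayExp X + 1)
    -- the rows of `G` are absolutely summable
    have hrow : ∀ z, jb (x - z) ^ decayExp X * ‖G p x z‖ ≤ A * jb x := fun z => by
      have h1 := hA p x z
      have hz := jb_pos (x - z)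
      rw [pow_succ, mul_one] at h1
      have h2 : jb z ≤ jb (x - z) * jb x := by rw [jb_sub_comm]; exact jb_le_sub_mul z x
      refine le_of_mul_le_mul_right ?_ hz
      calc jb (x - z) ^ decayExp X * ‖G p x z‖ * jb (x - z)
          = jb (x - z) ^ decayExp X * jb (x - z) * ‖G p x z‖ := by ring
        _ ≤ A * ρ z := h1
        _ ≤ A * (jb (x - z) * jb x) := by gcongr; exact (hρ2 z).trans h2
        _ = _ := by ring
    have hmem : t ∈ Set.Ioo (-T) T := by
      constructor
      · have := neg_abs_le t; simp only [T]; linarith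
      · have := le_abs_self t; simp only [T]; linarith
    refine hasDerivAt_of_tendstoUniformlyOn (f := fun (F : Finset X) s => Y F s x)
      (f' := fun F s => ∑' z, G p x z * Y F s z) (g' := fun s => ∑' z, G p x z * y s z)
      (l := Filter.atTop) (s := Set.Ioo (-T) T) isOpen_Ioo ?_ ?_ (fun s _ => hy s x) hmem
    · rw [Metric.tendstoUniformlyOn_iff]
      intro ε hε
      have hlim0 : Filter.Tendsto (fun F : Finset X =>
          A * jb x * Real.sqrt (C * tail F) * decaySum X) Filter.atTop (nhds 0) := by
        have h1 : Filter.Tendsto (fun F : Finset X => Real.sqrt (C * tail F)) Filter.atTop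
            (nhds 0) := by
          have := (Real.continuous_sqrt.tendsto (C * 0)).comp (tail_tendsto (X := X) |>.const_mul C)
          rw [mul_zero, Real.sqrt_zero] at this
          exact this
        simpa using (h1.const_mul (A * jb x)).mul_const (decaySum X)
      filter_upwards [hlim0.eventually_lt_const hε] with F hF s hs
      have hsT : |s| ≤ T := abs_le.2 ⟨hs.1.le, hs.2.le⟩
      have hbig : ∀ z, ‖y s z - Y F s z‖ ≤ Real.sqrt (C * tail F) := hC F s hsT
      have hsum : ∀ w : X → ℂ, (∃ D, ∀ z, ‖w z‖ ≤ D) → Summable fun z => G p x z * w z := by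
        rintro w ⟨D, hD⟩
        refine summable_of_decay_sub x (C := A * jb x * D) fun z => ?_
        have hD0 : 0 ≤ D := (norm_nonneg _).trans (hD z)
        have := jb_pos (x - z)
        rw [norm_mul, ← mul_assoc]
        have hjx := jb_pos x
        exact mul_le_mul (hrow z) (hD z) (norm_nonneg _) (by positivity)
      have hYb : ∃ D, ∀ z, ‖Y F s z‖ ≤ D := by
        obtain ⟨D, -, hD⟩ := hbd T 0
        exact ⟨D, fun z => by simpa using hD F s hsT z⟩
      have hyb : ∃ D, ∀ z, ‖y s z‖ ≤ D := by
        obtain ⟨D, hD⟩ := hYb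
        refine ⟨Real.sqrt (C * tail F) + D, fun z => ?_⟩
        have := norm_add_le (y s z - Y F s z) (Y F s z)
        rw [sub_add_cancel] at this
        linarith [hbig z, hD z]
      rw [dist_eq_norm, ← (hsum _ hyb).tsum_sub (hsum _ hYb)]
      refine (norm_tsum_le_of_decay_sub (C := A * jb x * Real.sqrt (C * tail F)) x
        fun z => ?_).trans_lt hF
      rw [← mul_sub, norm_mul, ← mul_assoc]
      have hjx := jb_pos x
      exact mul_le_mul (hrow z) (hbig z) (norm_nonneg _) (by positivity)
    · filter_upwards [Filter.eventually_ge_atTop {x}] with F hF s _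
      refine (hYd F s x (hF (Finset.mem_singleton_self x))).congr_deriv ?_
      rw [tsum_eq_sum fun z hz => by rw [hY0 F s z hz, mul_zero]]

/-- `U` is the flow of `y' = G y` on rapidly decreasing sequences. -/
structure IsMatFlow (G : X → X → ℂ) (U : ℝ → Module.End ℂ (RS X)) : Prop where
  zero : U 0 = 1
  deriv : ∀ t (v : RS X) x,
    HasDerivAt (fun s => (U s v).1 x) (∑' z, G x z * (U t v).1 z) t
  rapid : ∀ v : RS X, LocRapid fun t => (U t v).1

theorem solution_unique (hρ1 : ∀ x, 1 ≤ ρ x) (hρ2 : ∀ x, ρ x ≤ jb x)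
    (hG : MatBd ρ (fun _ => 1) G) (hH : HermBd G) (p : P) {y y' : ℝ → X → ℂ}
    (hy : LocRapid y) (hy' : LocRapid y')
    (hd : ∀ t x, HasDerivAt (fun s => y s x) (∑' z, G p x z * y t z) t)
    (hd' : ∀ t x, HasDerivAt (fun s => y' s x) (∑' z, G p x z * y' t z) t)
    (h0 : ∀ x, y 0 x = y' 0 x) : y = y' := by
  obtain ⟨K, hK, h⟩ := energy_estimate hρ1 hρ2 hG hH (weight_one (ρ := ρ))
  have hT := hG.temp hρ2 hρ1 p
  have mk : ∀ (w : ℝ → X → ℂ), LocRapid w → ∀ t, ∃ v : RS X, v.1 = w t := fun w hw t =>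
    ⟨⟨w t, fun L => by obtain ⟨C, hC⟩ := hw |t| L; exact ⟨C, hC t le_rfl⟩⟩, rfl⟩
  have hs : ∀ (w : ℝ → X → ℂ), LocRapid w → ∀ t x, Summable fun z => G p x z * w t z := by
    intro w hw t x
    obtain ⟨v, hv⟩ := mk w hw t
    rw [← hv]; exact hT.summable v x
  funext t x
  have := h p (fun t x => y t x - y' t x) (fun _ _ => 0) |t| 0 0 (abs_nonneg t)
    (fun L => by
      obtain ⟨C, hC⟩ := hy |t| L
      obtain ⟨C', hC'⟩ := hy' |t| L
      refine ⟨C + C', fun s hs x => ?_⟩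
      have := mul_le_mul_of_nonneg_left (norm_sub_le (y s x) (y' s x)) (jb_pow_pos x L).le
      linarith [hC s hs x, hC' s hs x])
    (fun s _ x => by
      refine ((hd s x).sub (hd' s x)).congr_deriv ?_
      rw [← (hs y hy s x).tsum_sub (hs y' hy' s x), add_zero]
      exact tsum_congr fun z => by ring)
    (fun s _ F => by simp) (fun F => by simp [h0]) t le_rfl {x}
  simp only [one_pow, one_mul, Finset.sum_singleton, mul_zero, add_zero] at this
  have h2 : ‖y t x - y' t x‖ = 0 := by
    have := norm_nonneg (y t x - y' t x)
    nlinarith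
  exact sub_eq_zero.1 (norm_eq_zero.1 h2)

/-- The solution operators of the system are linear by uniqueness, and form a flow. -/
theorem exists_flow (hρ1 : ∀ x, 1 ≤ ρ x) (hρ2 : ∀ x, ρ x ≤ jb x)
    (hG : MatBd ρ (fun _ => 1) G) (hH : HermBd G) (p : P) :
    ∃ U : ℝ → Module.End ℂ (RS X), IsMatFlow (G p) U := by
  choose Y h0 hr hd using exists_solution hρ1 hρ2 hG hH p
  have hT := hG.temp hρ2 hρ1 p
  have mem : ∀ v t, Y v t ∈ RS X := fun v t L => by
    obtain ⟨C, hC⟩ := hr v |t| L; exact ⟨C, hC t le_rfl⟩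
  have hsum : ∀ v t x, Summable fun z => G p x z * Y v t z := fun v t x =>
    hT.summable ⟨Y v t, mem v t⟩ x
  have hadd : ∀ u v, Y (u + v) = fun t x => Y u t x + Y v t x := fun u v =>
    solution_unique hρ1 hρ2 hG hH p (hr _) (fun T L => by
      obtain ⟨C, hC⟩ := hr u T L
      obtain ⟨C', hC'⟩ := hr v T L
      refine ⟨C + C', fun s hs x => ?_⟩
      have := mul_le_mul_of_nonneg_left (norm_add_le (Y u s x) (Y v s x)) (jb_pow_pos x L).le
      linarith [hC s hs x, hC' s hs x]) (hd _) (fun t x => by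
      refine ((hd u t x).add (hd v t x)).congr_deriv ?_
      rw [← (hsum u t x).tsum_add (hsum v t x)]
      exact tsum_congr fun z => by ring) (fun x => by simp [h0])
  have hsmul : ∀ (c : ℂ) v, Y (c • v) = fun t x => c * Y v t x := fun c v =>
    solution_unique hρ1 hρ2 hG hH p (hr _) (fun T L => by
      obtain ⟨C, hC⟩ := hr v T L
      refine ⟨‖c‖ * C, fun s hs x => ?_⟩
      have := mul_le_mul_of_nonneg_left (hC s hs x) (norm_nonneg c)
      rw [norm_mul]; linarith) (hd _) (fun t x => by
      refine ((hd v t x).const_mul c).congr_deriv ?_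
      rw [← tsum_mul_left]
      exact tsum_congr fun z => by ring) (fun x => by simp [h0])
  refine ⟨fun t => { toFun := fun v => ⟨Y v t, mem v t⟩, map_add' := ?_, map_smul' := ?_ },
    ?_, fun t v x => hd v t x, fun v => hr v⟩
  · exact fun u v => RS.ext fun x => by simp [hadd]
  · exact fun c v => RS.ext fun x => by simp [hsmul]
  · exact LinearMap.ext fun v => RS.ext fun x => h0 v x

end flow

/-! ### Lipschitz families of lattice symbols -/

/-- A set of parameters with pairs of parameters `s e`, `t e` at distance `len e`; families are
required to be bounded on the parameters and Lipschitz along these pairs. -/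
structure ParamGraph where
  /-- the parameters -/
  P : Type
  /-- the pairs of parameters to be compared -/
  E : Type
  /-- the first parameter of a pair -/
  s : E → P
  /-- the second parameter of a pair -/
  t : E → P
  /-- the distance of a pair -/
  len : E → ℝ
  len_nonneg : ∀ e, 0 ≤ len e

/-- The parameters together with a time in `[-T, T]`, which is the same at both ends of a pair. -/
@[reducible] def ParamGraph.withTime (Γ : ParamGraph) (T : ℝ) : ParamGraph where
  P := Γ.P × Set.Icc (-T) T
  E := Γ.E × Set.Icc (-T) T
  s e := (Γ.s e.1, e.2)
  t e := (Γ.t e.1, e.2)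
  len e := Γ.len e.1
  len_nonneg e := Γ.len_nonneg e.1

section LipBd
variable {n d : ℕ} {Γ : ParamGraph} {m m' : ℝ} {a b : Γ.P → Hat n d}

/-- One seminorm of the class `LipBd`. -/
def LipBdAt (Γ : ParamGraph) (v : List (Fin d)) (L : ℕ) (m : ℝ) (a : Γ.P → Hat n d) : Prop :=
  BdAt v L m (fun _ => 1) a ∧
    BdAt v L m Γ.len fun e κ q => a (Γ.s e) κ q - a (Γ.t e) κ q

/-- Bounded and Lipschitz families of lattice symbols of order `m`. -/
def LipBd (Γ : ParamGraph) (m : ℝ) (a : Γ.P → Hat n d) : Prop :=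
  Bd m (fun _ => 1) a ∧ Bd m Γ.len fun e κ q => a (Γ.s e) κ q - a (Γ.t e) κ q

theorem lipBd_iff : LipBd Γ m a ↔ ∀ v L, LipBdAt Γ v L m a :=
  ⟨fun h v L => ⟨h.1 v L, h.2 v L⟩, fun h => ⟨fun v L => (h v L).1, fun v L => (h v L).2⟩⟩

theorem LipBd.congr (h : LipBd Γ m a) (e : ∀ p κ q, a p κ q = b p κ q) : LipBd Γ m b := by
  rwa [show b = a from funext fun p => funext fun κ => funext fun q => (e p κ q).symm]

theorem LipBd.mono (h : LipBd Γ m a) (hm : m ≤ m') : LipBd Γ m' a := ⟨h.1.mono hm, h.2.mono hm⟩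

theorem LipBdAt.mono {v : List (Fin d)} {L : ℕ} (h : LipBdAt Γ v L m a) (hm : m ≤ m') :
    LipBdAt Γ v L m' a := ⟨h.1.mono hm, h.2.mono hm⟩

theorem LipBd.temp (h : LipBd Γ m a) (p : Γ.P) : Temp (a p) := h.1.temp p

theorem LipBdAt.add {v : List (Fin d)} {L : ℕ} (ha : LipBdAt Γ v L m a) (hb : LipBdAt Γ v L m b) :
    LipBdAt Γ v L m fun p κ q => a p κ q + b p κ q := by
  refine ⟨ha.1.add hb.1, ?_⟩
  have := ha.2.add hb.2
  refine cast (congrArg _ ?_) this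
  funext e κ q; ring

theorem LipBd.add (ha : LipBd Γ m a) (hb : LipBd Γ m b) :
    LipBd Γ m fun p κ q => a p κ q + b p κ q :=
  lipBd_iff.2 fun v L => (lipBd_iff.1 ha v L).add (lipBd_iff.1 hb v L)

/-- Multiplication by a Lipschitz function of the parameters of polynomial growth in `κ`. -/
theorem LipBd.mul_freq (ha : LipBd Γ m a) (f : Γ.P → Freq n d → ℂ) {C C' : ℝ} {N N' : ℕ}
    (hf : ∀ p κ, ‖f p κ‖ ≤ C * jb κ ^ N)
    (hf' : ∀ e κ, ‖f (Γ.s e) κ - f (Γ.t e) κ‖ ≤ C' * Γ.len e * jb κ ^ N') :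
    LipBd Γ m fun p κ q => f p κ * a p κ q := by
  constructor
  · have := ha.1.mul_freq (wt' := fun _ => 1) f (C := C) (N := N) (by simpa using hf)
    exact this.congr_wt (by simp)
  · have h1 := (ha.1.comp Γ.s).mul_freq (wt' := Γ.len) (fun e κ => f (Γ.s e) κ - f (Γ.t e) κ) hf'
    have h2 := ha.2.mul_freq (wt' := fun _ => 1) (fun e κ => f (Γ.t e) κ) (C := C) (N := N)
      (by simpa using fun e => hf (Γ.t e))
    have h3 := (h1.congr_wt (wt' := Γ.len) (by simp)).add (h2.congr_wt (wt' := Γ.len) (by simp))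
    refine cast (congrArg _ ?_) h3
    funext e κ q; ring

theorem LipBd.scalar_mul (ha : LipBd Γ m a) (f : Γ.P → ℂ) {C : ℝ} (hf : ∀ p, ‖f p‖ ≤ C)
    (hf' : ∀ e, f (Γ.s e) = f (Γ.t e)) : LipBd Γ m fun p κ q => f p * a p κ q :=
  ha.mul_freq (fun p _ => f p) (C := C) (C' := 0) (N := 0) (N' := 0) (by simpa using hf)
    (by simp [hf'])

theorem LipBd.neg (ha : LipBd Γ m a) : LipBd Γ m fun p κ q => -a p κ q := by
  simpa using ha.scalar_mul (fun _ => -1) (C := 1) (by simp) (by simp)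

theorem LipBd.sub (ha : LipBd Γ m a) (hb : LipBd Γ m b) :
    LipBd Γ m fun p κ q => a p κ q - b p κ q := by
  simpa [sub_eq_add_neg] using ha.add hb.neg

theorem avg_eq (a : Hat n d) (κ : Freq n d) (q : Fin d → ℤ) :
    avg a κ q = (if κ = 0 then 1 else 0) * a κ q := by simp [avg]

theorem LipBd.avg (ha : LipBd Γ m a) : LipBd Γ m fun p => avg (a p) := by
  have := ha.mul_freq (fun _ κ => if κ = 0 then 1 else 0) (C := 1) (C' := 0) (N := 0) (N' := 0)
    (fun p κ => by split_ifs <;> simp) (by simp)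
  refine cast (congrArg _ ?_) this
  funext p κ q
  rw [avg_eq]

theorem LipBd.adj (ha : LipBd Γ m a) : LipBd Γ m fun p => adj (a p) := by
  refine ⟨ha.1.adj, ?_⟩
  refine cast (congrArg _ ?_) ha.2.adj
  funext e κ q; simp [TorusPDO.adj]

theorem comm_sub_left {a a' b : Hat n d} (ha : Temp a) (ha' : Temp a') (hb : Temp b) :
    comm (fun κ q => a κ q - a' κ q) b = fun κ q => comm a b κ q - comm a' b κ q := by
  funext κ q
  simp only [comm, sharp]
  rw [gsharp_sub_left 0 ha ha' hb, gsharp_sub_right 0 hb ha ha']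
  ring

theorem comm_sub_right {a b b' : Hat n d} (ha : Temp a) (hb : Temp b) (hb' : Temp b') :
    comm a (fun κ q => b κ q - b' κ q) = fun κ q => comm a b κ q - comm a b' κ q := by
  funext κ q
  simp only [comm, sharp]
  rw [gsharp_sub_left 0 hb hb' ha, gsharp_sub_right 0 ha hb hb']
  ring

theorem LipBd.comm (ha : LipBd Γ m a) (hb : LipBd Γ m' b) :
    LipBd Γ (m + m' - 1) fun p => comm (a p) (b p) := by
  constructor
  · exact (ha.1.comm (fun _ => zero_le_one) (fun _ => zero_le_one) hb.1).congr_wt (by simp)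
  · have h1 := ha.2.comm Γ.len_nonneg (fun _ => zero_le_one) (hb.1.comp Γ.s)
    have h2 := (ha.1.comp Γ.t).comm (fun _ => zero_le_one) Γ.len_nonneg hb.2
    have h3 := (h1.congr_wt (wt' := Γ.len) (by simp)).add (h2.congr_wt (wt' := Γ.len) (by simp))
    refine cast (congrArg _ ?_) h3
    funext e κ q
    rw [comm_sub_left (ha.temp _) (ha.temp _) (hb.temp _),
      comm_sub_right (ha.temp _) (hb.temp _) (hb.temp _)]
    ring

/-- The symbol has a bounded Hermitian part. -/
def SH (Γ : ParamGraph) (a : Γ.P → Hat n d) : Prop :=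
  LipBd Γ 0 fun p κ q => a p κ q + adj (a p) κ q

theorem SH.of_eq {c : Γ.P → Hat n d} (h : LipBd Γ 0 c)
    (e : ∀ p κ q, c p κ q = a p κ q + adj (a p) κ q) : SH Γ a := h.congr e

theorem SH.of_nonpos (ha : LipBd Γ m a) (hm : m ≤ 0) : SH Γ a := (ha.mono hm).add (ha.mono hm).adj

theorem adj_add (a b : Hat n d) :
    adj (fun κ q => a κ q + b κ q) = fun κ q => adj a κ q + adj b κ q := by
  funext κ q; simp [adj]

theorem adj_sub (a b : Hat n d) :
    adj (fun κ q => a κ q - b κ q) = fun κ q => adj a κ q - adj b κ q := by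
  funext κ q; simp [adj]

theorem SH.add (ha : SH Γ a) (hb : SH Γ b) : SH Γ fun p κ q => a p κ q + b p κ q := by
  refine SH.of_eq (LipBd.add ha hb) fun p κ q => ?_
  rw [adj_add]; ring

theorem SH.scalar_mul (ha : SH Γ a) (f : Γ.P → ℝ) {C : ℝ} (hf : ∀ p, |f p| ≤ C)
    (hf' : ∀ e, f (Γ.s e) = f (Γ.t e)) : SH Γ fun p κ q => (f p : ℂ) * a p κ q := by
  have := LipBd.scalar_mul ha (fun p => (f p : ℂ)) (C := C) (by simpa using hf) (by simp [hf'])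
  refine SH.of_eq this fun p κ q => ?_
  simp [adj]; ring

theorem SH.avg (ha : SH Γ a) : SH Γ fun p => avg (a p) := by
  refine SH.of_eq (LipBd.avg ha) fun p κ q => ?_
  simp only [TorusPDO.avg, adj, neg_eq_zero]
  split_ifs <;> simp

/-- Commutators of symbols of order one with bounded Hermitian parts have bounded Hermitian
parts. -/
theorem SH.comm (ha : LipBd Γ 1 a) (hb : LipBd Γ 1 b) (hsa : SH Γ a) (hsb : SH Γ b) :
    SH Γ fun p => comm (a p) (b p) := by
  -- `[a, b] + [a, b]^* = [b + b^*, a^*] - [b, a + a^*]`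
  have h1 := LipBd.comm hsb ha.adj
  have h2 := LipBd.comm hb hsa
  have h3 := h1.sub ((show (0 : ℝ) + 1 - 1 = 1 + 0 - 1 by norm_num) ▸ h2)
  norm_num at h3
  refine SH.of_eq h3 fun p κ q => ?_
  have ta := ha.temp p
  have tb := hb.temp p
  have ta' := ha.adj.temp p
  have tb' := hb.adj.temp p
  have e1 : TorusPDO.adj (TorusPDO.comm (a p) (b p))
      = TorusPDO.comm (TorusPDO.adj (b p)) (TorusPDO.adj (a p)) := by
    have : TorusPDO.comm (a p) (b p)
      = fun κ q => sharp (a p) (b p) κ q - sharp (b p) (a p) κ q := rfl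
    rw [this, adj_sub, adj_sharp, adj_sharp]
    rfl
  have e2 : (fun κ q => b p κ q + TorusPDO.adj (b p) κ q)
      = fun κ q => b p κ q - (-TorusPDO.adj (b p) κ q) := by funext κ q; ring
  have e3 : (fun κ q => a p κ q + TorusPDO.adj (a p) κ q)
      = fun κ q => a p κ q - (-TorusPDO.adj (a p) κ q) := by funext κ q; ring
  have neg_l : ∀ {x y : Hat n d}, Temp x → Temp y →
      TorusPDO.comm (fun κ q => -x κ q) y = fun κ q => -TorusPDO.comm x y κ q := by
    intro x y hx hy
    have := comm_sub_left (hx.sub hx) hx hy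
    have z := comm_sub_left hx hx hy
    simp only [sub_self, zero_sub] at this z
    rw [this, z]; simp
  have neg_r : ∀ {x y : Hat n d}, Temp x → Temp y →
      TorusPDO.comm x (fun κ q => -y κ q) = fun κ q => -TorusPDO.comm x y κ q := by
    intro x y hx hy
    have := comm_sub_right hx (hy.sub hy) hy
    have z := comm_sub_right hx hy hy
    simp only [sub_self, zero_sub] at this z
    rw [this, z]; simp
  rw [e1, e2, comm_sub_left tb tb'.neg ta', neg_l tb' ta', e3, comm_sub_right tb ta ta'.neg,
    neg_r tb ta']
  simp only [TorusPDO.comm]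
  ring

end LipBd

/-! ### Flows generated by lattice symbols -/

section product
variable {X Y Z : Type*} [NormedAddCommGroup X] [NormedAddCommGroup Y] [NormedAddCommGroup Z]

/-- Families of maps that are tame locally uniformly in time. -/
def UTame (T : ℝ → RS X →ₗ[ℂ] RS Y) : Prop :=
  ∀ (R : ℝ) (L : ℕ), ∃ (L' : ℕ) (C : ℝ), 0 ≤ C ∧ ∀ t, |t| ≤ R → ∀ (v : RS X) (B : ℝ),
    (∀ x, jb x ^ L' * ‖v.1 x‖ ≤ B) → ∀ y, jb y ^ L * ‖(T t v).1 y‖ ≤ C * B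

theorem Tame.utame {T : RS X →ₗ[ℂ] RS Y} (hT : Tame T) : UTame fun _ => T := fun _ L => by
  obtain ⟨L', C, h0, h⟩ := hT L
  exact ⟨L', C, h0, fun _ _ => h⟩

theorem UTame.tame {T : ℝ → RS X →ₗ[ℂ] RS Y} (hT : UTame T) (t : ℝ) : Tame (T t) := fun L => by
  obtain ⟨L', C, h0, h⟩ := hT |t| L
  exact ⟨L', C, h0, h t le_rfl⟩

theorem UTame.comp {T : ℝ → RS Y →ₗ[ℂ] RS Z} {S : ℝ → RS X →ₗ[ℂ] RS Y} (hT : UTame T)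
    (hS : UTame S) : UTame fun t => T t ∘ₗ S t := by
  intro R L
  obtain ⟨L₁, C₁, h₁, hT⟩ := hT R L
  obtain ⟨L₂, C₂, h₂, hS⟩ := hS R L₁
  refine ⟨L₂, C₁ * C₂, by positivity, fun t ht v B hv y => ?_⟩
  rw [mul_assoc]
  exact hT t ht _ _ (hS t ht v B hv) y

theorem UTame.locRapid {T : ℝ → RS X →ₗ[ℂ] RS Y} (hT : UTame T) {w : ℝ → RS X}
    (hw : LocRapid fun t => (w t).1) : LocRapid fun t => (T t (w t)).1 := by
  intro R L
  obtain ⟨L', C, h0, h⟩ := hT R L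
  obtain ⟨B, hB⟩ := hw R L'
  exact ⟨C * B, fun t ht => h t ht _ B (hB t ht)⟩

/-- The product rule for a family of operators applied to a curve. -/
theorem hasDerivAt_apply [PolySummable X] {T T' : ℝ → RS X →ₗ[ℂ] RS Y} (hT : UTame T)
    (hT' : UTame T') (hd : ∀ t v y, HasDerivAt (fun s => (T s v).1 y) ((T' t v).1 y) t)
    {w w' : ℝ → RS X} (hw : LocRapid fun t => (w t).1) (hw' : LocRapid fun t => (w' t).1)
    (hdw : ∀ t x, HasDerivAt (fun s => (w s).1 x) ((w' t).1 x) t) (t : ℝ) (y : Y) :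
    HasDerivAt (fun s => (T s (w s)).1 y) ((T' t (w t)).1 y + (T t (w' t)).1 y) t := by
  have e : (fun s => (T s (w s)).1 y) = fun s => ∑' x, (w s).1 x * (T s (delta x)).1 y :=
    funext fun s => ((hT.tame s).hasSum (w s) y).tsum_eq.symm
  have e' : (T' t (w t)).1 y + (T t (w' t)).1 y
      = ∑' x, ((w' t).1 x * (T t (delta x)).1 y + (w t).1 x * (T' t (delta x)).1 y) := by
    have h1 := (hT'.tame t).hasSum (w t) y
    have h2 := (hT.tame t).hasSum (w' t) y
    rw [(h2.add h1).tsum_eq, add_comm]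
  rw [e, e']
  set R := |t| + 1
  have hmem : t ∈ Set.Ioo (-R) R := by
    constructor
    · have := neg_abs_le t; simp only [R]; linarith
    · have := le_abs_self t; simp only [R]; linarith
  obtain ⟨L₁, C₁, hC₁, h₁⟩ := hT R 0
  obtain ⟨L₂, C₂, hC₂, h₂⟩ := hT' R 0
  obtain ⟨B₁, hB₁⟩ := hw' R (L₁ + decayExp X)
  obtain ⟨B₂, hB₂⟩ := hw R (L₂ + decayExp X)
  have hδ : ∀ (L : ℕ) (x z : X), jb z ^ L * ‖(delta x).1 z‖ ≤ jb x ^ L := fun L x z => by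
    rw [delta_apply]
    split_ifs with h
    · subst h; simp
    · simpa using (jb_pow_pos x L).le
  have bd : ∀ s ∈ Set.Ioo (-R) R, ∀ x,
      ‖(w' s).1 x * (T s (delta x)).1 y + (w s).1 x * (T' s (delta x)).1 y‖
        ≤ (C₁ * B₁ + C₂ * B₂) * (jb x ^ decayExp X)⁻¹ := by
    intro s hs x
    have hsR : |s| ≤ R := abs_le.2 ⟨hs.1.le, hs.2.le⟩
    have a1 := h₁ s hsR (delta x) _ (hδ L₁ x) y
    have a2 := h₂ s hsR (delta x) _ (hδ L₂ x) y
    have b1 := hB₁ s hsR x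
    have b2 := hB₂ s hsR x
    rw [pow_zero, one_mul] at a1 a2
    have hj := jb_pow_pos x (decayExp X)
    rw [← div_eq_mul_inv, le_div_iff₀ hj]
    rw [pow_add] at b1 b2
    have p1 := mul_le_mul_of_nonneg_left a1 (mul_nonneg (norm_nonneg ((w' s).1 x)) hj.le)
    have p2 := mul_le_mul_of_nonneg_left a2 (mul_nonneg (norm_nonneg ((w s).1 x)) hj.le)
    have q1 := mul_le_mul_of_nonneg_left b1 hC₁
    have q2 := mul_le_mul_of_nonneg_left b2 hC₂
    have := norm_add_le ((w' s).1 x * (T s (delta x)).1 y) ((w s).1 x * (T' s (delta x)).1 y)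
    rw [norm_mul, norm_mul] at this
    have := mul_le_mul_of_nonneg_right this hj.le
    nlinarith
  refine hasDerivAt_tsum_of_isPreconnected
    (u := fun x => (C₁ * B₁ + C₂ * B₂) * (jb x ^ decayExp X)⁻¹)
    (summable_decay.mul_left _) isOpen_Ioo isPreconnected_Ioo
    (g := fun x s => (w s).1 x * (T s (delta x)).1 y) (fun x s _ => (hdw s x).mul (hd s _ y))
    (fun x s hs => bd s hs x) hmem ((hT.tame t).hasSum (w t) y).summable hmem

end product

section hatflow
variable {n d : ℕ}

theorem hat_rho_one_le (κ : Freq n d) : 1 ≤ jb κ.2 := one_le_jb _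

theorem Bd.matBd {P : Type} {wt : P → ℝ} {m : ℝ} {g : P → Hat n d} (hwt : ∀ p, 0 ≤ wt p)
    (hg : Bd m wt g) (hm : m ≤ 1) :
    MatBd (fun κ : Freq n d => jb κ.2) wt fun p => hatMat (g p) := by
  intro L
  obtain ⟨C, hC⟩ := hg.mono hm [] L
  refine ⟨|C|, abs_nonneg _, fun p κ κ' => ?_⟩
  have h := hC p (κ - κ') κ'.2
  simp only [List.length_nil, Nat.cast_zero, sub_zero, diffList, Real.rpow_one] at h
  refine h.trans ?_
  have := jb_pos κ'.2
  have := hwt p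
  gcongr
  exact le_abs_self C

theorem Bd.hermBd {P : Type} {g : P → Hat n d}
    (hg : Bd 0 (fun _ => 1) fun p κ q => g p κ q + TorusPDO.adj (g p) κ q) :
    HermBd fun p => hatMat (g p) := by
  intro L
  obtain ⟨C, hC⟩ := hg [] L
  refine ⟨|C|, abs_nonneg _, fun p κ κ' => ?_⟩
  have h := hC p (κ - κ') κ'.2
  simp only [List.length_nil, Nat.cast_zero, sub_zero, diffList, Real.rpow_zero, mul_one,
    TorusPDO.adj] at h
  have e : κ'.2 + (κ - κ').2 = κ.2 := by simp
  rw [e, neg_sub] at h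
  simpa [hatMat] using h.trans (le_abs_self C)

/-- Weighted sup bounds on sequences, with weights in all frequencies and in the space
frequencies. -/
def wle (a b : ℝ) (v : Freq n d → ℂ) (B : ℝ) : Prop :=
  ∀ κ, jb κ ^ a * jb κ.2 ^ b * ‖v κ‖ ≤ B

theorem weight_ab (a b : ℝ) :
    Weight (fun κ : Freq n d => jb κ.2) fun κ => jb κ ^ a * jb κ.2 ^ b :=
  Weight.mul hat_rho_one_le
    ((weight_rpow (fun κ : Freq n d => κ) a fun _ _ => le_rfl).mono hat_rho_one_le jb_snd_le)
    (weight_rpow (fun κ : Freq n d => κ.2) b fun x y => norm_snd_le (x - y))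

theorem wle.sq_sum {a b : ℝ} {v : Freq n d → ℂ} {B : ℝ}
    (h : wle (a + decayExp (Freq n d)) b v B) (F : Finset (Freq n d)) :
    ∑ κ ∈ F, (jb κ ^ a * jb κ.2 ^ b) ^ 2 * ‖v κ‖ ^ 2 ≤ B ^ 2 * decaySum (Freq n d) := by
  refine sq_sum_le (weight_ab a b).pos (fun κ => ?_) F
  refine le_trans (le_of_eq ?_) (h κ)
  rw [Real.rpow_add (jb_pos κ), Real.rpow_natCast]
  ring

/-- A power of the weight in the space frequencies costs a power of the full weight. -/
theorem wle.trade {a b : ℝ} {v : Freq n d → ℂ} {B : ℝ} (h : wle (a + 1) b v B) :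
    wle a (b + 1) v B := fun κ => by
  refine le_trans ?_ (h κ)
  rw [Real.rpow_add (jb_pos κ), Real.rpow_add (jb_pos κ.2), Real.rpow_one, Real.rpow_one]
  have h1 := jb_rpow_pos κ a
  have h2 := jb_rpow_pos κ.2 b
  have h3 := jb_snd_le κ
  calc jb κ ^ a * (jb κ.2 ^ b * jb κ.2) * ‖v κ‖ ≤ jb κ ^ a * (jb κ.2 ^ b * jb κ) * ‖v κ‖ := by
        gcongr
    _ = _ := by ring

theorem wle.mono {a a' b : ℝ} {v : Freq n d → ℂ} {B : ℝ} (h : wle a' b v B) (ha : a ≤ a') :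
    wle a b v B := fun κ => by
  refine le_trans ?_ (h κ)
  have h2 := jb_rpow_pos κ.2 b
  gcongr
  exact one_le_jb κ

/-- Operators of order `μ` in the weighted norms. -/
theorem Bd.wle_hatOp {P : Type} {wt : P → ℝ} {μ : ℝ} {g : P → Hat n d} (hwt : ∀ p, 0 ≤ wt p)
    (hg : Bd μ wt g) (a b : ℝ) : ∃ C : ℝ, 0 ≤ C ∧ ∀ p (v : RS (Freq n d)) (B : ℝ),
      wle a (b + μ) v.1 B → wle a b (hatOp (g p) v).1 (C * wt p * B) := by
  set N := ⌈|a|⌉₊ + ⌈|b|⌉₊ + decayExp (Freq n d) with hN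
  obtain ⟨C, hC⟩ := hg [] N
  refine ⟨|C| * decaySum (Freq n d), mul_nonneg (abs_nonneg _) decaySum_nonneg,
    fun p v B hv κ => ?_⟩
  have hB : 0 ≤ B := (mul_nonneg (mul_pos (jb_rpow_pos _ _) (jb_rpow_pos _ _)).le
    (norm_nonneg _)).trans (hv 0)
  set W := jb κ ^ a * jb κ.2 ^ b with hW
  have hW0 : 0 < W := mul_pos (jb_rpow_pos _ _) (jb_rpow_pos _ _)
  rw [hatOp_apply (hg.temp p)]
  have key : ∀ κ', jb (κ - κ') ^ decayExp (Freq n d)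
      * ‖(W : ℝ) * (g p (κ - κ') κ'.2 * v.1 κ')‖ ≤ |C| * wt p * B := by
    intro κ'
    have h := hC p (κ - κ') κ'.2
    simp only [List.length_nil, Nat.cast_zero, sub_zero, diffList] at h
    have hj := jb_pos (κ - κ')
    have hw := hwt p
    have r1 : jb κ ^ a ≤ jb κ' ^ a * jb (κ - κ') ^ ⌈|a|⌉₊ := by
      have := jb_add_rpow_le κ' (κ - κ') a
      rwa [add_sub_cancel] at this
    have r2 : jb κ.2 ^ b ≤ jb κ'.2 ^ b * jb (κ - κ') ^ ⌈|b|⌉₊ := by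
      have := jb_add_rpow_le κ'.2 (κ - κ').2 b
      have e : κ'.2 + (κ - κ').2 = κ.2 := by simp
      rw [e] at this
      refine this.trans ?_
      have := jb_rpow_pos κ'.2 b
      have := jb_pos (κ - κ').2
      gcongr
      exact jb_snd_le _
    have q1 := jb_rpow_pos κ' a
    have q2 := jb_rpow_pos κ'.2 b
    have q3 := jb_rpow_pos κ'.2 μ
    have hvv := hv κ'
    rw [Real.rpow_add (jb_pos _)] at hvv
    rw [norm_mul, Complex.norm_real, Real.norm_of_nonneg hW0.le, norm_mul, hW]
    have s0 := jb_rpow_pos κ.2 b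
    calc jb (κ - κ') ^ decayExp (Freq n d) * (jb κ ^ a * jb κ.2 ^ b
            * (‖g p (κ - κ') κ'.2‖ * ‖v.1 κ'‖))
        ≤ jb (κ - κ') ^ decayExp (Freq n d) * ((jb κ' ^ a * jb (κ - κ') ^ ⌈|a|⌉₊)
            * (jb κ'.2 ^ b * jb (κ - κ') ^ ⌈|b|⌉₊) * (‖g p (κ - κ') κ'.2‖ * ‖v.1 κ'‖)) := by
          gcongr
      _ = (jb (κ - κ') ^ N * ‖g p (κ - κ') κ'.2‖) * (jb κ' ^ a * jb κ'.2 ^ b * ‖v.1 κ'‖) := by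
          rw [hN, pow_add, pow_add]; ring
      _ ≤ (|C| * wt p * jb κ'.2 ^ μ) * (jb κ' ^ a * jb κ'.2 ^ b * ‖v.1 κ'‖) := by
          refine mul_le_mul_of_nonneg_right (h.trans ?_) (by positivity)
          gcongr
          exact le_abs_self C
      _ = |C| * wt p * (jb κ' ^ a * (jb κ'.2 ^ b * jb κ'.2 ^ μ) * ‖v.1 κ'‖) := by ring
      _ ≤ _ := by gcongr
  have := norm_tsum_le_of_decay_sub κ key
  rw [tsum_mul_left, norm_mul, Complex.norm_real, Real.norm_of_nonneg hW0.le] at this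
  refine this.trans (le_of_eq (by ring))

/-- The assumptions on a generator: order at most one, with a bounded Hermitian part. -/
structure IsGen (Γ : ParamGraph) (m : ℝ) (g : Γ.P → Hat n d) : Prop where
  bd : LipBd Γ m g
  sh : SH Γ g
  le_one : m ≤ 1

variable {Γ : ParamGraph} {m : ℝ} {g : Γ.P → Hat n d}

theorem IsGen.matBd (hg : IsGen Γ m g) :
    MatBd (fun κ : Freq n d => jb κ.2) (fun _ => 1) fun p => hatMat (g p) :=
  hg.bd.1.matBd (fun _ => zero_le_one) hg.le_one

theorem IsGen.hermBd (hg : IsGen Γ m g) : HermBd fun p => hatMat (g p) := Bd.hermBd hg.sh.1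

theorem IsGen.exists_flow (hg : IsGen Γ m g) (p : Γ.P) :
    ∃ U : ℝ → Module.End ℂ (RS (Freq n d)), IsMatFlow (hatMat (g p)) U :=
  TorusPDO.exists_flow hat_rho_one_le jb_snd_le hg.matBd hg.hermBd p

variable {U : Γ.P → ℝ → Module.End ℂ (RS (Freq n d))}

/-- Weighted bounds for the flow. The passage between supremum bounds and the square sums of the
energy estimate costs `decayExp` powers of the weight. -/
theorem IsGen.flow_wle (hg : IsGen Γ m g) (hU : ∀ p, IsMatFlow (hatMat (g p)) (U p)) (a b T : ℝ) :
    ∃ C : ℝ, 0 ≤ C ∧ ∀ p t, |t| ≤ T → ∀ (v : RS (Freq n d)) (B : ℝ),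
      wle (a + decayExp (Freq n d)) b v.1 B → wle a b (U p t v).1 (C * B) := by
  rcases lt_or_ge T 0 with hT | hT
  · exact ⟨0, le_rfl, fun p t ht => by linarith [abs_nonneg t]⟩
  obtain ⟨K, hK, h⟩ := energy_estimate hat_rho_one_le jb_snd_le hg.matBd hg.hermBd
    (weight_ab (n := n) (d := d) a b)
  refine ⟨Real.sqrt (Real.exp (K * T) * decaySum (Freq n d)), Real.sqrt_nonneg _,
    fun p t ht v B hv κ => ?_⟩
  have hB : 0 ≤ B := (mul_nonneg (mul_pos (jb_rpow_pos _ _) (jb_rpow_pos _ _)).le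
    (norm_nonneg _)).trans (hv 0)
  have := h p (fun t => (U p t v).1) (fun _ _ => 0) T (B ^ 2 * decaySum (Freq n d)) 0 hT
    (fun L => (hU p).rapid v T L) (fun t _ x => by simpa using (hU p).deriv t v x)
    (fun t _ F => by simp) (fun F => by rw [(hU p).zero]; exact hv.sq_sum F) t ht {κ}
  rw [Finset.sum_singleton, ← mul_pow] at this
  have h2 := Real.le_sqrt_of_sq_le this
  refine h2.trans (le_of_eq ?_)
  rw [show Real.exp (K * T) * (B ^ 2 * decaySum (Freq n d) + 2 * 0)
    = (Real.exp (K * T) * decaySum (Freq n d)) * B ^ 2 by ring,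
    Real.sqrt_mul (mul_nonneg (Real.exp_pos _).le decaySum_nonneg), Real.sqrt_sq hB]

/-- Lipschitz dependence of the flow on the parameters, with a loss of weight. -/
theorem IsGen.flow_lip (hg : IsGen Γ m g) (hU : ∀ p, IsMatFlow (hatMat (g p)) (U p)) (a b T : ℝ) :
    ∃ C : ℝ, 0 ≤ C ∧ ∀ e t, |t| ≤ T → ∀ (v : RS (Freq n d)) (B : ℝ),
      wle (a + decayExp (Freq n d) + 1 + decayExp (Freq n d)) b v.1 B →
      wle a b (U (Γ.s e) t v - U (Γ.t e) t v).1 (C * Γ.len e * B) := by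
  rcases lt_or_ge T 0 with hT | hT
  · exact ⟨0, le_rfl, fun p t ht => by linarith [abs_nonneg t]⟩
  obtain ⟨K, hK, h⟩ := energy_estimate hat_rho_one_le jb_snd_le hg.matBd hg.hermBd
    (weight_ab (n := n) (d := d) a b)
  obtain ⟨C₁, hC₁, h₁⟩ := hg.flow_wle hU (a + decayExp (Freq n d) + 1) b T
  obtain ⟨C₂, hC₂, h₂⟩ := (hg.bd.2.mono hg.le_one).wle_hatOp Γ.len_nonneg
    (a + decayExp (Freq n d)) b
  refine ⟨Real.sqrt (Real.exp (K * T) * (2 * decaySum (Freq n d))) * (C₂ * C₁),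
    by positivity, fun e t ht v B hv κ => ?_⟩
  have hB : 0 ≤ B := (mul_nonneg (mul_pos (jb_rpow_pos _ _) (jb_rpow_pos _ _)).le
    (norm_nonneg _)).trans (hv 0)
  have hlen := Γ.len_nonneg e
  have ts := hg.bd.temp (Γ.s e)
  have tt := hg.bd.temp (Γ.t e)
  -- the difference of the two flows solves the equation of the first one with this source
  set f : ℝ → Freq n d → ℂ := fun t =>
    (hatOp (fun κ q => g (Γ.s e) κ q - g (Γ.t e) κ q) (U (Γ.t e) t v)).1 with hf
  have hfb : ∀ t, |t| ≤ T → wle (a + decayExp (Freq n d)) b (f t)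
      (C₂ * Γ.len e * (C₁ * B)) := fun t ht => h₂ e _ _ ((h₁ (Γ.t e) t ht v B hv).trade)
  have := h (Γ.s e) (fun t => (U (Γ.s e) t v - U (Γ.t e) t v).1) f T 0
    ((C₂ * Γ.len e * (C₁ * B)) ^ 2 * decaySum (Freq n d)) hT
    (fun L => by
      obtain ⟨D, hD⟩ := (hU (Γ.s e)).rapid v T L
      obtain ⟨D', hD'⟩ := (hU (Γ.t e)).rapid v T L
      refine ⟨D + D', fun s hs x => ?_⟩
      have := mul_le_mul_of_nonneg_left
        (norm_sub_le ((U (Γ.s e) s v).1 x) ((U (Γ.t e) s v).1 x)) (jb_pow_pos x L).le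
      rw [RS.sub_apply]
      linarith [hD s hs x, hD' s hs x])
    (fun t _ x => by
      have d1 := ((hU (Γ.s e)).deriv t v x).sub ((hU (Γ.t e)).deriv t v x)
      refine d1.congr_deriv ?_
      rw [hf]
      simp only [hatOp_sub ts tt]
      have e1 := matOp_apply ts.mat (U (Γ.s e) t v) x
      have e2 := matOp_apply tt.mat (U (Γ.t e) t v) x
      have e3 := matOp_apply ts.mat (U (Γ.s e) t v - U (Γ.t e) t v) x
      rw [← e1, ← e2, ← e3, LinearMap.sub_apply, map_sub]
      simp only [RS.sub_apply, hatOp]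
      ring)
    (fun t ht F => (hfb t ht).sq_sum F) (fun F => by simp [(hU _).zero]) t ht {κ}
  rw [Finset.sum_singleton, ← mul_pow] at this
  have h2 := Real.le_sqrt_of_sq_le this
  refine h2.trans (le_of_eq ?_)
  rw [show Real.exp (K * T) * (0 + 2 * ((C₂ * Γ.len e * (C₁ * B)) ^ 2 * decaySum (Freq n d)))
    = (Real.exp (K * T) * (2 * decaySum (Freq n d))) * (C₂ * Γ.len e * (C₁ * B)) ^ 2 by ring,
    Real.sqrt_mul (mul_nonneg (Real.exp_pos _).le (mul_nonneg zero_le_two decaySum_nonneg)),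
    Real.sqrt_sq (by positivity)]
  ring

end hatflow

/-! ### Conjugation by flows -/

section group
variable {n d : ℕ} {Γ : ParamGraph} {m : ℝ} {g : Γ.P → Hat n d}
  {U : Γ.P → ℝ → Module.End ℂ (RS (Freq n d))}

theorem wle_natCast {L : ℕ} {v : Freq n d → ℂ} {B : ℝ} :
    wle (L : ℝ) 0 v B ↔ ∀ κ, jb κ ^ L * ‖v κ‖ ≤ B := by
  simp [wle]

theorem IsGen.utame (hg : IsGen Γ m g) (hU : ∀ p, IsMatFlow (hatMat (g p)) (U p)) (p : Γ.P) :
    UTame (U p) := fun R L => by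
  obtain ⟨C, hC, h⟩ := hg.flow_wle hU L 0 R
  refine ⟨L + decayExp (Freq n d), C, hC, fun t ht v B hv => ?_⟩
  refine wle_natCast.1 (h p t ht v B ?_)
  rw [← Nat.cast_add]
  exact wle_natCast.2 hv

theorem IsGen.deriv (hg : IsGen Γ m g) (hU : ∀ p, IsMatFlow (hatMat (g p)) (U p)) (p : Γ.P) (t : ℝ)
    (v : RS (Freq n d)) (κ : Freq n d) :
    HasDerivAt (fun s => (U p s v).1 κ) ((hatOp (g p) (U p t v)).1 κ) t := by
  rw [hatOp_apply (hg.bd.temp p)]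
  exact (hU p).deriv t v κ

theorem IsGen.unique (hg : IsGen Γ m g) (p : Γ.P) {w w' : ℝ → RS (Freq n d)}
    (hw : LocRapid fun t => (w t).1) (hw' : LocRapid fun t => (w' t).1)
    (hd : ∀ t κ, HasDerivAt (fun s => (w s).1 κ) ((hatOp (g p) (w t)).1 κ) t)
    (hd' : ∀ t κ, HasDerivAt (fun s => (w' s).1 κ) ((hatOp (g p) (w' t)).1 κ) t)
    (h0 : w 0 = w' 0) (t : ℝ) : w t = w' t := by
  have := solution_unique hat_rho_one_le jb_snd_le hg.matBd hg.hermBd p hw hw'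
    (fun t κ => by
      have := hd t κ
      rwa [hatOp_apply (hg.bd.temp p)] at this)
    (fun t κ => by
      have := hd' t κ
      rwa [hatOp_apply (hg.bd.temp p)] at this) (fun κ => by rw [h0])
  exact Subtype.ext (congrFun this t)

theorem IsGen.flow_add (hg : IsGen Γ m g) (hU : ∀ p, IsMatFlow (hatMat (g p)) (U p)) (p : Γ.P)
    (t s : ℝ) : U p t * U p s = U p (t + s) := by
  refine LinearMap.ext fun v => ?_
  refine hg.unique p (w := fun t => U p t (U p s v)) (w' := fun t => U p (t + s) v)
    ((hU p).rapid _) (fun T L => ?_) (fun t κ => hg.deriv hU p t _ κ) (fun t κ => ?_) ?_ t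
  · obtain ⟨C, hC⟩ := (hU p).rapid v (T + |s|) L
    exact ⟨C, fun t ht => hC _ ((abs_add_le t s).trans (by linarith))⟩
  · exact (hg.deriv hU p (t + s) v κ).comp_add_const t s
  · simp [(hU p).zero]

theorem IsGen.flow_mul_neg (hg : IsGen Γ m g) (hU : ∀ p, IsMatFlow (hatMat (g p)) (U p)) (p : Γ.P)
    (t : ℝ) : U p t * U p (-t) = 1 := by
  rw [hg.flow_add hU, add_neg_cancel, (hU p).zero]

theorem IsGen.flow_neg_mul (hg : IsGen Γ m g) (hU : ∀ p, IsMatFlow (hatMat (g p)) (U p)) (p : Γ.P)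
    (t : ℝ) : U p (-t) * U p t = 1 := by
  rw [hg.flow_add hU, neg_add_cancel, (hU p).zero]

/-- A tame operator commuting with the generator commutes with the flow. -/
theorem IsGen.commute_flow (hg : IsGen Γ m g) (hU : ∀ p, IsMatFlow (hatMat (g p)) (U p)) (p : Γ.P)
    {S : Module.End ℂ (RS (Freq n d))} (hS : Tame S)
    (h : S * hatOp (g p) = hatOp (g p) * S) (t : ℝ) : S * U p t = U p t * S := by
  refine LinearMap.ext fun v => ?_
  refine hg.unique p (w := fun t => S (U p t v)) (w' := fun t => U p t (S v))
    (hS.utame.locRapid ((hU p).rapid v)) ((hU p).rapid _) (fun t κ => ?_)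
    (fun t κ => hg.deriv hU p t _ κ) ?_ t
  · have h1 := hasDerivAt_apply (T := fun _ => S) (T' := fun _ => 0) hS.utame
      (fun _ _ => ⟨0, 0, le_rfl, fun _ _ _ _ _ _ => by simp⟩)
      (fun t v y => hasDerivAt_const _ _) ((hU p).rapid v)
      (w' := fun t => hatOp (g p) (U p t v))
      ((hatOp_tame (g p)).utame.locRapid ((hU p).rapid v)) (fun t x => hg.deriv hU p t v x) t κ
    refine h1.congr_deriv ?_
    have := LinearMap.congr_fun h (U p t v)
    simp only [Module.End.mul_apply] at this
    rw [this]; simp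
  · simp [(hU p).zero]

theorem IsGen.flow_shiftInv (hg : IsGen Γ m g) (hU : ∀ p, IsMatFlow (hatMat (g p)) (U p)) (p : Γ.P)
    (t : ℝ) : ShiftInv (U p t) := fun l =>
  (hg.commute_flow hU p (shiftOp_tame l) (hatOp_shiftInv (hg.bd.temp p) l).symm t).symm

/-- The derivative of `U_t B U_{-t}` is `U_t [g, B] U_{-t}`. -/
theorem IsGen.hasDerivAt_conj (hg : IsGen Γ m g) (hU : ∀ p, IsMatFlow (hatMat (g p)) (U p))
    (p : Γ.P) {B : Module.End ℂ (RS (Freq n d))} (hB : Tame B) (t : ℝ) (v : RS (Freq n d))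
    (κ : Freq n d) :
    HasDerivAt (fun s => ((U p s * B * U p (-s)) v).1 κ)
      (((U p t * (hatOp (g p) * B - B * hatOp (g p)) * U p (-t)) v).1 κ) t := by
  have hr : LocRapid fun t => (U p (-t) v).1 := fun T L => by
    obtain ⟨C, hC⟩ := (hU p).rapid v T L
    exact ⟨C, fun t ht => hC _ (by rwa [abs_neg])⟩
  have hr' : LocRapid fun t => (-(hatOp (g p) (U p (-t) v))).1 := fun T L => by
    obtain ⟨C, hC⟩ := (hatOp_tame (g p)).utame.locRapid hr T L
    exact ⟨C, fun t ht x => by simpa using hC t ht x⟩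
  have hUt := hg.utame hU p
  have d1 : ∀ t κ, HasDerivAt (fun s => (B (U p (-s) v)).1 κ)
      ((B (-(hatOp (g p) (U p (-t) v)))).1 κ) t := fun t κ => by
    have h1 := hasDerivAt_apply (T := fun _ => B) (T' := fun _ => 0) hB.utame
      (fun _ _ => ⟨0, 0, le_rfl, fun _ _ _ _ _ _ => by simp⟩)
      (fun t v y => hasDerivAt_const _ _) hr hr' (fun t x => by
        have := (hg.deriv hU p (-t) v x).scomp t (hasDerivAt_neg t)
        simpa [Function.comp_def] using this) t κ
    simpa using h1
  have h := hasDerivAt_apply (T := U p) (T' := fun t => hatOp (g p) ∘ₗ U p t) hUt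
    ((hatOp_tame (g p)).utame.comp hUt) (fun t v y => hg.deriv hU p t v y)
    (w := fun t => B (U p (-t) v)) (w' := fun t => B (-(hatOp (g p) (U p (-t) v))))
    (hB.utame.locRapid hr) (hB.utame.locRapid hr') d1 t κ
  refine h.congr_deriv ?_
  have hc := LinearMap.congr_fun (hg.commute_flow hU p (hatOp_tame (g p)) rfl t) (B (U p (-t) v))
  simp only [Module.End.mul_apply] at hc
  simp only [LinearMap.comp_apply, Module.End.mul_apply, LinearMap.sub_apply, map_sub, map_neg,
    RS.sub_apply, RS.neg_apply, hc]
  ring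

/-- The symbol of the conjugate of the operator with symbol `b` by the flow `V`. -/
def cj (V : ℝ → Module.End ℂ (RS (Freq n d))) (b : Hat n d) (t : ℝ) : Hat n d :=
  symb (V t * hatOp b * V (-t))

theorem IsGen.tame_conj (hg : IsGen Γ m g) (hU : ∀ p, IsMatFlow (hatMat (g p)) (U p))
    (p : Γ.P) {B : Module.End ℂ (RS (Freq n d))} (hB : Tame B) (t : ℝ) :
    Tame (U p t * B * U p (-t)) :=
  (((hg.utame hU p).tame t).mul hB).mul ((hg.utame hU p).tame (-t))

theorem IsGen.hasDerivAt_cj (hg : IsGen Γ m g) (hU : ∀ p, IsMatFlow (hatMat (g p)) (U p)) (p : Γ.P)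
    {b : Hat n d} (hb : Temp b) (t : ℝ) (κ : Freq n d) (q : Fin d → ℤ) :
    HasDerivAt (fun s => cj (U p) b s κ q) (cj (U p) (comm (g p) b) t κ q) t := by
  have := hg.hasDerivAt_conj hU p (hatOp_tame b) t (delta (0, q)) (κ + (0, q))
  rwa [hatOp_comm (hg.bd.temp p) hb] at this

theorem IsGen.cj_zero (hU : ∀ p, IsMatFlow (hatMat (g p)) (U p)) (p : Γ.P)
    {b : Hat n d} (hb : Temp b) : cj (U p) b 0 = b := by
  simp [cj, (hU p).zero, symb_hatOp hb]

end group

/-! ### Primitives of families of symbols -/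

section primitive
variable {n d : ℕ}

theorem hasDerivAt_diffList (v : List (Fin d)) {F : ℝ → (Fin d → ℤ) → ℂ} {f : (Fin d → ℤ) → ℂ}
    {t : ℝ} (h : ∀ q, HasDerivAt (fun s => F s q) (f q) t) (q : Fin d → ℤ) :
    HasDerivAt (fun s => diffList v (F s) q) (diffList v f q) t := by
  induction v generalizing F f with
  | nil => exact h q
  | cons j v ih => exact ih fun q => (h (q + Pi.single j 1)).sub (h q)

theorem BdAt.slope {P : Type} {wt : P → ℝ} {T : ℝ} {v : List (Fin d)} {L : ℕ} {m : ℝ}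
    {F f : P → ℝ → Hat n d}
    (hd : ∀ p t κ q, HasDerivAt (fun s => F p s κ q) (f p t κ q) t)
    (hf : BdAt v L m (fun x : P × Set.Icc (-T) T => wt x.1) fun x => f x.1 x.2) :
    BdAt v L m (fun x : P × Set.Icc (-T) T => wt x.1) fun x κ q =>
      ((x.2 : ℝ)⁻¹ : ℝ) * (F x.1 x.2 κ q - F x.1 0 κ q) := by
  obtain ⟨C, hC⟩ := hf
  refine ⟨C, fun x κ q => ?_⟩
  obtain ⟨p, t, ht⟩ := x
  have hL := jb_pow_pos κ L
  have hT : 0 ≤ T := by have := ht.1.trans ht.2; linarith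
  have h0 : (0 : ℝ) ∈ Set.Icc (-T) T := ⟨by linarith, hT⟩
  have hC0 := (mul_nonneg hL.le (norm_nonneg _)).trans (hC (p, ⟨t, ht⟩) κ q)
  have key := Convex.norm_image_sub_le_of_norm_hasDerivWithin_le (𝕜 := ℝ)
    (f := fun s => diffList v (F p s κ) q) (f' := fun s => diffList v (f p s κ) q)
    (C := C * wt p * jb q ^ (m - v.length) / jb κ ^ L)
    (fun s _ => (hasDerivAt_diffList v (fun q => hd p s κ q) q).hasDerivWithinAt)
    (fun s hs => by
      rw [le_div_iff₀ hL, mul_comm]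
      exact hC (p, ⟨s, hs⟩) κ q) (convex_Icc (-T) T) h0 ht
  rw [sub_zero, Real.norm_eq_abs] at key
  rw [diffList_const_mul, diffList_sub, norm_mul, Complex.norm_real, Real.norm_eq_abs, abs_inv]
  rcases eq_or_ne t 0 with rfl | hne
  · simpa using hC0
  · have ht0 : 0 < |t| := abs_pos.2 hne
    calc jb κ ^ L * (|t|⁻¹ * ‖diffList v (F p t κ) q - diffList v (F p 0 κ) q‖)
        ≤ jb κ ^ L * (|t|⁻¹ * (C * wt p * jb q ^ (m - v.length) / jb κ ^ L * |t|)) := by gcongr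
      _ = _ := by field_simp

variable {Γ : ParamGraph} {T m : ℝ} {v : List (Fin d)} {L : ℕ}

/-- Difference quotients in time inherit the bounds of the time derivative. -/
theorem LipBdAt.slope {F f : Γ.P → ℝ → Hat n d}
    (hd : ∀ p t κ q, HasDerivAt (fun s => F p s κ q) (f p t κ q) t)
    (hf : LipBdAt (Γ.withTime T) v L m fun x => f x.1 x.2) :
    LipBdAt (Γ.withTime T) v L m fun x κ q =>
      ((x.2 : ℝ)⁻¹ : ℝ) * (F x.1 x.2 κ q - F x.1 0 κ q) := by
  refine ⟨BdAt.slope (P := Γ.P) (wt := fun _ => 1) hd hf.1, ?_⟩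
  have := BdAt.slope (P := Γ.E) (wt := Γ.len) (T := T) (v := v) (L := L) (m := m)
    (F := fun e t κ q => F (Γ.s e) t κ q - F (Γ.t e) t κ q)
    (f := fun e t κ q => f (Γ.s e) t κ q - f (Γ.t e) t κ q)
    (fun e t κ q => (hd _ t κ q).sub (hd _ t κ q)) hf.2
  refine cast (congrArg _ ?_) this
  funext e κ q
  simp only
  ring

theorem LipBd.slope {F f : Γ.P → ℝ → Hat n d}
    (hd : ∀ p t κ q, HasDerivAt (fun s => F p s κ q) (f p t κ q) t)
    (hf : LipBd (Γ.withTime T) m fun x => f x.1 x.2) :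
    LipBd (Γ.withTime T) m fun x κ q =>
      ((x.2 : ℝ)⁻¹ : ℝ) * (F x.1 x.2 κ q - F x.1 0 κ q) :=
  lipBd_iff.2 fun v L => LipBdAt.slope hd (lipBd_iff.1 hf v L)

theorem BdAt.time_mul {P : Type} {wt : P → ℝ} {a : P × Set.Icc (-T) T → Hat n d}
    (ha : BdAt v L m (fun x : P × Set.Icc (-T) T => wt x.1) a) :
    BdAt v L m (fun x : P × Set.Icc (-T) T => wt x.1) fun x κ q => (x.2 : ℝ) * a x κ q := by
  obtain ⟨C, hC⟩ := ha
  refine ⟨T * C, fun x κ q => ?_⟩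
  have h := hC x κ q
  have h0 := (mul_nonneg (jb_pow_pos κ L).le (norm_nonneg _)).trans h
  rw [diffList_const_mul, norm_mul, Complex.norm_real, Real.norm_eq_abs]
  calc jb κ ^ L * (|(x.2 : ℝ)| * ‖diffList v (a x κ) q‖)
      = |(x.2 : ℝ)| * (jb κ ^ L * ‖diffList v (a x κ) q‖) := by ring
    _ ≤ T * (C * wt x.1 * jb q ^ (m - v.length)) := by
        have hT : |(x.2 : ℝ)| ≤ T := abs_le.2 x.2.2
        have := jb_pos κ
        gcongr
        exact (abs_nonneg _).trans hT
    _ = _ := by ring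

/-- A family whose time derivative and initial value are bounded. -/
theorem LipBdAt.of_deriv {F f : Γ.P → ℝ → Hat n d}
    (hd : ∀ p t κ q, HasDerivAt (fun s => F p s κ q) (f p t κ q) t)
    (hf : LipBdAt (Γ.withTime T) v L m fun x => f x.1 x.2)
    (h0 : LipBdAt Γ v L m fun p => F p 0) :
    LipBdAt (Γ.withTime T) v L m fun x => F x.1 x.2 := by
  have h1 := LipBdAt.slope hd hf
  have h2 : LipBdAt (Γ.withTime T) v L m fun x κ q => (x.2 : ℝ) *
      (((x.2 : ℝ)⁻¹ : ℝ) * (F x.1 x.2 κ q - F x.1 0 κ q)) := by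
    refine ⟨BdAt.time_mul (P := Γ.P) (wt := fun _ => 1) h1.1, ?_⟩
    have := BdAt.time_mul (P := Γ.E) (wt := Γ.len) h1.2
    refine cast (congrArg _ ?_) this
    funext e κ q
    simp only
    ring
  have h3 : LipBdAt (Γ.withTime T) v L m fun x => F x.1 0 := by
    obtain ⟨⟨C, hC⟩, ⟨C', hC'⟩⟩ := h0
    exact ⟨⟨C, fun x => hC x.1⟩, ⟨C', fun x => hC' x.1⟩⟩
  have h4 := h2.add h3
  refine cast (congrArg _ ?_) h4
  funext x κ q
  rcases eq_or_ne (x.2 : ℝ) 0 with h | h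
  · simp [h]
  · have : ((x.2 : ℝ) : ℂ) ≠ 0 := by exact_mod_cast h
    push_cast
    field_simp
    ring

theorem LipBd.of_deriv {F f : Γ.P → ℝ → Hat n d}
    (hd : ∀ p t κ q, HasDerivAt (fun s => F p s κ q) (f p t κ q) t)
    (hf : LipBd (Γ.withTime T) m fun x => f x.1 x.2) (h0 : LipBd Γ m fun p => F p 0) :
    LipBd (Γ.withTime T) m fun x => F x.1 x.2 :=
  lipBd_iff.2 fun v L => LipBdAt.of_deriv hd (lipBd_iff.1 hf v L) (lipBd_iff.1 h0 v L)

/-- Evaluation at a time depending on the parameter. -/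
theorem LipBd.at_time {a : (Γ.withTime T).P → Hat n d} (h : LipBd (Γ.withTime T) m a)
    (θ : Γ.P → Set.Icc (-T) T) (hθ : ∀ e, θ (Γ.s e) = θ (Γ.t e)) :
    LipBd Γ m fun p => a (p, θ p) := by
  refine ⟨h.1.comp fun p => (p, θ p), ?_⟩
  have := h.2.comp fun e => ((e, θ (Γ.s e)) : (Γ.withTime T).E)
  refine cast (congrArg _ ?_) this
  funext e κ q
  simp only [hθ e]

theorem LipBd.withTime {a : Γ.P → Hat n d} (h : LipBd Γ m a) :
    LipBd (Γ.withTime T) m fun x => a x.1 := ⟨h.1.comp (Q := Γ.P × Set.Icc (-T) T) Prod.fst, h.2.comp (Q := Γ.E × Set.Icc (-T) T) Prod.fst⟩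

theorem SH.withTime {a : Γ.P → Hat n d} (h : SH Γ a) :
    SH (Γ.withTime T) fun x => a x.1 := LipBd.withTime h

theorem hasDerivAt_adj {F : ℝ → Hat n d} {f : Hat n d} {t : ℝ}
    (h : ∀ κ q, HasDerivAt (fun s => F s κ q) (f κ q) t) (κ : Freq n d) (q : Fin d → ℤ) :
    HasDerivAt (fun s => adj (F s) κ q) (adj f κ q) t := by
  have := (h (-κ) (q + κ.2)).star
  simpa [adj] using this

end primitive

/-! ### Egorov's theorem -/

section egorov
variable {n d : ℕ}

/-- Bounds for a family of operators between weighted spaces. -/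
def WBd {Q : Type} (wt : Q → ℝ) (a b a' b' : ℝ) (S : Q → Module.End ℂ (RS (Freq n d))) : Prop :=
  ∃ C : ℝ, 0 ≤ C ∧ ∀ p (v : RS (Freq n d)) (B : ℝ),
    wle a' b' v.1 B → wle a b (S p v).1 (C * wt p * B)

theorem WBd.comp {Q : Type} {wt wt' : Q → ℝ} {a b a' b' a'' b'' : ℝ}
    {S S' : Q → Module.End ℂ (RS (Freq n d))} (h : WBd wt a b a' b' S)
    (h' : WBd wt' a' b' a'' b'' S') : WBd (fun p => wt p * wt' p) a b a'' b'' fun p => S p * S' p := by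
  obtain ⟨C, hC, h⟩ := h
  obtain ⟨C', hC', h'⟩ := h'
  refine ⟨C * C', by positivity, fun p v B hv => ?_⟩
  have := h p (S' p v) _ (h' p v B hv)
  rwa [show C * wt p * (C' * wt' p * B) = C * C' * (wt p * wt' p) * B by ring] at this

theorem WBd.congr_wt {Q : Type} {wt wt' : Q → ℝ} {a b a' b' : ℝ}
    {S : Q → Module.End ℂ (RS (Freq n d))} (h : WBd wt a b a' b' S) (e : ∀ p, wt p = wt' p) :
    WBd wt' a b a' b' S := by rwa [show wt' = wt from funext fun p => (e p).symm]

theorem WBd.mono {Q : Type} {wt : Q → ℝ} {a b a' a'' b' : ℝ}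
    {S : Q → Module.End ℂ (RS (Freq n d))} (h : WBd wt a b a' b' S) (ha : a' ≤ a'') :
    WBd wt a b a'' b' S := by
  obtain ⟨C, hC, h⟩ := h
  exact ⟨C, hC, fun p v B hv => h p v B (hv.mono ha)⟩

theorem WBd.add {Q : Type} {wt : Q → ℝ} {a b a' b' : ℝ}
    {S S' : Q → Module.End ℂ (RS (Freq n d))} (h : WBd wt a b a' b' S) (h' : WBd wt a b a' b' S') :
    WBd wt a b a' b' fun p => S p + S' p := by
  obtain ⟨C, hC, h⟩ := h
  obtain ⟨C', hC', h'⟩ := h'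
  refine ⟨C + C', by positivity, fun p v B hv κ => ?_⟩
  have h1 := h p v B hv κ
  have h2 := h' p v B hv κ
  have h3 := mul_le_mul_of_nonneg_left (norm_add_le ((S p v).1 κ) ((S' p v).1 κ))
    (mul_pos (jb_rpow_pos κ a) (jb_rpow_pos κ.2 b)).le
  simp only [LinearMap.add_apply, RS.add_apply]
  nlinarith

theorem wle_delta (L b : ℝ) (q : Fin d → ℤ) :
    wle L b (delta ((0, q) : Freq n d)).1 (jb q ^ (L + b)) := fun κ => by
  by_cases h : κ = (0, q)
  · subst h
    rw [delta_self, norm_one, mul_one, jb_zero_prod, Real.rpow_add (jb_pos q)]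
  · rw [delta_ne h, norm_zero, mul_zero]
    exact (jb_rpow_pos q _).le

/-- The symbol of an operator bounded between weighted spaces is polynomially bounded. -/
theorem WBd.bdAt_symb {Q : Type} {wt : Q → ℝ} {L : ℕ} {a μ : ℝ}
    {S : Q → Module.End ℂ (RS (Freq n d))} (h : WBd wt L 0 a μ S) :
    BdAt [] L (L + a + μ) wt fun p => symb (S p) := by
  obtain ⟨C, hC, h⟩ := h
  refine ⟨C, fun p κ q => ?_⟩
  have h1 := wle_natCast.1 (h p _ _ (wle_delta a μ q)) (κ + (0, q))
  have h2 : jb κ ^ L ≤ jb (κ + (0, q)) ^ L * jb q ^ L := by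
    rw [← mul_pow]
    refine pow_le_pow_left₀ (jb_pos κ).le ?_ L
    have := jb_add_le (κ + (0, q)) (-(0, q) : Freq n d)
    rwa [jb_neg, jb_zero_prod, add_neg_cancel_right] at this
  have hq := jb_pow_pos q L
  simp only [diffList, List.length_nil, Nat.cast_zero, sub_zero, symb]
  calc jb κ ^ L * ‖(S p (delta (0, q))).1 (κ + (0, q))‖
      ≤ (jb (κ + (0, q)) ^ L * jb q ^ L) * ‖(S p (delta (0, q))).1 (κ + (0, q))‖ := by gcongr
    _ = (jb (κ + (0, q)) ^ L * ‖(S p (delta (0, q))).1 (κ + (0, q))‖) * jb q ^ L := by ring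
    _ ≤ (C * wt p * jb q ^ (a + μ)) * jb q ^ L := by gcongr
    _ = _ := by
      rw [show (L : ℝ) + a + μ = (a + μ) + L by ring, Real.rpow_add (jb_pos q) _ (L : ℝ),
        Real.rpow_natCast]
      ring

/-- Bounds on the symbol bound its differences, without gain. -/
theorem BdAt.of_nil {Q : Type} {wt : Q → ℝ} {L : ℕ} {m : ℝ} {a : Q → Hat n d}
    (h : BdAt [] L m wt a) (v : List (Fin d)) : BdAt v L (m + v.length) wt a := by
  obtain ⟨C, hC⟩ := h
  obtain ⟨A, hA, hv⟩ := norm_diffList_le v m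
  refine ⟨A * C, fun p κ q => ?_⟩
  have hL := jb_pow_pos κ L
  have := hv (fun q => (jb κ ^ L : ℝ) * a p κ q) (C * wt p) (fun q => by
    rw [norm_mul, Complex.norm_real, Real.norm_of_nonneg hL.le]
    simpa [diffList] using hC p κ q) q
  rw [diffList_const_mul, norm_mul, Complex.norm_real, Real.norm_of_nonneg hL.le] at this
  rw [add_sub_cancel_right]
  exact this.trans (le_of_eq (by ring))

variable {Γ : ParamGraph} {m : ℝ} {g : Γ.P → Hat n d}
  {U : Γ.P → ℝ → Module.End ℂ (RS (Freq n d))}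

/-- A crude bound on conjugated symbols, with a loss that does not depend on their order. -/
theorem IsGen.cj_base (hg : IsGen Γ m g) (hU : ∀ p, IsMatFlow (hatMat (g p)) (U p)) (T : ℝ)
    (L : ℕ) (v : List (Fin d)) : ∃ N : ℝ, ∀ (μ : ℝ) (b : Γ.P → Hat n d), LipBd Γ μ b →
      LipBdAt (Γ.withTime T) v L (N + μ) fun x => cj (U x.1) (b x.1) x.2 := by
  -- the flow loses `r` powers of the weight; the difference of two flows loses `r + 1 + r`, since
  -- it solves an equation whose source has order at most one
  set r : ℝ := ((decayExp (Freq n d) : ℕ) : ℝ) with hr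
  have hr0 : 0 ≤ r := Nat.cast_nonneg _
  have fl : ∀ a b, WBd (fun _ : (Γ.withTime T).P => 1) a b (a + r) b fun x => U x.1 x.2 := by
    intro a b
    obtain ⟨C, hC, h⟩ := hg.flow_wle hU a b T
    exact ⟨C, hC, fun x v B hv => by simpa using h x.1 x.2 (abs_le.2 x.2.2) v B hv⟩
  have fln : ∀ a b, WBd (fun _ : (Γ.withTime T).P => 1) a b (a + r) b fun x => U x.1 (-x.2) := by
    intro a b
    obtain ⟨C, hC, h⟩ := hg.flow_wle hU a b T
    exact ⟨C, hC, fun x v B hv => by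
      simpa using h x.1 (-x.2) (by rw [abs_neg]; exact abs_le.2 x.2.2) v B hv⟩
  have dfl : ∀ a b, WBd (Γ.withTime T).len a b (a + r + 1 + r) b
      fun e => U (Γ.s e.1) e.2 - U (Γ.t e.1) e.2 := by
    intro a b
    obtain ⟨C, hC, h⟩ := hg.flow_lip hU a b T
    exact ⟨C, hC, fun x v B hv => h x.1 x.2 (abs_le.2 x.2.2) v B hv⟩
  have dfln : ∀ a b, WBd (Γ.withTime T).len a b (a + r + 1 + r) b
      fun e => U (Γ.s e.1) (-e.2) - U (Γ.t e.1) (-e.2) := by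
    intro a b
    obtain ⟨C, hC, h⟩ := hg.flow_lip hU a b T
    exact ⟨C, hC, fun x v B hv =>
      h x.1 (-x.2) (by rw [abs_neg]; exact abs_le.2 x.2.2) v B hv⟩
  refine ⟨L + (L + r + 1 + r + r) + v.length, fun μ b hb => ?_⟩
  have op : ∀ a, WBd (fun _ : (Γ.withTime T).P => 1) a 0 a μ fun x => hatOp (b x.1) := by
    intro a
    obtain ⟨C, hC, h⟩ := hb.1.wle_hatOp (fun _ => zero_le_one) a 0
    rw [zero_add] at h
    exact ⟨C, hC, fun x v B hv => h x.1 v B hv⟩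
  have dop : ∀ a, WBd (Γ.withTime T).len a 0 a μ
      fun e => hatOp (b (Γ.s e.1)) - hatOp (b (Γ.t e.1)) := by
    intro a
    obtain ⟨C, hC, h⟩ := hb.2.wle_hatOp Γ.len_nonneg a 0
    rw [zero_add] at h
    refine ⟨C, hC, fun x v B hv => ?_⟩
    have h' := h x.1 v B hv
    rw [hatOp_sub (hb.temp _) (hb.temp _)] at h'
    exact h'
  have comp_s : ∀ {a b a' b' : ℝ} {S : (Γ.withTime T).P → Module.End ℂ (RS (Freq n d))},
      WBd (fun _ => 1) a b a' b' S →
      WBd (fun _ => 1) a b a' b' fun e => S ((Γ.withTime T).s e) := by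
    rintro a b a' b' S ⟨C, hC, h⟩
    exact ⟨C, hC, fun e => h _⟩
  have comp_t : ∀ {a b a' b' : ℝ} {S : (Γ.withTime T).P → Module.End ℂ (RS (Freq n d))},
      WBd (fun _ => 1) a b a' b' S →
      WBd (fun _ => 1) a b a' b' fun e => S ((Γ.withTime T).t e) := by
    rintro a b a' b' S ⟨C, hC, h⟩
    exact ⟨C, hC, fun e => h _⟩
  rw [show (L : ℝ) + (L + r + 1 + r + r) + v.length + μ
    = (L + (L + r + 1 + r + r) + μ) + v.length by ring]
  constructor
  · refine BdAt.of_nil ?_ v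
    have h := (((fl L 0).comp (op _)).comp (fln _ μ)).congr_wt (wt' := fun _ => 1) (by simp)
    exact (h.mono (by linarith)).bdAt_symb
  · refine BdAt.of_nil ?_ v
    -- the difference of `U Op(b) U⁻¹` at the two ends of an edge, telescoped
    have h1 := (((dfl L 0).comp (comp_s (op _))).comp (comp_s (fln _ μ))).congr_wt
      (wt' := (Γ.withTime T).len) (by simp)
    have h2 := (((comp_t (fl L 0)).comp (dop _)).comp (comp_s (fln _ μ))).congr_wt
      (wt' := (Γ.withTime T).len) (by simp)
    have h3 := (((comp_t (fl L 0)).comp (comp_t (op _))).comp (dfln _ μ)).congr_wt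
      (wt' := (Γ.withTime T).len) (by simp)
    have h := (((h1.mono (a'' := L + r + 1 + r + r) (by linarith)).add
      (h2.mono (by linarith))).add (h3.mono (by linarith))).bdAt_symb
    refine cast (congrArg _ ?_) h
    funext e κ q
    simp only [symb, cj, LinearMap.add_apply, LinearMap.sub_apply,
      Module.End.mul_apply, RS.add_apply, RS.sub_apply, map_sub]
    ring

/-- Egorov's theorem: conjugation by the flow of a generator of order less than one preserves the
order of symbols. The commutators with the generator have smaller and smaller order, and
for very negative order the crude bound suffices. -/
theorem IsGen.egorov (hg : IsGen Γ m g) (hU : ∀ p, IsMatFlow (hatMat (g p)) (U p)) (hm : m < 1)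
    (T : ℝ) {μ : ℝ} {b : Γ.P → Hat n d} (hb : LipBd Γ μ b) :
    LipBd (Γ.withTime T) μ fun x => cj (U x.1) (b x.1) x.2 := by
  refine lipBd_iff.2 fun v L => ?_
  obtain ⟨N, hN⟩ := hg.cj_base hU T L v
  -- `k` commutators with `g` lower the order by `k (1 - m)`; once this exceeds the loss `N`, the
  -- crude bound applies
  have key : ∀ (k : ℕ) (μ' : ℝ) (b : Γ.P → Hat n d), LipBd Γ μ' b → μ' ≤ μ →
      N + (μ' - k * (1 - m)) ≤ μ →
      LipBdAt (Γ.withTime T) v L μ fun x => cj (U x.1) (b x.1) x.2 := by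
    intro k
    induction k with
    | zero => exact fun μ' b hb _ h => (hN μ' b hb).mono (by simpa using h)
    | succ k ih =>
      intro μ' b hb hμ h
      have h1 := ih (m + μ' - 1) _ (hg.bd.comm hb) (by linarith) (by push_cast at h; linarith)
      have h0 : LipBdAt Γ v L μ fun p => cj (U p) (b p) 0 := by
        rw [show (fun p => cj (U p) (b p) 0) = b from
          funext fun p => IsGen.cj_zero hU p (hb.temp p)]
        exact lipBd_iff.1 (hb.mono hμ) v L
      exact LipBdAt.of_deriv (F := fun p t => cj (U p) (b p) t)
        (f := fun p t => cj (U p) (comm (g p) (b p)) t)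
        (fun p t κ q => hg.hasDerivAt_cj hU p (hb.temp p) t κ q) h1 h0
  obtain ⟨k, hk⟩ := exists_nat_ge (N / (1 - m))
  rw [div_le_iff₀ (by linarith)] at hk
  exact key k μ b hb le_rfl (by linarith)

/-- Conjugation by the flow preserves the boundedness of the Hermitian part. -/
theorem IsGen.egorov_sh (hg : IsGen Γ m g) (hU : ∀ p, IsMatFlow (hatMat (g p)) (U p)) (hm : m < 1)
    (T : ℝ) {b : Γ.P → Hat n d} (hb : LipBd Γ 1 b) (hs : SH Γ b) :
    SH (Γ.withTime T) fun x => cj (U x.1) (b x.1) x.2 := by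
  have key : ∀ (k : ℕ) (μ : ℝ) (b : Γ.P → Hat n d), LipBd Γ μ b → μ ≤ 1 → SH Γ b →
      μ - k * (1 - m) ≤ 0 → SH (Γ.withTime T) fun x => cj (U x.1) (b x.1) x.2 := by
    intro k
    induction k with
    | zero => exact fun μ b hb _ _ h => SH.of_nonpos (hg.egorov hU hm T hb) (by simpa using h)
    | succ k ih =>
      intro μ b hb hμ hs h
      have h1 := ih (m + μ - 1) _ (hg.bd.comm hb) (by linarith)
        (SH.comm (hg.bd.mono hg.le_one) (hb.mono hμ) hg.sh hs) (by push_cast at h; linarith)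
      have h0 : LipBd Γ 0 fun p κ q => cj (U p) (b p) 0 κ q + adj (cj (U p) (b p) 0) κ q :=
        LipBd.congr hs fun p κ q => by rw [IsGen.cj_zero hU p (hb.temp p)]
      exact LipBd.of_deriv (F := fun p t κ q => cj (U p) (b p) t κ q + adj (cj (U p) (b p) t) κ q)
        (f := fun p t κ q => cj (U p) (comm (g p) (b p)) t κ q
          + adj (cj (U p) (comm (g p) (b p)) t) κ q)
        (fun p t κ q => (hg.hasDerivAt_cj hU p (hb.temp p) t κ q).add
          (hasDerivAt_adj (fun κ q => hg.hasDerivAt_cj hU p (hb.temp p) t κ q) κ q)) h1 h0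
  obtain ⟨k, hk⟩ := exists_nat_ge (1 / (1 - m))
  rw [div_le_iff₀ (by linarith)] at hk
  exact key k 1 b hb le_rfl hs (by linarith)

end egorov

/-! ### Reality and reversibility of lattice symbols -/

section symmetry
variable {n d : ℕ} {σ : ℂ →+* ℂ}

/-- The symmetry `a(-κ, -q) = s σ(a(κ, q))`. For `σ` the conjugation and `s = 1` it expresses
reality, for `σ = id` and `s = -1` reversibility. -/
def HatSym (σ : ℂ →+* ℂ) (s : ℝ) (a : Hat n d) : Prop :=
  ∀ κ q, a (-κ) (-q) = s * σ (a κ q)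

/-- The two involutions of `ℂ` over `ℝ`. -/
def IsInvol (σ : ℂ →+* ℂ) : Prop := σ = RingHom.id ℂ ∨ σ = starRingEnd ℂ

theorem IsInvol.norm (h : IsInvol σ) (z : ℂ) : ‖σ z‖ = ‖z‖ := by
  rcases h with rfl | rfl <;> simp

theorem IsInvol.ofReal (h : IsInvol σ) (r : ℝ) : σ (r : ℂ) = r := by
  rcases h with rfl | rfl <;> simp

theorem IsInvol.tsum {X : Type*} (h : IsInvol σ) (f : X → ℂ) : σ (∑' x, f x) = ∑' x, σ (f x) := by
  rcases h with rfl | rfl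
  · rfl
  · exact Complex.conj_tsum f

theorem IsInvol.hasDerivAt (h : IsInvol σ) {f : ℝ → ℂ} {f' : ℂ} {t : ℝ} (hf : HasDerivAt f f' t) :
    HasDerivAt (fun s => σ (f s)) (σ f') t := by
  rcases h with rfl | rfl
  · exact hf
  · exact hf.star

theorem HatSym.add {s : ℝ} {a b : Hat n d} (ha : HatSym σ s a) (hb : HatSym σ s b) :
    HatSym σ s fun κ q => a κ q + b κ q := fun κ q => by
  dsimp only; rw [ha, hb, map_add]; ring

theorem HatSym.real_mul (hσ : IsInvol σ) {s : ℝ} {a : Hat n d} (ha : HatSym σ s a) (c : ℝ) :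
    HatSym σ s fun κ q => (c : ℂ) * a κ q := fun κ q => by
  dsimp only; rw [ha, map_mul, hσ.ofReal]; ring

theorem HatSym.sub {s : ℝ} {a b : Hat n d} (ha : HatSym σ s a) (hb : HatSym σ s b) :
    HatSym σ s fun κ q => a κ q - b κ q := fun κ q => by
  dsimp only; rw [ha, hb, map_sub]; ring

theorem HatSym.avg {s : ℝ} {a : Hat n d} (ha : HatSym σ s a) : HatSym σ s (avg a) := fun κ q => by
  simp only [TorusPDO.avg, neg_eq_zero]
  split_ifs
  · exact ha κ q
  · simp

theorem HatSym.sharp (hσ : IsInvol σ) {s s' : ℝ} {a b : Hat n d} (ha : HatSym σ s a)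
    (hb : HatSym σ s' b) : HatSym σ (s * s') (sharp a b) := fun κ q => by
  rw [sharp_apply, sharp_apply, hσ.tsum, ← tsum_mul_left, ← (Equiv.neg _).tsum_eq]
  refine tsum_congr fun κ' => ?_
  have e1 : -κ - -κ' = -(κ - κ') := by abel
  have e2 : -q + (-κ').2 = -(q + κ'.2) := by rw [Prod.snd_neg]; abel
  rw [Equiv.neg_apply, e1, e2, ha, hb, map_mul]
  push_cast; ring

theorem HatSym.comm (hσ : IsInvol σ) {s s' : ℝ} {a b : Hat n d} (ha : HatSym σ s a)
    (hb : HatSym σ s' b) : HatSym σ (s * s') (comm a b) :=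
  (ha.sharp hσ hb).sub (mul_comm s' s ▸ hb.sharp hσ ha)

/-- The antilinear or linear involution `v(κ) ↦ σ(v(-κ))`. -/
def flip (hσ : IsInvol σ) (v : RS (Freq n d)) : RS (Freq n d) :=
  ⟨fun κ => σ (v.1 (-κ)), fun L => by
    obtain ⟨C, -, hC⟩ := RS.decay v L
    exact ⟨C, fun κ => by simpa [hσ.norm] using hC (-κ)⟩⟩

theorem flip_apply (hσ : IsInvol σ) (v : RS (Freq n d)) (κ : Freq n d) :
    (flip hσ v).1 κ = σ (v.1 (-κ)) := rfl

theorem flip_delta (hσ : IsInvol σ) (κ : Freq n d) : flip hσ (delta κ) = delta (-κ) := by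
  refine RS.ext fun κ' => ?_
  rw [flip_apply, delta_apply, delta_apply]
  by_cases h : κ' = -κ
  · simp [h]
  · have : ¬ -κ' = κ := fun h' => h (by rw [← h', neg_neg])
    simp [h, this]

/-- The symmetry `S J = s J S` of an operator, for `J` the involution `flip`. -/
def OpSym (hσ : IsInvol σ) (s : ℝ) (S : Module.End ℂ (RS (Freq n d))) : Prop :=
  ∀ v, S (flip hσ v) = (s : ℂ) • flip hσ (S v)

variable {hσ : IsInvol σ} {s s' : ℝ}

theorem flip_real_smul (c : ℝ) (v : RS (Freq n d)) :
    flip hσ ((c : ℂ) • v) = (c : ℂ) • flip hσ v := by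
  refine RS.ext fun κ => ?_
  simp [flip_apply, hσ.ofReal]

theorem OpSym.mul {S S' : Module.End ℂ (RS (Freq n d))} (h : OpSym hσ s S) (h' : OpSym hσ s' S') :
    OpSym hσ (s * s') (S * S') := fun v => by
  simp only [Module.End.mul_apply]
  rw [h' v, map_smul, h, smul_smul]
  push_cast
  rw [mul_comm]

theorem OpSym.add {S S' : Module.End ℂ (RS (Freq n d))} (h : OpSym hσ s S) (h' : OpSym hσ s S') :
    OpSym hσ s (S + S') := fun v => by
  refine RS.ext fun κ => ?_
  simp only [LinearMap.add_apply, h v, h' v, RS.add_apply, RS.smul_apply, flip_apply, map_add]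
  ring

theorem OpSym.real_smul {S : Module.End ℂ (RS (Freq n d))} (h : OpSym hσ s S) (c : ℝ) :
    OpSym hσ s ((c : ℂ) • S) := fun v => by
  rw [LinearMap.smul_apply, LinearMap.smul_apply, h v, flip_real_smul, smul_comm]

theorem OpSym.sub {S S' : Module.End ℂ (RS (Freq n d))} (h : OpSym hσ s S) (h' : OpSym hσ s S') :
    OpSym hσ s (S - S') := fun v => by
  refine RS.ext fun κ => ?_
  simp only [LinearMap.sub_apply, h v, h' v, RS.sub_apply, RS.smul_apply, flip_apply, map_sub]
  ring

theorem OpSym.hatSym_symb {S : Module.End ℂ (RS (Freq n d))} (h : OpSym hσ s S) :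
    HatSym σ s (symb S) := fun κ q => by
  have e : ((0, -q) : Freq n d) = -(0, q) := Prod.ext (by simp) rfl
  unfold symb
  rw [e, ← flip_delta hσ, h, RS.smul_apply, flip_apply]
  rw [neg_add, neg_neg, neg_neg]

theorem HatSym.opSym {a : Hat n d} (ht : Temp a) (ha : HatSym σ s a) : OpSym hσ s (hatOp a) :=
  fun v => RS.ext fun κ => by
    rw [RS.smul_apply, flip_apply, hatOp_apply ht, hatOp_apply ht, hσ.tsum, ← tsum_mul_left,
      ← (Equiv.neg _).tsum_eq]
    refine tsum_congr fun κ' => ?_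
    have e1 : κ - -κ' = -(-κ - κ') := by abel
    rw [Equiv.neg_apply, flip_apply, e1, Prod.snd_neg, ha, map_mul, neg_neg]
    ring

/-- The flow inherits the symmetries of its generator, by uniqueness. -/
theorem IsGen.flow_opSym {Γ : ParamGraph} {m : ℝ} {g : Γ.P → Hat n d}
    {U : Γ.P → ℝ → Module.End ℂ (RS (Freq n d))} (hg : IsGen Γ m g)
    (hU : ∀ p, IsMatFlow (hatMat (g p)) (U p)) (p : Γ.P) (hs : HatSym σ 1 (g p)) (t : ℝ) :
    OpSym hσ 1 (U p t) := fun v => by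
  rw [Complex.ofReal_one, one_smul]
  refine hg.unique p (w := fun t => U p t (flip hσ v)) (w' := fun t => flip hσ (U p t v))
    ((hU p).rapid _) (fun T L => ?_) (fun t κ => hg.deriv hU p t _ κ) (fun t κ => ?_) ?_ t
  · obtain ⟨C, hC⟩ := (hU p).rapid v T L
    exact ⟨C, fun t ht κ => by simpa [flip_apply, hσ.norm] using hC t ht (-κ)⟩
  · have h := hs.opSym (hσ := hσ) (hg.bd.temp p) (U p t v)
    rw [h, Complex.ofReal_one, one_smul, flip_apply]
    exact hσ.hasDerivAt (hg.deriv hU p t v (-κ))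
  · simp [(hU p).zero]

end symmetry

/-! ### The normal form step -/

section step
variable {n d : ℕ}

/-- The diagonal matrix with entries `l`. -/
def diagOp (l : Freq n d → ℂ) : Module.End ℂ (RS (Freq n d)) :=
  matOp fun κ κ' => if κ = κ' then l κ else 0

/-- Linear functions `λ_p(κ)` of the frequency, Lipschitz in the parameter, purely imaginary and
bounded below by a negative power of the frequency. -/
structure SmallDiv (Γ : ParamGraph) (lam : Γ.P → Freq n d → ℂ) : Prop where
  add : ∀ p κ κ', lam p (κ + κ') = lam p κ + lam p κ'
  bound : ∀ p, ∃ C : ℝ, ∀ κ, ‖lam p κ‖ ≤ C * jb κ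
  lip : ∃ C : ℝ, ∀ e κ, ‖lam (Γ.s e) κ - lam (Γ.t e) κ‖ ≤ C * Γ.len e * jb κ
  small : ∃ (C : ℝ) (N : ℕ), ∀ p κ, κ ≠ 0 → lam p κ ≠ 0 ∧ ‖(lam p κ)⁻¹‖ ≤ C * jb κ ^ N
  conj : ∀ p κ, (starRingEnd ℂ) (lam p κ) = -lam p κ

variable {Γ : ParamGraph} {lam : Γ.P → Freq n d → ℂ}

theorem diag_matTemp {l : Freq n d → ℂ} {C : ℝ} (h : ∀ κ, ‖l κ‖ ≤ C * jb κ) :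
    MatTemp fun κ κ' => if κ = κ' then l κ else 0 := fun L => by
  have hC : 0 ≤ C := by have := (norm_nonneg _).trans (h 0); simpa using this
  refine ⟨C, 1, hC, fun x y => ?_⟩
  dsimp only
  split_ifs with e
  · subst e; simpa using h x
  · simpa using mul_nonneg hC (jb_pos y).le

theorem diagOp_apply {l : Freq n d → ℂ} {C : ℝ} (h : ∀ κ, ‖l κ‖ ≤ C * jb κ) (v : RS (Freq n d))
    (κ : Freq n d) : (diagOp l v).1 κ = l κ * v.1 κ := by
  rw [diagOp, matOp_apply (diag_matTemp h), tsum_eq_single κ fun κ' h' => by simp [h'.symm]]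
  simp

theorem SmallDiv.diag_apply (h : SmallDiv Γ lam) (p : Γ.P) (v : RS (Freq n d)) (κ : Freq n d) :
    (diagOp (lam p) v).1 κ = lam p κ * v.1 κ := by
  obtain ⟨C, hC⟩ := h.bound p
  exact diagOp_apply hC v κ

theorem SmallDiv.zero (h : SmallDiv Γ lam) (p : Γ.P) : lam p 0 = 0 := by
  have := h.add p 0 0
  rw [add_zero] at this
  exact left_eq_add.1 this

theorem SmallDiv.neg (h : SmallDiv Γ lam) (p : Γ.P) (κ : Freq n d) : lam p (-κ) = -lam p κ := by
  have := h.add p κ (-κ)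
  rw [add_neg_cancel, h.zero] at this
  exact (neg_eq_of_add_eq_zero_right this.symm).symm

theorem SmallDiv.sub (h : SmallDiv Γ lam) (p : Γ.P) (κ κ' : Freq n d) :
    lam p (κ - κ') = lam p κ - lam p κ' := by
  rw [sub_eq_add_neg, h.add, h.neg, sub_eq_add_neg]

theorem SmallDiv.diag_shift (h : SmallDiv Γ lam) (p : Γ.P) (l : Fin n → ℤ) :
    diagOp (lam p) * shiftOp l = shiftOp l * diagOp (lam p) + lam p (l, 0) • shiftOp l := by
  refine LinearMap.ext fun v => RS.ext fun κ => ?_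
  simp only [Module.End.mul_apply, LinearMap.add_apply, LinearMap.smul_apply, RS.add_apply,
    RS.smul_apply, h.diag_apply, shiftOp_apply, h.sub]
  ring

/-- The commutator of `Op(g)` with the diagonal operator has the symbol `-lam g`, because `lam` is
additive. -/
theorem SmallDiv.comm_diag (h : SmallDiv Γ lam) (p : Γ.P) {g : Hat n d} (hg : Temp g) :
    hatOp g * diagOp (lam p) - diagOp (lam p) * hatOp g = hatOp fun κ q => -(lam p κ * g κ q) := by
  obtain ⟨C, hC⟩ := h.bound p
  have ht : Temp fun κ q => -(lam p κ * g κ q) :=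
    (hg.mul_freq (lam p) (C := C) (N := 1) (by simpa using hC)).neg
  refine (((hatOp_tame g).mul (matOp_tame _)).sub ((matOp_tame _).mul (hatOp_tame g))).ext
    (hatOp_tame _) fun x y => ?_
  have e : diagOp (lam p) (delta x) = lam p x • delta x := by
    refine RS.ext fun κ => ?_
    rw [h.diag_apply, RS.smul_apply]
    by_cases hx : κ = x
    · subst hx; rfl
    · rw [delta_ne hx]; simp
  have e' := h.diag_apply p (hatOp g (delta x)) y
  simp only [diagOp] at e e'
  simp only [LinearMap.sub_apply, Module.End.mul_apply, RS.sub_apply]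
  rw [e, e', map_smul, RS.smul_apply, hatOp_delta hg, hatOp_delta ht, h.sub]
  ring

/-- The inverse of `lam`, zero at the zero frequency. -/
def invFreq (l : Freq n d → ℂ) (κ : Freq n d) : ℂ := if κ = 0 then 0 else (l κ)⁻¹

/-- Division by small divisors costs powers of `κ` only, in which symbols decrease rapidly. -/
theorem SmallDiv.lip_inv_mul (h : SmallDiv Γ lam) {μ : ℝ} {w : Γ.P → Hat n d} (hw : LipBd Γ μ w) :
    LipBd Γ μ fun p κ q => invFreq (lam p) κ * w p κ q := by
  obtain ⟨C, N, hC⟩ := h.small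
  obtain ⟨D, hD⟩ := h.lip
  refine hw.mul_freq (fun p κ => invFreq (lam p) κ) (C := |C|) (C' := |C| * |C| * |D|)
    (N := N) (N' := N + N + 1) (fun p κ => ?_) fun e κ => ?_
  · unfold invFreq
    have hj := jb_pos κ
    split_ifs with h0
    · rw [norm_zero]; positivity
    · refine (hC p κ h0).2.trans ?_
      gcongr
      exact le_abs_self C
  · unfold invFreq
    have hj := jb_pos κ
    have hl := Γ.len_nonneg e
    split_ifs with h0
    · rw [sub_zero, norm_zero]; positivity
    · obtain ⟨n1, b1⟩ := hC (Γ.s e) κ h0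
      obtain ⟨n2, b2⟩ := hC (Γ.t e) κ h0
      have eq : (lam (Γ.s e) κ)⁻¹ - (lam (Γ.t e) κ)⁻¹
          = -((lam (Γ.s e) κ)⁻¹ * (lam (Γ.t e) κ)⁻¹ * (lam (Γ.s e) κ - lam (Γ.t e) κ)) := by
        field_simp
        ring
      rw [eq, norm_neg, norm_mul, norm_mul]
      have b1' := b1.trans (mul_le_mul_of_nonneg_right (le_abs_self C) (jb_pow_pos κ N).le)
      have b2' := b2.trans (mul_le_mul_of_nonneg_right (le_abs_self C) (jb_pow_pos κ N).le)
      have b3 : ‖lam (Γ.s e) κ - lam (Γ.t e) κ‖ ≤ |D| * Γ.len e * jb κ :=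
        (hD e κ).trans (by gcongr; exact le_abs_self D)
      calc _ ≤ (|C| * jb κ ^ N) * (|C| * jb κ ^ N) * (|D| * Γ.len e * jb κ) := by gcongr
        _ = _ := by rw [pow_succ, pow_add]; ring

theorem SmallDiv.conj_invFreq (h : SmallDiv Γ lam) (p : Γ.P) (κ : Freq n d) :
    (starRingEnd ℂ) (invFreq (lam p) (-κ)) = invFreq (lam p) κ := by
  unfold invFreq
  simp only [neg_eq_zero]
  split_ifs
  · simp
  · rw [map_inv₀, h.conj, h.neg, neg_neg]

theorem SmallDiv.sh_inv_mul (h : SmallDiv Γ lam) {w : Γ.P → Hat n d} (hw : SH Γ w) :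
    SH Γ fun p κ q => invFreq (lam p) κ * w p κ q := by
  refine SH.of_eq (h.lip_inv_mul hw) fun p κ q => ?_
  simp only [adj, map_mul, h.conj_invFreq]
  ring

/-- The operator `λ(κ) + ε Op(z + w)` on functions of `(φ, x)`. -/
def fullOp (l : Freq n d → ℂ) (ε : ℝ) (z w : Hat n d) : Module.End ℂ (RS (Freq n d)) :=
  diagOp l + (ε : ℂ) • (hatOp z + hatOp w)

/-- The parity of the unperturbed operator under the involution `σ`: `1` for the conjugation and
`-1` for the identity. -/
def HasParity (Γ : ParamGraph) (lam : Γ.P → Freq n d → ℂ) (σ : ℂ →+* ℂ) (s : ℝ) : Prop :=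
  (s = 1 ∨ s = -1) ∧ ∀ p κ, lam p (-κ) = s * σ (lam p κ)

theorem SmallDiv.opSym_diag (h : SmallDiv Γ lam) {σ : ℂ →+* ℂ} (hσ : IsInvol σ) {s : ℝ}
    (hs : HasParity Γ lam σ s) (p : Γ.P) : OpSym hσ s (diagOp (lam p)) := fun v => by
  refine RS.ext fun κ => ?_
  have := hs.2 p (-κ)
  rw [neg_neg] at this
  rw [RS.smul_apply, flip_apply, h.diag_apply, h.diag_apply, flip_apply, map_mul, this]
  ring

theorem hatSym_inv_mul {σ : ℂ →+* ℂ} {s : ℝ} (hs : HasParity Γ lam σ s) {p : Γ.P} {w : Hat n d}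
    (hw : HatSym σ s w) : HatSym σ 1 fun κ q => invFreq (lam p) κ * w κ q := fun κ q => by
  simp only [invFreq, neg_eq_zero]
  split_ifs
  · simp
  · rw [hw, hs.2, map_mul, map_inv₀]
    rcases hs.1 with rfl | rfl
    · simp
    · push_cast; rw [neg_one_mul, neg_one_mul, inv_neg, one_mul]; ring

/-- One step of the normal form procedure: the generator solves the homological equation
`[g, λ] = -(w - ⟨w⟩)`, and the new remainder gains `1 - μ₀` orders. -/
theorem exists_step (h : SmallDiv Γ lam) {ε : Γ.P → ℝ} {T : ℝ} (hε : ∀ p, 0 < ε p ∧ ε p ≤ T)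
    (hεe : ∀ e, ε (Γ.s e) = ε (Γ.t e)) {μ₀ μ : ℝ} (hμ₀ : μ₀ < 1) (hμ : μ ≤ μ₀)
    {z w : Γ.P → Hat n d} (hz : LipBd Γ μ₀ z) (hw : LipBd Γ μ w) (hzs : SH Γ z) (hws : SH Γ w)
    (hz0 : ∀ p κ q, κ ≠ 0 → z p κ q = 0) :
    ∃ (g : Γ.P → Hat n d) (U : Γ.P → ℝ → Module.End ℂ (RS (Freq n d))) (z' w' : Γ.P → Hat n d),
      IsGen Γ μ g ∧ (∀ p, IsMatFlow (hatMat (g p)) (U p)) ∧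
      LipBd Γ μ₀ z' ∧ LipBd Γ (μ + μ₀ - 1) w' ∧ SH Γ z' ∧ SH Γ w' ∧
      (∀ p κ q, κ ≠ 0 → z' p κ q = 0) ∧
      (∀ p, fullOp (lam p) (ε p) (z p) (w p) * U p (-ε p)
        = U p (-ε p) * fullOp (lam p) (ε p) (z' p) (w' p)) ∧
      ∀ (σ : ℂ →+* ℂ) (s : ℝ), IsInvol σ → HasParity Γ lam σ s → ∀ p,
        HatSym σ s (z p) → HatSym σ s (w p) → HatSym σ s (z' p) ∧ HatSym σ s (w' p) := by
  have hμ1 : μ < 1 := hμ.trans_lt hμ₀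
  have habs : ∀ p, |ε p| ≤ T := fun p => by rw [abs_of_pos (hε p).1]; exact (hε p).2
  set g : Γ.P → Hat n d := fun p κ q => invFreq (lam p) κ * w p κ q with hgdef
  have hgb : LipBd Γ μ g := h.lip_inv_mul hw
  have hg : IsGen Γ μ g := ⟨hgb, h.sh_inv_mul hws, hμ1.le⟩
  choose U hU using hg.exists_flow
  -- the commutator of the generator with the perturbation
  have hzw : LipBd Γ μ₀ fun p κ q => z p κ q + w p κ q := hz.add (hw.mono hμ)
  set c : Γ.P → Hat n d := fun p κ q => (ε p : ℂ) * comm (g p) (fun κ q => z p κ q + w p κ q) κ q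
    with hcdef
  have hc : LipBd Γ (μ + μ₀ - 1) c :=
    (hgb.comm hzw).scalar_mul (fun p => (ε p : ℂ)) (C := T) (by simpa using habs) (by simp [hεe])
  have hcs : SH Γ c := SH.scalar_mul (SH.comm (hgb.mono hμ1.le) (hzw.mono hμ₀.le) hg.sh
    (hzs.add hws)) ε habs hεe
  -- the derivative of the conjugated operator
  set y : Γ.P → Hat n d := fun p κ q => c p κ q - (w p κ q - avg (w p) κ q) with hydef
  have hwa : LipBd Γ μ fun p κ q => w p κ q - avg (w p) κ q := hw.sub hw.avg
  have hwas : SH Γ fun p κ q => w p κ q - avg (w p) κ q := by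
    refine SH.of_eq (LipBd.sub hws (SH.avg hws)) fun p κ q => ?_
    rw [adj_sub]; ring
  have hy : LipBd Γ μ y := (hc.mono (by linarith)).sub hwa
  have hys : SH Γ y := by
    refine SH.of_eq (LipBd.sub hcs hwas) fun p κ q => ?_
    simp only [hydef, adj, map_sub]; ring
  have hLt : ∀ p, Tame (fullOp (lam p) (ε p) (z p) (w p)) := fun p =>
    (matOp_tame _).add (((hatOp_tame _).add (hatOp_tame _)).smul _)
  -- `[g, 𝓛] = Op(y)` for the full operator `𝓛`: the homological equation replaces the commutator
  -- with the diagonal part by `-(w - ⟨w⟩)`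
  have hgL : ∀ p, hatOp (g p) * fullOp (lam p) (ε p) (z p) (w p)
      - fullOp (lam p) (ε p) (z p) (w p) * hatOp (g p) = hatOp (y p) := fun p => by
    have tg := hgb.temp p
    have t1 := hzw.temp p
    have e1 := h.comm_diag p tg
    have e2 := hatOp_comm tg t1
    rw [hatOp_add (hz.temp p) (hw.temp p)] at e2
    have e3 : hatOp (y p) = (ε p : ℂ) • hatOp (comm (g p) fun κ q => z p κ q + w p κ q)
        + hatOp fun κ q => -(lam p κ * g p κ q) := by
      rw [← hatOp_smul (tg.comm t1), ← hatOp_add ((tg.comm t1).const_mul _) ?_]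
      · congr 1
        funext κ q
        simp only [hydef, hcdef, hgdef, avg, invFreq]
        split_ifs with h0
        · simp
        · obtain ⟨C, N, hs⟩ := h.small
          rw [mul_inv_cancel_left₀ (hs p κ h0).1]; ring
      · obtain ⟨C, hC⟩ := h.bound p
        exact (tg.mul_freq (lam p) (C := C) (N := 1) (by simpa using hC)).neg
    rw [e3, ← e1, ← e2, fullOp]
    simp only [mul_add, add_mul, mul_smul_comm, smul_mul_assoc]
    module
  -- the remainder of the expansion to first order in `t` of `U_t 𝓛 U_{-t}`
  set X : Γ.P → ℝ → Module.End ℂ (RS (Freq n d)) := fun p t =>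
    U p t * fullOp (lam p) (ε p) (z p) (w p) * U p (-t) - fullOp (lam p) (ε p) (z p) (w p)
      - (t : ℂ) • hatOp (y p) with hX
  have hXt : ∀ p t, Tame (X p t) := fun p t =>
    ((hg.tame_conj hU p (hLt p) t).sub (hLt p)).sub ((hatOp_tame _).smul _)
  -- `𝓛` does not commute with the translations, but its commutator with a translation is a multiple
  -- of the translation, hence unchanged by the conjugation
  have hXs : ∀ p t, ShiftInv (X p t) := fun p t l => by
    have s1 := hg.flow_shiftInv hU p t l
    have s2 := hg.flow_shiftInv hU p (-t) l
    have s3 : fullOp (lam p) (ε p) (z p) (w p) * shiftOp l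
        = shiftOp l * fullOp (lam p) (ε p) (z p) (w p) + lam p (l, 0) • shiftOp l := by
      simp only [fullOp, add_mul, mul_add, smul_mul_assoc, mul_smul_comm, h.diag_shift,
        hatOp_shiftInv (hz.temp p) l, hatOp_shiftInv (hw.temp p) l, smul_add]
      abel
    have s4 := hatOp_shiftInv (hy.temp p) l
    have s5 : U p t * fullOp (lam p) (ε p) (z p) (w p) * U p (-t) * shiftOp l
        = shiftOp l * (U p t * fullOp (lam p) (ε p) (z p) (w p) * U p (-t))
          + lam p (l, 0) • shiftOp l := by
      rw [mul_assoc, s2, ← mul_assoc, mul_assoc (U p t), s3, mul_add, ← mul_assoc, s1, add_mul,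
        mul_smul_comm, s1, smul_mul_assoc, mul_assoc (shiftOp l) (U p t) (U p (-t)),
        hg.flow_mul_neg hU, mul_one]
      simp only [mul_assoc]
    have e : X p t = U p t * fullOp (lam p) (ε p) (z p) (w p) * U p (-t)
      - fullOp (lam p) (ε p) (z p) (w p) - (t : ℂ) • hatOp (y p) := rfl
    rw [e]
    refine LinearMap.ext fun v => ?_
    have a3 := LinearMap.congr_fun s3 v
    have a4 := LinearMap.congr_fun s4 v
    have a5 := LinearMap.congr_fun s5 v
    simp only [Module.End.mul_apply, LinearMap.add_apply, LinearMap.smul_apply] at a3 a4 a5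
    simp only [Module.End.mul_apply, LinearMap.sub_apply, LinearMap.smul_apply, map_sub, map_smul,
      a3, a4, a5]
    abel
  -- first and second derivatives in time
  have hχd : ∀ p t κ q, HasDerivAt (fun s => symb (X p s) κ q)
      (cj (U p) (y p) t κ q - y p κ q) t := fun p t κ q => by
    have h1 := hg.hasDerivAt_conj hU p (hLt p) t (delta (0, q)) (κ + (0, q))
    rw [hgL p] at h1
    have h2 := ((h1.sub_const ((fullOp (lam p) (ε p) (z p) (w p) (delta (0, q))).1
      (κ + (0, q)))).sub ((Complex.ofRealCLM.hasDerivAt (x := t)).mul_const (y p κ q)))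
    have e : ∀ s : ℝ, symb (X p s) κ q = ((U p s * fullOp (lam p) (ε p) (z p) (w p) * U p (-s))
        (delta (0, q))).1 (κ + (0, q)) - (fullOp (lam p) (ε p) (z p) (w p) (delta (0, q))).1
          (κ + (0, q)) - (s : ℂ) * y p κ q := fun s => by
      have := congrFun (congrFun (symb_hatOp (hy.temp p)) κ) q
      unfold symb at this
      simp only [symb, hX, LinearMap.sub_apply, RS.sub_apply, LinearMap.smul_apply, RS.smul_apply,
        this]
    simp only [e]
    exact h2.congr_deriv (by simp [cj, symb])
  have hη : LipBd (Γ.withTime T) (μ + μ₀ - 1) fun x κ q =>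
      cj (U x.1) (y x.1) x.2 κ q - y x.1 κ q := by
    refine LipBd.of_deriv (F := fun p t κ q => cj (U p) (y p) t κ q - y p κ q)
      (f := fun p t => cj (U p) (comm (g p) (y p)) t)
      (fun p t κ q => (hg.hasDerivAt_cj hU p (hy.temp p) t κ q).sub_const _)
      ((hg.egorov hU hμ1 T (hgb.comm hy)).mono (by linarith)) ?_
    have : LipBd Γ (μ + μ₀ - 1) fun p κ q => y p κ q - y p κ q := by
      have h0 := hc.sub hc
      simp only [sub_self] at h0 ⊢
      exact h0
    exact this.congr fun p κ q => by rw [IsGen.cj_zero hU p (hy.temp p)]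
  have hηs : SH (Γ.withTime T) fun x κ q => cj (U x.1) (y x.1) x.2 κ q - y x.1 κ q := by
    refine SH.of_eq (LipBd.sub (hg.egorov_sh hU hμ1 T (hy.mono hμ1.le) hys)
      (SH.withTime hys)) fun p κ q => ?_
    simp only [adj, map_sub]; ring
  have hX0 : ∀ p, symb (X p 0) = fun _ _ => 0 := fun p => by
    funext κ q
    simp [hX, (hU p).zero, symb]
  set θ : Γ.P → Set.Icc (-T) T := fun p => ⟨ε p, abs_le.1 (habs p)⟩ with hθ
  have hθe : ∀ e, θ (Γ.s e) = θ (Γ.t e) := fun e => Subtype.ext (hεe e)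
  -- at time `ε` the factor `ε⁻¹` is absorbed by the difference quotient in time
  set r : Γ.P → Hat n d := fun p κ q => ((ε p)⁻¹ : ℝ) * symb (X p (ε p)) κ q with hr
  have hrb : LipBd Γ (μ + μ₀ - 1) r := by
    have h1 := LipBd.slope (F := fun p t => symb (X p t)) hχd hη
    refine (h1.at_time θ hθe).congr fun p κ q => ?_
    simp only [hX0, sub_zero]
    rfl
  have hrs : SH Γ r := by
    have h1 := LipBd.slope (F := fun p t κ q => symb (X p t) κ q + adj (symb (X p t)) κ q)
      (fun p t κ q => (hχd p t κ q).add (hasDerivAt_adj (fun κ q => hχd p t κ q) κ q)) hηs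
    refine SH.of_eq (h1.at_time θ hθe) fun p κ q => ?_
    simp only [hX0, hr, hθ, adj, map_zero, map_mul, Complex.conj_ofReal]
    ring
  -- the average goes into the normal form, commutator and remainder into the perturbation
  refine ⟨g, U, fun p κ q => z p κ q + avg (w p) κ q, fun p κ q => c p κ q + r p κ q,
    hg, hU, hz.add (hw.avg.mono hμ), hc.add hrb, SH.add hzs (SH.avg hws), SH.add hcs hrs,
    fun p κ q hκ => by simp [hz0 p κ q hκ, avg, hκ], fun p => ?_, fun σ s hσ hs p hzp hwp => ?_⟩
  · have e1 : hatOp (symb (X p (ε p))) = X p (ε p) := ((hXt p _).eq_hatOp_symb (hXs p _)).symm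
    have hεne : (ε p : ℂ) ≠ 0 := by exact_mod_cast (hε p).1.ne'
    have tX := (hXt p (ε p)).temp_symb
    have e2 : (ε p : ℂ) • hatOp (r p) = X p (ε p) := by
      rw [← hatOp_smul (hrb.temp p), ← e1]
      congr 1
      funext κ q
      simp only [hr]
      push_cast
      rw [mul_inv_cancel_left₀ hεne]
    have e3 : fullOp (lam p) (ε p) (fun κ q => z p κ q + avg (w p) κ q)
        (fun κ q => c p κ q + r p κ q)
        = U p (ε p) * fullOp (lam p) (ε p) (z p) (w p) * U p (-ε p) := by
      have e4 : hatOp (y p) = hatOp (c p) - (hatOp (w p) - hatOp (avg (w p))) := by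
        rw [← hatOp_sub (hw.temp p) (hw.avg.temp p), ← hatOp_sub (hc.temp p) (hwa.temp p)]
      have e5 : U p (ε p) * fullOp (lam p) (ε p) (z p) (w p) * U p (-ε p)
          = X p (ε p) + fullOp (lam p) (ε p) (z p) (w p) + (ε p : ℂ) • hatOp (y p) := by
        simp only [hX]; abel
      rw [e5, ← e2, fullOp, fullOp, hatOp_add (hz.temp p) (hw.avg.temp p),
        hatOp_add (hc.temp p) (hrb.temp p), e4]
      module
    rw [e3, ← mul_assoc, ← mul_assoc, hg.flow_neg_mul hU, one_mul]
  · have sg : HatSym σ 1 (g p) := hatSym_inv_mul hs hwp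
    have sc : HatSym σ s (c p) := by
      have := (sg.comm hσ (hzp.add hwp)).real_mul hσ (ε p)
      rwa [one_mul] at this
    have sy : HatSym σ s (y p) := sc.sub (hwp.sub hwp.avg)
    refine ⟨hzp.add hwp.avg, sc.add (HatSym.real_mul hσ (OpSym.hatSym_symb (hσ := hσ) ?_) _)⟩
    have sL : OpSym hσ s (fullOp (lam p) (ε p) (z p) (w p)) :=
      (h.opSym_diag hσ hs p).add (((hzp.opSym (hz.temp p)).add (hwp.opSym (hw.temp p))).real_smul _)
    have sU := (((hg.flow_opSym hU p sg (ε p)).mul sL).mul (hg.flow_opSym hU p sg (-ε p)))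
    rw [one_mul, mul_one] at sU
    exact (sU.sub sL).sub ((sy.opSym (hy.temp p)).real_smul _)

/-- Iteration of the normal form steps. -/
theorem exists_normal_form (h : SmallDiv Γ lam) {ε : Γ.P → ℝ} {T : ℝ}
    (hε : ∀ p, 0 < ε p ∧ ε p ≤ T) (hεe : ∀ e, ε (Γ.s e) = ε (Γ.t e)) {e : ℝ} (he : 0 < e)
    {w₀ : Γ.P → Hat n d} (hw₀ : LipBd Γ (1 - e) w₀) (hws₀ : SH Γ w₀) :
    ∃ (g : ℕ → Γ.P → Hat n d) (U : ℕ → Γ.P → ℝ → Module.End ℂ (RS (Freq n d)))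
      (z w : ℕ → Γ.P → Hat n d),
      (∀ j : ℕ, IsGen Γ (1 - (j + 1 : ℝ) * e) (g j)) ∧
      (∀ j p, IsMatFlow (hatMat (g j p)) (U j p)) ∧
      (∀ j, LipBd Γ (1 - e) (z j)) ∧ (∀ j : ℕ, LipBd Γ (1 - (j + 1 : ℝ) * e) (w j)) ∧
      (∀ j p κ q, κ ≠ 0 → z j p κ q = 0) ∧
      (∀ j p, fullOp (lam p) (ε p) (fun _ _ => 0) (w₀ p)
          * (List.ofFn fun i : Fin j => U i p (-ε p)).prod
        = (List.ofFn fun i : Fin j => U i p (-ε p)).prod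
          * fullOp (lam p) (ε p) (z j p) (w j p)) ∧
      ∀ (σ : ℂ →+* ℂ) (s : ℝ), IsInvol σ → HasParity Γ lam σ s → ∀ p,
        HatSym σ s (w₀ p) → ∀ j, HatSym σ s (z j p) ∧ HatSym σ s (w j p) := by
  let Good : ℕ → (Γ.P → Hat n d) × (Γ.P → Hat n d) → Prop := fun j x =>
    LipBd Γ (1 - e) x.1 ∧ LipBd Γ (1 - (j + 1 : ℝ) * e) x.2 ∧ SH Γ x.1 ∧ SH Γ x.2 ∧
      ∀ p κ q, κ ≠ 0 → x.1 p κ q = 0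
  have step : ∀ (j : ℕ) (x : (Γ.P → Hat n d) × (Γ.P → Hat n d)), Good j x →
      ∃ (g : Γ.P → Hat n d) (U : Γ.P → ℝ → Module.End ℂ (RS (Freq n d)))
        (x' : (Γ.P → Hat n d) × (Γ.P → Hat n d)),
        Good (j + 1) x' ∧ IsGen Γ (1 - (j + 1 : ℝ) * e) g ∧
        (∀ p, IsMatFlow (hatMat (g p)) (U p)) ∧
        (∀ p, fullOp (lam p) (ε p) (x.1 p) (x.2 p) * U p (-ε p)
          = U p (-ε p) * fullOp (lam p) (ε p) (x'.1 p) (x'.2 p)) ∧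
        ∀ (σ : ℂ →+* ℂ) (s : ℝ), IsInvol σ → HasParity Γ lam σ s → ∀ p,
          HatSym σ s (x.1 p) → HatSym σ s (x.2 p) →
            HatSym σ s (x'.1 p) ∧ HatSym σ s (x'.2 p) := by
    rintro j ⟨z, w⟩ ⟨hz, hw, hzs, hws, hz0⟩
    obtain ⟨g, U, z', w', h1, h2, h3, h4, h5, h6, h7, h8, h9⟩ :=
      exists_step h hε hεe (μ₀ := 1 - e) (μ := 1 - (j + 1 : ℝ) * e) (by linarith)
        (by nlinarith [mul_nonneg (Nat.cast_nonneg (α := ℝ) j) he.le]) hz hw hzs hws hz0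
    refine ⟨g, U, (z', w'), ⟨h3, ?_, h5, h6, h7⟩, h1, h2, h8, h9⟩
    rwa [show 1 - ((j + 1 : ℕ) + 1 : ℝ) * e = 1 - (j + 1 : ℝ) * e + (1 - e) - 1 by
      push_cast; ring]
  choose! G V nxt hgood hgen hflow hconj hsym using step
  have hzero : LipBd Γ (1 - e) (fun _ _ _ => 0 : Γ.P → Hat n d) := by
    have := hw₀.sub hw₀
    simpa using this
  let st : ℕ → (Γ.P → Hat n d) × (Γ.P → Hat n d) := fun j =>
    Nat.rec (fun _ _ _ => 0, w₀) (fun j x => nxt j x) j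
  have hst : ∀ j, Good j (st j) := fun j => by
    induction j with
    | zero =>
      refine ⟨hzero, ?_, ?_, hws₀, fun _ _ _ _ => rfl⟩
      · change LipBd Γ (1 - ((0 : ℕ) + 1 : ℝ) * e) w₀
        simpa using hw₀
      exact SH.of_eq (LipBd.sub hws₀ hws₀) fun p κ q => by simp [adj, st]
    | succ j ih => exact hgood j _ ih
  refine ⟨fun j => G j (st j), fun j => V j (st j), fun j => (st j).1, fun j => (st j).2,
    fun j => hgen j _ (hst j), fun j => hflow j _ (hst j), fun j => (hst j).1,
    fun j => (hst j).2.1, fun j => (hst j).2.2.2.2, fun j p => ?_, fun σ s hσ hs p hwp j => ?_⟩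
  · induction j with
    | zero => simp [st]
    | succ j ih =>
      simp only [List.ofFn_succ', List.concat_eq_append, List.prod_append, List.prod_singleton,
        Fin.val_castSucc, Fin.val_last]
      rw [← mul_assoc, ih, mul_assoc, hconj j _ (hst j) p, ← mul_assoc]
  · induction j with
    | zero => exact ⟨fun κ q => by simp [st], hwp⟩
    | succ j ih => exact hsym j _ (hst j) σ s hσ hs p ih.1 ih.2

end step

/-! ### Fourier series of smooth functions on the torus -/

section fourier
variable {k : ℕ}

theorem character_norm (ξ : Fin k → ℤ) (x : Vec k) : ‖character ξ x‖ = 1 := by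
  rw [character, mul_comm, Complex.norm_exp_ofReal_mul_I]

theorem dot_add_left (x y z : Vec k) : dot (x + y) z = dot x z + dot y z := by
  simp [dot, add_mul, Finset.sum_add_distrib]

theorem dot_add_right (x y z : Vec k) : dot x (y + z) = dot x y + dot x z := by
  simp [dot, mul_add, Finset.sum_add_distrib]

theorem dot_smul_left (c : ℝ) (x y : Vec k) : dot (c • x) y = c * dot x y := by
  simp [dot, Finset.mul_sum, mul_assoc]

theorem intVec_add (ξ η : Fin k → ℤ) : intVec (ξ + η) = intVec ξ + intVec η := by
  funext i; simp [intVec]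

theorem intVec_neg (ξ : Fin k → ℤ) : intVec (-ξ) = -intVec ξ := by
  funext i; simp [intVec]

theorem intVec_single (j : Fin k) : intVec (Pi.single j 1 : Fin k → ℤ) = Pi.single j 1 := by
  funext i
  by_cases h : i = j
  · subst h; simp [intVec]
  · simp [intVec, h]

theorem dot_neg_right (x y : Vec k) : dot x (-y) = -dot x y := by simp [dot]
theorem dot_neg_left (x y : Vec k) : dot (-x) y = -dot x y := by simp [dot]

theorem character_add_freq (ξ η : Fin k → ℤ) (x : Vec k) :
    character (ξ + η) x = character ξ x * character η x := by
  rw [character, character, character, ← Complex.exp_add, intVec_add, dot_add_right]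
  push_cast; ring_nf

theorem character_add (ξ : Fin k → ℤ) (x y : Vec k) :
    character ξ (x + y) = character ξ x * character ξ y := by
  rw [character, character, character, ← Complex.exp_add, dot_add_left]
  push_cast; ring_nf

theorem character_conj (ξ : Fin k → ℤ) (x : Vec k) :
    (starRingEnd ℂ) (character ξ x) = character (-ξ) x := by
  rw [character, character, ← Complex.exp_conj, intVec_neg, dot_neg_right]
  simp

theorem character_neg_freq (ξ : Fin k → ℤ) (x : Vec k) : character (-ξ) x = character ξ (-x) := by
  rw [character, character, intVec_neg, dot_neg_right, dot_neg_left]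

@[simp] theorem character_zero_freq (x : Vec k) : character 0 x = 1 := by
  simp [character, dot, intVec]

@[simp] theorem character_zero (ξ : Fin k → ℤ) : character ξ 0 = 1 := by
  simp [character, dot]

theorem character_periodic (ξ : Fin k → ℤ) : IsPeriodic (character ξ) := fun x l => by
  rw [character_add]
  have : character ξ ((2 * Real.pi) • intVec l) = 1 := by
    rw [character, dot_smul_left]
    have e : dot (intVec l) (intVec ξ) = ((∑ i, l i * ξ i : ℤ) : ℝ) := by
      simp [dot, intVec]
    rw [e, Complex.exp_eq_one_iff]
    exact ⟨∑ i, l i * ξ i, by push_cast; ring⟩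
  rw [this, mul_one]

/-- The scalar product with a fixed vector as a continuous linear form. -/
def dotCLM (y : Vec k) : Vec k →L[ℝ] ℝ := ∑ i, y i • ContinuousLinearMap.proj i

theorem dotCLM_apply (y x : Vec k) : dotCLM y x = dot x y := by
  simp [dotCLM, dot, mul_comm]

theorem hasFDerivAt_character (ξ : Fin k → ℤ) (x : Vec k) :
    HasFDerivAt (character ξ)
      ((dotCLM (intVec ξ)).smulRight (Complex.I * character ξ x)) x := by
  have h1 : HasFDerivAt (fun x : Vec k => (dot x (intVec ξ) : ℂ))
      (Complex.ofRealCLM.comp (dotCLM (intVec ξ))) x := by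
    have := (Complex.ofRealCLM.comp (dotCLM (intVec ξ))).hasFDerivAt (x := x)
    refine this.congr_of_eventuallyEq (Filter.Eventually.of_forall fun y => ?_)
    simp [dotCLM_apply]
  have h2 := (h1.const_mul Complex.I).cexp
  refine h2.congr_fderiv ?_
  ext y
  simp [character, smul_eq_mul]
  ring

theorem contDiff_character (ξ : Fin k → ℤ) : ContDiff ℝ ∞ (character ξ) := by
  have : character ξ = fun x => Complex.exp (Complex.I * (Complex.ofRealCLM (dotCLM (intVec ξ) x))) :=
    funext fun x => by simp [character, dotCLM_apply]
  rw [this]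
  exact Complex.contDiff_exp.comp (contDiff_const.mul
    (Complex.ofRealCLM.contDiff.comp (dotCLM (intVec ξ)).contDiff))

/-- The character as an element of `C^∞(𝕋^k)`. -/
def charS (ξ : Fin k → ℤ) : Smooth k := ⟨character ξ, contDiff_character ξ, character_periodic ξ⟩

/-- The product of smooth functions on the torus. -/
def mulS (u v : Smooth k) : Smooth k :=
  ⟨fun x => u.1 x * v.1 x, u.2.1.mul v.2.1, fun x l => by
    dsimp only
    rw [u.2.2, v.2.2]⟩

theorem Smooth.differentiableAt (u : Smooth k) (x : Vec k) : DifferentiableAt ℝ u.1 x :=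
  u.2.1.differentiable (by simp) x

theorem Smooth.integrableOn (u : Smooth k) : MeasureTheory.IntegrableOn u.1 (cell k) :=
  u.2.1.continuous.continuousOn.integrableOn_compact isCompact_Icc

theorem partialD_apply (j : Fin k) (u : Smooth k) (x : Vec k) :
    (partialD j u).1 x = fderiv ℝ u.1 x (Pi.single j 1) := rfl

/-- The integral of a derivative over the torus vanishes. -/
theorem integral_partialD (j : Fin k) (u : Smooth k) : ∫ x in cell k, (partialD j u).1 x = 0 := by
  cases k with
  | zero => exact j.elim0
  | succ k =>
    -- the boundary terms on opposite faces cancel by periodicity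
    have h := MeasureTheory.integral_divergence_of_hasFDerivAt_off_countable'
      (0 : Vec (k + 1)) (fun _ => 2 * Real.pi) (fun i => by simpa using Real.pi_pos.le)
      (fun i => if i = j then u.1 else fun _ => 0) (fun i x => if i = j then fderiv ℝ u.1 x else 0)
      ∅ Set.countable_empty (fun i => ?_) (fun x _ i => ?_) ?_
    · have e : ∀ x : Vec (k + 1), ∑ i, (if i = j then fderiv ℝ u.1 x else 0) (Pi.single i 1)
          = (partialD j u).1 x := fun x => by
        rw [Finset.sum_eq_single j (fun i _ hi => by simp [hi]) (by simp)]
        simp [partialD_apply]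
      simp only [e] at h
      rw [cell, h]
      refine Finset.sum_eq_zero fun i _ => ?_
      by_cases hi : i = j
      · subst hi
        have e2 : ∀ x : Vec k, u.1 (i.insertNth (2 * Real.pi) x) = u.1 (i.insertNth 0 x) := fun x => by
          rw [← u.2.2 (i.insertNth 0 x) (Pi.single i 1)]
          refine congrArg u.1 (funext fun m => ?_)
          rcases eq_or_ne m i with rfl | hm
          · simp [intVec]
          · obtain ⟨m', rfl⟩ := Fin.exists_succAbove_eq hm
            simp [intVec, Fin.succAbove_ne]
        simp [e2]
      · simp [hi]
    · split_ifs
      · exact u.2.1.continuous.continuousOn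
      · exact continuousOn_const
    · split_ifs
      · exact (Smooth.differentiableAt u x).hasFDerivAt
      · exact hasFDerivAt_const _ _
    · have : ∀ x : Vec (k + 1), ∑ i, (if i = j then fderiv ℝ u.1 x else 0) (Pi.single i 1)
          = (partialD j u).1 x := fun x => by
        rw [Finset.sum_eq_single j (fun i _ hi => by simp [hi]) (by simp)]
        simp [partialD_apply]
      simp only [this]
      exact Smooth.integrableOn (partialD j u)

theorem partialD_charS (j : Fin k) (ξ : Fin k → ℤ) :
    partialD j (charS ξ) = (Complex.I * (ξ j : ℂ)) • charS ξ := by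
  refine Subtype.ext (funext fun x => ?_)
  rw [partialD_apply]
  change fderiv ℝ (character ξ) x _ = _ * character ξ x
  rw [(hasFDerivAt_character ξ x).fderiv]
  simp [dotCLM_apply, dot, intVec, Pi.single_apply]
  ring

theorem partialD_mulS (j : Fin k) (u v : Smooth k) :
    partialD j (mulS u v) = mulS (partialD j u) v + mulS u (partialD j v) := by
  refine Subtype.ext (funext fun x => ?_)
  change fderiv ℝ (fun x => u.1 x * v.1 x) x _ = fderiv ℝ u.1 x _ * v.1 x + u.1 x * fderiv ℝ v.1 x _
  rw [fderiv_fun_mul (Smooth.differentiableAt u x) (Smooth.differentiableAt v x)]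
  simp [smul_eq_mul]
  ring

theorem fourierCoeff_eq (u : Smooth k) (ξ : Fin k → ℤ) :
    fourierCoeff u ξ = (((2 * Real.pi) ^ k)⁻¹ : ℝ) * ∫ x in cell k, (mulS u (charS (-ξ))).1 x := by
  simp only [fourierCoeff, character_conj]
  rfl

theorem fourierCoeff_add (u v : Smooth k) (ξ : Fin k → ℤ) :
    fourierCoeff (u + v) ξ = fourierCoeff u ξ + fourierCoeff v ξ := by
  rw [fourierCoeff_eq, fourierCoeff_eq, fourierCoeff_eq, ← mul_add,
    ← MeasureTheory.integral_add (Smooth.integrableOn _) (Smooth.integrableOn _)]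
  congr 2
  funext x
  exact add_mul _ _ _

theorem fourierCoeff_smul (c : ℂ) (u : Smooth k) (ξ : Fin k → ℤ) :
    fourierCoeff (c • u) ξ = c * fourierCoeff u ξ := by
  have h : ∫ x in cell k, (mulS (c • u) (charS (-ξ))).1 x
      = c * ∫ x in cell k, (mulS u (charS (-ξ))).1 x := by
    rw [← MeasureTheory.integral_const_mul]
    exact MeasureTheory.integral_congr_ae (Filter.Eventually.of_forall fun x => mul_assoc _ _ _)
  rw [fourierCoeff_eq, fourierCoeff_eq, h, mul_left_comm]

theorem fourierCoeff_partialD (j : Fin k) (u : Smooth k) (ξ : Fin k → ℤ) :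
    fourierCoeff (partialD j u) ξ = Complex.I * ξ j * fourierCoeff u ξ := by
  have h := integral_partialD j (mulS u (charS (-ξ)))
  rw [partialD_mulS, partialD_charS] at h
  have e : ∀ x, (mulS (partialD j u) (charS (-ξ)) + mulS u ((Complex.I * ((-ξ) j : ℤ)) • charS (-ξ))).1 x
      = (mulS (partialD j u) (charS (-ξ))).1 x
        - Complex.I * ξ j * (mulS u (charS (-ξ))).1 x := fun x => by
    change _ + u.1 x * (Complex.I * ((-ξ) j : ℤ) * (charS (-ξ)).1 x) = _
    simp only [Pi.neg_apply, Int.cast_neg, mulS]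
    ring
  simp only [e] at h
  rw [MeasureTheory.integral_sub (Smooth.integrableOn _)
    ((Smooth.integrableOn _).const_mul _), MeasureTheory.integral_const_mul, sub_eq_zero] at h
  rw [fourierCoeff_eq, fourierCoeff_eq, h]
  ring

theorem volume_cell : MeasureTheory.volume.real (cell k) = (2 * Real.pi) ^ k := by
  rw [MeasureTheory.measureReal_def, cell, Real.volume_Icc_pi_toReal]
  · simp
  · intro i; simpa using Real.pi_pos.le

theorem norm_fourierCoeff_le {u : Smooth k} {B : ℝ} (h : ∀ x, ‖u.1 x‖ ≤ B) (ξ : Fin k → ℤ) :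
    ‖fourierCoeff u ξ‖ ≤ B := by
  have hp : (0 : ℝ) < (2 * Real.pi) ^ k := by have := Real.pi_pos; positivity
  rw [fourierCoeff, norm_mul, Complex.norm_real, Real.norm_of_nonneg (by positivity),
    inv_mul_le_iff₀ hp, mul_comm, ← volume_cell]
  refine MeasureTheory.norm_setIntegral_le_of_norm_le_const ?_ fun x _ => ?_
  · exact isCompact_Icc.measure_lt_top
  · rw [norm_mul, RCLike.norm_conj, character_norm, mul_one]
    exact h x

/-- Decay of the Fourier coefficients in terms of derivatives along the coordinate directions. -/
theorem fourierCoeff_decay (L : ℕ) {u : Smooth k} {B : ℝ} (h0 : ∀ x, ‖u.1 x‖ ≤ B)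
    (h : ∀ j x, ‖((partialD j ^ L) u).1 x‖ ≤ B) (ξ : Fin k → ℤ) :
    jb ξ ^ L * ‖fourierCoeff u ξ‖ ≤ 2 ^ L * B := by
  have hB : 0 ≤ B := (norm_nonneg _).trans (h0 0)
  by_cases hξ : ξ = 0
  · subst hξ
    rw [jb_zero, one_pow, one_mul]
    refine (norm_fourierCoeff_le h0 0).trans ?_
    exact le_mul_of_one_le_left hB (one_le_pow₀ one_le_two)
  · obtain ⟨j, hj⟩ : ∃ j, ‖ξ j‖ = ‖ξ‖ := by
      have : Nonempty (Fin k) := by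
        by_contra hne
        rw [not_nonempty_iff] at hne
        exact hξ (Subsingleton.elim _ _)
      obtain ⟨j, hj⟩ := Finite.exists_max fun j => ‖ξ j‖
      exact ⟨j, le_antisymm (norm_le_pi_norm ξ j)
        ((pi_norm_le_iff_of_nonneg (norm_nonneg _)).2 hj)⟩
    have hit : ∀ L : ℕ, fourierCoeff ((partialD j ^ L) u) ξ
        = (Complex.I * ξ j) ^ L * fourierCoeff u ξ := fun L => by
      induction L with
      | zero => simp
      | succ L ih => rw [pow_succ', Module.End.mul_apply, fourierCoeff_partialD, ih]; ring
    have h1 := norm_fourierCoeff_le (h j) ξ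
    rw [hit, norm_mul, norm_pow, norm_mul, Complex.norm_I, one_mul] at h1
    have h2 : ‖((ξ j : ℤ) : ℂ)‖ = ‖ξ‖ := by rw [← hj, Complex.norm_intCast, Int.norm_eq_abs]
    rw [h2] at h1
    have h3 : 1 ≤ ‖ξ‖ := by
      rw [← hj, Int.norm_eq_abs]
      have : ξ j ≠ 0 := fun h0 => hξ (norm_eq_zero.1 (by rw [← hj, h0, norm_zero]))
      exact_mod_cast Int.one_le_abs this
    have h4 : jb ξ ^ L ≤ 2 ^ L * ‖ξ‖ ^ L := by
      rw [← mul_pow]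
      refine pow_le_pow_left₀ (jb_pos ξ).le ?_ L
      unfold jb; linarith
    calc jb ξ ^ L * ‖fourierCoeff u ξ‖ ≤ (2 ^ L * ‖ξ‖ ^ L) * ‖fourierCoeff u ξ‖ := by gcongr
      _ = 2 ^ L * (‖ξ‖ ^ L * ‖fourierCoeff u ξ‖) := by ring
      _ ≤ _ := by gcongr

/-- A point of the cell equivalent to a given point. -/
theorem exists_mem_cell (x : Vec k) : ∃ l : Fin k → ℤ, x + (2 * Real.pi) • intVec l ∈ cell k := by
  have hp : 0 < 2 * Real.pi := by have := Real.pi_pos; positivity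
  refine ⟨fun i => -⌊x i / (2 * Real.pi)⌋, fun i => ?_, fun i => ?_⟩
  · have := Int.floor_le (x i / (2 * Real.pi))
    rw [le_div_iff₀ hp] at this
    simp only [intVec, Pi.add_apply, Pi.smul_apply, smul_eq_mul, Pi.zero_apply]
    push_cast; linarith
  · have := Int.lt_floor_add_one (x i / (2 * Real.pi))
    rw [div_lt_iff₀ hp] at this
    simp only [intVec, Pi.add_apply, Pi.smul_apply, smul_eq_mul]
    push_cast; linarith

theorem Smooth.bounded (u : Smooth k) : ∃ B, ∀ x, ‖u.1 x‖ ≤ B := by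
  obtain ⟨B, hB⟩ := isCompact_Icc.exists_bound_of_continuousOn
    (f := u.1) (s := cell k) u.2.1.continuous.continuousOn
  refine ⟨B, fun x => ?_⟩
  obtain ⟨l, hl⟩ := exists_mem_cell x
  rw [← u.2.2 x l]
  exact hB _ hl

/-- The sequence of Fourier coefficients. -/
def four : Smooth k →ₗ[ℂ] RS (Fin k → ℤ) where
  toFun u := ⟨fourierCoeff u, fun L => by
    obtain ⟨B, hB⟩ := Smooth.bounded u
    choose B' hB' using fun j => Smooth.bounded ((partialD j ^ L) u)
    have hB0 : 0 ≤ B := (norm_nonneg _).trans (hB 0)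
    have hB0' : ∀ j, 0 ≤ B' j := fun j => (norm_nonneg _).trans (hB' j 0)
    refine ⟨_, fourierCoeff_decay L (B := B + ∑ j, B' j) (fun x => (hB x).trans ?_)
      fun j x => (hB' j x).trans ?_⟩
    · exact le_add_of_nonneg_right (Finset.sum_nonneg fun j _ => hB0' j)
    · have := Finset.single_le_sum (fun j _ => hB0' j) (Finset.mem_univ j)
      linarith⟩
  map_add' u v := RS.ext fun ξ => fourierCoeff_add u v ξ
  map_smul' c u := RS.ext fun ξ => fourierCoeff_smul c u ξ

theorem four_apply (u : Smooth k) (ξ : Fin k → ℤ) : (four u).1 ξ = fourierCoeff u ξ := rfl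

theorem integral_character (ξ : Fin k → ℤ) :
    ∫ x in cell k, character ξ x = if ξ = 0 then (((2 * Real.pi) ^ k : ℝ) : ℂ) else 0 := by
  split_ifs with h
  · subst h
    simp [volume_cell]
  · obtain ⟨j, hj⟩ := Function.ne_iff.1 h
    have h1 := integral_partialD j (charS ξ)
    rw [partialD_charS] at h1
    change ∫ x in cell k, Complex.I * (ξ j : ℂ) * character ξ x = 0 at h1
    rw [MeasureTheory.integral_const_mul] at h1
    have hne : Complex.I * (ξ j : ℂ) ≠ 0 :=
      mul_ne_zero Complex.I_ne_zero (by exact_mod_cast hj)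
    exact (mul_eq_zero.1 h1).resolve_left hne

/-- Termwise integration of absolutely convergent trigonometric series against a bounded
continuous function. -/
theorem integral_tsum_mul {X : Type*} [Countable X] {c : X → ℂ} (hc : Summable fun x => ‖c x‖)
    (f : X → Vec k → ℂ) (hf : ∀ x, Continuous (f x)) {B : ℝ} (hB : ∀ x y, ‖f x y‖ ≤ B) :
    HasSum (fun x => c x * ∫ y in cell k, f x y) (∫ y in cell k, ∑' x, c x * f x y) := by
  have hint : ∀ x, MeasureTheory.IntegrableOn (fun y => c x * f x y) (cell k) := fun x =>
    ((continuous_const.mul (hf x)).continuousOn.integrableOn_compact isCompact_Icc)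
  have h := MeasureTheory.hasSum_integral_of_summable_integral_norm
    (μ := MeasureTheory.volume.restrict (cell k)) (F := fun x y => c x * f x y) hint ?_
  · simpa only [MeasureTheory.integral_const_mul] using h
  · refine Summable.of_nonneg_of_le (fun x => by positivity) (fun x => ?_)
      (hc.mul_right (B * (2 * Real.pi) ^ k))
    have : ∫ y in cell k, ‖c x * f x y‖ ≤ ∫ y in cell k, ‖c x‖ * B := by
      refine MeasureTheory.integral_mono (hint x).norm
        (continuous_const.continuousOn.integrableOn_compact isCompact_Icc) fun y => ?_
      simp only [norm_mul]
      exact mul_le_mul_of_nonneg_left (hB x y) (norm_nonneg _)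
    refine this.trans (le_of_eq ?_)
    rw [MeasureTheory.integral_const, MeasureTheory.measureReal_restrict_apply_univ, volume_cell]
    simp; ring

/-- The coefficients of an absolutely convergent Fourier series. -/
theorem coeff_of_series {c : (Fin k → ℤ) → ℂ} (hc : Summable fun x => ‖c x‖) (η : Fin k → ℤ) :
    (((2 * Real.pi) ^ k)⁻¹ : ℝ) * ∫ x in cell k, (∑' ξ, c ξ * character ξ x)
      * (starRingEnd ℂ) (character η x) = c η := by
  have h := integral_tsum_mul hc (fun ξ x => character (ξ - η) x)
    (fun ξ => (contDiff_character _).continuous) (B := 1) fun ξ x => (character_norm _ x).le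
  have e : ∀ x, (∑' ξ, c ξ * character ξ x) * (starRingEnd ℂ) (character η x)
      = ∑' ξ, c ξ * character (ξ - η) x := fun x => by
    rw [← tsum_mul_right]
    refine tsum_congr fun ξ => ?_
    rw [character_conj, sub_eq_add_neg, character_add_freq, mul_assoc]
  simp only [e]
  rw [← h.tsum_eq, tsum_eq_single η fun ξ hξ => by
    rw [integral_character, if_neg (sub_ne_zero.2 hξ), mul_zero]]
  have hp : (2 * Real.pi) ^ k ≠ 0 := by have := Real.pi_pos; positivity
  rw [integral_character, if_pos (sub_self η)]
  rw [mul_left_comm, ← Complex.ofReal_mul, inv_mul_cancel₀ hp]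
  simp

theorem series_unique {c c' : (Fin k → ℤ) → ℂ} (hc : Summable fun x => ‖c x‖)
    (hc' : Summable fun x => ‖c' x‖)
    (h : ∀ x, ∑' ξ, c ξ * character ξ x = ∑' ξ, c' ξ * character ξ x) : c = c' := by
  funext η
  rw [← coeff_of_series hc η, ← coeff_of_series hc' η]
  simp only [h]

open scoped Pointwise in
/-- Fourier inversion on `𝕋^k`. -/
theorem hasSum_fourier (u : Smooth k) (x : Vec k) :
    HasSum (fun ξ => fourierCoeff u ξ * character ξ x) (u.1 x) := by
  have hp : (0 : ℝ) < 2 * Real.pi := by have := Real.pi_pos; positivity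
  -- the function on the unit torus
  set rep : UnitAddCircle → ℝ := Quotient.out with hrep
  have hrepr : ∀ y : ℝ, ∃ m : ℤ, rep (y : UnitAddCircle) = y + m := fun y => by
    have h1 : ((rep (y : UnitAddCircle) : ℝ) : UnitAddCircle) = y := Quotient.out_eq _
    have h2 : ((rep (y : UnitAddCircle) - y : ℝ) : UnitAddCircle) = 0 := by
      rw [AddCircle.coe_sub, h1, sub_self]
    obtain ⟨m, hm⟩ := (AddCircle.coe_eq_zero_iff (1 : ℝ)).1 h2
    refine ⟨m, ?_⟩
    simp only [zsmul_eq_mul, mul_one] at hm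
    rw [hm]; ring
  set f₀ : UnitAddTorus (Fin k) → ℂ := fun y => u.1 ((2 * Real.pi) • fun i => rep (y i)) with hf₀
  have hf₀q : ∀ y : Vec k, f₀ (fun i => (y i : UnitAddCircle)) = u.1 ((2 * Real.pi) • y) := fun y => by
    choose m hm using fun i => hrepr (y i)
    rw [← u.2.2 ((2 * Real.pi) • y) m, ← smul_add]
    exact congrArg (fun z => u.1 ((2 * Real.pi) • z)) (funext fun i => hm i)
  have hcont : Continuous f₀ := by
    have hq : IsOpenQuotientMap (Pi.map fun (_ : Fin k) (y : ℝ) => (y : UnitAddCircle)) :=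
      IsOpenQuotientMap.piMap fun _ => QuotientAddGroup.isOpenQuotientMap_mk
    refine hq.continuous_comp_iff.1 ?_
    have : f₀ ∘ (Pi.map fun (_ : Fin k) (y : ℝ) => (y : UnitAddCircle))
        = fun y => u.1 ((2 * Real.pi) • y) := funext fun y => hf₀q y
    rw [this]
    exact u.2.1.continuous.comp (continuous_const_smul _)
  have hmono : ∀ (n : Fin k → ℤ) (y : Vec k), UnitAddTorus.mFourier n (fun i => (y i : UnitAddCircle))
      = character n ((2 * Real.pi) • y) := fun n y => by
    change ∏ i, fourier (n i) (y i : UnitAddCircle) = _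
    simp only [fourier_coe_apply]
    rw [← Complex.exp_sum, character]
    congr 1
    simp only [dot, intVec, Pi.smul_apply, smul_eq_mul]
    push_cast
    rw [Finset.mul_sum]
    exact Finset.sum_congr rfl fun i _ => by ring
  -- the coefficients agree after rescaling the cell
  have hcoef : ∀ n, UnitAddTorus.mFourierCoeff f₀ n = fourierCoeff u n := fun n => by
    rw [UnitAddTorus.mFourierCoeff_eq_integral f₀ n 0]
    have hset : {x : Vec k | ∀ i, x i ∈ Set.Ioc ((0 : Vec k) i) ((0 : Vec k) i + 1)}
        = Set.univ.pi fun i => Set.Ioc ((0 : Vec k) i) ((fun _ => 1 : Vec k) i) := by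
      ext y; simp
    have hint : ∀ y : Vec k, (UnitAddTorus.mFourier (-n) fun i => (y i : UnitAddCircle))
        • f₀ (fun i => (y i : UnitAddCircle))
        = (fun z => u.1 z * (starRingEnd ℂ) (character n z)) ((2 * Real.pi) • y) := fun y => by
      rw [hmono, hf₀q, smul_eq_mul, mul_comm, ← character_conj]
    have hcell : (2 * Real.pi) • Set.Icc (0 : Vec k) (fun _ => 1) = cell k := by
      ext y
      rw [Set.mem_smul_set_iff_inv_smul_mem₀ hp.ne', cell]
      simp only [Set.mem_Icc, Pi.le_def, Pi.smul_apply, smul_eq_mul, Pi.zero_apply]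
      refine and_congr (forall_congr' fun i => ?_) (forall_congr' fun i => ?_)
      · rw [mul_nonneg_iff_of_pos_left (inv_pos.2 hp)]
      · rw [inv_mul_le_iff₀ hp, mul_one]
    have hae : (Set.univ.pi fun i => Set.Ioc ((0 : Vec k) i) ((fun _ => 1 : Vec k) i))
        =ᵐ[MeasureTheory.volume] Set.Icc (0 : Vec k) (fun _ => 1) :=
      MeasureTheory.Measure.univ_pi_Ioc_ae_eq_Icc
    rw [MeasureTheory.integral_congr_ae (Filter.Eventually.of_forall hint), hset,
      MeasureTheory.setIntegral_congr_set hae,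
      MeasureTheory.Measure.setIntegral_comp_smul_of_pos (E := Vec k) MeasureTheory.volume
        (fun z => u.1 z * (starRingEnd ℂ) (character n z)) _ hp, hcell, fourierCoeff]
    rw [Complex.real_smul, Module.finrank_fin_fun]
  have hsum : Summable (UnitAddTorus.mFourierCoeff (⟨f₀, hcont⟩ : C(UnitAddTorus (Fin k), ℂ))) := by
    change Summable (UnitAddTorus.mFourierCoeff f₀)
    rw [show UnitAddTorus.mFourierCoeff f₀ = fun n => fourierCoeff u n from funext hcoef]
    obtain ⟨C, _, hC⟩ := RS.decay (four u) (decayExp (Fin k → ℤ))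
    exact summable_of_decay hC
  have h := UnitAddTorus.hasSum_mFourier_series_apply_of_summable hsum
    (fun i => ((((2 * Real.pi)⁻¹ • x) i : ℝ) : UnitAddCircle))
  simp only [ContinuousMap.coe_mk, hmono, hf₀q, hcoef, smul_inv_smul₀ hp.ne', smul_eq_mul] at h
  exact h

end fourier

/-! ### Rapidly convergent series of exponentials -/

section waves
open ContinuousLinearMap

/-- A family of functions of modulus one on `Y`, indexed by `X`, that are eigenfunctions of the
derivatives along finitely many coordinates, with eigenvalues of at most linear growth. -/
structure Waves (X Y J : Type) [NormedAddCommGroup X] [NormedAddCommGroup Y]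
    [NormedSpace ℝ Y] [Fintype J] where
  /-- the functions -/
  fn : X → Y → ℂ
  /-- the eigenvalues, up to a factor `i` -/
  freq : J → X → ℝ
  /-- the coordinates -/
  dir : J → Y →L[ℝ] ℝ
  norm_fn : ∀ x y, ‖fn x y‖ = 1
  freq_le : ∀ j x, |freq j x| ≤ jb x
  hasFDerivAt : ∀ x y,
    HasFDerivAt (fn x) (∑ j, (dir j).smulRight (Complex.I * freq j x * fn x y)) y

variable {X Y J : Type} [NormedAddCommGroup X] [NormedAddCommGroup Y]
    [NormedSpace ℝ Y] [Fintype J] (Ws : Waves X Y J)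

/-- The sum of a series of exponentials. -/
def Waves.sum (v : X → ℂ) (y : Y) : ℂ := ∑' x, v x * Ws.fn x y

variable {E ι : Type} [NormedAddCommGroup E] [Fintype ι]

/-- Rapid decrease of the coefficients, locally uniform in a parameter. -/
def LocDecay (c : E → X → ℂ) : Prop :=
  ∀ (R : ℝ) (L : ℕ), ∃ C : ℝ, ∀ p, ‖p‖ < R → ∀ x, jb x ^ L * ‖c p x‖ ≤ C

theorem LocDecay.mul_freq {c : E → X → ℂ} (hc : LocDecay c) {f : X → ℂ} {K : ℝ}
    (hf : ∀ x, ‖f x‖ ≤ K * jb x) : LocDecay fun p x => f x * c p x := fun R L => by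
  obtain ⟨C, hC⟩ := hc R (L + 1)
  have hK : 0 ≤ K := by
    have := (norm_nonneg _).trans (hf 0)
    simpa using this
  refine ⟨K * C, fun p hp x => ?_⟩
  have hj := jb_pos x
  calc jb x ^ L * ‖f x * c p x‖ ≤ jb x ^ L * (K * jb x * ‖c p x‖) := by
        rw [norm_mul]; gcongr; exact hf x
    _ = K * (jb x ^ (L + 1) * ‖c p x‖) := by ring
    _ ≤ K * C := by gcongr; exact hC p hp x

theorem Waves.sum_delta (x : X) (y : Y) : Ws.sum (delta x).1 y = Ws.fn x y := by
  rw [Waves.sum, tsum_eq_single x fun x' h => by rw [delta_ne h, zero_mul]]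
  simp

variable [PolySummable X]

theorem Waves.summable {v : X → ℂ} {C : ℝ} (h : ∀ x, jb x ^ decayExp X * ‖v x‖ ≤ C) (y : Y) :
    Summable fun x => v x * Ws.fn x y :=
  summable_of_decay (C := C) fun x => by rw [norm_mul, Ws.norm_fn, mul_one]; exact h x

theorem Waves.norm_sum_le {v : X → ℂ} {C : ℝ} (h : ∀ x, jb x ^ decayExp X * ‖v x‖ ≤ C) (y : Y) :
    ‖Ws.sum v y‖ ≤ C * decaySum X :=
  norm_tsum_le_of_decay fun x => by rw [norm_mul, Ws.norm_fn, mul_one]; exact h x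

theorem LocDecay.summable {c : E → X → ℂ} (hc : LocDecay c) (p : E) (y : Y) :
    Summable fun x => c p x * Ws.fn x y := by
  obtain ⟨C, hC⟩ := hc (‖p‖ + 1) (decayExp X)
  exact Ws.summable (hC p (by linarith)) y

variable [NormedSpace ℝ E]

/-- Termwise differentiation of series whose coefficients depend on a parameter. -/
theorem Waves.hasFDerivAt_sum {c : E → X → ℂ} {c' : ι → E → X → ℂ} (ℓ : ι → E →L[ℝ] ℝ)
    (hc : LocDecay c) (hc' : ∀ i, LocDecay (c' i))
    (hd : ∀ p x, HasFDerivAt (fun p => c p x) (∑ i, (ℓ i).smulRight (c' i p x)) p) (z : E × Y) :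
    HasFDerivAt (fun z : E × Y => Ws.sum (c z.1) z.2)
      (∑ i, ((ℓ i).comp (fst ℝ E Y)).smulRight (Ws.sum (c' i z.1) z.2)
        + ∑ j, ((Ws.dir j).comp (snd ℝ E Y)).smulRight
          (Ws.sum (fun x => Complex.I * Ws.freq j x * c z.1 x) z.2)) z := by
  have hm : ∀ j, LocDecay fun p x => Complex.I * Ws.freq j x * c p x := fun j =>
    hc.mul_freq (K := 1) fun x => by
      rw [norm_mul, Complex.norm_I, one_mul, one_mul, Complex.norm_real]; exact Ws.freq_le j x
  set D : X → E × Y → E × Y →L[ℝ] ℂ := fun x z =>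
    ∑ i, ((ℓ i).comp (fst ℝ E Y)).smulRight (c' i z.1 x * Ws.fn x z.2)
      + ∑ j, ((Ws.dir j).comp (snd ℝ E Y)).smulRight
        (Complex.I * Ws.freq j x * c z.1 x * Ws.fn x z.2) with hD
  have hDz : HasSum (fun x => D x z) (∑ i, ((ℓ i).comp (fst ℝ E Y)).smulRight
        (Ws.sum (c' i z.1) z.2) + ∑ j, ((Ws.dir j).comp (snd ℝ E Y)).smulRight
          (Ws.sum (fun x => Complex.I * Ws.freq j x * c z.1 x) z.2)) := by
    refine HasSum.add (hasSum_sum fun i _ => ?_) (hasSum_sum fun j _ => ?_)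
    · exact ((hc' i).summable Ws z.1 z.2).hasSum.mapL
        (smulRightL ℝ (E × Y) ℂ ((ℓ i).comp (fst ℝ E Y)))
    · exact ((hm j).summable Ws z.1 z.2).hasSum.mapL
        (smulRightL ℝ (E × Y) ℂ ((Ws.dir j).comp (snd ℝ E Y)))
  choose A hA using fun i => hc' i (‖z‖ + 1) (decayExp X)
  choose B hB using fun j => hm j (‖z‖ + 1) (decayExp X)
  have hz : z ∈ Metric.ball (0 : E × Y) (‖z‖ + 1) := by simp
  have hmain := hasFDerivAt_tsum_of_isPreconnected (𝕜 := ℝ)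
    (f := fun x (z : E × Y) => c z.1 x * Ws.fn x z.2) (f' := D)
    (u := fun x => (∑ i, ‖(ℓ i).comp (fst ℝ E Y)‖ * A i
      + ∑ j, ‖(Ws.dir j).comp (snd ℝ E Y)‖ * B j) * (jb x ^ decayExp X)⁻¹)
    (s := Metric.ball 0 (‖z‖ + 1)) (x₀ := z) (x := z)
    (summable_decay.mul_left _) Metric.isOpen_ball (convex_ball _ _).isPreconnected
    (fun x w _ => ?_) (fun x w hw => ?_) hz (hc.summable Ws z.1 z.2) hz
  · rwa [hDz.tsum_eq] at hmain
  · have h1 : HasFDerivAt (fun z : E × Y => c z.1 x) _ w := (hd w.1 x).comp w hasFDerivAt_fst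
    have h2 : HasFDerivAt (fun z : E × Y => Ws.fn x z.2) _ w :=
      (Ws.hasFDerivAt x w.2).comp w hasFDerivAt_snd
    refine (h1.mul h2).congr_fderiv ?_
    ext v <;> simp [hD, Finset.mul_sum] <;> refine Finset.sum_congr rfl fun i _ => ?_ <;> ring
  · have hw1 : ‖w.1‖ < ‖z‖ + 1 := (norm_fst_le w).trans_lt (by simpa using hw)
    have key : ∀ a : ℂ, ∀ C : ℝ, jb x ^ decayExp X * ‖a‖ ≤ C →
        ‖a * Ws.fn x w.2‖ ≤ C * (jb x ^ decayExp X)⁻¹ := fun a C h => by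
      rw [norm_mul, Ws.norm_fn, mul_one, ← div_eq_mul_inv, le_div_iff₀ (jb_pow_pos x _), mul_comm]
      exact h
    refine (norm_add_le _ _).trans ?_
    rw [add_mul, Finset.sum_mul, Finset.sum_mul]
    refine add_le_add ((_root_.norm_sum_le _ _).trans (Finset.sum_le_sum fun i _ => ?_))
      ((_root_.norm_sum_le _ _).trans (Finset.sum_le_sum fun j _ => ?_))
    · rw [norm_smulRight_apply, mul_assoc]
      exact mul_le_mul_of_nonneg_left (key _ _ (hA i w.1 hw1 x)) (norm_nonneg _)
    · rw [norm_smulRight_apply, mul_assoc ‖(Ws.dir j).comp (snd ℝ E Y)‖]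
      exact mul_le_mul_of_nonneg_left (key _ _ (hB j w.1 hw1 x)) (norm_nonneg _)

/-- Series whose coefficients belong to a class of rapidly decreasing functions that is closed
under differentiation and under multiplication by the eigenvalues are smooth. -/
theorem Waves.contDiff_sum (ℓ : ι → E →L[ℝ] ℝ) (S : Set (E → X → ℂ))
    (hr : ∀ c ∈ S, LocDecay c)
    (hd : ∀ c ∈ S, ∃ c' : ι → E → X → ℂ, (∀ i, c' i ∈ S) ∧
      ∀ p x, HasFDerivAt (fun p => c p x) (∑ i, (ℓ i).smulRight (c' i p x)) p)
    (hm : ∀ c ∈ S, ∀ j, (fun p x => Complex.I * Ws.freq j x * c p x) ∈ S) {c : E → X → ℂ}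
    (hc : c ∈ S) : ContDiff ℝ ∞ fun z : E × Y => Ws.sum (c z.1) z.2 := by
  refine contDiff_infty.2 fun N => ?_
  induction N generalizing c with
  | zero =>
    obtain ⟨c', hc', h⟩ := hd c hc
    refine contDiff_zero.2 (continuous_iff_continuousAt.2 fun z => ?_)
    exact (Ws.hasFDerivAt_sum ℓ (hr c hc) (fun i => hr _ (hc' i)) h z).continuousAt
  | succ N ih =>
    obtain ⟨c', hc', h⟩ := hd c hc
    rw [Nat.cast_add, Nat.cast_one]
    refine contDiff_succ_iff_hasFDerivAt.2
      ⟨_, ?_, Ws.hasFDerivAt_sum ℓ (hr c hc) (fun i => hr _ (hc' i)) h⟩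
    refine ContDiff.add (ContDiff.sum fun i _ => ?_) (ContDiff.sum fun j _ => ?_)
    · exact (smulRightL ℝ (E × Y) ℂ ((ℓ i).comp (fst ℝ E Y))).contDiff.comp (ih (hc' i))
    · exact (smulRightL ℝ (E × Y) ℂ ((Ws.dir j).comp (snd ℝ E Y))).contDiff.comp (ih (hm c hc j))

/-- The evaluation of a series at a point, as a tame map. -/
def Waves.eval (y : Y) : RS X →ₗ[ℂ] RS Unit where
  toFun v := ⟨fun _ => Ws.sum v.1 y, fun L => ⟨jb () ^ L * ‖Ws.sum v.1 y‖, fun _ => le_rfl⟩⟩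
  map_add' u v := RS.ext fun _ => by
    obtain ⟨C, -, hC⟩ := RS.decay u (decayExp X)
    obtain ⟨C', -, hC'⟩ := RS.decay v (decayExp X)
    change Ws.sum _ y = Ws.sum _ y + Ws.sum _ y
    simp only [Waves.sum]
    rw [← (Ws.summable hC y).tsum_add (Ws.summable hC' y)]
    exact tsum_congr fun x => by simp [add_mul]
  map_smul' c v := RS.ext fun _ => by
    change Ws.sum _ y = c * Ws.sum _ y
    simp only [Waves.sum]
    rw [← tsum_mul_left]
    exact tsum_congr fun x => by simp [mul_assoc]

theorem Waves.eval_apply (y : Y) (v : RS X) (q : Unit) : (Ws.eval y v).1 q = Ws.sum v.1 y := rfl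

theorem Waves.eval_tame (y : Y) : Tame (Ws.eval y) := fun L =>
  ⟨decayExp X, decaySum X, decaySum_nonneg, fun v B hv q => by
    have : jb q = 1 := by rw [show q = 0 from rfl, jb_zero]
    rw [this, one_pow, one_mul, mul_comm]
    exact Ws.norm_sum_le hv y⟩

theorem Waves.sum_add (u v : RS X) (y : Y) : Ws.sum (u + v).1 y = Ws.sum u.1 y + Ws.sum v.1 y :=
  congrArg (fun w : RS Unit => w.1 ()) (map_add (Ws.eval y) u v)

theorem Waves.sum_smul (c : ℂ) (v : RS X) (y : Y) : Ws.sum (c • v).1 y = c * Ws.sum v.1 y :=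
  congrArg (fun w : RS Unit => w.1 ()) (map_smul (Ws.eval y) c v)

/-- A tame operator is determined, inside a series, by the images of the single frequencies. -/
theorem Waves.hasSum_tame {X' : Type} [NormedAddCommGroup X'] [PolySummable X']
    {T : RS X' →ₗ[ℂ] RS X} (hT : Tame T) (v : RS X') (y : Y) :
    HasSum (fun x => v.1 x * Ws.sum (T (delta x)).1 y) (Ws.sum (T v).1 y) :=
  ((Ws.eval_tame y).comp hT).hasSum v ()

/-- Smoothness of a series with fixed coefficients. -/
theorem Waves.contDiff_sum_const (v : RS X) : ContDiff ℝ ∞ (Ws.sum v.1) := by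
  have h := Ws.contDiff_sum (E := Vec 0) (ι := Empty) (fun i => i.elim)
    {c | ∃ v : RS X, c = fun _ => v.1} ?_ ?_ ?_ (c := fun _ => v.1) ⟨v, rfl⟩
  · exact h.comp (contDiff_const (c := (0 : Vec 0)).prodMk contDiff_id)
  · rintro _ ⟨v, rfl⟩ R L
    obtain ⟨C, -, hC⟩ := RS.decay v L
    exact ⟨C, fun _ _ => hC⟩
  · rintro _ ⟨v, rfl⟩
    exact ⟨fun i => i.elim, fun i => i.elim, fun p x => by simpa using hasFDerivAt_const _ _⟩
  · rintro _ ⟨v, rfl⟩ j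
    refine ⟨⟨fun x => Complex.I * Ws.freq j x * v.1 x, fun L => ?_⟩, rfl⟩
    have hv : LocDecay fun (_ : Vec 0) => v.1 := fun R L => by
      obtain ⟨C, -, hC⟩ := RS.decay v L
      exact ⟨C, fun _ _ => hC⟩
    obtain ⟨C, hC⟩ := hv.mul_freq (K := 1) (f := fun x => Complex.I * Ws.freq j x) (fun x => by
      rw [norm_mul, Complex.norm_I, one_mul, one_mul, Complex.norm_real]; exact Ws.freq_le j x) 1 L
    exact ⟨C, hC 0 (by rw [norm_zero]; exact one_pos)⟩

/-- The derivatives of a series with fixed coefficients. -/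
theorem Waves.hasFDerivAt_sum_const (v : RS X) (y : Y) :
    HasFDerivAt (Ws.sum v.1)
      (∑ j, (Ws.dir j).smulRight (Ws.sum (fun x => Complex.I * Ws.freq j x * v.1 x) y)) y := by
  have hv : LocDecay fun (_ : Vec 0) => v.1 := fun R L => by
    obtain ⟨C, -, hC⟩ := RS.decay v L
    exact ⟨C, fun _ _ => hC⟩
  have h := Ws.hasFDerivAt_sum (E := Vec 0) (ι := Empty) (fun i => i.elim) (c' := fun i => i.elim)
    hv (fun i => i.elim) (fun p x => by simpa using hasFDerivAt_const _ _) (0, y)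
  have h2 := h.comp y ((hasFDerivAt_const (0 : Vec 0) y).prodMk (hasFDerivAt_id y))
  refine h2.congr_fderiv ?_
  ext w
  simp

end waves

/-! ### From operators in the variables `(φ, x)` to families of operators in `x` -/

section transfer
open ContinuousLinearMap

/-- The exponentials on `𝕋^k`. -/
def charWaves (k : ℕ) : Waves (Fin k → ℤ) (Vec k) (Fin k) where
  fn := character
  freq j ξ := ξ j
  dir j := proj j
  norm_fn := character_norm
  freq_le j ξ := by
    have := norm_le_pi_norm ξ j
    rw [Int.norm_eq_abs] at this
    unfold jb; linarith
  hasFDerivAt ξ x := (hasFDerivAt_character ξ x).congr_fderiv <| by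
    ext y
    simp [dotCLM_apply, dot, intVec, Finset.sum_mul]
    exact Finset.sum_congr rfl fun i _ => by ring

variable {n d : ℕ}

/-- The exponentials on `𝕋^n × 𝕋^d`. -/
def freqWaves (n d : ℕ) : Waves (Freq n d) (Vec n × Vec d) (Fin n ⊕ Fin d) where
  fn κ y := character κ.1 y.1 * character κ.2 y.2
  freq j κ := Sum.elim (fun i => (κ.1 i : ℝ)) (fun i => (κ.2 i : ℝ)) j
  dir := Sum.elim (fun i => (proj i).comp (fst ℝ _ _)) fun i => (proj i).comp (snd ℝ _ _)
  norm_fn κ y := by rw [norm_mul, character_norm, character_norm, one_mul]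
  freq_le j κ := by
    rcases j with i | i
    · exact ((charWaves n).freq_le i κ.1).trans (jb_fst_le κ)
    · exact ((charWaves d).freq_le i κ.2).trans (jb_snd_le κ)
  hasFDerivAt κ y := by
    have h1 : HasFDerivAt (fun y : Vec n × Vec d => character κ.1 y.1) _ y :=
      (hasFDerivAt_character κ.1 y.1).comp y hasFDerivAt_fst
    have h2 : HasFDerivAt (fun y : Vec n × Vec d => character κ.2 y.2) _ y :=
      (hasFDerivAt_character κ.2 y.2).comp y hasFDerivAt_snd
    refine (h1.mul h2).congr_fderiv ?_
    ext w <;> simp [dotCLM_apply, dot, intVec, Finset.sum_mul, Finset.mul_sum] <;>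
      exact Finset.sum_congr rfl fun i _ => by ring

theorem freqWaves_fn (κ : Freq n d) (y : Vec n × Vec d) :
    (freqWaves n d).fn κ y = character κ.1 y.1 * character κ.2 y.2 := rfl

theorem freqWaves_fn_add (κ κ' : Freq n d) (y : Vec n × Vec d) :
    (freqWaves n d).fn (κ + κ') y = (freqWaves n d).fn κ y * (freqWaves n d).fn κ' y := by
  simp only [freqWaves_fn, Prod.fst_add, Prod.snd_add, character_add_freq]
  ring

/-- The smooth function with given Fourier coefficients. -/
def synth : RS (Fin d → ℤ) →ₗ[ℂ] Smooth d where
  toFun v := ⟨(charWaves d).sum v.1, (charWaves d).contDiff_sum_const v, fun x l => by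
    simp only [Waves.sum]
    exact tsum_congr fun ξ => by
      rw [show (charWaves d).fn ξ = character ξ from rfl, character_periodic]⟩
  map_add' u v := Subtype.ext (funext fun x => (charWaves d).sum_add u v x)
  map_smul' c v := Subtype.ext (funext fun x => (charWaves d).sum_smul c v x)

theorem synth_apply (v : RS (Fin d → ℤ)) (x : Vec d) : (synth v).1 x = (charWaves d).sum v.1 x := rfl

theorem synth_four (u : Smooth d) : synth (four u) = u :=
  Subtype.ext (funext fun x => (hasSum_fourier u x).tsum_eq)

theorem four_synth (v : RS (Fin d → ℤ)) : four (synth v) = v := by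
  refine RS.ext fun ξ => ?_
  obtain ⟨C, -, hC⟩ := RS.decay v (decayExp (Fin d → ℤ))
  exact coeff_of_series (summable_norm_of_decay hC) ξ

/-- Functions of `x` as functions of `(φ, x)` that do not depend on `φ`, in terms of Fourier
coefficients. -/
def incl (n : ℕ) {d : ℕ} : RS (Fin d → ℤ) →ₗ[ℂ] RS (Freq n d) where
  toFun v := ⟨fun κ => if κ.1 = 0 then v.1 κ.2 else 0, fun L => by
    obtain ⟨C, hC0, hC⟩ := RS.decay v L
    refine ⟨C, fun κ => ?_⟩
    dsimp only
    split_ifs with h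
    · have : jb κ = jb κ.2 := by
        conv_lhs => rw [show κ = (0, κ.2) from Prod.ext h rfl]
        exact jb_zero_prod _
      rw [this]; exact hC _
    · simpa using hC0⟩
  map_add' u v := RS.ext fun κ => by
    simp only [RS.add_apply]; split_ifs <;> simp
  map_smul' c v := RS.ext fun κ => by
    simp only [RS.smul_apply, RingHom.id_apply]; split_ifs <;> simp

theorem incl_apply (v : RS (Fin d → ℤ)) (κ : Freq n d) :
    (incl n v).1 κ = if κ.1 = 0 then v.1 κ.2 else 0 := rfl

theorem incl_tame : Tame (incl n (d := d)) := fun L => ⟨L, 1, zero_le_one, fun v B hv κ => by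
  rw [incl_apply]
  split_ifs with h
  · have : jb κ = jb κ.2 := by
      conv_lhs => rw [show κ = (0, κ.2) from Prod.ext h rfl]
      exact jb_zero_prod _
    rw [this, one_mul]; exact hv _
  · simpa using (mul_nonneg (jb_pow_pos 0 _).le (norm_nonneg _)).trans (hv 0)⟩

theorem incl_delta (k : Fin d → ℤ) : incl n (delta k) = delta (0, k) := by
  refine RS.ext fun κ => ?_
  rw [incl_apply, delta_apply, delta_apply]
  by_cases h : κ.1 = 0 <;> by_cases h' : κ.2 = k <;> simp [h, h', Prod.ext_iff]

theorem jb_fst_mul_snd_le (l : Fin n → ℤ) (k : Fin d → ℤ) (a L : ℕ) :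
    jb l ^ a * jb k ^ L ≤ jb ((l, k) : Freq n d) ^ (a + L) := by
  rw [pow_add]
  exact mul_le_mul (pow_le_pow_left₀ (jb_pos _).le (jb_fst_le ((l, k) : Freq n d)) a)
    (pow_le_pow_left₀ (jb_pos _).le (jb_snd_le ((l, k) : Freq n d)) L) (jb_pow_pos _ _).le
    (jb_pow_pos _ _).le

/-- The bound for a partial sum over the angular frequencies. -/
theorem angle_decay {w : Freq n d → ℂ} {L : ℕ} {B : ℝ}
    (h : ∀ κ, jb κ ^ (decayExp (Fin n → ℤ) + L) * ‖w κ‖ ≤ B) (φ : Vec n) (k : Fin d → ℤ)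
    (l : Fin n → ℤ) :
    jb l ^ decayExp (Fin n → ℤ) * ‖(jb k ^ L : ℝ) * (w (l, k) * character l φ)‖ ≤ B := by
  refine le_trans (le_of_eq ?_) ((mul_le_mul_of_nonneg_right (jb_fst_mul_snd_le l k _ L)
    (norm_nonneg _)).trans (h (l, k)))
  have := jb_pow_pos k L
  rw [norm_mul, norm_mul, character_norm, Complex.norm_real, Real.norm_of_nonneg this.le]
  ring

theorem angle_summable (w : RS (Freq n d)) (φ : Vec n) (k : Fin d → ℤ) :
    Summable fun l : Fin n → ℤ => w.1 (l, k) * character l φ := by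
  obtain ⟨B, -, hB⟩ := RS.decay w (decayExp (Fin n → ℤ) + 0)
  exact summable_of_decay (C := B) fun l => by simpa using angle_decay hB φ k l

theorem angle_tsum_le {w : Freq n d → ℂ} {L : ℕ} {B : ℝ}
    (h : ∀ κ, jb κ ^ (decayExp (Fin n → ℤ) + L) * ‖w κ‖ ≤ B) (φ : Vec n) (k : Fin d → ℤ) :
    jb k ^ L * ‖∑' l : Fin n → ℤ, w (l, k) * character l φ‖ ≤ B * decaySum (Fin n → ℤ) := by
  have h1 := norm_tsum_le_of_decay (angle_decay h φ k)
  rwa [tsum_mul_left, norm_mul, Complex.norm_real, Real.norm_of_nonneg (jb_pow_pos k L).le] at h1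

/-- The restriction of a function of `(φ, x)` to a fixed value of `φ`, in terms of Fourier
coefficients. -/
def evAt (φ : Vec n) : RS (Freq n d) →ₗ[ℂ] RS (Fin d → ℤ) where
  toFun w := ⟨fun k => ∑' l : Fin n → ℤ, w.1 (l, k) * character l φ, fun L => by
    obtain ⟨B, -, hB⟩ := RS.decay w (decayExp (Fin n → ℤ) + L)
    exact ⟨_, angle_tsum_le hB φ⟩⟩
  map_add' u v := RS.ext fun k => by
    simp only [RS.add_apply]
    rw [← (angle_summable u φ k).tsum_add (angle_summable v φ k)]
    exact tsum_congr fun l => by ring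
  map_smul' c v := RS.ext fun k => by
    simp only [RS.smul_apply, RingHom.id_apply]
    rw [← tsum_mul_left]
    exact tsum_congr fun l => by ring

theorem evAt_apply (φ : Vec n) (w : RS (Freq n d)) (k : Fin d → ℤ) :
    (evAt φ w).1 k = ∑' l : Fin n → ℤ, w.1 (l, k) * character l φ := rfl

theorem evAt_tame (φ : Vec n) : Tame (evAt φ : RS (Freq n d) →ₗ[ℂ] RS (Fin d → ℤ)) := fun L =>
  ⟨decayExp (Fin n → ℤ) + L, decaySum (Fin n → ℤ), decaySum_nonneg, fun w B hw k => by
    rw [mul_comm (decaySum _)]; exact angle_tsum_le hw φ k⟩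

theorem evAt_delta (φ : Vec n) (κ : Freq n d) :
    evAt φ (delta κ) = character κ.1 φ • delta κ.2 := by
  refine RS.ext fun k => ?_
  rw [evAt_apply, RS.smul_apply, tsum_eq_single κ.1 fun l hl => by
    rw [delta_ne fun h => hl (congrArg Prod.fst h), zero_mul]]
  rw [delta_apply, delta_apply]
  by_cases h : k = κ.2 <;> simp [h, Prod.ext_iff]

theorem evAt_shiftOp (φ : Vec n) (l : Fin n → ℤ) (w : RS (Freq n d)) :
    evAt φ (shiftOp l w) = character l φ • evAt φ w := by
  refine RS.ext fun k => ?_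
  rw [evAt_apply, RS.smul_apply, evAt_apply, ← tsum_mul_left, ← (Equiv.addRight l).tsum_eq]
  refine tsum_congr fun l' => ?_
  rw [shiftOp_apply, Equiv.coe_addRight, character_add_freq]
  simp only [Prod.mk_sub_mk, add_sub_cancel_right, sub_zero]
  ring

theorem evAt_incl (φ : Vec n) (v : RS (Fin d → ℤ)) : evAt φ (incl n v) = v := by
  refine RS.ext fun k => ?_
  rw [evAt_apply, tsum_eq_single 0 fun l hl => by simp [incl_apply, hl]]
  simp [incl_apply]

theorem sum_evAt (φ : Vec n) (w : RS (Freq n d)) (x : Vec d) :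
    (charWaves d).sum (evAt φ w).1 x = (freqWaves n d).sum w.1 (φ, x) := by
  have h : (charWaves d).eval x ∘ₗ evAt φ = (freqWaves n d).eval (φ, x) :=
    Tame.ext (((charWaves d).eval_tame x).comp (evAt_tame φ)) ((freqWaves n d).eval_tame _)
      fun κ q => by
        rw [LinearMap.comp_apply, evAt_delta, Waves.eval_apply, Waves.eval_apply, Waves.sum_smul,
          Waves.sum_delta, Waves.sum_delta]
        rfl
  exact congrArg (fun v : RS Unit => v.1 ()) (LinearMap.congr_fun h w)

/-- The action of an operator in `(φ, x)` on functions of `x`, at a fixed angle `φ`. -/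
def atAngle (T : Module.End ℂ (RS (Freq n d))) (φ : Vec n) : Module.End ℂ (RS (Fin d → ℤ)) :=
  evAt φ ∘ₗ T ∘ₗ incl n

theorem atAngle_tame {T : Module.End ℂ (RS (Freq n d))} (hT : Tame T) (φ : Vec n) :
    Tame (atAngle T φ) := (evAt_tame φ).comp (hT.comp incl_tame)

/-- Operators that commute with multiplication by functions of `φ` act fibrewise. -/
theorem evAt_comp {T : Module.End ℂ (RS (Freq n d))} (hT : Tame T) (hs : ShiftInv T) (φ : Vec n)
    (w : RS (Freq n d)) : evAt φ (T w) = atAngle T φ (evAt φ w) := by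
  have h : evAt φ ∘ₗ T = atAngle T φ ∘ₗ evAt φ :=
    -- every exponential is a translate of one without frequency in `φ`
    Tame.ext ((evAt_tame φ).comp hT) ((atAngle_tame hT φ).comp (evAt_tame φ)) fun κ k => by
      have e : (delta κ : RS (Freq n d)) = shiftOp κ.1 (delta (0, κ.2)) := by
        rw [shiftOp_delta]; simp
      have e2 : T (delta κ) = shiftOp κ.1 (T (delta (0, κ.2))) := by
        rw [e]; exact LinearMap.congr_fun (hs κ.1) _
      rw [LinearMap.comp_apply, LinearMap.comp_apply, evAt_delta, e2, evAt_shiftOp, map_smul,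
        atAngle, LinearMap.comp_apply, LinearMap.comp_apply, incl_delta]
  exact LinearMap.congr_fun h w

/-- The family of operators on `C^∞(𝕋^d)` defined by an operator in the variables `(φ, x)`. -/
def opAt (T : Module.End ℂ (RS (Freq n d))) (φ : Vec n) : Oper d := synth ∘ₗ atAngle T φ ∘ₗ four

theorem opAt_eq (T : Module.End ℂ (RS (Freq n d))) (φ : Vec n) (u : Smooth d) :
    opAt T φ u = synth (evAt φ (T (incl n (four u)))) := rfl

theorem opAt_apply (T : Module.End ℂ (RS (Freq n d))) (φ : Vec n) (u : Smooth d) (x : Vec d) :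
    (opAt T φ u).1 x = (freqWaves n d).sum (T (incl n (four u))).1 (φ, x) := sum_evAt φ _ x

theorem four_opAt (T : Module.End ℂ (RS (Freq n d))) (φ : Vec n) (u : Smooth d) :
    four (opAt T φ u) = evAt φ (T (incl n (four u))) := four_synth _

theorem opAt_mul {T S : Module.End ℂ (RS (Freq n d))} (hT : Tame T) (hs : ShiftInv T) (φ : Vec n) :
    opAt (T * S) φ = opAt T φ * opAt S φ := LinearMap.ext fun u => by
  rw [Module.End.mul_apply, opAt_eq, opAt_eq T, four_opAt, Module.End.mul_apply, evAt_comp hT hs]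
  rfl

theorem opAt_one (φ : Vec n) : opAt (1 : Module.End ℂ (RS (Freq n d))) φ = 1 :=
  LinearMap.ext fun u => by
    rw [opAt_eq, Module.End.one_apply, evAt_incl, synth_four, Module.End.one_apply]

theorem opAt_add (T S : Module.End ℂ (RS (Freq n d))) (φ : Vec n) :
    opAt (T + S) φ = opAt T φ + opAt S φ := LinearMap.ext fun u => by
  simp only [opAt_eq, LinearMap.add_apply, map_add]

theorem opAt_prod {N : ℕ} {T : Fin N → Module.End ℂ (RS (Freq n d))} (hT : ∀ i, Tame (T i))
    (hs : ∀ i, ShiftInv (T i)) (φ : Vec n) :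
    opAt (List.ofFn T).prod φ = (List.ofFn fun i => opAt (T i) φ).prod := by
  induction N with
  | zero => simpa using opAt_one φ
  | succ N ih =>
    rw [List.ofFn_succ, List.ofFn_succ, List.prod_cons, List.prod_cons, opAt_mul (hT 0) (hs 0),
      ih (fun i => hT i.succ) fun i => hs i.succ]

theorem ext_of_isOp {a : Vec d → Vec d → ℂ} {A B : Oper d} (hA : IsOp a A) (hB : IsOp a B) :
    A = B := LinearMap.ext fun u => Subtype.ext (funext fun x => (hA u x).unique (hB u x))

/-- The symbol of the family of operators on `C^∞(𝕋^d)` with lattice symbol `a`. -/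
def latticeSymbol (a : Hat n d) (φ : Vec n) (x : Vec d) (q : Fin d → ℤ) : ℂ :=
  (freqWaves n d).sum (fun κ => a κ q) (φ, x)

theorem sum_hatOp_delta {a : Hat n d} (ha : Temp a) (κ' : Freq n d) (y : Vec n × Vec d) :
    (freqWaves n d).sum (hatOp a (delta κ')).1 y
      = (freqWaves n d).sum (fun κ => a κ κ'.2) y * (freqWaves n d).fn κ' y := by
  simp only [Waves.sum]
  rw [← tsum_mul_right, ← (Equiv.addRight κ').tsum_eq]
  refine tsum_congr fun κ => ?_
  rw [Equiv.coe_addRight, hatOp_delta ha, freqWaves_fn_add, add_sub_cancel_right]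
  ring

/-- The operators with a given lattice symbol, as pseudodifferential operators. -/
theorem isOp_opAt {a : Hat n d} (ha : Temp a) {σ : Vec d → Vec d → ℂ} {φ : Vec n}
    (h : ∀ x q, σ x (intVec q) = latticeSymbol a φ x q) : IsOp σ (opAt (hatOp a) φ) := by
  intro u x
  rw [opAt_apply]
  have h1 := (freqWaves n d).hasSum_tame (hatOp_tame a) (incl n (four u)) (φ, x)
  have hinj : Function.Injective fun q : Fin d → ℤ => ((0, q) : Freq n d) :=
    fun q q' hq => congrArg Prod.snd hq
  rw [← hinj.hasSum_iff fun κ hκ => ?_] at h1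
  · refine (congrArg (HasSum · _) (funext fun q => ?_)).mp h1
    simp only [Function.comp]
    rw [sum_hatOp_delta ha, h, incl_apply, if_pos rfl, freqWaves_fn]
    simp only [character_zero_freq, latticeSymbol, four_apply]
    ring
  · rw [incl_apply, if_neg fun h0 => hκ ⟨κ.2, Prod.ext h0.symm rfl⟩, zero_mul]

end transfer

/-! ### Japanese brackets -/

section bracket
variable {k : ℕ}

theorem norm_intVec (ξ : Fin k → ℤ) : ‖intVec ξ‖ = ‖ξ‖ := by
  simp only [Pi.norm_def, intVec]
  congr 1

theorem jb_intVec (ξ : Fin k → ℤ) : jb (intVec ξ) = jb ξ := by rw [jb, jb, norm_intVec]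

theorem dot_self_nonneg (ξ : Vec k) : 0 ≤ dot ξ ξ :=
  Finset.sum_nonneg fun _ _ => mul_self_nonneg _

theorem one_le_bracket (ξ : Vec k) : 1 ≤ bracket ξ := by
  rw [bracket, Real.one_le_sqrt]; linarith [dot_self_nonneg ξ]

theorem bracket_pos (ξ : Vec k) : 0 < bracket ξ := one_pos.trans_le (one_le_bracket ξ)

theorem dot_self_le (ξ : Vec k) : dot ξ ξ ≤ k * ‖ξ‖ ^ 2 := by
  calc dot ξ ξ ≤ ∑ _i : Fin k, ‖ξ‖ ^ 2 := Finset.sum_le_sum fun i _ => by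
        rw [← sq, ← sq_abs]
        exact pow_le_pow_left₀ (abs_nonneg _) (norm_le_pi_norm ξ i) 2
    _ = _ := by simp

theorem bracket_le (ξ : Vec k) : bracket ξ ≤ (k + 1 : ℝ) * jb ξ := by
  have hk : (0 : ℝ) ≤ k := Nat.cast_nonneg k
  refine Real.sqrt_le_iff.2 ⟨by have := jb_pos ξ; positivity, ?_⟩
  have h1 := dot_self_le ξ
  have h2 : ‖ξ‖ ^ 2 ≤ jb ξ ^ 2 := by
    unfold jb; nlinarith [norm_nonneg ξ]
  have h3 := one_le_jb_pow ξ 2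
  nlinarith [mul_le_mul_of_nonneg_left h2 hk, mul_nonneg hk (sq_nonneg (jb ξ)),
    mul_nonneg (mul_nonneg hk hk) (sq_nonneg (jb ξ))]

theorem norm_le_bracket (ξ : Vec k) : ‖ξ‖ ≤ bracket ξ := by
  refine (pi_norm_le_iff_of_nonneg (bracket_pos ξ).le).2 fun i => ?_
  refine Real.abs_le_sqrt ?_
  have : ξ i * ξ i ≤ dot ξ ξ :=
    Finset.single_le_sum (f := fun i => ξ i * ξ i) (fun i _ => mul_self_nonneg _)
      (Finset.mem_univ i)
  nlinarith

theorem jb_le_bracket (ξ : Vec k) : jb ξ ≤ (k + 2 : ℝ) * bracket ξ := by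
  have h1 := one_le_bracket ξ
  have h2 := norm_le_bracket ξ
  have hk : (0 : ℝ) ≤ k := Nat.cast_nonneg k
  unfold jb
  nlinarith

theorem rpow_le_of_equiv {a b c : ℝ} (ha : 0 < a) (hb : 0 < b) (hc : 1 ≤ c) (h1 : a ≤ c * b)
    (h2 : b ≤ c * a) (m : ℝ) : a ^ m ≤ c ^ |m| * b ^ m := by
  have hc0 : 0 < c := by linarith
  rcases le_total 0 m with hm | hm
  · rw [abs_of_nonneg hm, ← Real.mul_rpow hc0.le hb.le]
    exact Real.rpow_le_rpow ha.le h1 hm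
  · rw [abs_of_nonpos hm]
    have h3 : c⁻¹ * b ≤ a := by rwa [inv_mul_le_iff₀ hc0]
    refine (Real.rpow_le_rpow_of_nonpos (by positivity) h3 hm).trans (le_of_eq ?_)
    rw [Real.mul_rpow (by positivity) hb.le, Real.inv_rpow hc0.le, Real.rpow_neg hc0.le]

/-- The comparison of powers of `⟨ξ⟩` and of `1 + |ξ|`. -/
theorem bracket_rpow_le (m : ℝ) : ∃ C : ℝ, 0 ≤ C ∧ ∀ ξ : Vec k,
    bracket ξ ^ m ≤ C * jb ξ ^ m ∧ jb ξ ^ m ≤ C * bracket ξ ^ m := by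
  have hk : (0 : ℝ) ≤ k := Nat.cast_nonneg k
  refine ⟨(k + 2 : ℝ) ^ |m|, by positivity, fun ξ => ?_⟩
  have h1 : bracket ξ ≤ (k + 2 : ℝ) * jb ξ := (bracket_le ξ).trans
    (mul_le_mul_of_nonneg_right (by linarith) (jb_pos ξ).le)
  have h2 := jb_le_bracket ξ
  exact ⟨rpow_le_of_equiv (bracket_pos ξ) (jb_pos ξ) (by linarith) h1 h2 m,
    rpow_le_of_equiv (jb_pos ξ) (bracket_pos ξ) (by linarith) h2 h1 m⟩

end bracket

/-! ### The flows on `C^∞(𝕋^d)` -/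

section flows
variable {n d : ℕ} {Γ : ParamGraph} {m : ℝ} {g : Γ.P → Hat n d}
  {U : Γ.P → ℝ → Module.End ℂ (RS (Freq n d))}

/-- The matrix of the action of a lattice symbol at a fixed angle. -/
def angMat (a : Hat n d) (φ : Vec n) (k z : Fin d → ℤ) : ℂ :=
  ∑' l : Fin n → ℤ, a (l, k - z) z * character l φ

theorem atAngle_delta {a : Hat n d} (ha : Temp a) (φ : Vec n) (k z : Fin d → ℤ) :
    (atAngle (hatOp a) φ (delta z)).1 k = angMat a φ k z := by
  rw [atAngle, LinearMap.comp_apply, LinearMap.comp_apply, incl_delta, evAt_apply]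
  refine tsum_congr fun l => ?_
  rw [hatOp_delta ha]
  simp

theorem Bd.angMat_bd {P : Type} {a : P → Hat n d} (ha : Bd m (fun _ => 1) a) {ρ : (Fin d → ℤ) → ℝ}
    (hρ : ∀ q, jb q ^ m ≤ ρ q) :
    MatBd ρ (fun _ => 1) fun (p : P × Vec n) => angMat (a p.1) p.2 := fun L => by
  obtain ⟨C, hC⟩ := ha [] (decayExp (Fin n → ℤ) + L)
  refine ⟨|C| * decaySum (Fin n → ℤ), mul_nonneg (abs_nonneg _) decaySum_nonneg, fun p k z => ?_⟩
  have h : ∀ κ, jb κ ^ (decayExp (Fin n → ℤ) + L) * ‖a p.1 κ z‖ ≤ |C| * ρ z := fun κ => by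
    refine (hC p.1 κ z).trans ?_
    simp only [List.length_nil, Nat.cast_zero, sub_zero, mul_one]
    exact mul_le_mul (le_abs_self C) (hρ z) (jb_rpow_pos z m).le (abs_nonneg _)
  refine (angle_tsum_le (w := fun κ => a p.1 κ z) h p.2 (k - z)).trans (le_of_eq ?_)
  ring

theorem angMat_adj (a : Hat n d) (φ : Vec n) (k z : Fin d → ℤ) :
    angMat (adj a) φ k z = (starRingEnd ℂ) (angMat a φ z k) := by
  rw [angMat, angMat, Complex.conj_tsum, ← (Equiv.neg _).tsum_eq]
  refine tsum_congr fun l => ?_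
  simp only [Equiv.neg_apply, adj, map_mul, character_conj]
  congr 2
  · congr 1 <;> simp

theorem angMat_add {a b : Hat n d} (ha : Temp a) (hb : Temp b) (φ : Vec n) (k z : Fin d → ℤ) :
    angMat (fun κ q => a κ q + b κ q) φ k z = angMat a φ k z + angMat b φ k z := by
  rw [← atAngle_delta ha, ← atAngle_delta hb, ← atAngle_delta (ha.add hb), hatOp_add ha hb]
  rw [atAngle, LinearMap.add_comp, LinearMap.comp_add]
  rfl

/-- At a fixed angle the generator has a bounded Hermitian part, uniformly in the angle. -/
theorem IsGen.angMat_herm (hg : IsGen Γ m g) :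
    HermBd fun (p : Γ.P × Vec n) => angMat (g p.1) p.2 := fun L => by
  obtain ⟨C, h0, hC⟩ := hg.sh.1.angMat_bd (ρ := fun _ => 1) (fun q => by simp) L
  refine ⟨C, h0, fun p x y => ?_⟩
  have := hC p x y
  dsimp only at this
  rw [angMat_add (hg.bd.temp p.1) (hg.bd.adj.temp p.1), angMat_adj] at this
  exact this

theorem IsGen.hasDerivAt_evAt (hg : IsGen Γ m g) (hU : ∀ p, IsMatFlow (hatMat (g p)) (U p))
    (p : Γ.P) {Y : Type} [NormedAddCommGroup Y] {S : RS (Freq n d) →ₗ[ℂ] RS Y} (hS : Tame S)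
    (v : RS (Freq n d)) (t : ℝ) (y : Y) :
    HasDerivAt (fun s => (S (U p s v)).1 y) ((S (hatOp (g p) (U p t v))).1 y) t := by
  have h := hasDerivAt_apply (T := fun _ => S) (T' := fun _ => 0) hS.utame
    (fun R L => ⟨0, 0, le_rfl, fun t _ v B _ y => by simp⟩)
    (fun t v y => by simpa using hasDerivAt_const _ _)
    (w := fun s => U p s v) (w' := fun s => hatOp (g p) (U p s v)) ((hU p).rapid v)
    ((hatOp_tame _).utame.locRapid ((hU p).rapid v)) (fun t κ => hg.deriv hU p t v κ) t y
  simpa using h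

theorem sobolev_summable (s : ℝ) (u : Smooth d) :
    Summable fun ξ : Fin d → ℤ => bracket (intVec ξ) ^ (2 * s) * ‖fourierCoeff u ξ‖ ^ 2 := by
  obtain ⟨C, hC0, hC⟩ := bracket_rpow_le (k := d) (2 * s)
  obtain ⟨B, hB0, hB⟩ := RS.decay (four u) (⌈2 * s⌉₊ + decayExp (Fin d → ℤ))
  obtain ⟨B', hB0', hB'⟩ := RS.decay (four u) 0
  refine summable_norm_of_decay (C := C * B * B') (fun ξ => ?_) |>.of_norm
  have h1 := (hC (intVec ξ)).1
  rw [jb_intVec] at h1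
  have hj := jb_pos ξ
  have h2 : jb ξ ^ (2 * s) ≤ jb ξ ^ ⌈2 * s⌉₊ := by
    rw [← Real.rpow_natCast]
    exact jb_rpow_mono ξ (Nat.le_ceil _)
  have h3 := hB ξ
  have h4 := hB' ξ
  rw [pow_zero, one_mul] at h4
  have hb := bracket_pos (intVec ξ)
  rw [norm_mul, norm_pow, norm_norm, Real.norm_of_nonneg (by positivity)]
  calc jb ξ ^ decayExp (Fin d → ℤ) * (bracket (intVec ξ) ^ (2 * s) * ‖fourierCoeff u ξ‖ ^ 2)
      ≤ jb ξ ^ decayExp (Fin d → ℤ) * ((C * jb ξ ^ ⌈2 * s⌉₊) * ‖fourierCoeff u ξ‖ ^ 2) := by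
        gcongr
        exact h1.trans (mul_le_mul_of_nonneg_left h2 hC0)
    _ = C * (jb ξ ^ (⌈2 * s⌉₊ + decayExp (Fin d → ℤ)) * ‖fourierCoeff u ξ‖)
        * ‖fourierCoeff u ξ‖ := by rw [pow_add]; ring
    _ ≤ C * B * B' := by
        gcongr
        · exact h3
        · exact h4

/-- The Sobolev bounds for the flow, uniform in the angle. -/
theorem IsGen.sobolev_bound (hg : IsGen Γ m g) (hU : ∀ p, IsMatFlow (hatMat (g p)) (U p))
    (p : Γ.P) (s T : ℝ) : ∃ C : ℝ, ∀ τ : ℝ, |τ| ≤ T → ∀ (φ : Vec n) (u : Smooth d),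
      sobolevNorm s (opAt (U p τ) φ u) ≤ C * sobolevNorm s u := by
  -- at a fixed angle the Fourier coefficients solve a system on `ℤ^d`
  obtain ⟨K, hK0, hK⟩ := energy_estimate (ρ := fun q : Fin d → ℤ => jb q) (fun q => one_le_jb q)
    (fun q => le_rfl) (hg.bd.1.angMat_bd fun q => by
      simpa using jb_rpow_mono q hg.le_one) hg.angMat_herm
    (weight_rpow (fun q : Fin d → ℤ => q) s fun _ _ => le_rfl)
  obtain ⟨c, hc0, hc⟩ := bracket_rpow_le (k := d) (2 * s)
  have hw : ∀ q : Fin d → ℤ, (jb q ^ s) ^ 2 = jb q ^ (2 * s) := fun q => by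
    rw [mul_comm, Real.rpow_mul (jb_pos q).le]; norm_cast
  refine ⟨Real.sqrt (c * (Real.exp (K * T) * c)), fun τ hτ φ u => ?_⟩
  have hT : 0 ≤ T := (abs_nonneg τ).trans hτ
  set v := incl n (four u)
  have hrap := (evAt_tame φ).utame.locRapid ((hU p).rapid v)
  have hmain := hK (p, φ) (fun t => (evAt φ (U p t v)).1) (fun _ _ => 0) T
    (c * ∑' ξ : Fin d → ℤ, bracket (intVec ξ) ^ (2 * s) * ‖fourierCoeff u ξ‖ ^ 2) 0 hT
    (fun L => hrap T L) (fun t _ k => ?_) (by simp) (fun F => ?_) τ hτ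
  · rw [sobolevNorm, sobolevNorm, ← Real.sqrt_mul (by positivity)]
    refine Real.sqrt_le_sqrt ?_
    refine Summable.tsum_le_of_sum_le (sobolev_summable s _) fun F => ?_
    calc ∑ ξ ∈ F, bracket (intVec ξ) ^ (2 * s) * ‖fourierCoeff (opAt (U p τ) φ u) ξ‖ ^ 2
        ≤ ∑ ξ ∈ F, c * ((jb ξ ^ s) ^ 2 * ‖(evAt φ (U p τ v)).1 ξ‖ ^ 2) := by
          refine Finset.sum_le_sum fun ξ _ => ?_
          have h1 := (hc (intVec ξ)).1
          rw [jb_intVec, ← hw] at h1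
          rw [← four_apply, four_opAt, ← mul_assoc]
          gcongr
      _ ≤ c * (Real.exp (K * T) * (c * ∑' ξ : Fin d → ℤ,
            bracket (intVec ξ) ^ (2 * s) * ‖fourierCoeff u ξ‖ ^ 2 + 2 * 0)) := by
          rw [← Finset.mul_sum]
          gcongr
          exact hmain F
      _ = _ := by ring
  · have h1 := hg.hasDerivAt_evAt hU p (evAt_tame φ) v t k
    refine h1.congr_deriv ?_
    have ht := hg.bd.temp p
    rw [evAt_comp (hatOp_tame _) (hatOp_shiftInv ht),
      ← ((atAngle_tame (hatOp_tame _) φ).hasSum _ k).tsum_eq, add_zero]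
    exact tsum_congr fun z => by rw [atAngle_delta ht, mul_comm]
  · rw [(hU p).zero, Module.End.one_apply, evAt_incl]
    refine le_trans (Finset.sum_le_sum fun ξ _ => ?_) ((le_of_eq (Finset.mul_sum F
      (fun ξ => bracket (intVec ξ) ^ (2 * s) * ‖fourierCoeff u ξ‖ ^ 2) c).symm).trans
      (mul_le_mul_of_nonneg_left ((sobolev_summable s u).sum_le_tsum F fun ξ _ => ?_) hc0))
    · have h1 := (hc (intVec ξ)).2
      rw [jb_intVec, ← hw] at h1
      rw [four_apply, ← mul_assoc]
      gcongr
    · have := bracket_pos (intVec ξ); positivity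

theorem IsGen.contDiff_flow (hg : IsGen Γ m g) (hU : ∀ p, IsMatFlow (hatMat (g p)) (U p))
    (p : Γ.P) (v : RS (Freq n d)) :
    ContDiff ℝ ∞ fun z : ℝ × Vec n × Vec d => (freqWaves n d).sum (U p z.1 v).1 z.2 := by
  refine (freqWaves n d).contDiff_sum (ι := Unit) (fun _ => ContinuousLinearMap.id ℝ ℝ)
    {c | ∃ (v : RS (Freq n d)) (f : Freq n d → ℂ) (C : ℝ) (N : ℕ),
      (∀ κ, ‖f κ‖ ≤ C * jb κ ^ N) ∧ c = fun t κ => f κ * (U p t v).1 κ} ?_ ?_ ?_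
    (c := fun t κ => (U p t v).1 κ) ⟨v, fun _ => 1, 1, 0, by simp, by simp⟩
  · rintro _ ⟨v, f, C, N, hf, rfl⟩ R L
    obtain ⟨D, hD⟩ := (hU p).rapid v R (L + N)
    have hC : 0 ≤ C := by simpa using (norm_nonneg _).trans (hf 0)
    refine ⟨C * D, fun t ht κ => ?_⟩
    have hj := jb_pos κ
    calc jb κ ^ L * ‖f κ * (U p t v).1 κ‖
        ≤ jb κ ^ L * ((C * jb κ ^ N) * ‖(U p t v).1 κ‖) := by
          rw [norm_mul]; gcongr; exact hf κ
      _ = C * (jb κ ^ (L + N) * ‖(U p t v).1 κ‖) := by rw [pow_add]; ring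
      _ ≤ C * D := by gcongr; exact hD t ht.le κ
  · rintro _ ⟨v, f, C, N, hf, rfl⟩
    refine ⟨fun _ t κ => f κ * (U p t (hatOp (g p) v)).1 κ,
      fun _ => ⟨_, f, C, N, hf, rfl⟩, fun t κ => ?_⟩
    have h1 := (hg.deriv hU p t v κ).const_mul (f κ)
    -- the flow commutes with its generator, so that the class is closed under time derivatives
    have h2 : hatOp (g p) (U p t v) = U p t (hatOp (g p) v) :=
      LinearMap.congr_fun (hg.commute_flow hU p (hatOp_tame (g p)) rfl t) v
    rw [h2] at h1
    refine h1.hasFDerivAt.congr_fderiv ?_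
    ext; simp
  · rintro _ ⟨v, f, C, N, hf, rfl⟩ j
    have hC : 0 ≤ C := by simpa using (norm_nonneg _).trans (hf 0)
    refine ⟨v, fun κ => Complex.I * (freqWaves n d).freq j κ * f κ, C, N + 1, fun κ => ?_,
      funext fun t => funext fun κ => by ring⟩
    rw [norm_mul, norm_mul, Complex.norm_I, one_mul, Complex.norm_real]
    calc ‖(freqWaves n d).freq j κ‖ * ‖f κ‖ ≤ jb κ * (C * jb κ ^ N) :=
          mul_le_mul ((freqWaves n d).freq_le j κ) (hf κ) (norm_nonneg _) (jb_pos κ).le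
      _ = _ := by ring

/-- The operators `opAt (U p t) φ` form the flow of `opAt (hatOp (g p)) φ`. -/
theorem IsGen.isFlow (hg : IsGen Γ m g) (hU : ∀ p, IsMatFlow (hatMat (g p)) (U p)) (p : Γ.P) :
    IsFlow (opAt (hatOp (g p))) fun t φ => opAt (U p t) φ where
  initial φ := by rw [(hU p).zero, opAt_one]
  smooth u := by
    simp only [opAt_apply]
    exact hg.contDiff_flow hU p _
  equation τ φ u x := by
    rw [← Module.End.mul_apply, ← opAt_mul (hatOp_tame _) (hatOp_shiftInv (hg.bd.temp p))]
    simp only [opAt_apply]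
    exact hg.hasDerivAt_evAt hU p ((freqWaves n d).eval_tame (φ, x)) _ τ ()
  bounded s _ T := hg.sobolev_bound hU p s T

end flows

/-! ### The conjugation of the operators on `C^∞(𝕋^d)` -/

section conjugation
variable {n d : ℕ}

theorem norm_dot_le {k : ℕ} (a : Vec k) (l : Fin k → ℤ) : |dot a (intVec l)| ≤ k * ‖a‖ * jb l := by
  calc |dot a (intVec l)| ≤ ∑ i, |a i * intVec l i| := Finset.abs_sum_le_sum_abs _ _
    _ ≤ ∑ _i : Fin k, ‖a‖ * jb l := Finset.sum_le_sum fun i _ => by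
        rw [abs_mul]
        exact mul_le_mul (norm_le_pi_norm a i) ((charWaves k).freq_le i l) (abs_nonneg _)
          (norm_nonneg _)
    _ = _ := by rw [Finset.sum_const, Finset.card_univ, Fintype.card_fin, nsmul_eq_mul]; ring

/-- The eigenvalues of the derivative in the direction `(a, b)`. -/
def dirFreq (a : Vec n) (b : Vec d) (κ : Freq n d) : ℂ :=
  Complex.I * ((dot a (intVec κ.1) + dot b (intVec κ.2) : ℝ) : ℂ)

theorem norm_dirFreq_le (a : Vec n) (b : Vec d) (κ : Freq n d) :
    ‖dirFreq a b κ‖ ≤ (n * ‖a‖ + d * ‖b‖) * jb κ := by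
  rw [dirFreq, norm_mul, Complex.norm_I, one_mul, Complex.norm_real, Real.norm_eq_abs, add_mul]
  exact (abs_add_le _ _).trans (add_le_add
    ((norm_dot_le a κ.1).trans (mul_le_mul_of_nonneg_left (jb_fst_le κ) (by positivity)))
    ((norm_dot_le b κ.2).trans (mul_le_mul_of_nonneg_left (jb_snd_le κ) (by positivity))))

theorem diagOp_dirFreq_apply (a : Vec n) (b : Vec d) (v : RS (Freq n d)) (κ : Freq n d) :
    (diagOp (dirFreq a b) v).1 κ = dirFreq a b κ * v.1 κ :=
  diagOp_apply (norm_dirFreq_le a b) v κ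

/-- Directional derivatives of series of exponentials. -/
theorem hasDerivAt_sum_dir (v : RS (Freq n d)) (a φ : Vec n) (b x : Vec d) :
    HasDerivAt (fun t : ℝ => (freqWaves n d).sum v.1 (φ + t • a, x + t • b))
      ((freqWaves n d).sum (diagOp (dirFreq a b) v).1 (φ, x)) 0 := by
  have h1 : HasDerivAt (fun t : ℝ => (φ + t • a, x + t • b)) (a, b) 0 := by
    have ha : HasDerivAt (fun t : ℝ => φ + t • a) a 0 := by
      simpa using ((hasDerivAt_id (0 : ℝ)).smul_const a).const_add φ
    have hb : HasDerivAt (fun t : ℝ => x + t • b) b 0 := by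
      simpa using ((hasDerivAt_id (0 : ℝ)).smul_const b).const_add x
    exact ha.prodMk hb
  have h2 := (freqWaves n d).hasFDerivAt_sum_const v (φ, x)
  refine (h2.comp_hasDerivAt_of_eq (0 : ℝ) h1 (by simp)).congr_deriv ?_
  have hv : ∀ j, Summable fun κ =>
      Complex.I * (freqWaves n d).freq j κ * v.1 κ * (freqWaves n d).fn κ (φ, x) := fun j => by
    have hv : LocDecay fun (_ : Vec 0) => v.1 := fun R L => by
      obtain ⟨C, -, hC⟩ := RS.decay v L
      exact ⟨C, fun _ _ => hC⟩
    exact (hv.mul_freq (K := 1) (f := fun x => Complex.I * (freqWaves n d).freq j x) (fun x => by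
      rw [norm_mul, Complex.norm_I, one_mul, one_mul, Complex.norm_real]
      exact (freqWaves n d).freq_le j x)).summable (freqWaves n d) 0 (φ, x)
  simp only [_root_.sum_apply, ContinuousLinearMap.smulRight_apply, Waves.sum]
  have e : ∀ j, (freqWaves n d).dir j (a, b) • ∑' κ,
      Complex.I * (freqWaves n d).freq j κ * v.1 κ * (freqWaves n d).fn κ (φ, x)
      = ∑' κ, (freqWaves n d).dir j (a, b) * (Complex.I * (freqWaves n d).freq j κ * v.1 κ
        * (freqWaves n d).fn κ (φ, x)) := fun j => by
    rw [Complex.real_smul, tsum_mul_left]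
  simp only [e]
  rw [← Summable.tsum_finsetSum fun j _ => (hv j).mul_left _]
  refine tsum_congr fun κ => ?_
  rw [diagOp_dirFreq_apply, Fintype.sum_sum_type]
  simp only [freqWaves, dirFreq, dot, intVec, Sum.elim_inl, Sum.elim_inr]
  push_cast
  simp only [Finset.mul_sum, Finset.sum_mul, mul_add, add_mul]
  congr 1 <;> exact Finset.sum_congr rfl fun i _ => by simp; ring

theorem transport_apply (ν : Vec d) (u : Smooth d) (x : Vec d) :
    (transport ν u).1 x = fderiv ℝ u.1 x ν := by
  have h : (transport ν u).1 x = ∑ i, (ν i : ℂ) * fderiv ℝ u.1 x (Pi.single i 1) := by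
    simp only [transport, LinearMap.sum_apply, LinearMap.smul_apply, Submodule.coe_sum,
      Submodule.coe_smul, Finset.sum_apply, Pi.smul_apply, smul_eq_mul]
    rfl
  rw [h]
  conv_rhs => rw [pi_eq_sum_univ' ν, map_sum]
  refine Finset.sum_congr rfl fun i _ => ?_
  rw [map_smul, Complex.real_smul]

theorem transport_opAt (ν : Vec d) (T : Module.End ℂ (RS (Freq n d))) (φ : Vec n) (u : Smooth d)
    (x : Vec d) : (transport ν (opAt T φ u)).1 x
      = (freqWaves n d).sum (diagOp (dirFreq 0 ν) (T (incl n (four u)))).1 (φ, x) := by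
  rw [transport_apply]
  have h1 : HasDerivAt (fun t : ℝ => (opAt T φ u).1 (x + t • ν))
      (fderiv ℝ (opAt T φ u).1 x ν) 0 := by
    have ha : HasDerivAt (fun t : ℝ => x + t • ν) ν 0 := by
      simpa using ((hasDerivAt_id (0 : ℝ)).smul_const ν).const_add x
    have hf : HasFDerivAt (opAt T φ u).1 (fderiv ℝ (opAt T φ u).1 x) (x + (0 : ℝ) • ν) := by
      simpa using (Smooth.differentiableAt (opAt T φ u) x).hasFDerivAt
    exact hf.comp_hasDerivAt (0 : ℝ) ha
  have h2 := hasDerivAt_sum_dir (T (incl n (four u))) 0 φ ν x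
  refine h1.unique (h2.congr_of_eventuallyEq (Filter.Eventually.of_forall fun t => ?_))
  dsimp only
  rw [opAt_apply, smul_zero, add_zero]

theorem incl_four_transport (ν : Vec d) (u : Smooth d) (a : Vec n) :
    incl n (four (transport ν u)) = diagOp (dirFreq a ν) (incl n (four u)) := by
  refine RS.ext fun κ => ?_
  rw [diagOp_dirFreq_apply, incl_apply, incl_apply]
  split_ifs with h
  · have : four (transport ν u) = ∑ i, (ν i : ℂ) • four (partialD i u) := by
      simp only [transport, LinearMap.sum_apply, LinearMap.smul_apply, map_sum, map_smul]
    rw [this, RS.sum_apply, dirFreq, h]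
    simp only [RS.smul_apply, four_apply, fourierCoeff_partialD]
    have h0 : dot a (intVec (0 : Fin n → ℤ)) = 0 := by simp [dot, intVec]
    rw [h0, zero_add, dot]
    push_cast
    rw [Finset.mul_sum, Finset.sum_mul]
    exact Finset.sum_congr rfl fun i _ => by simp [intVec]; ring
  · rw [mul_zero]

/-- A conjugation of operators in the variables `(φ, x)`, where `φ` moves with frequency `α`, is a
time dependent change of variables on `C^∞(𝕋^d)`. -/
theorem transforms_of_conj {V : Module.End ℂ (RS (Freq n d))} (hV : Tame V) (hVs : ShiftInv V)
    {α : Vec n} {ν : Vec d} {ε : ℝ} {w₀ z w : Hat n d} (hw₀ : Temp w₀)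
    (hu : ∀ φ, IsUnit (opAt V φ))
    (h : fullOp (dirFreq (-α) ν) ε (fun _ _ => 0) w₀ * V = V * fullOp (dirFreq (-α) ν) ε z w) :
    Transforms α (opAt V) (fun φ => transport ν + (ε : ℂ) • opAt (hatOp w₀) φ)
      (fun φ => transport ν + (ε : ℂ) • opAt (hatOp z) φ + (ε : ℂ) • opAt (hatOp w) φ) := by
  refine fun φ => ⟨hu φ, fun u x => ?_⟩
  have h1 := hasDerivAt_sum_dir (V (incl n (four u))) α φ 0 x
  simp only [smul_zero, add_zero] at h1
  refine (h1.congr_of_eventuallyEq (Filter.Eventually.of_forall fun t =>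
    opAt_apply V _ u x)).congr_deriv ?_
  have hz : hatOp (fun _ _ => 0 : Hat n d) = 0 := by
    have h0 : Temp (fun _ _ => 0 : Hat n d) := fun L => ⟨0, 0, le_rfl, by simp⟩
    have := hatOp_smul h0 0
    simpa using this
  set v := incl n (four u) with hv
  have hrel : diagOp (dirFreq (-α) ν) (V v) + (ε : ℂ) • hatOp w₀ (V v)
      = V (diagOp (dirFreq (-α) ν) v) + ((ε : ℂ) • V (hatOp z v) + (ε : ℂ) • V (hatOp w v)) := by
    have := LinearMap.congr_fun h v
    simpa only [fullOp, hz, zero_add, Module.End.mul_apply, LinearMap.add_apply,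
      LinearMap.smul_apply, map_add, map_smul, smul_add] using this
  -- `φ` moves with frequency `α`: `ν·∇` is `-α·∂_φ + ν·∇` plus `α·∂_φ`, and the second term is
  -- the derivative of the change of variables
  have hD : diagOp (dirFreq 0 ν) (V v)
      = diagOp (dirFreq (-α) ν) (V v) + diagOp (dirFreq α 0) (V v) := RS.ext fun κ => by
    rw [RS.add_apply, diagOp_dirFreq_apply, diagOp_dirFreq_apply, diagOp_dirFreq_apply]
    have e0 : dot (0 : Vec n) (intVec κ.1) = 0 := by simp [dot]
    have e0' : dot (0 : Vec d) (intVec κ.2) = 0 := by simp [dot]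
    simp only [dirFreq, dot_neg_left, e0, e0']
    push_cast; ring
  have hS := congrArg (fun w : RS (Freq n d) => (freqWaves n d).sum w.1 (φ, x)) hrel
  simp only [Waves.sum_add, Waves.sum_smul] at hS
  have e1 : ((transport ν + (ε : ℂ) • opAt (hatOp w₀) φ) (opAt V φ u)).1 x
      = (freqWaves n d).sum (diagOp (dirFreq 0 ν) (V v)).1 (φ, x)
        + ε * (freqWaves n d).sum (hatOp w₀ (V v)).1 (φ, x) := by
    have e : (opAt (hatOp w₀) φ (opAt V φ u)).1 x
        = (freqWaves n d).sum (hatOp w₀ (V v)).1 (φ, x) := by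
      rw [← Module.End.mul_apply, ← opAt_mul (hatOp_tame _) (hatOp_shiftInv hw₀), opAt_apply]
      rfl
    rw [← e, ← transport_opAt]
    rfl
  have e2 : (opAt V φ ((transport ν + (ε : ℂ) • opAt (hatOp z) φ
      + (ε : ℂ) • opAt (hatOp w) φ) u)).1 x
      = (freqWaves n d).sum (V (diagOp (dirFreq (-α) ν) v)).1 (φ, x)
        + (ε * (freqWaves n d).sum (V (hatOp z v)).1 (φ, x)
        + ε * (freqWaves n d).sum (V (hatOp w v)).1 (φ, x)) := by
    have e : ∀ a : Hat n d, (opAt V φ (opAt (hatOp a) φ u)).1 x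
        = (freqWaves n d).sum (V (hatOp a v)).1 (φ, x) := fun a => by
      rw [← Module.End.mul_apply, ← opAt_mul hV hVs, opAt_apply]
      rfl
    rw [← e, ← e, hv, ← incl_four_transport, ← opAt_apply, ← add_assoc]
    simp only [LinearMap.add_apply, LinearMap.smul_apply, map_add, map_smul]
    rfl
  rw [e1, e2, ← hS, hD, Waves.sum_add]
  ring

end conjugation

/-! ### Adjoints and symmetries on `C^∞(𝕋^d)` -/

section adjoints
variable {n d : ℕ}

/-- A lattice symbol is determined by the operators on `C^∞(𝕋^d)` that it defines. -/
theorem opAt_injective {T S : Module.End ℂ (RS (Freq n d))}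
    (h : ∀ φ, opAt T φ = opAt S φ) (v : RS (Fin d → ℤ)) : T (incl n v) = S (incl n v) := by
  refine RS.ext fun κ => ?_
  have h1 : ∀ φ, evAt φ (T (incl n v)) = evAt φ (S (incl n v)) := fun φ => by
    have := congrArg four (LinearMap.congr_fun (h φ) (synth v))
    rwa [four_opAt, four_opAt, four_synth] at this
  have hs : ∀ w : RS (Freq n d), Summable fun l : Fin n → ℤ => ‖w.1 (l, κ.2)‖ := fun w => by
    simpa [character_norm] using (angle_summable w 0 κ.2).norm
  have h2 := series_unique (hs (T (incl n v))) (hs (S (incl n v))) fun φ =>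
    congrArg (fun w : RS (Fin d → ℤ) => w.1 κ.2) (h1 φ)
  exact congrFun h2 κ.1

theorem hatOp_opAt_injective {a b : Hat n d} (ha : Temp a) (hb : Temp b)
    (h : ∀ φ, opAt (hatOp a) φ = opAt (hatOp b) φ) : a = b := by
  funext κ q
  have h1 := congrArg (fun w : RS (Freq n d) => w.1 (κ + (0, q))) (opAt_injective h (delta q))
  simpa only [incl_delta, hatOp_delta ha, hatOp_delta hb, add_sub_cancel_right] using h1

/-- Expansion of a pairing with a rapidly decreasing sequence. -/
theorem hasSum_pairing {A : Module.End ℂ (RS (Fin d → ℤ))} (hA : Tame A)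
    (v c : RS (Fin d → ℤ)) :
    HasSum (fun z => v.1 z * ∑' k, (A (delta z)).1 k * c.1 k) (∑' k, (A v).1 k * c.1 k) := by
  -- the pairing is the entry `0` of a matrix with a single non-zero row
  have hG : MatTemp fun x y : Fin d → ℤ => if x = 0 then c.1 y else 0 := fun L => by
    obtain ⟨C, hC0, hC⟩ := RS.decay c L
    refine ⟨C, 0, hC0, fun x y => ?_⟩
    dsimp only
    split_ifs with h
    · simpa [h] using hC y
    · simpa using hC0
  have e : ∀ w : RS (Fin d → ℤ),
      (matOp (fun x y : Fin d → ℤ => if x = 0 then c.1 y else 0) w).1 0 = ∑' k, w.1 k * c.1 k :=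
    fun w => by
      rw [matOp_apply hG]
      exact tsum_congr fun y => by rw [if_pos rfl, mul_comm]
  have h := ((matOp_tame fun x y : Fin d → ℤ => if x = 0 then c.1 y else 0).mul hA).hasSum v 0
  simpa only [Module.End.mul_apply, e] using h

/-- Parseval's identity. -/
theorem l2inner_eq (u v : Smooth d) : l2inner u v
    = ((2 * Real.pi) ^ d : ℝ) * ∑' k, fourierCoeff u k * (starRingEnd ℂ) (fourierCoeff v k) := by
  have hp : (2 * Real.pi) ^ d ≠ 0 := by have := Real.pi_pos; positivity
  obtain ⟨C, -, hC⟩ := RS.decay (four u) (decayExp (Fin d → ℤ))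
  obtain ⟨B, hB⟩ := Smooth.bounded v
  have h := integral_tsum_mul (summable_norm_of_decay hC)
    (fun ξ x => character ξ x * (starRingEnd ℂ) (v.1 x))
    (fun ξ => (contDiff_character ξ).continuous.mul
      (Complex.continuous_conj.comp v.2.1.continuous)) (B := B) fun ξ x => by
        rw [norm_mul, character_norm, one_mul, RCLike.norm_conj]; exact hB x
  have e1 : ∀ x, ∑' ξ, (four u).1 ξ * (character ξ x * (starRingEnd ℂ) (v.1 x))
      = u.1 x * (starRingEnd ℂ) (v.1 x) := fun x => by
    rw [← (hasSum_fourier u x).tsum_eq, ← tsum_mul_right]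
    exact tsum_congr fun ξ => (mul_assoc _ _ _).symm
  have e2 : ∀ ξ, ∫ x in cell d, character ξ x * (starRingEnd ℂ) (v.1 x)
      = ((2 * Real.pi) ^ d : ℝ) * (starRingEnd ℂ) (fourierCoeff v ξ) := fun ξ => by
    rw [fourierCoeff, map_mul, ← integral_conj, Complex.conj_ofReal, ← mul_assoc,
      ← Complex.ofReal_mul, mul_inv_cancel₀ hp, Complex.ofReal_one, one_mul]
    congr 1
    funext x
    rw [map_mul, Complex.conj_conj, mul_comm]
  simp only [e1, e2] at h
  rw [l2inner, ← h.tsum_eq, ← tsum_mul_left]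
  exact tsum_congr fun ξ => by rw [four_apply]; ring

theorem conjRS_mem (v : RS (Fin d → ℤ)) : (fun k => (starRingEnd ℂ) (v.1 k)) ∈ RS (Fin d → ℤ) :=
  fun L => by
    obtain ⟨C, -, hC⟩ := RS.decay v L
    exact ⟨C, fun k => by simpa using hC k⟩

theorem l2inner_adj {a : Hat n d} (ha : Temp a) (ha' : Temp (adj a)) (φ : Vec n) (u v : Smooth d) :
    l2inner (opAt (hatOp a) φ u) v = l2inner u (opAt (hatOp (adj a)) φ v) := by
  rw [l2inner_eq, l2inner_eq]
  congr 1
  have h := hasSum_pairing (atAngle_tame (hatOp_tame a) φ) (four u) ⟨_, conjRS_mem (four v)⟩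
  have e0 : ∀ k, (atAngle (hatOp a) φ (four u)).1 k = fourierCoeff (opAt (hatOp a) φ u) k :=
    fun k => by rw [← four_apply, four_opAt]; rfl
  simp only [e0, four_apply] at h
  rw [← h.tsum_eq]
  refine tsum_congr fun z => ?_
  have h2 := (atAngle_tame (hatOp_tame (adj a)) φ).hasSum (four v) z
  have e : fourierCoeff (opAt (hatOp (adj a)) φ v) z
      = (atAngle (hatOp (adj a)) φ (four v)).1 z := by rw [← four_apply, four_opAt]; rfl
  rw [e, ← h2.tsum_eq, Complex.conj_tsum]
  congr 1
  refine tsum_congr fun k => ?_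
  rw [atAngle_delta ha, atAngle_delta ha', angMat_adj, map_mul, Complex.conj_conj, mul_comm, four_apply]

theorem Smooth.continuous (u : Smooth d) : Continuous u.1 := u.2.1.continuous

theorem l2inner_add_left (u v w : Smooth d) :
    l2inner (u + v) w = l2inner u w + l2inner v w := by
  rw [l2inner, l2inner, l2inner, ← MeasureTheory.integral_add]
  · congr 1
    funext x
    rw [← add_mul]
    rfl
  all_goals
    exact ((Smooth.continuous _).mul (Complex.continuous_conj.comp
      (Smooth.continuous _))).continuousOn.integrableOn_compact isCompact_Icc

/-- Smooth functions with the same scalar products with all smooth functions coincide. -/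
theorem eq_of_l2inner {u v : Smooth d} (h : ∀ w : Smooth d, l2inner u w = l2inner v w) :
    u = v := by
  rw [← synth_four u, ← synth_four v]
  congr 1
  refine RS.ext fun k => ?_
  rw [four_apply, four_apply, fourierCoeff, fourierCoeff]
  exact congrArg _ (h (charS k))

/-- On the level of lattice symbols, `A + A^* = B` means `a + a^* = b`. -/
theorem l2inner_sum_iff {a b : Hat n d} (ha : Temp a) (ha' : Temp (adj a)) (hb : Temp b) :
    (∀ φ, ∀ u v : Smooth d, l2inner (opAt (hatOp a) φ u) v + l2inner u (opAt (hatOp a) φ v)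
      = l2inner (opAt (hatOp b) φ u) v) ↔ b = fun κ q => a κ q + adj a κ q := by
  have key : ∀ φ, ∀ u v : Smooth d,
      l2inner (opAt (hatOp a) φ u) v + l2inner u (opAt (hatOp a) φ v)
        = l2inner (opAt (hatOp fun κ q => a κ q + adj a κ q) φ u) v := fun φ u v => by
    have h := l2inner_adj (n := n) ha' (by rwa [adj_adj]) φ u v
    rw [adj_adj] at h
    rw [← h, hatOp_add ha ha', opAt_add, ← l2inner_add_left]
    rfl
  constructor
  · intro h
    refine hatOp_opAt_injective hb (ha.add ha') fun φ => LinearMap.ext fun u =>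
      eq_of_l2inner fun v => ?_
    rw [← h, key]
  · rintro rfl φ u v
    exact key φ u v

end adjoints

section symmetries
variable {n d : ℕ}

/-- The complex conjugate of a smooth function. -/
def conjS (u : Smooth d) : Smooth d :=
  ⟨fun x => (starRingEnd ℂ) (u.1 x), Complex.conjCLE.contDiff.comp u.2.1, fun x l => by
    dsimp only
    rw [u.2.2]⟩

theorem conj_isInvol : IsInvol (starRingEnd ℂ) := Or.inr rfl
theorem id_isInvol : IsInvol (RingHom.id ℂ) := Or.inl rfl

theorem sum_flip_conj (w : RS (Freq n d)) (y : Vec n × Vec d) :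
    (freqWaves n d).sum (flip conj_isInvol w).1 y
      = (starRingEnd ℂ) ((freqWaves n d).sum w.1 y) := by
  rw [Waves.sum, Waves.sum, Complex.conj_tsum, ← (Equiv.neg _).tsum_eq]
  refine tsum_congr fun κ => ?_
  rw [Equiv.neg_apply, flip_apply, neg_neg, map_mul, freqWaves_fn, freqWaves_fn, map_mul,
    character_conj, character_conj]
  rfl

theorem sum_flip_id (w : RS (Freq n d)) (y : Vec n × Vec d) :
    (freqWaves n d).sum (flip id_isInvol w).1 y = (freqWaves n d).sum w.1 (-y) := by
  rw [Waves.sum, Waves.sum, ← (Equiv.neg _).tsum_eq]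
  refine tsum_congr fun κ => ?_
  rw [Equiv.neg_apply, flip_apply, neg_neg, freqWaves_fn, freqWaves_fn, Prod.fst_neg, Prod.snd_neg,
    Prod.fst_neg, Prod.snd_neg, character_neg_freq, character_neg_freq]
  rfl

theorem incl_four_conjS (u : Smooth d) :
    incl n (four (conjS u)) = flip conj_isInvol (incl n (four u)) := by
  refine RS.ext fun κ => ?_
  rw [flip_apply, incl_apply, incl_apply, apply_ite (starRingEnd ℂ), map_zero]
  simp only [Prod.fst_neg, neg_eq_zero, Prod.snd_neg, four_apply]
  congr 1
  rw [fourierCoeff, fourierCoeff, map_mul, Complex.conj_ofReal, ← integral_conj]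
  congr 2
  funext x
  rw [map_mul, character_conj, character_conj, character_conj, neg_neg]
  rfl

theorem fourierCoeff_reflect (u : Smooth d) (k : Fin d → ℤ) :
    fourierCoeff (reflect d u) k = fourierCoeff u (-k) := by
  have h : reflect d u = synth ⟨fun k => (four u).1 (-k), fun L => by
      obtain ⟨C, -, hC⟩ := RS.decay (four u) L
      exact ⟨C, fun k => by simpa using hC (-k)⟩⟩ := Subtype.ext (funext fun x => by
    change u.1 (-x) = ∑' k, fourierCoeff u (-k) * character k x
    rw [← (hasSum_fourier u (-x)).tsum_eq, ← (Equiv.neg _).tsum_eq]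
    refine tsum_congr fun k => ?_
    rw [Equiv.neg_apply, character_neg_freq, neg_neg])
  rw [← four_apply, h, four_synth]
  rfl

theorem incl_four_reflect (u : Smooth d) :
    incl n (four (reflect d u)) = flip id_isInvol (incl n (four u)) := by
  refine RS.ext fun κ => ?_
  rw [flip_apply, incl_apply, incl_apply]
  simp only [Prod.fst_neg, neg_eq_zero, Prod.snd_neg, four_apply, fourierCoeff_reflect]
  rfl

theorem isRealOp_iff_conj {A : Oper d} : IsRealOp A ↔ ∀ u, A (conjS u) = conjS (A u) := by
  constructor
  · intro h u
    -- the real and imaginary parts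
    set a : Smooth d := (1 / 2 : ℂ) • (u + conjS u) with ha
    set b : Smooth d := (-Complex.I / 2) • (u - conjS u) with hb
    have hab : u = a + Complex.I • b := by
      rw [ha, hb, smul_smul]
      have : Complex.I * (-Complex.I / 2) = 1 / 2 := by
        rw [mul_div_assoc', mul_neg, Complex.I_mul_I, neg_neg]
      rw [this]; module
    have hab' : conjS u = a - Complex.I • b := by
      rw [ha, hb, smul_smul]
      have : Complex.I * (-Complex.I / 2) = 1 / 2 := by
        rw [mul_div_assoc', mul_neg, Complex.I_mul_I, neg_neg]
      rw [this]; module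
    have hra := h a fun x => by
      change ((1 / 2 : ℂ) * (u.1 x + (starRingEnd ℂ) (u.1 x))).im = 0
      simp
    have hrb := h b fun x => by
      change ((-Complex.I / 2) * (u.1 x - (starRingEnd ℂ) (u.1 x))).im = 0
      simp
    refine Subtype.ext (funext fun x => ?_)
    have e1 : (A (conjS u)).1 x = (A a).1 x - Complex.I * (A b).1 x := by
      rw [hab', map_sub, map_smul A Complex.I b]; rfl
    have e2 : (A u).1 x = (A a).1 x + Complex.I * (A b).1 x := by
      conv_lhs => rw [hab, map_add, map_smul A Complex.I b]
      rfl
    change _ = (starRingEnd ℂ) ((A u).1 x)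
    rw [e1, e2, map_add, map_mul, Complex.conj_I, Complex.conj_eq_iff_im.2 (hra x),
      Complex.conj_eq_iff_im.2 (hrb x)]
    ring
  · intro h u hu x
    have hu' : conjS u = u := Subtype.ext (funext fun x => Complex.conj_eq_iff_im.2 (hu x))
    have := h u
    rw [hu'] at this
    exact Complex.conj_eq_iff_im.1 (congrArg (fun w : Smooth d => w.1 x) this).symm

theorem conjS_opAt (T : Module.End ℂ (RS (Freq n d))) (φ : Vec n) (u : Smooth d) (x : Vec d) :
    (conjS (opAt T φ u)).1 x
      = (freqWaves n d).sum (flip conj_isInvol (T (incl n (four u)))).1 (φ, x) := by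
  rw [sum_flip_conj, ← opAt_apply]
  rfl

theorem reflect_opAt (T : Module.End ℂ (RS (Freq n d))) (φ : Vec n) (u : Smooth d) (x : Vec d) :
    (reflect d (opAt T (-φ) u)).1 x
      = (freqWaves n d).sum (flip id_isInvol (T (incl n (four u)))).1 (φ, x) := by
  rw [sum_flip_id]
  exact opAt_apply T (-φ) u (-x)

/-- A series of exponentials determines its coefficients. -/
theorem eq_of_sum {v w : RS (Freq n d)}
    (h : ∀ y, (freqWaves n d).sum v.1 y = (freqWaves n d).sum w.1 y) : v = w := by
  refine RS.ext fun κ => ?_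
  have h1 : ∀ φ, evAt φ v = evAt φ w := fun φ => by
    rw [← four_synth (evAt φ v), ← four_synth (evAt φ w)]
    congr 1
    refine Subtype.ext (funext fun x => ?_)
    rw [synth_apply, synth_apply, sum_evAt, sum_evAt, h]
  have hs : ∀ w : RS (Freq n d), Summable fun l : Fin n → ℤ => ‖w.1 (l, κ.2)‖ := fun w => by
    simpa [character_norm] using (angle_summable w 0 κ.2).norm
  have h2 := series_unique (hs v) (hs w) fun φ =>
    congrArg (fun w : RS (Fin d → ℤ) => w.1 κ.2) (h1 φ)
  exact congrFun h2 κ.1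

theorem hatSym_of_incl {σ : ℂ →+* ℂ} (hσ : IsInvol σ) {s : ℝ} {a : Hat n d} (ha : Temp a)
    (h : ∀ v : RS (Fin d → ℤ),
      hatOp a (flip hσ (incl n v)) = (s : ℂ) • flip hσ (hatOp a (incl n v))) :
    HatSym σ s a := fun κ q => by
  have h1 := congrArg (fun w : RS (Freq n d) => w.1 (-κ + (0, -q))) (h (delta q))
  simp only [RS.smul_apply, flip_apply, incl_delta, flip_delta, hatOp_delta ha] at h1
  have e0 : ((0, -q) : Freq n d) = -(0, q) := by simp
  have e1 : -κ + (0, -q) - -((0, q) : Freq n d) = -κ := by rw [e0]; abel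
  have e2 : -(-κ + (0, -q)) - ((0, q) : Freq n d) = κ := by rw [e0]; abel
  rw [e1, e2] at h1
  exact h1

/-- Reality of the operators as a symmetry of the lattice symbol. -/
theorem isRealOp_iff_hatSym {a : Hat n d} (ha : Temp a) :
    (∀ φ, IsRealOp (opAt (hatOp a) φ)) ↔ HatSym (starRingEnd ℂ) 1 a := by
  simp only [isRealOp_iff_conj]
  constructor
  · refine fun h => hatSym_of_incl conj_isInvol ha fun v => eq_of_sum fun y => ?_
    have h1 := congrArg (fun w : Smooth d => w.1 y.2) (h y.1 (synth v))
    simp only [conjS_opAt] at h1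
    rw [opAt_apply, incl_four_conjS, four_synth] at h1
    rw [Complex.ofReal_one, one_smul]
    exact h1
  · intro h φ u
    refine Subtype.ext (funext fun x => ?_)
    rw [conjS_opAt, opAt_apply, incl_four_conjS, h.opSym (hσ := conj_isInvol) ha,
      Complex.ofReal_one, one_smul]

/-- Reversibility of the operators as a symmetry of the lattice symbol. -/
theorem isReversible_iff_hatSym {a : Hat n d} (ha : Temp a) :
    IsReversible (fun φ : Vec n => opAt (hatOp a) φ) ↔ HatSym (RingHom.id ℂ) (-1) a := by
  have key : ∀ φ u x, (-(reflect d * opAt (hatOp a) (-φ)) u : Smooth d).1 x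
      = -(freqWaves n d).sum (flip id_isInvol (hatOp a (incl n (four u)))).1 (φ, x) :=
    fun φ u x => by
      rw [← reflect_opAt]; rfl
  constructor
  · refine fun h => hatSym_of_incl id_isInvol ha fun v => eq_of_sum fun y => ?_
    have h1 := congrArg (fun w : Smooth d => w.1 y.2) (LinearMap.congr_fun (h y.1) (synth v))
    dsimp only at h1
    rw [LinearMap.neg_apply, key, Module.End.mul_apply, opAt_apply, incl_four_reflect,
      four_synth] at h1
    rw [Waves.sum_smul, h1]
    push_cast; ring
  · intro h φ
    refine LinearMap.ext fun u => Subtype.ext (funext fun x => ?_)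
    rw [LinearMap.neg_apply, key, Module.End.mul_apply, opAt_apply, incl_four_reflect,
      h.opSym (hσ := id_isInvol) ha, Waves.sum_smul]
    push_cast; ring

end symmetries

/-! ### Symbols with real frequencies -/

section symbols
variable {n d : ℕ}

/-- Smooth functions of `(φ, x, ξ)` that are periodic in `φ` and `x`. -/
def PSym (n d : ℕ) : Submodule ℂ (Phase n d → ℂ) where
  carrier := {f | ContDiff ℝ ∞ f ∧ ∀ (l : Fin n → ℤ) (k : Fin d → ℤ) p,
    f (p + ((2 * Real.pi) • intVec l, (2 * Real.pi) • intVec k, 0)) = f p}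
  add_mem' := fun {a b} ha hb =>
    ⟨ha.1.add hb.1, fun l k p => by simp only [Pi.add_apply, ha.2 l k p, hb.2 l k p]⟩
  zero_mem' := ⟨contDiff_const, fun _ _ _ => rfl⟩
  smul_mem' := fun c a ha =>
    ⟨contDiff_const.smul ha.1, fun l k p => by simp only [Pi.smul_apply, ha.2 l k p]⟩

theorem PSym.differentiableAt (f : PSym n d) (p : Phase n d) : DifferentiableAt ℝ f.1 p :=
  f.2.1.differentiable (by simp) p

/-- A partial derivative of a symbol. -/
def PSym.deriv (f : PSym n d) (c : Fin n ⊕ Fin d ⊕ Fin d) : PSym n d :=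
  ⟨fun p => fderiv ℝ f.1 p (coordDir c),
    (f.2.1.fderiv_right (m := ∞) (by simp)).clm_apply contDiff_const, fun l k p => by
      have h2 := fderiv_comp_add_right (𝕜 := ℝ) (f := f.1) (x := p)
        (((2 * Real.pi) • intVec l, (2 * Real.pi) • intVec k, 0) : Phase n d)
      rw [show (fun y => f.1 (y + ((2 * Real.pi) • intVec l, (2 * Real.pi) • intVec k, 0))) = f.1
        from funext fun y => f.2.2 l k y] at h2
      dsimp only
      rw [h2]⟩

theorem PSym.deriv_sub (c : Fin n ⊕ Fin d ⊕ Fin d) (f g : PSym n d) :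
    PSym.deriv (f - g) c = PSym.deriv f c - PSym.deriv g c := Subtype.ext (funext fun p => by
  change fderiv ℝ (f.1 - g.1) p _ = fderiv ℝ f.1 p _ - fderiv ℝ g.1 p _
  rw [fderiv_sub (PSym.differentiableAt f p) (PSym.differentiableAt g p)]
  rfl)

/-- Repeated partial derivatives, the first direction of the list being applied last. -/
def PSym.dl : List (Fin n ⊕ Fin d ⊕ Fin d) → PSym n d → PSym n d
  | [], f => f
  | c :: v, f => PSym.deriv (PSym.dl v f) c

theorem PSym.dl_append (u v : List (Fin n ⊕ Fin d ⊕ Fin d)) (f : PSym n d) :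
    PSym.dl (u ++ v) f = PSym.dl u (PSym.dl v f) := by
  induction u with
  | nil => rfl
  | cons c u ih => simp only [List.cons_append, PSym.dl, ih]

theorem PSym.dl_sub (v : List (Fin n ⊕ Fin d ⊕ Fin d)) (f g : PSym n d) :
    PSym.dl v (f - g) = PSym.dl v f - PSym.dl v g := by
  induction v with
  | nil => rfl
  | cons c v ih => simp only [PSym.dl, ih, PSym.deriv_sub]

theorem mixedDeriv_eq {N : ℕ} (v : Fin N → Fin n ⊕ Fin d ⊕ Fin d) (f : PSym n d) (p : Phase n d) :
    mixedDeriv v f.1 p = (PSym.dl (List.ofFn v) f).1 p := by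
  induction N generalizing p with
  | zero => simp [mixedDeriv, PSym.dl]
  | succ N ih =>
    rw [List.ofFn_succ, PSym.dl]
    have h : (PSym.dl (List.ofFn fun i => v i.succ) f).1
        = fun p => iteratedFDeriv ℝ N f.1 p fun i => coordDir (v i.succ) :=
      funext fun p => (ih (fun i => v i.succ) p).symm
    change _ = fderiv ℝ (PSym.dl (List.ofFn fun i => v i.succ) f).1 p (coordDir (v 0))
    rw [h, mixedDeriv, iteratedFDeriv_succ_apply_left]
    have hd : DifferentiableAt ℝ (iteratedFDeriv ℝ N f.1) p :=
      f.2.1.differentiable_iteratedFDeriv (by exact_mod_cast WithTop.coe_lt_top _) p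
    rw [fderiv_continuousMultilinear_apply_const_apply hd]
    rfl

/-- The number of `ξ`-derivatives in a list. -/
def xiCount (v : List (Fin n ⊕ Fin d ⊕ Fin d)) : ℕ :=
  (v.filter fun c => c.elim (fun _ => false) fun c => c.elim (fun _ => false) fun _ => true).length

@[simp] theorem xiCount_nil : xiCount ([] : List (Fin n ⊕ Fin d ⊕ Fin d)) = 0 := rfl

theorem xiCount_cons (c : Fin n ⊕ Fin d ⊕ Fin d) (v : List (Fin n ⊕ Fin d ⊕ Fin d)) :
    xiCount (c :: v) = xiCount [c] + xiCount v := by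
  rcases c with i | i | i <;> simp [xiCount, List.filter_cons, Nat.add_comm]

theorem xiCount_append (u v : List (Fin n ⊕ Fin d ⊕ Fin d)) :
    xiCount (u ++ v) = xiCount u + xiCount v := by simp [xiCount]

theorem xiOrder_eq {N : ℕ} (v : Fin N → Fin n ⊕ Fin d ⊕ Fin d) :
    xiOrder v = xiCount (List.ofFn v) := by
  induction N with
  | zero => simp [xiOrder, xiCount]
  | succ N ih =>
    rw [List.ofFn_succ, xiCount_cons, ← ih, xiOrder, xiOrder, Finset.card_filter,
      Finset.card_filter, Fin.sum_univ_succ]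
    congr 1
    rcases h : v 0 with i | i | i <;> simp [xiCount, List.filter_cons]

/-- The difference of a symbol in the direction `ξ_j`. -/
def PSym.diff (f : PSym n d) (j : Fin d) : PSym n d :=
  ⟨fun p => f.1 (p + coordDir (.inr (.inr j))) - f.1 p,
    (f.2.1.comp (contDiff_id.add contDiff_const)).sub f.2.1, fun l k p => by
      dsimp only
      rw [f.2.2, add_right_comm, f.2.2]⟩

theorem PSym.deriv_diff (c : Fin n ⊕ Fin d ⊕ Fin d) (j : Fin d) (f : PSym n d) :
    PSym.deriv (PSym.diff f j) c = PSym.diff (PSym.deriv f c) j := Subtype.ext (funext fun p => by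
  change fderiv ℝ (fun p => f.1 (p + coordDir (.inr (.inr j))) - f.1 p) p _
    = fderiv ℝ f.1 (p + coordDir (.inr (.inr j))) _ - fderiv ℝ f.1 p _
  have h1 : DifferentiableAt ℝ (fun p => f.1 (p + coordDir (.inr (.inr j)))) p :=
    (PSym.differentiableAt f _).comp p (differentiableAt_id.add_const _)
  rw [fderiv_fun_sub h1 (PSym.differentiableAt f p), fderiv_comp_add_right]
  rfl)

theorem PSym.dl_diff (v : List (Fin n ⊕ Fin d ⊕ Fin d)) (j : Fin d) (f : PSym n d) :
    PSym.dl v (PSym.diff f j) = PSym.diff (PSym.dl v f) j := by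
  induction v with
  | nil => rfl
  | cons c v ih => simp only [PSym.dl, ih, PSym.deriv_diff]

/-- Repeated differences in `ξ`. -/
def PSym.ddl : List (Fin d) → PSym n d → PSym n d
  | [], f => f
  | j :: v, f => PSym.ddl v (PSym.diff f j)

theorem PSym.dl_ddl (u : List (Fin n ⊕ Fin d ⊕ Fin d)) (v : List (Fin d)) (f : PSym n d) :
    PSym.dl u (PSym.ddl v f) = PSym.ddl v (PSym.dl u f) := by
  induction v generalizing f with
  | nil => rfl
  | cons j v ih => simp only [PSym.ddl, ih, PSym.dl_diff]

/-- A difference is controlled by the corresponding derivative. -/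
theorem PSym.norm_diff_le (μ : ℝ) (j : Fin d) (f : PSym n d) {B : ℝ}
    (h : ∀ p, ‖(PSym.deriv f (.inr (.inr j))).1 p‖ ≤ B * jb p.2.2 ^ μ) (p : Phase n d) :
    ‖(PSym.diff f j).1 p‖ ≤ 2 ^ ⌈|μ|⌉₊ * B * jb p.2.2 ^ μ := by
  have hB : 0 ≤ B := by
    have h0 := (norm_nonneg _).trans (h 0)
    have : (0 : Phase n d).2.2 = 0 := rfl
    rw [this, jb_zero, Real.one_rpow, mul_one] at h0
    exact h0
  set c : Phase n d := coordDir (.inr (.inr j)) with hc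
  have hd : ∀ t ∈ Set.Icc (0 : ℝ) 1, HasDerivWithinAt (fun t : ℝ => f.1 (p + t • c))
      ((PSym.deriv f (.inr (.inr j))).1 (p + t • c)) (Set.Icc 0 1) t := fun t _ => by
    have h1 : HasDerivAt (fun t : ℝ => p + t • c) c t := by
      simpa using ((hasDerivAt_id t).smul_const c).const_add p
    exact ((PSym.differentiableAt f _).hasFDerivAt.comp_hasDerivAt t h1).hasDerivWithinAt
  have hb : ∀ t ∈ Set.Ico (0 : ℝ) 1, ‖(PSym.deriv f (.inr (.inr j))).1 (p + t • c)‖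
      ≤ 2 ^ ⌈|μ|⌉₊ * B * jb p.2.2 ^ μ := fun t ht => by
    refine (h _).trans ?_
    have e : (p + t • c).2.2 = p.2.2 + t • (Pi.single j 1 : Vec d) := rfl
    have h2 : jb (t • (Pi.single j 1 : Vec d)) ≤ 2 := by
      have : ‖(Pi.single j 1 : Vec d)‖ = 1 := by rw [Pi.norm_single, norm_one]
      rw [jb, norm_smul, this, Real.norm_of_nonneg ht.1]; linarith [ht.2]
    calc B * jb (p + t • c).2.2 ^ μ
        ≤ B * (jb p.2.2 ^ μ * jb (t • (Pi.single j 1 : Vec d)) ^ ⌈|μ|⌉₊) := by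
          rw [e]; gcongr; exact jb_add_rpow_le _ _ _
      _ ≤ B * (jb p.2.2 ^ μ * 2 ^ ⌈|μ|⌉₊) := by
          have := jb_rpow_pos p.2.2 μ
          have := jb_pos (t • (Pi.single j 1 : Vec d))
          gcongr
      _ = _ := by ring
  have := norm_image_sub_le_of_norm_deriv_le_segment' hd hb 1 (by simp)
  simp only [one_smul, zero_smul, add_zero, sub_zero, mul_one] at this
  exact this

theorem PSym.norm_ddl_le (v : List (Fin d)) (μ : ℝ) : ∃ A : ℝ, 0 ≤ A ∧
    ∀ (f : PSym n d) (B : ℝ),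
      (∀ p, ‖(PSym.dl (v.map fun j => .inr (.inr j)) f).1 p‖ ≤ B * jb p.2.2 ^ μ) →
      ∀ p, ‖(PSym.ddl v f).1 p‖ ≤ A * B * jb p.2.2 ^ μ := by
  induction v with
  | nil => exact ⟨1, zero_le_one, fun f B h p => by rw [one_mul]; exact h p⟩
  | cons j v ih =>
    obtain ⟨A, hA, h⟩ := ih
    refine ⟨A * 2 ^ ⌈|μ|⌉₊, by positivity, fun f B hf p => ?_⟩
    rw [mul_assoc A]
    refine h (PSym.diff f j) _ (fun p => ?_) p
    rw [PSym.dl_diff]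
    exact PSym.norm_diff_le μ j _ hf p

/-- The splitting of the variables `(φ, x)`. -/
def splitVar (n d : ℕ) : Vec (n + d) →L[ℝ] Vec n × Vec d :=
  ContinuousLinearMap.prod
    (ContinuousLinearMap.pi fun i => ContinuousLinearMap.proj (Fin.castAdd d i))
    (ContinuousLinearMap.pi fun i => ContinuousLinearMap.proj (Fin.natAdd n i))

theorem splitVar_apply (y : Vec (n + d)) :
    splitVar n d y = (fun i => y (Fin.castAdd d i), fun i => y (Fin.natAdd n i)) := rfl

/-- The joined frequency. -/
def joinFreq (κ : Freq n d) : Fin (n + d) → ℤ := Fin.append κ.1 κ.2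

theorem character_joinFreq (κ : Freq n d) (y : Vec (n + d)) :
    character (joinFreq κ) y = (freqWaves n d).fn κ (splitVar n d y) := by
  rw [freqWaves_fn, character, character, character, ← Complex.exp_add]
  congr 1
  simp only [dot, intVec, joinFreq, Fin.sum_univ_add, Fin.append_left, Fin.append_right,
    splitVar_apply]
  push_cast; ring

theorem norm_joinFreq (κ : Freq n d) : ‖κ‖ ≤ ‖joinFreq κ‖ := by
  refine max_le ((pi_norm_le_iff_of_nonneg (norm_nonneg _)).2 fun i => ?_)
    ((pi_norm_le_iff_of_nonneg (norm_nonneg _)).2 fun i => ?_)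
  · simpa [joinFreq] using norm_le_pi_norm (joinFreq κ) (Fin.castAdd d i)
  · simpa [joinFreq] using norm_le_pi_norm (joinFreq κ) (Fin.natAdd n i)

/-- A symbol at a fixed frequency `ξ`, as a function on `𝕋^{n+d}`. -/
def PSym.slice (f : PSym n d) (ξ : Vec d) : Smooth (n + d) :=
  ⟨fun y => f.1 ((splitVar n d y).1, (splitVar n d y).2, ξ),
    f.2.1.comp (((contDiff_fst.comp (splitVar n d).contDiff)).prodMk
      ((contDiff_snd.comp (splitVar n d).contDiff).prodMk contDiff_const)), fun y l => by
    have h := f.2.2 (fun i => l (Fin.castAdd d i)) (fun i => l (Fin.natAdd n i))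
      ((splitVar n d y).1, (splitVar n d y).2, ξ)
    refine Eq.trans (congrArg f.1 ?_) h
    simp only [map_add, splitVar_apply, Prod.mk_add_mk, add_zero]
    rfl⟩

/-- The directions `φ` and `x` among the coordinate directions. -/
def torusDir (j : Fin (n + d)) : Fin n ⊕ Fin d ⊕ Fin d :=
  Fin.addCases (fun i => .inl i) (fun i => .inr (.inl i)) j

theorem xiCount_replicate (j : Fin (n + d)) (L : ℕ) :
    xiCount (List.replicate L (torusDir (n := n) (d := d) j)) = 0 := by
  refine Fin.addCases (fun i => ?_) (fun i => ?_) j <;> simp [torusDir, xiCount]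

theorem coordDir_torusDir (j : Fin (n + d)) : (coordDir (torusDir (n := n) (d := d) j) : Phase n d)
    = ((splitVar n d (Pi.single j 1)).1, (splitVar n d (Pi.single j 1)).2, 0) := by
  refine Fin.addCases (fun i => ?_) (fun i => ?_) j
  · simp only [torusDir, Fin.addCases_left, coordDir, splitVar_apply, Prod.mk.injEq, and_true]
    constructor <;> funext i' <;> simp [Pi.single_apply, Fin.ext_iff]
    omega
  · simp only [torusDir, Fin.addCases_right, coordDir, splitVar_apply, Prod.mk.injEq, and_true]
    constructor <;> funext i' <;> simp [Pi.single_apply, Fin.ext_iff]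
    omega

theorem PSym.partialD_slice (j : Fin (n + d)) (f : PSym n d) (ξ : Vec d) :
    partialD j (PSym.slice f ξ) = PSym.slice (PSym.deriv f (torusDir j)) ξ := by
  refine Subtype.ext (funext fun y => ?_)
  rw [partialD_apply]
  have ha : HasFDerivAt (fun y : Vec (n + d) => (splitVar n d y).1)
      ((ContinuousLinearMap.fst ℝ (Vec n) (Vec d)).comp (splitVar n d)) y :=
    ContinuousLinearMap.hasFDerivAt _
  have hb : HasFDerivAt (fun y : Vec (n + d) => (splitVar n d y).2)
      ((ContinuousLinearMap.snd ℝ (Vec n) (Vec d)).comp (splitVar n d)) y :=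
    ContinuousLinearMap.hasFDerivAt _
  have h1 := ha.prodMk (hb.prodMk (hasFDerivAt_const ξ y))
  have h2 := (PSym.differentiableAt f _).hasFDerivAt.comp y h1
  change fderiv ℝ (f.1 ∘ fun y : Vec (n + d) =>
      (((splitVar n d y).1, (splitVar n d y).2, ξ) : Phase n d)) y _
    = fderiv ℝ f.1 _ (coordDir (torusDir j))
  rw [h2.fderiv, coordDir_torusDir]
  rfl

theorem PSym.partialD_pow_slice (j : Fin (n + d)) (L : ℕ) (f : PSym n d) (ξ : Vec d) :
    (partialD j ^ L) (PSym.slice f ξ) = PSym.slice (PSym.dl (List.replicate L (torusDir j)) f) ξ := by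
  induction L with
  | zero => rfl
  | succ L ih => rw [pow_succ', Module.End.mul_apply, ih, PSym.partialD_slice]; rfl

/-- The lattice symbol of a symbol. -/
def PSym.hat (f : PSym n d) : Hat n d := fun κ q => fourierCoeff (PSym.slice f (intVec q)) (joinFreq κ)

theorem fourierCoeff_sub {k : ℕ} (u v : Smooth k) (ξ : Fin k → ℤ) :
    fourierCoeff (u - v) ξ = fourierCoeff u ξ - fourierCoeff v ξ := by
  have := RS.sub_apply (four u) (four v) ξ
  rwa [← map_sub] at this

theorem PSym.hat_sub (f g : PSym n d) : PSym.hat (f - g) = fun κ q => PSym.hat f κ q - PSym.hat g κ q := by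
  funext κ q
  rw [PSym.hat, PSym.hat, PSym.hat, ← fourierCoeff_sub]
  rfl

theorem PSym.diffList_hat (v : List (Fin d)) (f : PSym n d) (κ : Freq n d) (q : Fin d → ℤ) :
    diffList v (PSym.hat f κ) q = PSym.hat (PSym.ddl v f) κ q := by
  induction v generalizing f with
  | nil => rfl
  | cons j v ih =>
    rw [diffList, PSym.ddl, ← ih]
    congr 1
    funext q
    rw [PSym.hat, PSym.hat, PSym.hat, ← fourierCoeff_sub]
    congr 1
    refine Subtype.ext (funext fun y => ?_)
    change f.1 (_, _, intVec (q + Pi.single j 1)) - f.1 (_, _, intVec q)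
      = f.1 (_ + coordDir (.inr (.inr j))) - f.1 (_, _, intVec q)
    rw [intVec_add, intVec_single]
    simp [coordDir]

/-- The seminorms of the lattice symbol of a symbol. -/
theorem PSym.hat_bound (v : List (Fin d)) (L : ℕ) (m : ℝ) : ∃ A : ℝ, 0 ≤ A ∧
    ∀ (f : PSym n d) (B : ℝ),
      (∀ p, ‖(PSym.dl (v.map fun j => .inr (.inr j)) f).1 p‖ ≤ B * jb p.2.2 ^ m) →
      (∀ j : Fin (n + d), ∀ p,
        ‖(PSym.dl ((v.map fun j => .inr (.inr j)) ++ List.replicate L (torusDir j)) f).1 p‖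
          ≤ B * jb p.2.2 ^ m) →
      ∀ κ q, jb κ ^ L * ‖diffList v (PSym.hat f κ) q‖ ≤ A * B * jb q ^ m := by
  obtain ⟨A, hA, h⟩ := PSym.norm_ddl_le (n := n) v m
  refine ⟨2 ^ L * A, by positivity, fun f B h0 hL κ q => ?_⟩
  rw [PSym.diffList_hat, PSym.hat]
  have h1 := fourierCoeff_decay L (u := PSym.slice (PSym.ddl v f) (intVec q)) (B := A * B * jb q ^ m)
    (fun y => ?_) (fun j y => ?_) (joinFreq κ)
  · refine le_trans (mul_le_mul_of_nonneg_right ?_ (norm_nonneg _)) (h1.trans (le_of_eq (by ring)))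
    refine pow_le_pow_left₀ (jb_pos κ).le ?_ L
    unfold jb; linarith [norm_joinFreq κ]
  · have := h f B h0 ((splitVar n d y).1, (splitVar n d y).2, intVec q)
    rwa [jb_intVec] at this
  · rw [PSym.partialD_pow_slice, PSym.dl_ddl]
    have := h (PSym.dl (List.replicate L (torusDir j)) f) B (fun p => by
      rw [← PSym.dl_append]; exact hL j p) ((splitVar n d y).1, (splitVar n d y).2, intVec q)
    rwa [jb_intVec] at this

/-- The Fourier expansion of a symbol in `(φ, x)`. -/
theorem PSym.latticeSymbol_hat (f : PSym n d) (φ : Vec n) (x : Vec d) (q : Fin d → ℤ) :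
    latticeSymbol (PSym.hat f) φ x q = f.1 (φ, x, intVec q) := by
  have h := hasSum_fourier (PSym.slice f (intVec q)) (Fin.append φ x)
  have e : splitVar n d (Fin.append φ x) = (φ, x) := by
    rw [splitVar_apply]; simp
  have hj : Function.Bijective (joinFreq : Freq n d → (Fin (n + d) → ℤ)) :=
    (Fin.appendEquiv n d (α := ℤ)).bijective
  rw [← (Equiv.ofBijective _ hj).hasSum_iff] at h
  have h2 : (PSym.slice f (intVec q)).1 (Fin.append φ x) = f.1 (φ, x, intVec q) := by
    change f.1 ((splitVar n d _).1, (splitVar n d _).2, _) = _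
    rw [e]
  rw [← h2, ← h.tsum_eq, latticeSymbol, Waves.sum]
  refine tsum_congr fun κ => ?_
  simp only [Function.comp, Equiv.ofBijective_apply, character_joinFreq, e]
  rfl

end symbols

/-! ### Interpolation of functions on the lattice by band limited kernels -/

section bump

/-- Smooth functions with support in `[-3/4, 3/4]`. -/
def IsBump (f : ℝ → ℂ) : Prop := ContDiff ℝ ∞ f ∧ ∀ t, 3 / 4 < |t| → f t = 0

theorem IsBump.hasCompactSupport {f : ℝ → ℂ} (hf : IsBump f) : HasCompactSupport f :=
  HasCompactSupport.intro (K := Set.Icc (-(3 / 4)) (3 / 4)) isCompact_Icc fun t ht => by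
    refine hf.2 t ?_
    by_contra h
    exact ht (abs_le.1 (not_lt.1 h))

/-- The Fourier transform on the line. -/
def ft (f : ℝ → ℂ) : ℝ → ℂ := FourierTransform.fourier f

theorem ft_apply (f : ℝ → ℂ) (ξ : ℝ) :
    ft f ξ = ∫ t : ℝ, Complex.exp (-2 * Real.pi * Complex.I * t * ξ) * f t := by
  rw [ft, Real.fourier_real_eq_integral_exp_smul]
  congr 1
  funext t
  rw [smul_eq_mul]
  congr 2
  push_cast; ring

theorem IsBump.ft_decay {f : ℝ → ℂ} (hf : IsBump f) (N : ℕ) : ∃ C : ℝ, 0 ≤ C ∧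
    ∀ ξ : ℝ, (1 + |ξ|) ^ N * ‖ft f ξ‖ ≤ C := by
  set F := FourierTransform.fourier (hf.hasCompactSupport.toSchwartzMap hf.1) with hF
  have h := fun ξ : ℝ => SchwartzMap.one_add_le_sup_seminorm_apply (𝕜 := ℂ) (m := (N, 0)) (k := N)
    (n := 0) le_rfl le_rfl F ξ
  have e : ∀ ξ, F ξ = ft f ξ := fun ξ => by
    rw [hF, SchwartzMap.fourier_coe]; rfl
  simp only [norm_iteratedFDeriv_zero, e, Real.norm_eq_abs] at h
  exact ⟨_, (by positivity : (0 : ℝ) ≤ (1 + |(0 : ℝ)|) ^ N * ‖ft f 0‖).trans (h 0), h⟩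

/-- The entire function `(e^z - 1) / z`. -/
def expQuot : ℂ → ℂ := dslope Complex.exp 0

theorem mul_expQuot (z : ℂ) : z * expQuot z = Complex.exp z - 1 := by
  have := sub_smul_dslope Complex.exp 0 z
  simpa [expQuot] using this

theorem contDiff_expQuot : ContDiff ℝ ∞ expQuot := by
  have h : DifferentiableOn ℂ expQuot Set.univ :=
    (Complex.differentiableOn_dslope Filter.univ_mem).2 Complex.differentiable_exp.differentiableOn
  exact (differentiableOn_univ.1 h).contDiff.restrict_scalars ℝ

theorem expQuot_ne_zero {t : ℝ} (ht : |t| < 1) : expQuot (-2 * Real.pi * Complex.I * t) ≠ 0 := by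
  intro h0
  have h := mul_expQuot (-2 * Real.pi * Complex.I * t)
  rw [h0, mul_zero] at h
  obtain ⟨N, hN⟩ := Complex.exp_eq_one_iff.1 (sub_eq_zero.1 h.symm)
  have hI : (2 * Real.pi * Complex.I : ℂ) ≠ 0 := Complex.two_pi_I_ne_zero
  have h1 : (-t : ℂ) = N := mul_right_cancel₀ hI (by rw [← hN]; ring)
  have h2 : -t = (N : ℝ) := by exact_mod_cast h1
  have h3 : |(N : ℝ)| < 1 := by rwa [← h2, abs_neg]
  have h4 : N = 0 := by
    rw [← Int.abs_lt_one_iff]; exact_mod_cast h3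
  have h5 : t = 0 := by rw [h4] at h2; simpa using h2
  rw [h5] at h0
  simp [expQuot] at h0

/-- The bump function whose transform has as differences the derivative of the transform
of `f`. -/
def quot (f : ℝ → ℂ) (t : ℝ) : ℂ := (expQuot (-2 * Real.pi * Complex.I * t))⁻¹ * f t

/-- The divisor `exp (-2πit) - 1` has no zeros with `0 < |t| < 1`, and `f` vanishes for
`|t| > 3/4`. -/
theorem IsBump.quot {f : ℝ → ℂ} (hf : IsBump f) : IsBump (quot f) := by
  refine ⟨contDiff_iff_contDiffAt.2 fun t => ?_, fun t ht => by
    rw [TorusPDO.quot, hf.2 t ht, mul_zero]⟩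
  by_cases ht : |t| < 1
  · refine ContDiffAt.mul (ContDiffAt.inv ?_ (expQuot_ne_zero ht)) hf.1.contDiffAt
    exact (contDiff_expQuot.comp (contDiff_const.mul Complex.ofRealCLM.contDiff)).contDiffAt
  · have h : ∀ᶠ s in nhds t, TorusPDO.quot f s = 0 := by
      have : ∀ᶠ s in nhds t, 3 / 4 < |s| :=
        continuous_abs.continuousAt.eventually (lt_mem_nhds (by linarith))
      filter_upwards [this] with s hs
      rw [TorusPDO.quot, hf.2 s hs, mul_zero]
    exact contDiffAt_const.congr_of_eventuallyEq h

theorem quot_mul {f : ℝ → ℂ} (hf : IsBump f) (t : ℝ) :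
    (-2 * Real.pi * Complex.I * t) * f t
      = quot f t * (Complex.exp (-2 * Real.pi * Complex.I * t) - 1) := by
  by_cases ht : |t| < 1
  · rw [← mul_expQuot, quot]
    have := inv_mul_cancel₀ (expQuot_ne_zero ht)
    linear_combination -(-2 * Real.pi * Complex.I * t) * f t * this
  · have := hf.2 t (by linarith)
    rw [quot, this]; ring

theorem IsBump.integrable {f : ℝ → ℂ} (hf : IsBump f) {k : ℝ → ℂ} (hk : Continuous k) :
    MeasureTheory.Integrable fun t => k t * f t :=
  (hk.mul hf.1.continuous).integrable_of_hasCompactSupport hf.hasCompactSupport.mul_left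

/-- The derivative of the transform of a bump function as a difference. -/
theorem IsBump.hasDerivAt_ft {f : ℝ → ℂ} (hf : IsBump f) (ξ : ℝ) :
    HasDerivAt (ft f) (ft (TorusPDO.quot f) (ξ + 1) - ft (TorusPDO.quot f) ξ) ξ := by
  have h1 := Real.hasDerivAt_fourier (f := f)
    (hf.1.continuous.integrable_of_hasCompactSupport hf.hasCompactSupport)
    (by simpa using hf.integrable Complex.continuous_ofReal) ξ
  refine h1.congr_deriv ?_
  change ft _ ξ = _
  rw [ft_apply, ft_apply, ft_apply, ← MeasureTheory.integral_sub]
  · congr 1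
    funext t
    rw [smul_eq_mul, quot_mul hf]
    have : Complex.exp (-2 * Real.pi * Complex.I * t * ((ξ + 1 : ℝ) : ℂ))
        = Complex.exp (-2 * Real.pi * Complex.I * t * ξ)
          * Complex.exp (-2 * Real.pi * Complex.I * t) := by
      rw [← Complex.exp_add]; push_cast; ring_nf
    rw [this]; ring
  all_goals exact hf.quot.integrable (by fun_prop)

/-- A bump function whose integer translates add up to one. -/
def partBump (t : ℝ) : ℂ :=
  ((Real.smoothTransition (2 * (t + 1) - 1 / 2) - Real.smoothTransition (2 * t - 1 / 2) : ℝ) : ℂ)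

theorem partBump_isBump : IsBump partBump := by
  constructor
  · refine Complex.ofRealCLM.contDiff.comp (ContDiff.sub ?_ ?_) <;>
      refine Real.smoothTransition.contDiff.comp (by fun_prop)
  · intro t ht
    rw [partBump]
    rcases lt_abs.1 ht with h | h
    · rw [Real.smoothTransition.one_of_one_le (by linarith),
        Real.smoothTransition.one_of_one_le (by linarith), sub_self, Complex.ofReal_zero]
    · rw [Real.smoothTransition.zero_of_nonpos (by linarith),
        Real.smoothTransition.zero_of_nonpos (by linarith), sub_self, Complex.ofReal_zero]

theorem integral_exp_int (j : ℤ) :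
    ∫ t in (0 : ℝ)..1, Complex.exp (-2 * Real.pi * Complex.I * t * j) = if j = 0 then 1 else 0 := by
  split_ifs with h
  · simp [h]
  · have hc : (-2 * Real.pi * Complex.I * j : ℂ) ≠ 0 := by
      have hj : (j : ℂ) ≠ 0 := by exact_mod_cast h
      refine mul_ne_zero ?_ hj
      simp
    have e : (fun t : ℝ => Complex.exp (-2 * Real.pi * Complex.I * t * j))
        = fun t : ℝ => Complex.exp ((-2 * Real.pi * Complex.I * j) * t) := by
      funext t; congr 1; ring
    rw [e, integral_exp_mul_complex hc]
    have : Complex.exp (-2 * Real.pi * Complex.I * j) = 1 :=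
      Complex.exp_eq_one_iff.2 ⟨-j, by push_cast; ring⟩
    rw [Complex.ofReal_one, mul_one, this, Complex.ofReal_zero, mul_zero, Complex.exp_zero, sub_self,
      zero_div]

/-- The transform of `partBump` at integers, computed from the fact that the integer translates of
`partBump` add up to one. -/
theorem ft_partBump (j : ℤ) : ft partBump j = if j = 0 then 1 else 0 := by
  set S : ℝ → ℂ := fun t => (Real.smoothTransition (2 * t - 1 / 2) : ℂ) with hS
  have hSc : Continuous S := by
    refine Complex.continuous_ofReal.comp (Real.smoothTransition.continuous.comp (by fun_prop))
  set E : ℝ → ℂ := fun t => Complex.exp (-2 * Real.pi * Complex.I * t * j) with hE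
  have hEc : Continuous E := by fun_prop
  have hEp : ∀ t, E (t - 1) = E t := fun t => by
    simp only [hE]
    have : Complex.exp (2 * Real.pi * Complex.I * j) = 1 :=
      Complex.exp_eq_one_iff.2 ⟨j, by ring⟩
    rw [show (-2 * Real.pi * Complex.I * ((t - 1 : ℝ) : ℂ) * j : ℂ)
      = -2 * Real.pi * Complex.I * t * j + 2 * Real.pi * Complex.I * j by push_cast; ring,
      Complex.exp_add, this, mul_one]
  have hsupp : Function.support (fun t => E t * partBump t) ⊆ Set.Ioc (-1) 1 := fun t ht => by
    by_contra h
    refine ht ?_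
    have : 3 / 4 < |t| := by
      by_contra h2
      have := abs_le.1 (not_lt.1 h2)
      exact h ⟨by linarith, by linarith⟩
    dsimp only
    rw [partBump_isBump.2 t this, mul_zero]
  have hbc : Continuous fun t => E t * partBump t := hEc.mul partBump_isBump.1.continuous
  have h1 : ft partBump j = ∫ t in (-1 : ℝ)..1, E t * partBump t := by
    rw [ft_apply, intervalIntegral.integral_eq_integral_of_support_subset hsupp]
    rfl
  rw [h1, ← intervalIntegral.integral_add_adjacent_intervals (b := 0)
    (hbc.intervalIntegrable _ _) (hbc.intervalIntegrable _ _)]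
  -- translating the left half of the integral by one completes the bump to a constant
  have h2 : ∫ t in (-1 : ℝ)..0, E t * partBump t = ∫ t in (0 : ℝ)..1, E t * S t := by
    have := intervalIntegral.integral_comp_sub_right (a := 0) (b := 1)
      (fun t => E t * partBump t) 1
    rw [zero_sub, sub_self] at this
    rw [← this]
    refine intervalIntegral.integral_congr fun t ht => ?_
    rw [Set.uIcc_of_le zero_le_one] at ht
    rw [hEp, partBump, sub_add_cancel,
      Real.smoothTransition.zero_of_nonpos (x := 2 * (t - 1) - 1 / 2) (by linarith [ht.2]), sub_zero]
  have h3 : ∫ t in (0 : ℝ)..1, E t * partBump t = ∫ t in (0 : ℝ)..1, (E t - E t * S t) := by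
    refine intervalIntegral.integral_congr fun t ht => ?_
    rw [Set.uIcc_of_le zero_le_one] at ht
    rw [partBump, Real.smoothTransition.one_of_one_le (x := 2 * (t + 1) - 1 / 2)
      (by linarith [ht.1])]
    push_cast
    simp only [hS]
    ring
  rw [h2, h3, intervalIntegral.integral_sub (g := fun t => E t * S t) (hEc.intervalIntegrable _ _)
    ((hEc.mul hSc).intervalIntegrable _ _), add_sub_cancel]
  exact integral_exp_int j

end bump

section kernel
variable {d : ℕ}

/-- The product kernel of a family of bump functions. -/
def ker (f : Fin d → ℝ → ℂ) (ξ : Vec d) : ℂ := ∏ j, ft (f j) (ξ j)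

/-- The family of bump functions for a derivative in the direction `j`. -/
def kerStep (f : Fin d → ℝ → ℂ) (j : Fin d) : Fin d → ℝ → ℂ := Function.update f j (quot (f j))

theorem kerStep_isBump {f : Fin d → ℝ → ℂ} (hf : ∀ i, IsBump (f i)) (j i : Fin d) :
    IsBump (kerStep f j i) := by
  rcases eq_or_ne i j with rfl | h
  · rw [kerStep, Function.update_self]; exact (hf i).quot
  · rw [kerStep, Function.update_of_ne h]; exact hf i

theorem one_le_prod_of_one_le {ι : Type*} {s : Finset ι} {g : ι → ℝ} (h : ∀ i ∈ s, 1 ≤ g i) :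
    1 ≤ ∏ i ∈ s, g i := by
  simpa using Finset.prod_le_prod (f := fun _ => (1 : ℝ)) (fun _ _ => zero_le_one) h

theorem jb_le_prod (ξ : Vec d) : jb ξ ≤ ∏ j, (1 + |ξ j|) := by
  have h1 : ∀ j, 1 ≤ 1 + |ξ j| := fun j => by linarith [abs_nonneg (ξ j)]
  have h0 : 1 ≤ ∏ j, (1 + |ξ j|) := one_le_prod_of_one_le fun j _ => h1 j
  have : ‖ξ‖ ≤ ∏ j, (1 + |ξ j|) - 1 :=
    (pi_norm_le_iff_of_nonneg (by linarith)).2 fun i => by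
      have h2 : 1 + |ξ i| ≤ ∏ j, (1 + |ξ j|) := by
        rw [← Finset.mul_prod_erase _ _ (Finset.mem_univ i)]
        refine le_mul_of_one_le_right (by linarith [h1 i]) (one_le_prod_of_one_le fun j _ => h1 j)
      rw [Real.norm_eq_abs]; linarith
  unfold jb; linarith

theorem ker_decay {f : Fin d → ℝ → ℂ} (hf : ∀ i, IsBump (f i)) (N : ℕ) : ∃ C : ℝ, 0 ≤ C ∧
    ∀ ξ : Vec d, jb ξ ^ N * ‖ker f ξ‖ ≤ C := by
  choose C hC0 hC using fun i => (hf i).ft_decay N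
  refine ⟨∏ i, C i, Finset.prod_nonneg fun i _ => hC0 i, fun ξ => ?_⟩
  calc jb ξ ^ N * ‖ker f ξ‖ ≤ (∏ j, (1 + |ξ j|)) ^ N * ‖ker f ξ‖ := by
        gcongr
        · exact (jb_pos ξ).le
        · exact jb_le_prod ξ
    _ = ∏ j, ((1 + |ξ j|) ^ N * ‖ft (f j) (ξ j)‖) := by
        rw [ker, norm_prod, ← Finset.prod_pow, ← Finset.prod_mul_distrib]
    _ ≤ _ := Finset.prod_le_prod (fun j _ => by positivity) fun j _ => hC j (ξ j)

/-- The partial derivatives of a kernel are differences of kernels. -/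
theorem ker_hasFDerivAt {f : Fin d → ℝ → ℂ} (hf : ∀ i, IsBump (f i)) (ξ : Vec d) :
    HasFDerivAt (ker f) (∑ j, (ContinuousLinearMap.proj j : Vec d →L[ℝ] ℝ).smulRight
      (ker (kerStep f j) (ξ + Pi.single j 1) - ker (kerStep f j) ξ)) ξ := by
  have h := HasFDerivAt.finsetProd (u := Finset.univ) (g := fun j (ξ : Vec d) => ft (f j) (ξ j))
    (x := ξ) fun j _ => ((hf j).hasDerivAt_ft (ξ j)).hasFDerivAt.comp ξ
      (ContinuousLinearMap.proj (R := ℝ) (φ := fun _ : Fin d => ℝ) j).hasFDerivAt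
  refine h.congr_fderiv (Finset.sum_congr rfl fun j _ => ?_)
  have e : ∀ η : Vec d, (∀ i ≠ j, η i = ξ i) → ker (kerStep f j) η
      = (∏ i ∈ Finset.univ.erase j, ft (f i) (ξ i)) * ft (quot (f j)) (η j) := fun η hη => by
    rw [ker, ← Finset.prod_erase_mul _ _ (Finset.mem_univ j)]
    congr 1
    · refine Finset.prod_congr rfl fun i hi => ?_
      have := Finset.ne_of_mem_erase hi
      rw [hη i this, kerStep, Function.update_of_ne this]
    · rw [kerStep, Function.update_self]
  rw [e ξ fun _ _ => rfl, e (ξ + Pi.single j 1) fun i hi => by simp [hi]]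
  ext v
  simp
  ring

/-- The interpolation of a function on the lattice. -/
def interp (f : Fin d → ℝ → ℂ) (α : (Fin d → ℤ) → ℂ) (ξ : Vec d) : ℂ :=
  ∑' q, ker f (ξ - intVec q) * α q

/-- The kernels decay in the distance to a lattice point near `ξ`. -/
theorem interp_term_le {f : Fin d → ℝ → ℂ} (hf : ∀ i, IsBump (f i)) (m : ℝ) : ∃ C : ℝ, 0 ≤ C ∧
    ∀ (α : (Fin d → ℤ) → ℂ) (B : ℝ), (∀ q, ‖α q‖ ≤ B * jb q ^ m) → ∀ ξ : Vec d, ∀ q,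
      jb ((fun i => ⌊ξ i⌋) - q) ^ decayExp (Fin d → ℤ) * ‖ker f (ξ - intVec q) * α q‖
        ≤ C * B * jb ξ ^ m := by
  set D := decayExp (Fin d → ℤ)
  obtain ⟨C, hC0, hC⟩ := ker_decay hf (D + ⌈|m|⌉₊)
  refine ⟨2 ^ D * C, by positivity, fun α B hα ξ q => ?_⟩
  have hB : 0 ≤ B := by simpa using (norm_nonneg _).trans (hα 0)
  set q₀ : Fin d → ℤ := fun i => ⌊ξ i⌋
  have hj := jb_pos (ξ - intVec q)
  have h1 : jb (q₀ - q) ≤ 2 * jb (ξ - intVec q) := by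
    have e : jb (q₀ - q) = jb ((ξ - intVec q) + (intVec q₀ - ξ)) := by
      rw [← jb_intVec, sub_eq_add_neg q₀, intVec_add, intVec_neg]; congr 1; abel
    have h2 : jb (intVec q₀ - ξ) ≤ 2 := by
      have : ‖intVec q₀ - ξ‖ ≤ 1 := (pi_norm_le_iff_of_nonneg zero_le_one).2 fun i => by
        rw [Pi.sub_apply, Real.norm_eq_abs, abs_le]
        have h3 := Int.floor_le (ξ i)
        have h4 := Int.lt_floor_add_one (ξ i)
        simp only [intVec, q₀]
        constructor <;> linarith
      unfold jb; linarith
    rw [e, mul_comm]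
    exact (jb_add_le _ _).trans (mul_le_mul_of_nonneg_left h2 hj.le)
  have h2 : jb q ^ m ≤ jb ξ ^ m * jb (ξ - intVec q) ^ ⌈|m|⌉₊ := by
    have := jb_add_rpow_le ξ (intVec q - ξ) m
    rwa [add_sub_cancel, jb_intVec, jb_sub_comm] at this
  have hm := jb_rpow_pos ξ m
  have hq := jb_pos (q₀ - q)
  calc jb (q₀ - q) ^ D * ‖ker f (ξ - intVec q) * α q‖
      ≤ (2 * jb (ξ - intVec q)) ^ D * (‖ker f (ξ - intVec q)‖
        * (B * (jb ξ ^ m * jb (ξ - intVec q) ^ ⌈|m|⌉₊))) := by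
        rw [norm_mul]
        gcongr
        exact (hα q).trans (mul_le_mul_of_nonneg_left h2 hB)
    _ = 2 ^ D * (jb (ξ - intVec q) ^ (D + ⌈|m|⌉₊) * ‖ker f (ξ - intVec q)‖) * B * jb ξ ^ m := by
        rw [mul_pow, pow_add]; ring
    _ ≤ _ := by gcongr; exact hC _

theorem interp_bound {f : Fin d → ℝ → ℂ} (hf : ∀ i, IsBump (f i)) (m : ℝ) : ∃ C : ℝ, 0 ≤ C ∧
    ∀ (α : (Fin d → ℤ) → ℂ) (B : ℝ), (∀ q, ‖α q‖ ≤ B * jb q ^ m) → ∀ ξ : Vec d,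
      Summable (fun q => ker f (ξ - intVec q) * α q) ∧ ‖interp f α ξ‖ ≤ C * B * jb ξ ^ m := by
  obtain ⟨C, hC0, hC⟩ := interp_term_le hf m
  refine ⟨C * decaySum (Fin d → ℤ), mul_nonneg hC0 decaySum_nonneg, fun α B hα ξ =>
    ⟨summable_of_decay_sub _ (hC α B hα ξ),
      (norm_tsum_le_of_decay_sub _ (hC α B hα ξ)).trans (le_of_eq (by ring))⟩⟩

theorem interp_const_mul (f : Fin d → ℝ → ℂ) (c : ℂ) (α : (Fin d → ℤ) → ℂ) (ξ : Vec d) :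
    interp f (fun q => c * α q) ξ = c * interp f α ξ := by
  rw [interp, interp, ← tsum_mul_left]
  exact tsum_congr fun q => by ring

/-- Decay of the terms of an interpolation, locally uniformly. -/
theorem interp_local {f : Fin d → ℝ → ℂ} (hf : ∀ i, IsBump (f i)) {α : (Fin d → ℤ) → ℂ} {B : ℝ}
    {N : ℕ} (hα : ∀ q, ‖α q‖ ≤ B * jb q ^ N) (R : ℝ) : ∃ K : ℝ, ∀ ξ : Vec d, ‖ξ‖ < R → ∀ q,
      jb q ^ decayExp (Fin d → ℤ) * ‖ker f (ξ - intVec q) * α q‖ ≤ K := by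
  set D := decayExp (Fin d → ℤ)
  obtain ⟨C, hC0, hC⟩ := ker_decay hf (D + N)
  have hB : 0 ≤ B := by simpa using (norm_nonneg _).trans (hα 0)
  refine ⟨C * B * (1 + R) ^ (D + N), fun ξ hξ q => ?_⟩
  have h1 : jb q ≤ jb (ξ - intVec q) * (1 + R) := by
    rw [← jb_intVec, jb_sub_comm]
    refine (jb_le_sub_mul (intVec q) ξ).trans (mul_le_mul_of_nonneg_left ?_ (jb_pos _).le)
    unfold jb; linarith
  have hq := jb_pos q
  have hR : 0 ≤ 1 + R := by linarith [norm_nonneg ξ]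
  calc jb q ^ D * ‖ker f (ξ - intVec q) * α q‖
      ≤ jb q ^ D * (‖ker f (ξ - intVec q)‖ * (B * jb q ^ N)) := by
        rw [norm_mul]; gcongr; exact hα q
    _ = jb q ^ (D + N) * (‖ker f (ξ - intVec q)‖ * B) := by rw [pow_add]; ring
    _ ≤ (jb (ξ - intVec q) * (1 + R)) ^ (D + N) * (‖ker f (ξ - intVec q)‖ * B) := by gcongr
    _ = (jb (ξ - intVec q) ^ (D + N) * ‖ker f (ξ - intVec q)‖) * B * (1 + R) ^ (D + N) := by
        rw [mul_pow]; ring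
    _ ≤ _ := by gcongr; exact hC _

/-- Derivatives of interpolations are interpolations of differences. -/
theorem interp_hasFDerivAt {f : Fin d → ℝ → ℂ} (hf : ∀ i, IsBump (f i)) {α : (Fin d → ℤ) → ℂ}
    {B : ℝ} {N : ℕ} (hα : ∀ q, ‖α q‖ ≤ B * jb q ^ N) (ξ : Vec d) :
    HasFDerivAt (interp f α) (∑ j, (ContinuousLinearMap.proj j : Vec d →L[ℝ] ℝ).smulRight
      (interp (kerStep f j) (fun q => α (q + Pi.single j 1) - α q) ξ)) ξ := by
  have hα' : ∀ q, ‖α q‖ ≤ B * jb q ^ (N : ℝ) := fun q => by rw [Real.rpow_natCast]; exact hα q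
  have hs : ∀ (g : Fin d → ℝ → ℂ), (∀ i, IsBump (g i)) → ∀ η, HasSum
      (fun q => ker g (η - intVec q) * α q) (interp g α η) := fun g hg η =>
    ((interp_bound hg N).choose_spec.2 α B hα' η).1.hasSum
  set D : (Fin d → ℤ) → Vec d → Vec d →L[ℝ] ℂ := fun q ξ =>
    ∑ j, (ContinuousLinearMap.proj j : Vec d →L[ℝ] ℝ).smulRight
      (ker (kerStep f j) (ξ + Pi.single j 1 - intVec q) * α q
        - ker (kerStep f j) (ξ - intVec q) * α q) with hD
  have hDξ : HasSum (fun q => D q ξ) (∑ j, (ContinuousLinearMap.proj j : Vec d →L[ℝ] ℝ).smulRight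
      (interp (kerStep f j) (fun q => α (q + Pi.single j 1) - α q) ξ)) := by
    refine hasSum_sum fun j _ => ?_
    have h1 := hs _ (kerStep_isBump hf j) (ξ + Pi.single j 1)
    have h2 := hs _ (kerStep_isBump hf j) ξ
    have h3 : HasSum (fun q => ker (kerStep f j) (ξ - intVec q) * α (q + Pi.single j 1))
        (interp (kerStep f j) α (ξ + Pi.single j 1)) := by
      rw [← (Equiv.addRight (Pi.single j 1 : Fin d → ℤ)).hasSum_iff] at h1
      refine (congrArg (HasSum · _) (funext fun q => ?_)).mp h1
      simp only [Function.comp, Equiv.coe_addRight, intVec_add, intVec_single]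
      congr 2
      abel
    have h4 : interp (kerStep f j) (fun q => α (q + Pi.single j 1) - α q) ξ
        = interp (kerStep f j) α (ξ + Pi.single j 1) - interp (kerStep f j) α ξ := by
      refine HasSum.tsum_eq ?_
      refine (congrArg (HasSum · _) (funext fun q => ?_)).mp (h3.sub h2)
      exact (mul_sub _ _ _).symm
    rw [h4]
    exact (h1.sub h2).mapL (ContinuousLinearMap.smulRightL ℝ (Vec d) ℂ
      (ContinuousLinearMap.proj j : Vec d →L[ℝ] ℝ))
  choose K hK using fun j => interp_local (kerStep_isBump hf j) hα (‖ξ‖ + 1 + 1)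
  have hξ : ξ ∈ Metric.ball (0 : Vec d) (‖ξ‖ + 1) := by simp
  have hmain := hasFDerivAt_tsum_of_isPreconnected (𝕜 := ℝ)
    (f := fun q (ξ : Vec d) => ker f (ξ - intVec q) * α q) (f' := D)
    (u := fun q => (∑ j, ‖(ContinuousLinearMap.proj j : Vec d →L[ℝ] ℝ)‖ * (K j + K j))
      * (jb q ^ decayExp (Fin d → ℤ))⁻¹)
    (s := Metric.ball 0 (‖ξ‖ + 1)) (x₀ := ξ) (x := ξ)
    (summable_decay.mul_left _) Metric.isOpen_ball (convex_ball _ _).isPreconnected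
    (fun q η _ => ?_) (fun q η hη => ?_) hξ (hs f hf ξ).summable hξ
  · rwa [hDξ.tsum_eq] at hmain
  · have h1 := (ker_hasFDerivAt hf (η - intVec q)).comp η ((hasFDerivAt_id η).sub_const (intVec q))
    refine (h1.mul_const (α q)).congr_fderiv ?_
    ext v
    simp [hD, Finset.mul_sum]
    refine Finset.sum_congr rfl fun j _ => ?_
    rw [show η - intVec q + Pi.single j 1 = η + Pi.single j 1 - intVec q by abel]
    ring
  · have hη' : ‖η‖ < ‖ξ‖ + 1 := by simpa using hη
    rw [Finset.sum_mul]
    refine (norm_sum_le _ _).trans (Finset.sum_le_sum fun j _ => ?_)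
    have hj : ‖η + Pi.single j 1‖ < ‖ξ‖ + 1 + 1 := by
      refine (norm_add_le _ _).trans_lt ?_
      rw [Pi.norm_single, norm_one]; linarith
    rw [ContinuousLinearMap.norm_smulRight_apply, mul_assoc, ← div_eq_mul_inv]
    refine mul_le_mul_of_nonneg_left ?_ (norm_nonneg _)
    rw [le_div_iff₀ (jb_pow_pos q _), mul_comm]
    refine (mul_le_mul_of_nonneg_left (norm_sub_le _ _) (jb_pow_pos q _).le).trans ?_
    rw [mul_add]
    exact add_le_add (hK j _ hj q) (hK j _ (by linarith) q)

theorem ker_partBump (q : Fin d → ℤ) :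
    ker (fun _ => partBump) (intVec q) = if q = 0 then 1 else 0 := by
  simp only [ker, intVec, ft_partBump]
  split_ifs with h
  · subst h; simp
  · obtain ⟨j, hj⟩ := Function.ne_iff.1 h
    exact Finset.prod_eq_zero (Finset.mem_univ j) (if_neg hj)

theorem interp_partBump (α : (Fin d → ℤ) → ℂ) (q : Fin d → ℤ) :
    interp (fun _ => partBump) α (intVec q) = α q := by
  have e : ∀ q' : Fin d → ℤ, intVec q - intVec q' = intVec (q - q') := fun q' => by
    rw [sub_eq_add_neg q, intVec_add, intVec_neg, sub_eq_add_neg]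
  rw [interp, tsum_eq_single q fun q' h => by
    rw [e, ker_partBump, if_neg (sub_ne_zero.2 h.symm), zero_mul]]
  rw [e, ker_partBump, if_pos (sub_self q), one_mul]

end kernel

/-! ### From lattice symbols to symbols with real frequencies -/

section ext
variable {n d : ℕ}

theorem Temp.interp_bound {a : Hat n d} (ha : Temp a) {f : Fin d → ℝ → ℂ} (hf : ∀ i, IsBump (f i))
    (L : ℕ) : ∃ (C : ℝ) (N : ℕ), 0 ≤ C ∧ ∀ κ ξ, jb κ ^ L * ‖interp f (a κ) ξ‖ ≤ C * jb ξ ^ N := by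
  obtain ⟨C, N, hC0, hC⟩ := ha L
  obtain ⟨A, hA0, hA⟩ := TorusPDO.interp_bound hf (N : ℝ)
  refine ⟨A * C, N, by positivity, fun κ ξ => ?_⟩
  have hκ := jb_pow_pos κ L
  have := (hA (a κ) ((jb κ ^ L)⁻¹ * C) (fun q => ?_) ξ).2
  · rw [Real.rpow_natCast] at this
    refine (mul_le_mul_of_nonneg_left this hκ.le).trans (le_of_eq ?_)
    field_simp
  · rw [Real.rpow_natCast, mul_assoc, ← div_eq_inv_mul, le_div_iff₀ hκ, mul_comm]
    exact hC κ q

theorem Temp.interp_summable {a : Hat n d} (ha : Temp a) {f : Fin d → ℝ → ℂ}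
    (hf : ∀ i, IsBump (f i)) (κ : Freq n d) (ξ : Vec d) :
    Summable fun q => ker f (ξ - intVec q) * a κ q := by
  obtain ⟨C, N, hC0, hC⟩ := ha 0
  obtain ⟨A, hA0, hA⟩ := TorusPDO.interp_bound hf (N : ℝ)
  exact (hA (a κ) C (fun q => by simpa using hC κ q) ξ).1

theorem Temp.interp_locDecay {a : Hat n d} (ha : Temp a) {f : Fin d → ℝ → ℂ}
    (hf : ∀ i, IsBump (f i)) : LocDecay fun ξ κ => interp f (a κ) ξ := fun R L => by
  obtain ⟨C, N, hC0, hC⟩ := ha.interp_bound hf L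
  refine ⟨C * (1 + R) ^ N, fun ξ hξ κ => (hC κ ξ).trans ?_⟩
  have : jb ξ ≤ 1 + R := by unfold jb; linarith
  have := jb_pos ξ
  gcongr

theorem Temp.interp_hasFDerivAt {a : Hat n d} (ha : Temp a) {f : Fin d → ℝ → ℂ}
    (hf : ∀ i, IsBump (f i)) (ξ : Vec d) (κ : Freq n d) : HasFDerivAt (fun ξ => interp f (a κ) ξ)
      (∑ j, (ContinuousLinearMap.proj j : Vec d →L[ℝ] ℝ).smulRight
        (interp (kerStep f j) (fun q => a κ (q + Pi.single j 1) - a κ q) ξ)) ξ := by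
  obtain ⟨C, N, hC0, hC⟩ := ha 0
  exact TorusPDO.interp_hasFDerivAt hf (fun q => by simpa using hC κ q) ξ

theorem freqWaves_freq_bound (j : Fin n ⊕ Fin d) (κ : Freq n d) :
    ‖Complex.I * ((freqWaves n d).freq j κ : ℂ)‖ ≤ 1 * jb κ ^ 1 := by
  rw [norm_mul, Complex.norm_I, one_mul, one_mul, pow_one, Complex.norm_real]
  exact (freqWaves n d).freq_le j κ

/-- The lattice symbol of a derivative, up to the choice of the interpolation kernel. -/
def hatDeriv (a : Hat n d) : Fin n ⊕ Fin d ⊕ Fin d → Hat n d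
  | .inl i => fun κ q => Complex.I * (freqWaves n d).freq (.inl i) κ * a κ q
  | .inr (.inl i) => fun κ q => Complex.I * (freqWaves n d).freq (.inr i) κ * a κ q
  | .inr (.inr j) => fun κ q => a κ (q + Pi.single j 1) - a κ q

/-- The interpolation kernel of a derivative. -/
def bumpDeriv (f : Fin d → ℝ → ℂ) : Fin n ⊕ Fin d ⊕ Fin d → Fin d → ℝ → ℂ
  | .inl _ => f
  | .inr (.inl _) => f
  | .inr (.inr j) => kerStep f j

theorem bumpDeriv_isBump {f : Fin d → ℝ → ℂ} (hf : ∀ i, IsBump (f i)) (c : Fin n ⊕ Fin d ⊕ Fin d) :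
    ∀ i, IsBump (bumpDeriv f c i) := by
  rcases c with i | i | j
  · exact hf
  · exact hf
  · exact kerStep_isBump hf j

theorem Temp.hatDeriv {a : Hat n d} (ha : Temp a) (c : Fin n ⊕ Fin d ⊕ Fin d) :
    Temp (hatDeriv a c) := by
  rcases c with i | i | j
  · exact ha.mul_freq _ (freqWaves_freq_bound (.inl i))
  · exact ha.mul_freq _ (freqWaves_freq_bound (.inr i))
  · exact (ha.shift _).sub ha

theorem Bd.hatDeriv {P : Type} {m : ℝ} {wt : P → ℝ} {a : P → Hat n d} (ha : Bd m wt a)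
    (c : Fin n ⊕ Fin d ⊕ Fin d) : Bd (m - xiCount [c]) wt fun p => hatDeriv (a p) c := by
  rcases c with i | i | j
  · rw [show xiCount [(.inl i : Fin n ⊕ Fin d ⊕ Fin d)] = 0 from rfl, Nat.cast_zero, sub_zero]
    exact (ha.mul_freq (wt' := fun _ => 1) (C := 1) (N := 1) (fun _ => _) fun _ κ => by
      rw [mul_one]; exact freqWaves_freq_bound (.inl i) κ).congr_wt fun p => one_mul _
  · rw [show xiCount [(.inr (.inl i) : Fin n ⊕ Fin d ⊕ Fin d)] = 0 from rfl, Nat.cast_zero, sub_zero]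
    exact (ha.mul_freq (wt' := fun _ => 1) (C := 1) (N := 1) (fun _ => _) fun _ κ => by
      rw [mul_one]; exact freqWaves_freq_bound (.inr i) κ).congr_wt fun p => one_mul _
  · rw [show xiCount [(.inr (.inr j) : Fin n ⊕ Fin d ⊕ Fin d)] = 1 from rfl, Nat.cast_one]
    exact ha.diff j

/-- The interpolation in `ξ` of the Fourier series in `(φ, x)` with coefficients `a`. -/
def extFun (f : Fin d → ℝ → ℂ) (a : Hat n d) (p : Phase n d) : ℂ :=
  (freqWaves n d).sum (fun κ => interp f (a κ) p.2.2) (p.1, p.2.1)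

/-- The variables of a symbol, the frequency first. -/
def freqFirst (n d : ℕ) : Phase n d →L[ℝ] Vec d × Vec n × Vec d :=
  ((ContinuousLinearMap.snd ℝ (Vec d) (Vec d)).comp (ContinuousLinearMap.snd ℝ (Vec n) _)).prod
    ((ContinuousLinearMap.fst ℝ (Vec n) _).prod
      ((ContinuousLinearMap.fst ℝ (Vec d) (Vec d)).comp (ContinuousLinearMap.snd ℝ (Vec n) _)))

theorem freqFirst_apply (p : Phase n d) : freqFirst n d p = (p.2.2, p.1, p.2.1) := rfl

/-- Derivatives of an interpolated symbol are interpolated symbols, of differences in the direction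
of `ξ`. -/
theorem extFun_fderiv {f : Fin d → ℝ → ℂ} (hf : ∀ i, IsBump (f i)) {a : Hat n d} (ha : Temp a)
    (c : Fin n ⊕ Fin d ⊕ Fin d) (p : Phase n d) :
    fderiv ℝ (extFun f a) p (coordDir c) = extFun (bumpDeriv f c) (hatDeriv a c) p := by
  have h := (freqWaves n d).hasFDerivAt_sum (c := fun ξ κ => interp f (a κ) ξ)
    (c' := fun j ξ κ => interp (kerStep f j) (fun q => a κ (q + Pi.single j 1) - a κ q) ξ)
    (fun j : Fin d => (ContinuousLinearMap.proj j : Vec d →L[ℝ] ℝ))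
    (ha.interp_locDecay hf) (fun j => ((ha.shift (Pi.single j 1)).sub ha).interp_locDecay
      (kerStep_isBump hf j)) (ha.interp_hasFDerivAt hf) (freqFirst n d p)
  have h2 := h.comp p (freqFirst n d).hasFDerivAt
  change fderiv ℝ ((fun z : Vec d × Vec n × Vec d =>
    (freqWaves n d).sum (fun κ => interp f (a κ) z.1) z.2) ∘ freqFirst n d) p _ = _
  rw [h2.fderiv]
  rcases c with i | i | j <;>
    simp [coordDir, freqFirst_apply, extFun, hatDeriv, bumpDeriv, interp_const_mul, freqWaves,
      Pi.single_apply]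

/-- The interpolations of the coefficients of lattice symbols. -/
def interpClass (n d : ℕ) : Set (Vec d → Freq n d → ℂ) :=
  {c | ∃ (f : Fin d → ℝ → ℂ) (a : Hat n d), (∀ i, IsBump (f i)) ∧ Temp a ∧
    c = fun ξ κ => interp f (a κ) ξ}

theorem interpClass_deriv (c : Vec d → Freq n d → ℂ) (hc : c ∈ interpClass n d) :
    ∃ c' : Fin d → Vec d → Freq n d → ℂ, (∀ i, c' i ∈ interpClass n d) ∧
      ∀ p x, HasFDerivAt (fun p => c p x)
        (∑ i, (ContinuousLinearMap.proj i : Vec d →L[ℝ] ℝ).smulRight (c' i p x)) p := by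
  obtain ⟨f, a, hf, ha, rfl⟩ := hc
  exact ⟨fun j ξ κ => interp (kerStep f j) (fun q => a κ (q + Pi.single j 1) - a κ q) ξ,
    fun j => ⟨_, _, kerStep_isBump hf j, (ha.shift (Pi.single j 1)).sub ha, rfl⟩,
    ha.interp_hasFDerivAt hf⟩

theorem interpClass_mul_freq (c : Vec d → Freq n d → ℂ) (hc : c ∈ interpClass n d)
    (j : Fin n ⊕ Fin d) :
    (fun ξ κ => Complex.I * (freqWaves n d).freq j κ * c ξ κ) ∈ interpClass n d := by
  obtain ⟨f, a, hf, ha, rfl⟩ := hc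
  refine ⟨f, _, hf, ha.mul_freq _ (freqWaves_freq_bound j), ?_⟩
  funext ξ κ
  rw [interp_const_mul]

theorem extFun_contDiff {f : Fin d → ℝ → ℂ} (hf : ∀ i, IsBump (f i)) {a : Hat n d} (ha : Temp a) :
    ContDiff ℝ ∞ (extFun f a) := by
  have h := (freqWaves n d).contDiff_sum
    (fun j : Fin d => (ContinuousLinearMap.proj j : Vec d →L[ℝ] ℝ)) (interpClass n d)
    (by rintro c ⟨f, a, hf, ha, rfl⟩; exact ha.interp_locDecay hf)
    interpClass_deriv interpClass_mul_freq
    (c := fun ξ κ => interp f (a κ) ξ) ⟨f, a, hf, ha, rfl⟩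
  change ContDiff ℝ ∞ ((fun z : Vec d × Vec n × Vec d =>
    (freqWaves n d).sum ((fun ξ κ => interp f (a κ) ξ) z.1) z.2) ∘ freqFirst n d)
  exact h.comp (freqFirst n d).contDiff

theorem character_add_period {k : ℕ} (ξ l : Fin k → ℤ) (x : Vec k) :
    character ξ (x + (2 * Real.pi) • intVec l) = character ξ x := by
  have := (charS ξ).2.2 x l
  exact this

/-- The interpolated symbol. -/
def ext {f : Fin d → ℝ → ℂ} (hf : ∀ i, IsBump (f i)) {a : Hat n d} (ha : Temp a) : PSym n d :=
  ⟨extFun f a, extFun_contDiff hf ha, fun l k p => by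
    rw [extFun, extFun, Waves.sum, Waves.sum]
    refine tsum_congr fun κ => ?_
    simp only [freqWaves_fn, Prod.fst_add, Prod.snd_add, add_zero, character_add_period]⟩

theorem ext_sub {f : Fin d → ℝ → ℂ} (hf : ∀ i, IsBump (f i)) {a b : Hat n d} (ha : Temp a)
    (hb : Temp b) : ext hf (ha.sub hb) = ext hf ha - ext hf hb := by
  refine Subtype.ext (funext fun p => ?_)
  change extFun f _ p = extFun f a p - extFun f b p
  have h1 := (ha.interp_locDecay hf).summable (freqWaves n d) p.2.2 (p.1, p.2.1)
  have h2 := (hb.interp_locDecay hf).summable (freqWaves n d) p.2.2 (p.1, p.2.1)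
  rw [extFun, extFun, extFun, Waves.sum, Waves.sum, Waves.sum, ← h1.tsum_sub h2]
  refine tsum_congr fun κ => ?_
  rw [← sub_mul, interp, interp, interp,
    ← (ha.interp_summable hf κ p.2.2).tsum_sub (hb.interp_summable hf κ p.2.2)]
  simp only [mul_sub]

theorem deriv_ext {f : Fin d → ℝ → ℂ} (hf : ∀ i, IsBump (f i)) {a : Hat n d} (ha : Temp a)
    (c : Fin n ⊕ Fin d ⊕ Fin d) :
    PSym.deriv (ext hf ha) c = ext (bumpDeriv_isBump hf c) (ha.hatDeriv c) :=
  Subtype.ext (funext fun p => extFun_fderiv hf ha c p)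

/-- Families of symbols of order `m`, with weights in the parameter. -/
def SymBd {P : Type} (m : ℝ) (wt : P → ℝ) (σ : P → PSym n d) : Prop :=
  ∀ u, ∃ C : ℝ, ∀ p z, ‖(PSym.dl u (σ p)).1 z‖ ≤ C * wt p * jb z.2.2 ^ (m - xiCount u)

variable {P : Type} {m : ℝ} {wt : P → ℝ}

theorem Bd.norm_ext_le {a : P → Hat n d} (ha : Bd m wt a) {f : Fin d → ℝ → ℂ}
    (hf : ∀ i, IsBump (f i)) :
    ∃ C : ℝ, ∀ p z, ‖(ext hf (ha.temp p)).1 z‖ ≤ C * wt p * jb z.2.2 ^ m := by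
  obtain ⟨C, hC⟩ := ha [] (decayExp (Freq n d))
  obtain ⟨A, hA0, hA⟩ := interp_bound hf m
  refine ⟨A * C * decaySum (Freq n d), fun p z => ?_⟩
  have := (freqWaves n d).norm_sum_le (v := fun κ => interp f (a p κ) z.2.2)
    (C := A * (C * wt p) * jb z.2.2 ^ m) (fun κ => ?_) (z.1, z.2.1)
  · exact this.trans (le_of_eq (by ring))
  · have hκ := jb_pow_pos κ (decayExp (Freq n d))
    have h := (hA (a p κ) ((jb κ ^ decayExp (Freq n d))⁻¹ * (C * wt p)) (fun q => ?_) z.2.2).2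
    · refine (mul_le_mul_of_nonneg_left h hκ.le).trans (le_of_eq ?_)
      field_simp
    · rw [mul_assoc, ← div_eq_inv_mul, le_div_iff₀ hκ, mul_comm]
      simpa [diffList] using hC p κ q

/-- The interpolated symbol has the order of the lattice symbol. -/
theorem Bd.ext {a : P → Hat n d} (ha : Bd m wt a) {f : Fin d → ℝ → ℂ} (hf : ∀ i, IsBump (f i)) :
    SymBd m wt fun p => ext hf (ha.temp p) := fun u => by
  induction u using List.reverseRecOn generalizing f a m with
  | nil => simpa [PSym.dl] using ha.norm_ext_le hf
  | append_singleton u c ih =>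
    obtain ⟨C, hC⟩ := ih (ha.hatDeriv c) (bumpDeriv_isBump hf c)
    refine ⟨C, fun p z => ?_⟩
    rw [PSym.dl_append, xiCount_append, Nat.cast_add, add_comm, ← sub_sub]
    change ‖(PSym.dl u (PSym.deriv (TorusPDO.ext hf (ha.temp p)) c)).1 z‖ ≤ _
    rw [deriv_ext]
    exact hC p z

theorem xiCount_map (v : List (Fin d)) :
    xiCount (v.map fun j => (.inr (.inr j) : Fin n ⊕ Fin d ⊕ Fin d)) = v.length := by
  induction v with
  | nil => rfl
  | cons j v ih => rw [List.map_cons, xiCount_cons, ih, List.length_cons, add_comm]; rfl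

/-- The lattice symbols of a family of symbols. -/
theorem SymBd.hat {σ : P → PSym n d} (hσ : SymBd m wt σ) (hwt : ∀ p, 0 ≤ wt p) :
    Bd m wt fun p => PSym.hat (σ p) := fun v L => by
  obtain ⟨A, hA0, hA⟩ := PSym.hat_bound (n := n) v L (m - v.length)
  choose C hC using hσ
  set u : List (Fin n ⊕ Fin d ⊕ Fin d) := v.map fun j => .inr (.inr j)
  have hu : xiCount u = v.length := xiCount_map v
  set B := |C u| + ∑ j, |C (u ++ List.replicate L (torusDir j))|
  have h0 : C u ≤ B := (le_abs_self _).trans (le_add_of_nonneg_right (by positivity))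
  have hj : ∀ j, C (u ++ List.replicate L (torusDir j)) ≤ B := fun j =>
    (le_abs_self _).trans ((Finset.single_le_sum
      (f := fun j => |C (u ++ List.replicate L (torusDir j))|) (fun _ _ => abs_nonneg _)
      (Finset.mem_univ j)).trans (le_add_of_nonneg_left (abs_nonneg _)))
  refine ⟨A * B, fun p κ q => ?_⟩
  rw [mul_assoc A]
  refine hA (σ p) (B * wt p) (fun z => ?_) (fun j z => ?_) κ q
  · refine (hC u p z).trans ?_
    rw [hu]
    have := hwt p
    have := jb_rpow_pos z.2.2 (m - v.length)
    gcongr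
  · refine (hC _ p z).trans ?_
    rw [xiCount_append, xiCount_replicate, add_zero, hu]
    have := hwt p
    have := jb_rpow_pos z.2.2 (m - v.length)
    gcongr
    exact hj j

/-- At integer frequencies the interpolated symbol is the lattice symbol. -/
theorem ext_partBump {a : Hat n d} (ha : Temp a) (φ : Vec n) (x : Vec d) (q : Fin d → ℤ) :
    (ext (fun _ : Fin d => partBump_isBump) ha).1 (φ, x, intVec q) = latticeSymbol a φ x q := by
  change extFun _ a _ = _
  simp only [extFun, interp_partBump, latticeSymbol]

end ext

/-! ### Families of pseudodifferential operators and families of lattice symbols -/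

section classes
variable {n d : ℕ} {I : Set ℝ} {Ω₀ : ℝ → Set (Param n d)} {m : ℝ}

/-- The parameters `(ε, (ω, ν))`; two of them are compared if they have the same `ε`. -/
@[reducible] def paramGraph (I : Set ℝ) (Ω₀ : ℝ → Set (Param n d)) : ParamGraph where
  P := {p : ℝ × Param n d // p.1 ∈ I ∧ p.2 ∈ Ω₀ p.1}
  E := {x : ℝ × Param n d × Param n d // x.1 ∈ I ∧ x.2.1 ∈ Ω₀ x.1 ∧ x.2.2 ∈ Ω₀ x.1}
  s x := ⟨(x.1.1, x.1.2.1), x.2.1, x.2.2.1⟩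
  t x := ⟨(x.1.1, x.1.2.2), x.2.1, x.2.2.2⟩
  len x := dist x.1.2.1 x.1.2.2
  len_nonneg _ := dist_nonneg

open Classical in
/-- A family on the admissible parameters, extended by zero. -/
def extendZero {α : Type*} [Zero α] (F : (paramGraph I Ω₀).P → α) (ε : ℝ) (w : Param n d) : α :=
  if h : ε ∈ I ∧ w ∈ Ω₀ ε then F ⟨(ε, w), h⟩ else 0

theorem extendZero_of_mem {α : Type*} [Zero α] (F : (paramGraph I Ω₀).P → α) {ε : ℝ}
    {w : Param n d} (hε : ε ∈ I) (hw : w ∈ Ω₀ ε) :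
    extendZero F ε w = F ⟨(ε, w), hε, hw⟩ := dif_pos ⟨hε, hw⟩

theorem PSym.dl_sub_apply (u : List (Fin n ⊕ Fin d ⊕ Fin d)) (f g : PSym n d) (z : Phase n d) :
    (PSym.dl u (f - g)).1 z = (PSym.dl u f).1 z - (PSym.dl u g).1 z := by
  rw [PSym.dl_sub]; rfl

/-- Lipschitz families of symbols in terms of the seminorms `SymBd`: the symbols are bounded on the
parameters, their differences along the edges of the graph by the distance. -/
theorem isLipSymbol_iff (σ : (paramGraph I Ω₀).P → PSym n d)
    {a : ℝ → Param n d → Phase n d → ℂ} (ha : ∀ p, a p.1.1 p.1.2 = (σ p).1) :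
    IsLipSymbol I Ω₀ m a ↔ SymBd m (fun _ => 1) σ ∧
      SymBd m (paramGraph I Ω₀).len fun x => σ ((paramGraph I Ω₀).s x) - σ ((paramGraph I Ω₀).t x) := by
  have hmem : ∀ {ε w} (hε : ε ∈ I) (hw : w ∈ Ω₀ ε), a ε w = (σ ⟨(ε, w), hε, hw⟩).1 :=
    fun hε hw => ha ⟨(_, _), hε, hw⟩
  constructor
  · intro h
    constructor
    · intro u
      obtain ⟨C, hC⟩ := h.bound u.length u.get
      obtain ⟨A, hA0, hA⟩ := bracket_rpow_le (k := d) (m - xiCount u)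
      refine ⟨|C| * A, fun p z => ?_⟩
      have h1 := hC p.1.1 p.2.1 p.1.2 p.2.2 z
      rw [ha p, mixedDeriv_eq, xiOrder_eq, List.ofFn_get] at h1
      have hb := Real.rpow_nonneg (bracket_pos z.2.2).le (m - xiCount u)
      calc _ ≤ C * bracket z.2.2 ^ (m - xiCount u) := h1
        _ ≤ |C| * (A * jb z.2.2 ^ (m - xiCount u)) := by
          gcongr
          · exact le_abs_self C
          · exact (hA z.2.2).1
        _ = _ := by ring
    · intro u
      obtain ⟨C, hC⟩ := h.lipschitz u.length u.get
      obtain ⟨A, hA0, hA⟩ := bracket_rpow_le (k := d) (m - xiCount u)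
      refine ⟨|C| * A, fun x z => ?_⟩
      have h1 := hC x.1.1 x.2.1 x.1.2.1 x.2.2.1 x.1.2.2 x.2.2.2 z
      rw [hmem x.2.1 x.2.2.1, hmem x.2.1 x.2.2.2, mixedDeriv_eq, mixedDeriv_eq, xiOrder_eq,
        List.ofFn_get, ← PSym.dl_sub_apply] at h1
      have hb := Real.rpow_nonneg (bracket_pos z.2.2).le (m - xiCount u)
      calc _ ≤ C * dist x.1.2.1 x.1.2.2 * bracket z.2.2 ^ (m - xiCount u) := h1
        _ ≤ |C| * dist x.1.2.1 x.1.2.2 * (A * jb z.2.2 ^ (m - xiCount u)) := by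
          gcongr
          · exact le_abs_self C
          · exact (hA z.2.2).1
        _ = _ := by ring
  · rintro ⟨h1, h2⟩
    refine ⟨fun ε hε w hw => ?_, fun ε hε w hw x ξ φ l => ?_, fun ε hε w hw φ ξ x k => ?_,
      fun N v => ?_, fun N v => ?_⟩
    · rw [hmem hε hw]; exact (σ _).2.1
    · rw [hmem hε hw]
      have := (σ ⟨(ε, w), hε, hw⟩).2.2 l 0 (φ, x, ξ)
      simpa [show intVec (0 : Fin d → ℤ) = 0 from funext fun _ => Int.cast_zero] using this
    · rw [hmem hε hw]
      have := (σ ⟨(ε, w), hε, hw⟩).2.2 0 k (φ, x, ξ)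
      simpa [show intVec (0 : Fin n → ℤ) = 0 from funext fun _ => Int.cast_zero] using this
    · obtain ⟨C, hC⟩ := h1 (List.ofFn v)
      obtain ⟨A, hA0, hA⟩ := bracket_rpow_le (k := d) (m - xiCount (List.ofFn v))
      refine ⟨|C| * A, fun ε hε w hw z => ?_⟩
      rw [hmem hε hw, mixedDeriv_eq, xiOrder_eq]
      have hb := jb_rpow_pos z.2.2 (m - xiCount (List.ofFn v))
      calc _ ≤ C * 1 * jb z.2.2 ^ (m - xiCount (List.ofFn v)) := hC ⟨(ε, w), hε, hw⟩ z
        _ ≤ |C| * 1 * (A * bracket z.2.2 ^ (m - xiCount (List.ofFn v))) := by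
          gcongr
          · exact le_abs_self C
          · exact (hA z.2.2).2
        _ = _ := by ring
    · obtain ⟨C, hC⟩ := h2 (List.ofFn v)
      obtain ⟨A, hA0, hA⟩ := bracket_rpow_le (k := d) (m - xiCount (List.ofFn v))
      refine ⟨|C| * A, fun ε hε w₁ hw₁ w₂ hw₂ z => ?_⟩
      rw [hmem hε hw₁, hmem hε hw₂, mixedDeriv_eq, mixedDeriv_eq, xiOrder_eq, ← PSym.dl_sub_apply]
      have hb := jb_rpow_pos z.2.2 (m - xiCount (List.ofFn v))
      calc _ ≤ C * dist w₁ w₂ * jb z.2.2 ^ (m - xiCount (List.ofFn v)) :=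
            hC ⟨(ε, w₁, w₂), hε, hw₁, hw₂⟩ z
        _ ≤ |C| * dist w₁ w₂ * (A * bracket z.2.2 ^ (m - xiCount (List.ofFn v))) := by
          gcongr
          · exact le_abs_self C
          · exact (hA z.2.2).2
        _ = _ := by ring

/-- The symbol obtained by interpolation from a family of lattice symbols. -/
theorem LipBd.isLipSymbol {a : (paramGraph I Ω₀).P → Hat n d} (ha : LipBd (paramGraph I Ω₀) m a) :
    IsLipSymbol I Ω₀ m (extendZero fun p => extFun (fun _ => partBump) (a p)) := by
  refine (isLipSymbol_iff (fun p => ext (fun _ => partBump_isBump) (ha.1.temp p))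
    fun p => extendZero_of_mem _ p.2.1 p.2.2).2 ⟨ha.1.ext _, fun u => ?_⟩
  obtain ⟨C, hC⟩ := ha.2.ext (fun _ : Fin d => partBump_isBump) u
  refine ⟨C, fun x z => ?_⟩
  have e := ext_sub (fun _ : Fin d => partBump_isBump) (ha.1.temp ((paramGraph I Ω₀).s x))
    (ha.1.temp ((paramGraph I Ω₀).t x))
  refine le_of_eq_of_le (congrArg (fun f => ‖(PSym.dl u f).1 z‖) e.symm) (hC x z)

/-- The operators of a family of lattice symbols. -/
theorem LipBd.inLipOPS {a : (paramGraph I Ω₀).P → Hat n d} (ha : LipBd (paramGraph I Ω₀) m a) :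
    InLipOPS I Ω₀ m (extendZero fun p φ => opAt (hatOp (a p)) φ) := by
  refine ⟨_, ha.isLipSymbol, fun ε hε w hw φ => ?_⟩
  rw [extendZero_of_mem _ hε hw, extendZero_of_mem _ hε hw]
  exact isOp_opAt (ha.1.temp _) fun x q => ext_partBump (ha.1.temp _) φ x q

/-- The lattice symbols of a family of operators. -/
theorem InLipOPS.exists_hat {A : ℝ → Param n d → Vec n → Oper d} (h : InLipOPS I Ω₀ m A) :
    ∃ a : (paramGraph I Ω₀).P → Hat n d, LipBd (paramGraph I Ω₀) m a ∧
      ∀ p φ, A p.1.1 p.1.2 φ = opAt (hatOp (a p)) φ := by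
  obtain ⟨s, hs, hA⟩ := h
  set σ : (paramGraph I Ω₀).P → PSym n d := fun p =>
    ⟨s p.1.1 p.1.2, hs.smooth _ p.2.1 _ p.2.2, fun l k z => by
      have h1 := hs.periodic_angle _ p.2.1 _ p.2.2 (z.2.1 + (2 * Real.pi) • intVec k) z.2.2 z.1 l
      have h2 := hs.periodic_space _ p.2.1 _ p.2.2 z.1 z.2.2 z.2.1 k
      dsimp only at h1 h2
      rw [h2] at h1
      refine Eq.trans (congrArg (s p.1.1 p.1.2) ?_) h1
      exact Prod.ext rfl (Prod.ext rfl (add_zero _))⟩ with hσ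
  have hb := (isLipSymbol_iff σ fun p => rfl).1 hs
  have hl : LipBd (paramGraph I Ω₀) m fun p => PSym.hat (σ p) := by
    refine ⟨hb.1.hat fun _ => zero_le_one, ?_⟩
    have := hb.2.hat fun _ => dist_nonneg
    simpa only [PSym.hat_sub] using this
  refine ⟨_, hl, fun p φ => ext_of_isOp (hA _ p.2.1 _ p.2.2 φ) (isOp_opAt (hl.1.temp p)
    fun x q => ?_)⟩
  rw [PSym.latticeSymbol_hat]

/-- The generators of the flows are symmetric hyperbolic. -/
theorem IsGen.isSymmHyperbolic {g : (paramGraph I Ω₀).P → Hat n d}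
    (hg : IsGen (paramGraph I Ω₀) m g) :
    IsSymmHyperbolic I Ω₀ (extendZero fun p φ => opAt (hatOp (g p)) φ) := by
  refine ⟨(hg.bd.mono hg.le_one).inLipOPS, _, LipBd.inLipOPS hg.sh, fun ε hε w hw φ u v => ?_⟩
  rw [extendZero_of_mem _ hε hw, extendZero_of_mem _ hε hw]
  exact (l2inner_sum_iff (hg.bd.1.temp _) (hg.bd.adj.1.temp _) (hg.sh.1.temp _)).2 rfl φ u v

/-- Symmetric hyperbolicity in terms of lattice symbols. -/
theorem IsSymmHyperbolic.sh {A : ℝ → Param n d → Vec n → Oper d} (h : IsSymmHyperbolic I Ω₀ A)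
    {a : (paramGraph I Ω₀).P → Hat n d} (ha : LipBd (paramGraph I Ω₀) m a)
    (hA : ∀ p φ, A p.1.1 p.1.2 φ = opAt (hatOp (a p)) φ) : SH (paramGraph I Ω₀) a := by
  obtain ⟨-, B, hB, hAB⟩ := h
  obtain ⟨b, hb, hBb⟩ := hB.exists_hat
  have e : b = fun p κ q => a p κ q + adj (a p) κ q := by
    funext p
    refine (l2inner_sum_iff (ha.1.temp p) (ha.adj.1.temp p) (hb.1.temp p)).1 fun φ u v => ?_
    rw [← hA, ← hBb]
    exact hAB _ p.2.1 _ p.2.2 φ u v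
  rwa [e] at hb

end classes

/-! ### The small divisors -/

section divisors
variable {n d : ℕ} {γ τ ε₀ : ℝ} {ν₀ : ℝ → Param n d → Vec d} {L : ℝ≥0}

theorem dirFreq_add (a : Vec n) (b : Vec d) (κ κ' : Freq n d) :
    dirFreq a b (κ + κ') = dirFreq a b κ + dirFreq a b κ' := by
  simp only [dirFreq, Prod.fst_add, Prod.snd_add, intVec_add, dot, Pi.add_apply, mul_add,
    Finset.sum_add_distrib]
  push_cast; ring

theorem dirFreq_neg (a : Vec n) (b : Vec d) (κ : Freq n d) : dirFreq a b (-κ) = -dirFreq a b κ := by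
  have h := dirFreq_add a b κ (-κ)
  have h0 : dirFreq a b (0 : Freq n d) = 0 := by simp [dirFreq, dot, intVec]
  rw [add_neg_cancel, h0] at h
  linear_combination -h

theorem dirFreq_conj (a : Vec n) (b : Vec d) (κ : Freq n d) :
    (starRingEnd ℂ) (dirFreq a b κ) = -dirFreq a b κ := by
  rw [dirFreq, map_mul, Complex.conj_I, Complex.conj_ofReal, neg_mul]

theorem dirFreq_sub (a a' : Vec n) (b b' : Vec d) (κ : Freq n d) :
    dirFreq a b κ - dirFreq a' b' κ = dirFreq (a - a') (b - b') κ := by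
  simp only [dirFreq, dot, Pi.sub_apply, sub_mul, Finset.sum_sub_distrib]
  push_cast; ring

/-- The nonresonance condition bounds the small divisors from below. -/
theorem inv_dirFreq_le (hγ : 0 < γ) (hτ : 0 ≤ τ) {ν : Param n d → Vec d} {w : Param n d}
    (hw : w ∈ Omega0 γ τ ν) {κ : Freq n d} (hκ : κ ≠ 0) :
    dirFreq (-w.1) (ν w) κ ≠ 0 ∧
      ‖(dirFreq (-w.1) (ν w) κ)⁻¹‖ ≤ γ⁻¹ * (n + d + 1 : ℝ) ^ τ * jb κ ^ ⌈τ⌉₊ := by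
  -- the condition is used at `(-l, j)`, since `φ` enters with frequency `-ω`
  have h := hw.2 (-κ.1) κ.2 fun h0 => hκ (Prod.ext (neg_eq_zero.1 (Prod.mk.inj h0).1)
    (Prod.mk.inj h0).2)
  rw [intVec_neg] at h
  have e : dot w.1 (-intVec κ.1) = dot (-w.1) (intVec κ.1) := by simp [dot]
  have e' : dot (-intVec κ.1) (-intVec κ.1) = dot (intVec κ.1) (intVec κ.1) := by simp [dot]
  rw [e, e'] at h
  set y := dot (-w.1) (intVec κ.1) + dot (ν w) (intVec κ.2) with hy
  set R := Real.sqrt (1 + dot (intVec κ.1) (intVec κ.1) + dot (intVec κ.2) (intVec κ.2)) with hR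
  have hj := jb_pos κ
  have hnd : (0 : ℝ) ≤ n + d := by positivity
  have hR0 : 0 < R := Real.sqrt_pos.2 (by
    linarith [dot_self_nonneg (intVec κ.1), dot_self_nonneg (intVec κ.2)])
  have hRle : R ≤ (n + d + 1) * jb κ := by
    refine Real.sqrt_le_iff.2 ⟨by positivity, ?_⟩
    have h1 := dot_self_le (intVec κ.1)
    have h2 := dot_self_le (intVec κ.2)
    rw [norm_intVec] at h1 h2
    have h3 : ‖κ.1‖ ^ 2 ≤ jb κ ^ 2 := pow_le_pow_left₀ (norm_nonneg _)
      ((norm_fst_le κ).trans (by unfold jb; linarith)) 2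
    have h4 : ‖κ.2‖ ^ 2 ≤ jb κ ^ 2 := pow_le_pow_left₀ (norm_nonneg _)
      ((norm_snd_le κ).trans (by unfold jb; linarith)) 2
    have h5 := one_le_jb_pow κ 2
    have h6 : (n : ℝ) * ‖κ.1‖ ^ 2 ≤ n * jb κ ^ 2 := by gcongr
    have h7 : (d : ℝ) * ‖κ.2‖ ^ 2 ≤ d * jb κ ^ 2 := by gcongr
    calc _ ≤ (n + d + 1) * jb κ ^ 2 := by linarith
      _ ≤ (n + d + 1) ^ 2 * jb κ ^ 2 := by
        gcongr
        exact le_self_pow₀ (by linarith) two_ne_zero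
      _ = _ := by ring
  have hRτ := Real.rpow_pos_of_pos hR0 τ
  have hy0 : 0 < |y| := (div_pos hγ hRτ).trans h
  have hn : ‖dirFreq (-w.1) (ν w) κ‖ = |y| := by
    rw [dirFreq, norm_mul, Complex.norm_I, one_mul, Complex.norm_real, Real.norm_eq_abs]
  refine ⟨norm_pos_iff.1 (hn ▸ hy0), ?_⟩
  rw [norm_inv, hn]
  calc |y|⁻¹ ≤ (γ / R ^ τ)⁻¹ := inv_anti₀ (div_pos hγ hRτ) h.le
    _ = γ⁻¹ * R ^ τ := by rw [inv_div, div_eq_inv_mul]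
    _ ≤ γ⁻¹ * ((n + d + 1) * jb κ) ^ τ := by gcongr
    _ = γ⁻¹ * (n + d + 1 : ℝ) ^ τ * jb κ ^ τ := by
      rw [Real.mul_rpow (by positivity) hj.le]; ring
    _ ≤ _ := by
      rw [← Real.rpow_natCast]
      have := jb_rpow_mono κ (Nat.le_ceil τ)
      gcongr

/-- The frequencies of `-ω·∂_φ + ν·∇` are admissible small divisors on the nonresonant parameters. -/
theorem smallDiv_dirFreq (hγ : 0 < γ) (hτ : 0 ≤ τ)
    (hν₀ : ∀ ε ∈ Set.Ioc 0 ε₀, LipschitzOnWith L (ν₀ ε) (Omega n d)) :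
    SmallDiv (paramGraph (Set.Ioc 0 ε₀) fun ε => Omega0 γ τ (ν₀ ε))
      fun p => dirFreq (-p.1.2.1) (ν₀ p.1.1 p.1.2) where
  add p := dirFreq_add _ _
  bound p := ⟨_, norm_dirFreq_le _ _⟩
  lip := by
    refine ⟨n + d * L, fun x κ => ?_⟩
    rw [dirFreq_sub]
    refine (norm_dirFreq_le _ _ κ).trans (mul_le_mul_of_nonneg_right ?_ (jb_pos κ).le)
    have h1 : ‖-x.1.2.1.1 - -x.1.2.2.1‖ ≤ dist x.1.2.1 x.1.2.2 := by
      rw [← dist_eq_norm, dist_neg_neg]; exact le_max_left _ _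
    have h2 : ‖ν₀ x.1.1 x.1.2.1 - ν₀ x.1.1 x.1.2.2‖ ≤ L * dist x.1.2.1 x.1.2.2 := by
      rw [← dist_eq_norm]
      exact (hν₀ _ x.2.1).dist_le_mul _ x.2.2.1.1 _ x.2.2.2.1
    calc _ ≤ n * dist x.1.2.1 x.1.2.2 + d * (L * dist x.1.2.1 x.1.2.2) := by gcongr
      _ = _ := by ring
  small := ⟨_, _, fun p κ hκ => inv_dirFreq_le hγ hτ p.2.2 hκ⟩
  conj p := dirFreq_conj _ _

end divisors

/-! ### Fourier multipliers -/

section multiplier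
variable {n d : ℕ}

theorem extFun_of_support {a : Hat n d} (h : ∀ κ q, κ ≠ 0 → a κ q = 0) (f : Fin d → ℝ → ℂ)
    (p : Phase n d) : extFun f a p = interp f (a 0) p.2.2 := by
  rw [extFun, Waves.sum, tsum_eq_single 0 fun κ hκ => by
    rw [show a κ = fun _ => 0 from funext fun q => h κ q hκ, interp]; simp]
  rw [freqWaves_fn]
  simp [character_zero_freq]

theorem latticeSymbol_of_support {a : Hat n d} (h : ∀ κ q, κ ≠ 0 → a κ q = 0) (φ : Vec n)
    (x : Vec d) (q : Fin d → ℤ) : latticeSymbol a φ x q = a 0 q := by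
  rw [latticeSymbol, Waves.sum, tsum_eq_single 0 fun κ hκ => by rw [h κ q hκ, zero_mul],
    freqWaves_fn]
  simp [character_zero_freq]

theorem isOp_of_support {a : Hat n d} (ha : Temp a) (h : ∀ κ q, κ ≠ 0 → a κ q = 0) (φ : Vec n) :
    IsOp (fun _ ξ => interp (fun _ => partBump) (a 0) ξ) (opAt (hatOp a) φ) :=
  isOp_opAt ha fun x q => by rw [interp_partBump, latticeSymbol_of_support h]

/-- A Fourier multiplier acts diagonally on the Fourier coefficients. -/
theorem IsOp.fourierCoeff {s : Vec d → ℂ} {A : Oper d} (hA : IsOp (fun _ ξ => s ξ) A)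
    (u : Smooth d) (q : Fin d → ℤ) :
    fourierCoeff (A u) q = s (intVec q) * fourierCoeff u q := by
  have h0 : Summable fun q => s (intVec q) * TorusPDO.fourierCoeff u q := by
    have h := (hA u 0).summable
    simpa [character, dot] using h
  rw [TorusPDO.fourierCoeff, ← coeff_of_series h0.norm q]
  simp only [fun x => (hA u x).tsum_eq]

/-- Fourier multipliers commute with derivatives. -/
theorem IsOp.commute_opK {s : Vec d → ℂ} {A : Oper d} (hA : IsOp (fun _ ξ => s ξ) A) (j : Fin d) :
    A * opK j - opK j * A = 0 := by
  suffices h : A * opK j = opK j * A by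
    rw [h]; exact sub_self (opK j * A)
  refine LinearMap.ext fun u => ?_
  have e : four (A (opK j u)) = four (opK j (A u)) := by
    refine Subtype.ext (funext fun q => ?_)
    rw [four_apply, four_apply, hA.fourierCoeff]
    simp only [opK, LinearMap.smul_apply, fourierCoeff_smul, fourierCoeff_partialD]
    rw [hA.fourierCoeff]
    ring
  have := congrArg synth e
  rwa [synth_four, synth_four] at this

end multiplier

/-! ### The reduction to constant coefficients -/

section reduction
variable {n d : ℕ} {I : Set ℝ} {Ω₀ : ℝ → Set (Param n d)} {ν₀ : ℝ → Param n d → Vec d}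

theorem tame_list_prod {N : ℕ} {T : Fin N → Module.End ℂ (RS (Freq n d))} (hT : ∀ i, Tame (T i)) :
    Tame (List.ofFn T).prod := by
  induction N with
  | zero => simpa using Tame.one
  | succ N ih =>
    rw [List.ofFn_succ, List.prod_cons]
    exact (hT 0).mul (ih fun i => hT i.succ)

theorem shiftInv_list_prod {N : ℕ} {T : Fin N → Module.End ℂ (RS (Freq n d))}
    (hT : ∀ i, ShiftInv (T i)) : ShiftInv (List.ofFn T).prod := by
  induction N with
  | zero => simpa using ShiftInv.one
  | succ N ih =>
    rw [List.ofFn_succ, List.prod_cons]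
    exact (hT 0).mul (ih fun i => hT i.succ)

theorem dirFreq_parity_conj : HasParity (paramGraph I Ω₀)
    (fun p => dirFreq (-p.1.2.1) (ν₀ p.1.1 p.1.2)) (starRingEnd ℂ) 1 :=
  ⟨.inl rfl, fun p κ => by dsimp only; rw [dirFreq_neg, dirFreq_conj]; simp⟩

theorem dirFreq_parity_id : HasParity (paramGraph I Ω₀)
    (fun p => dirFreq (-p.1.2.1) (ν₀ p.1.1 p.1.2)) (RingHom.id ℂ) (-1) :=
  ⟨.inr rfl, fun p κ => by dsimp only; rw [dirFreq_neg]; simp⟩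

/-- The reduction under a lower bound on the small divisors. -/
theorem exists_reduction (hdiv : SmallDiv (paramGraph I Ω₀)
      fun p => dirFreq (-p.1.2.1) (ν₀ p.1.1 p.1.2)) {ε₀ : ℝ} (hI : ∀ ε ∈ I, 0 < ε ∧ ε ≤ ε₀)
    {e : ℝ} (he : 0 < e) {W₀ : ℝ → Param n d → Vec n → Oper d} (hW₀ : InLipOPS I Ω₀ (1 - e) W₀)
    (hW₀sym : IsSymmHyperbolic I Ω₀ W₀) (M : ℕ) :
    ∃ (G : Fin M → ℝ → Param n d → Vec n → Oper d)
      (Φ : Fin M → ℝ → Param n d → ℝ → Vec n → Oper d) (z : ℝ → Param n d → Vec d → ℂ)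
      (Z : ℝ → Param n d → Oper d) (W : ℝ → Param n d → Vec n → Oper d),
      (∀ j : Fin M, InLipOPS I Ω₀ (1 - ((j : ℕ) + 1 : ℝ) * e) (G j) ∧
        IsSymmHyperbolic I Ω₀ (G j)) ∧
      (∀ j : Fin M, ∀ ε ∈ I, ∀ w ∈ Ω₀ ε, IsFlow (G j ε w) (Φ j ε w)) ∧
      (∀ ε ∈ I, ∀ w ∈ Ω₀ ε, Transforms w.1
        (fun φ => (List.ofFn fun j : Fin M => Φ j ε w (-ε) φ).prod)
        (fun φ => transport (ν₀ ε w) + (ε : ℂ) • W₀ ε w φ)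
        (fun φ => transport (ν₀ ε w) + (ε : ℂ) • Z ε w + (ε : ℂ) • W ε w φ)) ∧
      IsLipSymbol I Ω₀ (1 - e) (fun ε w p => z ε w p.2.2) ∧
      (∀ ε ∈ I, ∀ w ∈ Ω₀ ε, IsOp (fun _ ξ => z ε w ξ) (Z ε w) ∧
        ∀ m : Fin d, Z ε w * opK m - opK m * Z ε w = 0) ∧
      InLipOPS I Ω₀ (1 - (M : ℝ) * e) W ∧
      (∀ ε ∈ I, ∀ w ∈ Ω₀ ε, (∀ φ, IsRealOp (W₀ ε w φ)) → IsReversible (W₀ ε w) →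
        IsRealOp (Z ε w) ∧ IsReversible (fun _ : Vec n => Z ε w) ∧
        (∀ φ, IsRealOp (W ε w φ)) ∧ IsReversible (W ε w)) := by
  obtain ⟨w₀, hw₀, hWw₀⟩ := hW₀.exists_hat
  obtain ⟨g, U, z, w, hg, hU, hz, hw, hz0, hconj, hsym⟩ := exists_normal_form hdiv
    (ε := fun p => p.1.1) (T := ε₀) (fun p => hI _ p.2.1) (fun _ => rfl) he hw₀
    (hW₀sym.sh hw₀ hWw₀)
  -- the normal form has no frequencies in `φ` and `x`, so it does not depend on the angle
  have hconst : ∀ p φ, opAt (hatOp (z M p)) φ = opAt (hatOp (z M p)) 0 := fun p φ =>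
    ext_of_isOp (isOp_of_support ((hz M).temp p) (hz0 M p) φ)
      (isOp_of_support ((hz M).temp p) (hz0 M p) 0)
  have hUt : ∀ j p t, Tame (U j p t) := fun j p t => ((hg j).utame (hU j) p).tame t
  have hUs : ∀ j p t, ShiftInv (U j p t) := fun j p t => (hg j).flow_shiftInv (hU j) p t
  have hUu : ∀ j p t φ, IsUnit (opAt (U j p t) φ) := fun j p t φ =>
    ⟨⟨opAt (U j p t) φ, opAt (U j p (-t)) φ,
      by rw [← opAt_mul (hUt j p t) (hUs j p t), (hg j).flow_mul_neg (hU j), opAt_one],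
      by rw [← opAt_mul (hUt j p _) (hUs j p _), (hg j).flow_neg_mul (hU j), opAt_one]⟩, rfl⟩
  refine ⟨fun j => extendZero fun p φ => opAt (hatOp (g j p)) φ,
    fun j => extendZero fun p t φ => opAt (U j p t) φ,
    extendZero fun p ξ => interp (fun _ => partBump) (z M p 0) ξ,
    extendZero fun p => opAt (hatOp (z M p)) 0,
    extendZero fun p φ => opAt (hatOp (w M p)) φ,
    fun j => ⟨(hg j).bd.inLipOPS, (hg j).isSymmHyperbolic⟩, fun j ε hε v hv => ?_,
    fun ε hε v hv => ?_, ?_, fun ε hε v hv => ?_, ?_, fun ε hε v hv hreal hrev => ?_⟩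
  · dsimp only
    rw [extendZero_of_mem _ hε hv, extendZero_of_mem _ hε hv]
    exact (hg j).isFlow (hU j) _
  · set p : (paramGraph I Ω₀).P := ⟨(ε, v), hε, hv⟩ with hp
    have hV : ∀ φ, opAt (List.ofFn fun i : Fin M => U i p (-ε)).prod φ
        = (List.ofFn fun i : Fin M => opAt (U i p (-ε)) φ).prod :=
      opAt_prod (fun i => hUt i p _) fun i => hUs i p _
    have h := transforms_of_conj (V := (List.ofFn fun i : Fin M => U i p (-ε)).prod)
      (tame_list_prod fun i => hUt i p _) (shiftInv_list_prod fun i => hUs i p _)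
      (hw₀.temp p) (fun φ => by
        rw [hV]
        refine List.prod_isUnit fun A hA => ?_
        obtain ⟨i, rfl⟩ := (List.mem_ofFn' _ _).1 hA
        exact hUu _ _ _ _) (hconj M p)
    simp only [extendZero_of_mem _ hε hv]
    rw [funext hV] at h
    simp only [hconst, ← hWw₀] at h
    exact h
  · refine (congrArg (IsLipSymbol I Ω₀ (1 - e)) ?_).mp (hz M).isLipSymbol
    funext ε v y
    by_cases h : ε ∈ I ∧ v ∈ Ω₀ ε
    · rw [extendZero_of_mem _ h.1 h.2, extendZero_of_mem _ h.1 h.2,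
        extFun_of_support (hz0 M _)]
    · rw [extendZero, extendZero, dif_neg h, dif_neg h]; rfl
  · rw [extendZero_of_mem _ hε hv, extendZero_of_mem _ hε hv]
    have h := isOp_of_support ((hz M).temp _) (hz0 M ⟨(ε, v), hε, hv⟩) 0
    exact ⟨h, h.commute_opK⟩
  -- the remainder after `M` steps even has order `1 - (M + 1) e`
  · refine ((hw M).mono ?_).inLipOPS
    linarith
  · set p : (paramGraph I Ω₀).P := ⟨(ε, v), hε, hv⟩ with hp
    have e0 : W₀ ε v = fun φ => opAt (hatOp (w₀ p)) φ := funext (hWw₀ p)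
    rw [e0] at hreal hrev
    have h1 := hsym _ _ conj_isInvol dirFreq_parity_conj p
      ((isRealOp_iff_hatSym (hw₀.temp p)).1 hreal) M
    have h2 := hsym _ _ id_isInvol dirFreq_parity_id p
      ((isReversible_iff_hatSym (hw₀.temp p)).1 hrev) M
    rw [extendZero_of_mem _ hε hv, extendZero_of_mem _ hε hv]
    refine ⟨(isRealOp_iff_hatSym ((hz M).temp p)).2 h1.1 0, ?_,
      (isRealOp_iff_hatSym ((hw M).temp p)).2 h1.2, (isReversible_iff_hatSym ((hw M).temp p)).2 h2.2⟩
    rw [← funext (hconst p)]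
    exact (isReversible_iff_hatSym ((hz M).temp p)).2 h2.1

end reduction

end TorusPDO

end

theorem mainTheorem3 {n d : ℕ} (hd : 1 ≤ d) (e : ℝ) (he : 0 < e)
    (γ τ : ℝ) (hγ : 0 < γ) (hγ1 : γ < 1) (hτ : (n : ℝ) + d < τ)
    (ε₀ : ℝ) (hε₀ : 0 < ε₀)
    (ν₀ : ℝ → TorusPDO.Param n d → TorusPDO.Vec d) (L : ℝ≥0)
    (hν₀ : ∀ ε ∈ Set.Ioc 0 ε₀, LipschitzOnWith L (ν₀ ε) (TorusPDO.Omega n d))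
    (W₀ : ℝ → TorusPDO.Param n d → TorusPDO.Vec n → TorusPDO.Oper d)
    (hW₀ : TorusPDO.InLipOPS (Set.Ioc 0 ε₀) (fun ε => TorusPDO.Omega0 γ τ (ν₀ ε)) (1 - e) W₀)
    (hW₀sym : TorusPDO.IsSymmHyperbolic (Set.Ioc 0 ε₀)
      (fun ε => TorusPDO.Omega0 γ τ (ν₀ ε)) W₀)
    (M : ℕ) (hM : 0 < M) :
    ∃ (G : Fin M → ℝ → TorusPDO.Param n d → TorusPDO.Vec n → TorusPDO.Oper d)
      (Φ : Fin M → ℝ → TorusPDO.Param n d → ℝ → TorusPDO.Vec n → TorusPDO.Oper d)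
      (z : ℝ → TorusPDO.Param n d → TorusPDO.Vec d → ℂ)
      (Z : ℝ → TorusPDO.Param n d → TorusPDO.Oper d)
      (W : ℝ → TorusPDO.Param n d → TorusPDO.Vec n → TorusPDO.Oper d),
      -- the generators `G_1, …, G_M` (here `G_{j+1}` is `G j`)
      (∀ j : Fin M,
        TorusPDO.InLipOPS (Set.Ioc 0 ε₀) (fun ε => TorusPDO.Omega0 γ τ (ν₀ ε))
          (1 - ((j : ℕ) + 1 : ℝ) * e) (G j) ∧
        TorusPDO.IsSymmHyperbolic (Set.Ioc 0 ε₀) (fun ε => TorusPDO.Omega0 γ τ (ν₀ ε)) (G j)) ∧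
      -- their flows `Φ j ε w t φ = e^{t G_{j+1}(φ, w)}`
      (∀ j : Fin M, ∀ ε ∈ Set.Ioc 0 ε₀, ∀ w ∈ TorusPDO.Omega0 γ τ (ν₀ ε),
        TorusPDO.IsFlow (G j ε w) (Φ j ε w)) ∧
      -- the conjugation by `e^{-ε G_1} ⋯ e^{-ε G_M}`
      (∀ ε ∈ Set.Ioc 0 ε₀, ∀ w ∈ TorusPDO.Omega0 γ τ (ν₀ ε),
        TorusPDO.Transforms w.1
          (fun φ => (List.ofFn fun j : Fin M => Φ j ε w (-ε) φ).prod)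
          (fun φ => TorusPDO.transport (ν₀ ε w) + (ε : ℂ) • W₀ ε w φ)
          (fun φ => TorusPDO.transport (ν₀ ε w) + (ε : ℂ) • Z ε w + (ε : ℂ) • W ε w φ)) ∧
      -- `Z` is a time-independent Fourier multiplier of order `1 - e`
      TorusPDO.IsLipSymbol (Set.Ioc 0 ε₀) (fun ε => TorusPDO.Omega0 γ τ (ν₀ ε)) (1 - e)
        (fun ε w p => z ε w p.2.2) ∧
      (∀ ε ∈ Set.Ioc 0 ε₀, ∀ w ∈ TorusPDO.Omega0 γ τ (ν₀ ε),
        TorusPDO.IsOp (fun _ ξ => z ε w ξ) (Z ε w) ∧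
        ∀ m : Fin d, Z ε w * TorusPDO.opK m - TorusPDO.opK m * Z ε w = 0) ∧
      -- the remainder has order `1 - M e`
      TorusPDO.InLipOPS (Set.Ioc 0 ε₀) (fun ε => TorusPDO.Omega0 γ τ (ν₀ ε)) (1 - (M : ℝ) * e) W ∧
      -- reality and reversibility
      (∀ ε ∈ Set.Ioc 0 ε₀, ∀ w ∈ TorusPDO.Omega0 γ τ (ν₀ ε),
        (∀ φ, TorusPDO.IsRealOp (W₀ ε w φ)) → TorusPDO.IsReversible (W₀ ε w) →
          TorusPDO.IsRealOp (Z ε w) ∧ TorusPDO.IsReversible (fun _ : TorusPDO.Vec n => Z ε w) ∧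
          (∀ φ, TorusPDO.IsRealOp (W ε w φ)) ∧ TorusPDO.IsReversible (W ε w)) := by
  exact TorusPDO.exists_reduction (TorusPDO.smallDiv_dirFreq hγ (le_trans (by positivity) hτ.le) hν₀)
    (fun _ h => h) he hW₀ hW₀sym M
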